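/- **Setting.** Let $d\ge 1$ and let $\mathfrak s=(\mathfrak s_1,\dots,\mathfrak s_d)$ be positive integers, $|\mathfrak s|=\sum_i\mathfrak s_i$, $\|x\|_{\mathfrak s}=\sup_i|x_i|^{1/\mathfrak s_i}$, and $|k|_{\mathfrak s}=\sum_i \mathfrak s_ik_i$ for $k\in\mathbb N^d$ (the scaled degree of the monomial $X^k$). For $r\in\mathbb N$ let $\mathscr B^r$ be the set of smooth $\eta:\mathbb R^d\to\mathbb R$ supported in $\{\|x\|_{\mathfrak s}\le 1\}$ with $\sup_x|\partial^k\eta(x)|\le 1$ for all $k$ with $|k|_{\mathfrak s}\le r$, and let $\mathscr B^r_m$ be the set of those $\eta\in\mathscr B^r$ that annihilate all polynomials of scaled degree at most $m$. Put $\eta^\lambda_x(y)=\lambda^{-|\mathfrak s|}\eta\big(\lambda^{-\mathfrak s_1}(y_1-x_1),\dots,\lambda^{-\mathfrak s_d}(y_d-x_d)\big)$, $\eta_x=\eta^1_x$, $L^p=L^p(\mathbb R^d,dx)$ and $L^q_\lambda=L^q((0,1),\lambda^{-1}d\lambda)$. For $\alpha\in\mathbb R$ and $p,q\in[1,\infty]$,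 the space $\mathcal B^\alpha_{p,q}$ consists of the real tempered distributions $\xi$ on $\mathbb R^d$ with $\|\xi\|_{\mathcal B^\alpha_{p,q}}<\infty$, where $$\|\xi\|_{\mathcal B^\alpha_{p,q}}=\bigg\|\Big\|\sup_{\eta\in\mathscr B^r}\frac{|\langle\xi,\eta^\lambda_x\rangle|}{\lambda^\alpha}\Big\|_{L^p}\bigg\|_{L^q_\lambda}\quad\text{if }\alpha<0,$$ $$\|\xi\|_{\mathcal B^\alpha_{p,q}}=\Big\|\sup_{\eta\in\mathscr B^r}|\langle\xi,\eta_x\rangle|\Big\|_{L^p}+\bigg\|\Big\|\sup_{\eta\in\mathscr B^r_{\lfloor\alpha\rfloor}}\frac{|\langle\xi,\eta^\lambda_x\rangle|}{\lambda^\alpha}\Big\|_{L^p}\bigg\|_{L^q_\lambda}\quad\text{if }\alpha\ge0.$$ Let $\varphi:\mathbb R\to\mathbb R$ be a compactly supported $\mathcal C^r$ function such that (1) $\langle\varphi,\varphi(\cdot+k)\rangle=\delta_{k,0}$ for $k\in\mathbb Z$; (2) $\varphi(x)=\sum_{k\in\mathbb Z}a_k\varphi(2x-k)$ with finitely many non-zero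 $a_k$; (3) $\sum_{k\in\mathbb Z}\int P(y)\varphi(y-k)\,dy\;\varphi(x-k)=P(x)$ for every polynomial $P$ of degree at most $r$. Let $\Lambda_n=\{(2^{-n\mathfrak s_1}k_1,\dots,2^{-n\mathfrak s_d}k_d):k\in\mathbb Z^d\}$, $\varphi^n_x(y)=\prod_i2^{n\mathfrak s_i/2}\varphi(2^{n\mathfrak s_i}(y_i-x_i))$ and $\psi^n_x(y)=2^{n|\mathfrak s|/2}\psi\big(2^{n\mathfrak s_1}(y_1-x_1),\dots,2^{n\mathfrak s_d}(y_d-x_d)\big)$. Let $\Psi$ be a finite set of compactly supported $\mathcal C^r$ functions on $\mathbb R^d$ that annihilate all polynomials of degree at most $r$ and such that, for every $n\ge0$, $\{\varphi^n_x:x\in\Lambda_n\}\cup\{\psi^m_x:m\ge n,\psi\in\Psi,x\in\Lambda_m\}$ is an orthonormal basis of $L^2(\mathbb R^d)$. The pairing of $\xi$ with a compactly supported $\mathcal C^r$ function $f$ is defined by continuity: $\langle\xi,f\rangle=v$ means that $\langle\xi,g_j\rangle\to v$ for every sequence of smooth functions $g_j$ supported in a common compact set with $\partial^kg_j\to\partial^kf$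 uniformly for all $|k|_{\mathfrak s}\le r$. Finally $\|u\|_{\ell^p_n}=\big(\sum_{x\in\Lambda_n}2^{-n|\mathfrak s|}|u(x)|^p\big)^{1/p}$ (the supremum of $|u|$ for $p=\infty$), and $\ell^q$ is the usual sequence space over $n\ge 0$. **Proposition.** Let $\alpha\in\mathbb R$, $p,q\in[1,\infty]$, and let $r\in\mathbb N$ with $r>|\alpha|$; if $\alpha\le0$, assume moreover that $\mathfrak s_i\lfloor r/\mathfrak s_i\rfloor>|\alpha|$ for every $i$ (which is automatic if every $\mathfrak s_i$ divides $r$, in particular for $\mathfrak s=(1,\dots,1)$). Let $\varphi,\Psi$ be as above. Consider the condition $$\sup_{\psi\in\Psi}\bigg\|\Big\|\frac{a^{n,\psi}_x}{2^{-n\frac{|\mathfrak s|}2-n\alpha}}\Big\|_{\ell^p_n}\bigg\|_{\ell^q}<\infty,\qquad\big\|b^0_x\big\|_{\ell^p_0}<\infty.\qquad(\ast)$$ 1. If $\xi\in\mathcal B^\alpha_{p,q}$, then the pairings $a^{n,\psi}_x=\langle\xi,\psi^n_x\rangle$ ($n\ge0$, $\psi\in\Psi$, $x\in\Lambda_n$)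 and $b^0_x=\langle\xi,\varphi^0_x\rangle$ ($x\in\Lambda_0$) exist and satisfy $(\ast)$. 2. Conversely, for all real families $(a^{n,\psi}_x)$ and $(b^0_x)$ satisfying $(\ast)$ there is $\xi\in\mathcal B^\alpha_{p,q}$ with $\langle\xi,\psi^n_x\rangle=a^{n,\psi}_x$ and $\langle\xi,\varphi^0_x\rangle=b^0_x$ for all $n,\psi,x$. 3. The norms are equivalent: there is a constant $C\in(0,\infty)$, depending only on $d,\mathfrak s,\alpha,p,q,r,\varphi,\Psi$, such that for every tempered distribution $\xi$ whose wavelet coefficients $a^{n,\psi}_x=\langle\xi,\psi^n_x\rangle$, $b^0_x=\langle\xi,\varphi^0_x\rangle$ are defined, the sum $N$ of the two quantities in $(\ast)$ satisfies $N\le C\|\xi\|_{\mathcal B^\alpha_{p,q}}$ and $\|\xi\|_{\mathcal B^\alpha_{p,q}}\le CN$ in $[0,\infty]$. In particular such a $\xi$ lies in $\mathcal B^\alpha_{p,q}$ if and only if $(\ast)$ holds. -/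

import Mathlib

open MeasureTheory Filter Topology
open scoped ENNReal NNReal SchwartzMap

noncomputable section

namespace AnisoBesov

variable {d : ℕ}

/-! ### The scaling -/

/-- The homogeneous dimension `|𝔰| = ∑ i, 𝔰 i`. -/
def homDim (s : Fin d → ℕ) : ℕ := ∑ i, s i

/-- The `𝔰`-scaled "norm" `‖x‖_𝔰 = sup_i |x i| ^ (1 / 𝔰 i)`. -/
def scaledNorm (s : Fin d → ℕ) (x : Fin d → ℝ) : ℝ :=
  ⨆ i, |x i| ^ (1 / (s i : ℝ))

/-- The function `f` recentred around `x` and rescaled by `ε` at the level of its argument: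
`y ↦ f (ε ^ (-𝔰 1) (y 1 - x 1), …, ε ^ (-𝔰 d) (y d - x d))`. -/
def dilate (s : Fin d → ℕ) (ε : ℝ) (x : Fin d → ℝ) (f : (Fin d → ℝ) → ℝ) :
    (Fin d → ℝ) → ℝ :=
  fun y => f (fun i => (ε ^ s i)⁻¹ * (y i - x i))

/-- The recentred and rescaled test function `η_x^ε (y) = ε ^ (-|𝔰|) η (ε ^ (-𝔰) (y - x))`. -/
def rescale (s : Fin d → ℕ) (ε : ℝ) (x : Fin d → ℝ) (η : (Fin d → ℝ) → ℝ) :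
    (Fin d → ℝ) → ℝ :=
  fun y => (ε ^ homDim s)⁻¹ * dilate s ε x η y

/-- The mixed partial derivative `∂_{i 0} ∂_{i 1} ⋯ ∂_{i (n-1)} f`. For `f` of class `C^n` it is
`∂^k f` for the multi-index `k` with `k l = #{j | i j = l}`, whose scaled degree
`|k|_𝔰 = ∑ l, 𝔰 l * k l` is `∑ j, 𝔰 (i j)`. -/
def mixedDeriv {n : ℕ} (i : Fin n → Fin d) (f : (Fin d → ℝ) → ℝ) (x : Fin d → ℝ) : ℝ :=
  iteratedFDeriv ℝ n f x (fun j => Pi.single (i j) (1 : ℝ))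

/-! ### Test functions -/

/-- The set `ℬ^r` of smooth functions that are supported in the centred closed ball of `𝔰`-scaled
radius `1` and whose `C^r`-norm `max_{|k|_𝔰 ≤ r} sup |∂^k η|` is at most `1`. -/
def testBall (s : Fin d → ℕ) (r : ℕ) : Set ((Fin d → ℝ) → ℝ) :=
  {η | ContDiff ℝ (⊤ : ℕ∞) η ∧ Function.support η ⊆ {x | scaledNorm s x ≤ 1} ∧
    ∀ (n : ℕ) (i : Fin n → Fin d), ∑ j, s (i j) ≤ r → ∀ x, |mixedDeriv i η x| ≤ 1}

/-- The set `ℬ^r_m` of those elements of `ℬ^r` that annihilate all polynomials of scaled degree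
at most `m`. -/
def testBallAnnihil (s : Fin d → ℕ) (r m : ℕ) : Set ((Fin d → ℝ) → ℝ) :=
  {η | η ∈ testBall s r ∧
    ∀ P : MvPolynomial (Fin d) ℝ, P.weightedTotalDegree s ≤ m →
      ∫ x, η x * MvPolynomial.eval x P = 0}

/-! ### Besov spaces -/

/-- `sup_{η ∈ F} |⟨ξ, η_x^ε⟩|`, for a tempered distribution `ξ` and a set `F` of test functions. -/
def supTest (s : Fin d → ℕ) (F : Set ((Fin d → ℝ) → ℝ)) (ξ : 𝓢(Fin d → ℝ, ℝ) →L[ℝ] ℝ)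
    (ε : ℝ) (x : Fin d → ℝ) : ℝ≥0∞ :=
  ⨆ g ∈ {g : 𝓢(Fin d → ℝ, ℝ) | ∃ η ∈ F, ⇑g = rescale s ε x η}, ‖ξ g‖ₑ

/-- The measure `dε / ε` on `(0, 1)`. -/
def scaleMeasure : Measure ℝ :=
  (volume.restrict (Set.Ioo (0 : ℝ) 1)).withDensity (fun ε => ENNReal.ofReal ε⁻¹)

/-- `‖ ‖ sup_{η ∈ F} |⟨ξ, η_x^ε⟩| / ε^α ‖_{L^p(dx)} ‖_{L^q(dε/ε)}`. -/
def scaleNorm (s : Fin d → ℕ) (F : Set ((Fin d → ℝ) → ℝ)) (α : ℝ) (p q : ℝ≥0∞)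
    (ξ : 𝓢(Fin d → ℝ, ℝ) →L[ℝ] ℝ) : ℝ≥0∞ :=
  eLpNorm (fun ε : ℝ =>
    eLpNorm (fun x : Fin d → ℝ => supTest s F ξ ε x / ENNReal.ofReal (ε ^ α)) p volume)
    q scaleMeasure

/-- The norm of `ℬ^α_{p,q}`, with value `∞` outside that space. -/
def besovNorm (s : Fin d → ℕ) (α : ℝ) (p q : ℝ≥0∞) (r : ℕ)
    (ξ : 𝓢(Fin d → ℝ, ℝ) →L[ℝ] ℝ) : ℝ≥0∞ :=
  if α < 0 then scaleNorm s (testBall s r) α p q ξ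
  else eLpNorm (fun x : Fin d → ℝ => supTest s (testBall s r) ξ 1 x) p volume
    + scaleNorm s (testBallAnnihil s r ⌊α⌋₊) α p q ξ

/-- The Besov space `ℬ^α_{p,q}`. -/
def besovSpace (s : Fin d → ℕ) (α : ℝ) (p q : ℝ≥0∞) (r : ℕ) :
    Set (𝓢(Fin d → ℝ, ℝ) →L[ℝ] ℝ) :=
  {ξ | besovNorm s α p q r ξ < ∞}

/-! ### Wavelets -/

/-- The points `(2^{-n 𝔰 1} k 1, …, 2^{-n 𝔰 d} k d)`, `k ∈ ℤ^d`, of the grid `Λ_n`. -/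
def gridPoint (s : Fin d → ℕ) (n : ℕ) (k : Fin d → ℤ) : Fin d → ℝ :=
  fun i => (k i : ℝ) / 2 ^ (n * s i)

/-- `ψ^n_x (y) = 2^{n|𝔰|/2} ψ (2^{n 𝔰 1} (y 1 - x 1), …, 2^{n 𝔰 d} (y d - x d))` for the point `x`
of `Λ_n` with index `k`. -/
def waveletFun (s : Fin d → ℕ) (ψ : (Fin d → ℝ) → ℝ) (n : ℕ) (k : Fin d → ℤ) :
    (Fin d → ℝ) → ℝ :=
  fun y => (2 : ℝ) ^ ((n : ℝ) * (homDim s : ℝ) / 2) *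
    ψ (fun i => 2 ^ (n * s i) * (y i - gridPoint s n k i))

/-- `φ^n_x (y) = ∏ i, 2^{n 𝔰 i / 2} φ (2^{n 𝔰 i} (y i - x i))` for the point `x` of `Λ_n` with
index `k`. -/
def scalingFun (s : Fin d → ℕ) (φ : ℝ → ℝ) (n : ℕ) (k : Fin d → ℤ) : (Fin d → ℝ) → ℝ :=
  fun y => ∏ i, (2 : ℝ) ^ ((n : ℝ) * (s i : ℝ) / 2) *
    φ (2 ^ (n * s i) * (y i - gridPoint s n k i))

/-- The family `{φ^n_x : x ∈ Λ_n} ∪ {ψ^m_x : m ≥ n, ψ ∈ Ψ, x ∈ Λ_m}`. -/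
def waveletFamily (s : Fin d → ℕ) (φ : ℝ → ℝ) (Ψ : Finset ((Fin d → ℝ) → ℝ)) (n : ℕ) :
    (Fin d → ℤ) ⊕ ({m : ℕ // n ≤ m} × Ψ × (Fin d → ℤ)) → (Fin d → ℝ) → ℝ
  | Sum.inl k => scalingFun s φ n k
  | Sum.inr (m, ψ, k) => waveletFun s ψ.1 m.1 k

/-- `φ` is a compactly supported scaling function of class `C^r` on the line, and the finite set
`Ψ` is a set of associated compactly supported wavelets of class `C^r` for the scaling `𝔰`. -/
structure IsWaveletSystem (s : Fin d → ℕ) (r : ℕ) (φ : ℝ → ℝ)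
    (Ψ : Finset ((Fin d → ℝ) → ℝ)) : Prop where
  contDiff_scaling : ContDiff ℝ r φ
  compact_scaling : HasCompactSupport φ
  /-- The integer translates of `φ` are orthonormal. -/
  orthonormal_scaling : ∀ k : ℤ, ∫ x : ℝ, φ x * φ (x + k) = if k = 0 then 1 else 0
  /-- The refinement equation, with finitely many non-zero coefficients. -/
  refinement : ∃ a : ℤ →₀ ℝ, ∀ x : ℝ, φ x = a.sum fun k c => c * φ (2 * x - k)
  /-- The translates of `φ` reproduce the polynomials of degree at most `r`. -/
  reproduce : ∀ P : Polynomial ℝ, P.natDegree ≤ r → ∀ x : ℝ,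
    HasSum (fun k : ℤ => (∫ y : ℝ, P.eval y * φ (y - k)) * φ (x - k)) (P.eval x)
  contDiff_wavelet : ∀ ψ ∈ Ψ, ContDiff ℝ r ψ
  compact_wavelet : ∀ ψ ∈ Ψ, HasCompactSupport ψ
  /-- The wavelets annihilate the polynomials of degree at most `r`. -/
  annihilate : ∀ ψ ∈ Ψ, ∀ P : MvPolynomial (Fin d) ℝ, P.totalDegree ≤ r →
    ∫ x, ψ x * MvPolynomial.eval x P = 0
  /-- For every `n` the wavelet family of level `n` is an orthonormal basis of `L²`. -/
  basis : ∀ n : ℕ, ∃ b : HilbertBasis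
      ((Fin d → ℤ) ⊕ ({m : ℕ // n ≤ m} × Ψ × (Fin d → ℤ))) ℝ
      (Lp ℝ 2 (volume : Measure (Fin d → ℝ))),
    ∀ i, (b i : (Fin d → ℝ) → ℝ) =ᵐ[volume] waveletFamily s φ Ψ n i

/-- `ξ` extends by continuity to the compactly supported function `f` of class `C^r`, and
`⟨ξ, f⟩ = v`: whenever test functions `g n` are supported in a common compact set and converge to
`f` in `C^r`, that is, `∂^k (g n) → ∂^k f` uniformly for all `|k|_𝔰 ≤ r`, then `⟨ξ, g n⟩ → v`.
(Such sequences exist for every `f` of class `C^r` with compact support, by mollification, so there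
is at most one such `v`; for `f` a test function, `v = ξ f`, by taking `g n = f`.) -/
def HasPairing (s : Fin d → ℕ) (r : ℕ) (ξ : 𝓢(Fin d → ℝ, ℝ) →L[ℝ] ℝ)
    (f : (Fin d → ℝ) → ℝ) (v : ℝ) : Prop :=
  ∀ (g : ℕ → 𝓢(Fin d → ℝ, ℝ)) (K : Set (Fin d → ℝ)), IsCompact K →
    (∀ n, Function.support (g n) ⊆ K) →
    (∀ (m : ℕ) (i : Fin m → Fin d), ∑ j, s (i j) ≤ r →
      TendstoUniformly (fun n x => mixedDeriv i (g n) x) (mixedDeriv i f) atTop) →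
    Tendsto (fun n => ξ (g n)) atTop (𝓝 v)

/-- `a^{n,ψ}_x = ⟨ξ, ψ^n_x⟩` and `b^0_x = ⟨ξ, φ^0_x⟩` for all `n ≥ 0`, `ψ ∈ Ψ` and all grid
points `x`. -/
def IsWaveletCoeffs (s : Fin d → ℕ) (r : ℕ) (φ : ℝ → ℝ) (Ψ : Finset ((Fin d → ℝ) → ℝ))
    (ξ : 𝓢(Fin d → ℝ, ℝ) →L[ℝ] ℝ) (a : ℕ → Ψ → (Fin d → ℤ) → ℝ)
    (b : (Fin d → ℤ) → ℝ) : Prop :=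
  (∀ (n : ℕ) (ψ : Ψ) (k : Fin d → ℤ), HasPairing s r ξ (waveletFun s ψ.1 n k) (a n ψ k)) ∧
    ∀ k : Fin d → ℤ, HasPairing s r ξ (scalingFun s φ 0 k) (b k)

/-- The `ℓ^p_n`-norm: the `L^p`-norm for the measure that gives mass `2^{-n|𝔰|}` to each point of
`Λ_n`; it is `(∑_x 2^{-n|𝔰|} |u x|^p)^{1/p}` for `p < ∞` and `sup_x |u x|` for `p = ∞`. -/
def ellNorm (s : Fin d → ℕ) (p : ℝ≥0∞) (n : ℕ) (u : (Fin d → ℤ) → ℝ) : ℝ≥0∞ :=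
  eLpNorm u p (((2 : ℝ≥0∞) ^ (n * homDim s))⁻¹ • Measure.count)

/-- `sup_{ψ ∈ Ψ} ‖ ‖ a^{n,ψ}_x / 2^{-n|𝔰|/2 - nα} ‖_{ℓ^p_n} ‖_{ℓ^q}`. -/
def detailNorm (s : Fin d → ℕ) (α : ℝ) (p q : ℝ≥0∞) (Ψ : Finset ((Fin d → ℝ) → ℝ))
    (a : ℕ → Ψ → (Fin d → ℤ) → ℝ) : ℝ≥0∞ :=
  ⨆ ψ : Ψ, eLpNorm (fun n : ℕ =>
    ellNorm s p n (fun k => a n ψ k / (2 : ℝ) ^ (-(n : ℝ) * (homDim s : ℝ) / 2 - (n : ℝ) * α)))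
    q Measure.count

/-! ### Sanity checks for the definitions -/

/-- The rescaled test functions in the definition of `supTest` are Schwartz functions. -/
theorem exists_schwartz_rescale {s : Fin d → ℕ} (hs : ∀ i, 0 < s i) {r : ℕ}
    {η : (Fin d → ℝ) → ℝ} (hη : η ∈ testBall s r) {ε : ℝ} (hε : 0 < ε) (x : Fin d → ℝ) :
    ∃ g : 𝓢(Fin d → ℝ, ℝ), ⇑g = rescale s ε x η := by
  have hsm : ContDiff ℝ (⊤ : ℕ∞) (rescale s ε x η) := by
    unfold rescale dilate
    refine contDiff_const.mul (hη.1.comp ?_)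
    fun_prop
  have hc : HasCompactSupport (rescale s ε x η) := by
    refine HasCompactSupport.of_support_subset_isCompact
      (K := Set.Icc (fun i => x i - ε ^ s i) (fun i => x i + ε ^ s i)) isCompact_Icc ?_
    intro y hy
    have h1 : η (fun i => (ε ^ s i)⁻¹ * (y i - x i)) ≠ 0 := by
      intro h0
      exact hy (by simp [rescale, dilate, h0])
    have h2 : scaledNorm s (fun i => (ε ^ s i)⁻¹ * (y i - x i)) ≤ 1 := hη.2.1 h1
    have h3 : ∀ i, |y i - x i| ≤ ε ^ s i := by
      intro i
      have h4 : |(ε ^ s i)⁻¹ * (y i - x i)| ^ (1 / (s i : ℝ)) ≤ 1 :=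
        le_trans (le_ciSup (f := fun i => |(ε ^ s i)⁻¹ * (y i - x i)| ^ (1 / (s i : ℝ)))
          (Set.finite_range _).bddAbove i) h2
      have hsi : (0 : ℝ) < s i := by exact_mod_cast hs i
      have h5 : |(ε ^ s i)⁻¹ * (y i - x i)| ≤ 1 := by
        by_contra hlt
        exact absurd h4 (not_le.mpr (Real.one_lt_rpow (not_le.mp hlt) (by positivity)))
      have hp : 0 < ε ^ s i := pow_pos hε _
      rw [abs_mul, abs_inv, abs_of_pos hp, inv_mul_le_iff₀ hp, mul_one] at h5
      exact h5
    exact ⟨fun i => by linarith [(abs_le.mp (h3 i)).1],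
      fun i => by linarith [(abs_le.mp (h3 i)).2]⟩
  exact ⟨hc.toSchwartzMap hsm, rfl⟩

end AnisoBesov

end

/-! The proof compares two scales, the scale `2^{-n}` of a wavelet and the scale `ε` of a test
function.

Coefficients from the Besov norm. After a fixed shift by `N` levels, a wavelet of level `j + N` is,
up to normalisation, a `C^r`-limit of rescaled elements of a test ball at every scale `ε` in
`[2^{-j-1}, 2^{-j})` around every point of its grid cell (`enorm_pairing_waveletFun_le`). Its
coefficient is therefore bounded by `supTest` on a whole cell and a whole dyadic interval of scales,
and `eLpNorm_le_of_cells` turns this into a comparison of norms. The scaling function and the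
finitely many coarser levels need not fit into such balls. A partition of unity cuts them into small
pieces (`enorm_apply_le_sum_supTest`), which are controlled by the scales near one.

Besov norm from the coefficients. The pairing of a wavelet of level `n` with a test function of
scale `ε` is at most `kerBound`: it vanishes unless the centres are close with respect to `max(ε,
2^{-n})`, and it carries a factor `min(2^n ε, (2^n ε)⁻¹)^δ` with `δ > 0` beyond the homogeneous
factor `(2^n ε)^α`. For `ε ≥ 2^{-n}` the gain comes from the cancellations of the wavelet. Only
derivatives of scaled order at most `r` are under control, so a Taylor expansion of ordinary order
`r` is not available. Interpolation coordinate by coordinate needs only pure derivatives `∂_i^{m i}`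
with `s i * m i ≤ r`; this is where the condition on `s i * (r / s i)` enters. The interpolant has
degree at most `r` in each variable, and wavelets annihilate such functions because they are
orthogonal to the translates of the scaling function, which reproduce them
(`integral_mul_prod_polynomial`). For `ε ≤ 2^{-n}` the gain comes from a Taylor expansion of the
wavelet and the vanishing moments of the test function. Two Schur tests, over the grid points in
`L^p` and over the levels in `L^q`, sum these bounds in `exists_besovNorm_le`.

Existence. The same cancellations make the wavelet series with given coefficients converge
absolutely on Schwartz functions, and orthonormality together with dominated convergence identifies
its coefficients (`exists_distribution`).

Uniqueness. To bound an arbitrary `ξ` by its coefficients, it must agree with its series on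
compactly supported test functions (`apply_eq_zero_of_hasPairing_waveletFamily`). A `C^r` function
orthogonal to all wavelets of large level is a finite combination of basis functions, so a `ξ` with
zero coefficients kills it. This applies to Riemann sums, on fine grids, of the convolution of a
test function `g` with a dilate of the scaling function. Refining the grid, and then letting the
dilates concentrate, gives `ξ g = 0`; no `C^r` convergence of wavelet expansions is needed. -/

namespace AnisoBesov

variable {d : ℕ}

/-! ### Partial derivatives -/

/-- The partial derivative in direction `j`. -/
noncomputable def pd (j : Fin d) (f : (Fin d → ℝ) → ℝ) : (Fin d → ℝ) → ℝ :=
  fun x => fderiv ℝ f x (Pi.single j 1)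

theorem contDiff_pd {n : ℕ} {f : (Fin d → ℝ) → ℝ} (hf : ContDiff ℝ ((n + 1 : ℕ) : WithTop ℕ∞) f)
    (j : Fin d) : ContDiff ℝ (n : WithTop ℕ∞) (pd j f) := by
  unfold pd
  exact (hf.fderiv_right (m := (n : WithTop ℕ∞)) (by push_cast; exact le_rfl)).clm_apply
    contDiff_const

theorem hasCompactSupport_pd {f : (Fin d → ℝ) → ℝ} (hf : HasCompactSupport f) (j : Fin d) :
    HasCompactSupport (pd j f) :=
  hf.fderiv_apply (𝕜 := ℝ) (Pi.single j 1)

theorem mixedDeriv_fin_zero (i : Fin 0 → Fin d) (f : (Fin d → ℝ) → ℝ) : mixedDeriv i f = f := by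
  ext x
  simp [mixedDeriv]

/-- The last slot of the iterated derivative is the innermost differentiation, so evaluation of
`fderiv` at a fixed vector can be pulled through the other `n` derivatives. Inductions on the order
of a derivative go through this recursion. -/
theorem mixedDeriv_succ {n : ℕ} (i : Fin (n + 1) → Fin d) {f : (Fin d → ℝ) → ℝ}
    (hf : ContDiff ℝ ((n + 1 : ℕ) : WithTop ℕ∞) f) :
    mixedDeriv i f = mixedDeriv (Fin.init i) (pd (i (Fin.last n)) f) := by
  ext x
  unfold mixedDeriv
  rw [iteratedFDeriv_succ_apply_right]
  have h1 : ContDiff ℝ (n : WithTop ℕ∞) (fderiv ℝ f) :=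
    hf.fderiv_right (m := (n : WithTop ℕ∞)) (by push_cast; exact le_rfl)
  have h2 : pd (i (Fin.last n)) f =
      (ContinuousLinearMap.apply ℝ ℝ (Pi.single (i (Fin.last n)) (1 : ℝ))) ∘ (fderiv ℝ f) := by
    ext y; rfl
  rw [h2, ContinuousLinearMap.iteratedFDeriv_comp_left _ h1.contDiffAt le_rfl]
  rfl

theorem mixedDeriv_add {n : ℕ} (i : Fin n → Fin d) {f g : (Fin d → ℝ) → ℝ}
    (hf : ContDiff ℝ (n : WithTop ℕ∞) f) (hg : ContDiff ℝ (n : WithTop ℕ∞) g) :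
    mixedDeriv i (fun x => f x + g x) = fun x => mixedDeriv i f x + mixedDeriv i g x := by
  ext x
  have := iteratedFDeriv_add_apply (𝕜 := ℝ) (x := x) (i := n) hf.contDiffAt hg.contDiffAt
  unfold mixedDeriv
  change (iteratedFDeriv ℝ n (f + g) x) _ = _
  rw [this]; rfl

theorem mixedDeriv_const_mul {n : ℕ} (i : Fin n → Fin d) {f : (Fin d → ℝ) → ℝ}
    (hf : ContDiff ℝ (n : WithTop ℕ∞) f) (c : ℝ) :
    mixedDeriv i (fun x => c * f x) = fun x => c * mixedDeriv i f x := by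
  ext x
  have := iteratedFDeriv_const_smul_apply (𝕜 := ℝ) (a := c) (x := x) (i := n) hf.contDiffAt
  unfold mixedDeriv
  change (iteratedFDeriv ℝ n (c • f) x) _ = _
  rw [this]; rfl

theorem mixedDeriv_sub {n : ℕ} (i : Fin n → Fin d) {f g : (Fin d → ℝ) → ℝ}
    (hf : ContDiff ℝ (n : WithTop ℕ∞) f) (hg : ContDiff ℝ (n : WithTop ℕ∞) g) :
    mixedDeriv i (fun x => f x - g x) = fun x => mixedDeriv i f x - mixedDeriv i g x := by
  have h1 := mixedDeriv_const_mul i hg (-1)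
  have h2 := mixedDeriv_add i hf (contDiff_const.mul hg : ContDiff ℝ n (fun x => (-1) * g x))
  rw [h1] at h2
  simpa [sub_eq_add_neg] using h2

theorem mixedDeriv_zero {n : ℕ} (i : Fin n → Fin d) :
    mixedDeriv i (fun _ => (0 : ℝ)) = fun _ => 0 := by
  have h := mixedDeriv_const_mul i (f := fun _ => (0 : ℝ)) contDiff_const 0
  simpa using h

theorem mixedDeriv_sum {n : ℕ} (i : Fin n → Fin d) {ι : Type*} (S : Finset ι)
    {f : ι → (Fin d → ℝ) → ℝ} (hf : ∀ a ∈ S, ContDiff ℝ (n : WithTop ℕ∞) (f a)) :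
    mixedDeriv i (fun x => ∑ a ∈ S, f a x) = fun x => ∑ a ∈ S, mixedDeriv i (f a) x := by
  classical
  induction S using Finset.induction_on with
  | empty => simpa using mixedDeriv_zero i
  | insert a S ha ih =>
    simp only [Finset.sum_insert ha]
    rw [mixedDeriv_add i (hf a (by simp))
      (ContDiff.sum fun b hb => hf b (by simp [hb])), ih fun b hb => hf b (by simp [hb])]

theorem continuous_mixedDeriv {n : ℕ} (i : Fin n → Fin d) {f : (Fin d → ℝ) → ℝ}
    (hf : ContDiff ℝ (n : WithTop ℕ∞) f) : Continuous (mixedDeriv i f) := by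
  unfold mixedDeriv
  have := hf.continuous_iteratedFDeriv (m := n) le_rfl
  exact (ContinuousMultilinearMap.apply ℝ (fun _ : Fin n => Fin d → ℝ) ℝ
    (fun j => Pi.single (i j) (1 : ℝ))).continuous.comp this

theorem hasCompactSupport_mixedDeriv {n : ℕ} (i : Fin n → Fin d) {f : (Fin d → ℝ) → ℝ}
    (hf : HasCompactSupport f) : HasCompactSupport (mixedDeriv i f) := by
  refine (hf.iteratedFDeriv (𝕜 := ℝ) n).mono' ?_
  intro x hx
  refine subset_tsupport _ ?_
  intro h0
  exact hx (by simp [mixedDeriv, h0])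

/-! ### Uniform bounds for derivatives up to a given scaled order -/

/-- `∂^k f` is bounded by `B` for all `k` with `|k|_𝔰 ≤ r`. -/
def CrBound (s : Fin d → ℕ) (r : ℕ) (B : ℝ) (f : (Fin d → ℝ) → ℝ) : Prop :=
  ∀ (n : ℕ) (i : Fin n → Fin d), ∑ j, s (i j) ≤ r → ∀ x, |mixedDeriv i f x| ≤ B

theorem length_le_of_sum_le {s : Fin d → ℕ} (hs : ∀ i, 0 < s i) {r n : ℕ} {i : Fin n → Fin d}
    (h : ∑ j, s (i j) ≤ r) : n ≤ r := by
  calc n = ∑ _j : Fin n, 1 := by simp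
    _ ≤ ∑ j, s (i j) := Finset.sum_le_sum fun j _ => hs (i j)
    _ ≤ r := h

theorem CrBound.nonneg {s : Fin d → ℕ} {r : ℕ} {B : ℝ} {f : (Fin d → ℝ) → ℝ}
    (h : CrBound s r B f) : 0 ≤ B :=
  (abs_nonneg _).trans (h 0 Fin.elim0 (by simp) 0)

theorem CrBound.mono {s : Fin d → ℕ} {r : ℕ} {B B' : ℝ} {f : (Fin d → ℝ) → ℝ}
    (h : CrBound s r B f) (hB : B ≤ B') : CrBound s r B' f :=
  fun n i hi x => (h n i hi x).trans hB

theorem CrBound.const_mul {s : Fin d → ℕ} (hs : ∀ i, 0 < s i) {r : ℕ} {B : ℝ}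
    {f : (Fin d → ℝ) → ℝ} (hf : ContDiff ℝ (r : WithTop ℕ∞) f)
    (h : CrBound s r B f) (c : ℝ) : CrBound s r (|c| * B) (fun x => c * f x) := by
  intro n i hi x
  have hn : (n : WithTop ℕ∞) ≤ r := by exact_mod_cast length_le_of_sum_le hs hi
  rw [mixedDeriv_const_mul i (hf.of_le hn), abs_mul]
  exact mul_le_mul_of_nonneg_left (h n i hi x) (abs_nonneg _)

theorem exists_crBound {s : Fin d → ℕ} (hs : ∀ i, 0 < s i) {r : ℕ} {f : (Fin d → ℝ) → ℝ}
    (hf : ContDiff ℝ (r : WithTop ℕ∞) f) (hc : HasCompactSupport f) :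
    ∃ B, CrBound s r B f := by
  have h1 : ∀ n : Fin (r + 1), ∀ i : Fin n → Fin d, ∃ C, ∀ x, |mixedDeriv i f x| ≤ C := by
    intro n i
    have hn : (((n : ℕ)) : WithTop ℕ∞) ≤ r := by exact_mod_cast Nat.lt_succ_iff.mp n.2
    obtain ⟨C, hC⟩ := (hasCompactSupport_mixedDeriv i hc).exists_bound_of_continuous
      (continuous_mixedDeriv i (hf.of_le hn))
    exact ⟨C, fun x => hC x⟩
  choose C hC using h1
  refine ⟨∑ n : Fin (r + 1), ∑ i : Fin n → Fin d, |C n i|, ?_⟩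
  intro n i hi x
  have hn : n < r + 1 := Nat.lt_succ_of_le (length_le_of_sum_le hs hi)
  calc |mixedDeriv i f x| ≤ |C ⟨n, hn⟩ i| := (hC ⟨n, hn⟩ i x).trans (le_abs_self _)
    _ ≤ ∑ i : Fin n → Fin d, |C ⟨n, hn⟩ i| :=
      Finset.single_le_sum (f := fun i => |C ⟨n, hn⟩ i|) (fun _ _ => abs_nonneg _)
        (Finset.mem_univ i)
    _ ≤ _ := Finset.single_le_sum
      (f := fun n : Fin (r + 1) => ∑ i : Fin n → Fin d, |C n i|)
      (fun _ _ => Finset.sum_nonneg fun _ _ => abs_nonneg _) (Finset.mem_univ (⟨n, hn⟩ : Fin (r+1)))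

theorem pd_mul {f g : (Fin d → ℝ) → ℝ} (hf : ContDiff ℝ 1 f) (hg : ContDiff ℝ 1 g) (j : Fin d) :
    pd j (fun x => f x * g x) = fun x => f x * pd j g x + pd j f x * g x := by
  ext x
  unfold pd
  rw [fderiv_fun_mul (hf.differentiable one_ne_zero x) (hg.differentiable one_ne_zero x)]
  simp [mul_comm]

/-- Leibniz rule by induction on the order; each differentiation doubles the number of products,
hence `2 ^ n`. The budget `r` is generalised too, because a factor that has absorbed one derivative
is only controlled with a budget reduced by the weight of that direction. -/
theorem abs_mixedDeriv_mul_le {s : Fin d → ℕ} {A B : ℝ} (n : ℕ) :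
    ∀ (r : ℕ) (i : Fin n → Fin d) (f g : (Fin d → ℝ) → ℝ),
      ContDiff ℝ (n : WithTop ℕ∞) f → ContDiff ℝ (n : WithTop ℕ∞) g →
      (∀ (m : ℕ) (i : Fin m → Fin d), m ≤ n → ∑ j, s (i j) ≤ r → ∀ x, |mixedDeriv i f x| ≤ A) →
      (∀ (m : ℕ) (i : Fin m → Fin d), m ≤ n → ∑ j, s (i j) ≤ r → ∀ x, |mixedDeriv i g x| ≤ B) →
      ∑ j, s (i j) ≤ r → ∀ x, |mixedDeriv i (fun x => f x * g x) x| ≤ 2 ^ n * (A * B) := by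
  induction n with
  | zero =>
    intro r i f g _ _ hA hB _ x
    have h1 := hA 0 Fin.elim0 le_rfl (by simp) x
    have h2 := hB 0 Fin.elim0 le_rfl (by simp) x
    rw [mixedDeriv_fin_zero] at h1 h2 ⊢
    rw [abs_mul, pow_zero, one_mul]
    exact mul_le_mul h1 h2 (abs_nonneg _) ((abs_nonneg _).trans h1)
  | succ n ih =>
    intro r i f g hf hg hA hB hi x
    have h1 : (1 : WithTop ℕ∞) ≤ ((n + 1 : ℕ) : WithTop ℕ∞) := by
      exact_mod_cast Nat.succ_le_succ (Nat.zero_le n)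
    have hn : ((n : ℕ) : WithTop ℕ∞) ≤ ((n + 1 : ℕ) : WithTop ℕ∞) := by
      exact_mod_cast Nat.le_succ n
    have hsum : ∑ j, s (Fin.init i j) + s (i (Fin.last n)) ≤ r := by
      rw [Fin.sum_univ_castSucc] at hi
      exact hi
    have key : ∀ (h : (Fin d → ℝ) → ℝ) (D : ℝ), ContDiff ℝ ((n + 1 : ℕ) : WithTop ℕ∞) h →
        (∀ (m : ℕ) (i : Fin m → Fin d), m ≤ n + 1 → ∑ j, s (i j) ≤ r →
          ∀ x, |mixedDeriv i h x| ≤ D) →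
        ∀ (m : ℕ) (i' : Fin m → Fin d), m ≤ n → ∑ j, s (i' j) ≤ r - s (i (Fin.last n)) →
          ∀ x, |mixedDeriv i' (pd (i (Fin.last n)) h) x| ≤ D := by
      intro h D hh hD m i' hm hi' x
      have := hD (m + 1) (Fin.snoc i' (i (Fin.last n))) (by omega)
        (by rw [Fin.sum_univ_castSucc]; simp; omega) x
      rwa [mixedDeriv_succ _ (hh.of_le (by exact_mod_cast Nat.succ_le_succ hm)), Fin.init_snoc,
        Fin.snoc_last] at this
    rw [mixedDeriv_succ i (hf.mul hg), pd_mul (hf.of_le h1) (hg.of_le h1),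
      mixedDeriv_add _ ((hf.of_le hn).mul (contDiff_pd hg _)) ((contDiff_pd hf _).mul (hg.of_le hn))]
    refine (abs_add_le _ _).trans ?_
    have e1 := ih (r - s (i (Fin.last n))) (Fin.init i) f (pd (i (Fin.last n)) g) (hf.of_le hn)
      (contDiff_pd hg _) (fun m i' hm hi' => hA m i' (by omega) (by omega)) (key g B hg hB)
      (by omega) x
    have e2 := ih (r - s (i (Fin.last n))) (Fin.init i) (pd (i (Fin.last n)) f) g
      (contDiff_pd hf _) (hg.of_le hn) (key f A hf hA)
      (fun m i' hm hi' => hB m i' (by omega) (by omega)) (by omega) x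
    calc _ ≤ _ := add_le_add e1 e2
      _ = _ := by ring

theorem CrBound.mul {s : Fin d → ℕ} (hs : ∀ i, 0 < s i) {r : ℕ} {A B : ℝ}
    {f g : (Fin d → ℝ) → ℝ} (hf : ContDiff ℝ (r : WithTop ℕ∞) f)
    (hg : ContDiff ℝ (r : WithTop ℕ∞) g) (hA : CrBound s r A f) (hB : CrBound s r B g) :
    CrBound s r (2 ^ r * (A * B)) (fun x => f x * g x) := by
  intro n i hi x
  have hn := length_le_of_sum_le hs hi
  have hn' : ((n : ℕ) : WithTop ℕ∞) ≤ (r : ℕ) := by exact_mod_cast hn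
  refine (abs_mixedDeriv_mul_le n r i f g (hf.of_le hn') (hg.of_le hn')
    (fun m i _ hi => hA m i hi) (fun m i _ hi => hB m i hi) hi x).trans ?_
  exact mul_le_mul_of_nonneg_right (pow_le_pow_right₀ one_le_two hn)
    (mul_nonneg hA.nonneg hB.nonneg)

/-! ### Diagonal affine changes of variables -/

theorem pd_comp_affine {f : (Fin d → ℝ) → ℝ} (hf : ContDiff ℝ 1 f) (a c : Fin d → ℝ) (j : Fin d) :
    pd j (fun x => f (fun l => a l * x l + c l)) =
      fun x => a j * pd j f (fun l => a l * x l + c l) := by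
  ext x
  unfold pd
  have h1 : HasFDerivAt (fun x : Fin d → ℝ => (fun l => a l * x l + c l))
      (ContinuousLinearMap.pi fun l =>
        a l • ContinuousLinearMap.proj (R := ℝ) (φ := fun _ : Fin d => ℝ) l) x := by
    rw [hasFDerivAt_pi]
    intro l
    exact ((hasFDerivAt_apply l x).const_mul (a l)).add_const (c l)
  have h2 := (hf.differentiable one_ne_zero (fun l => a l * x l + c l)).hasFDerivAt.comp x h1
  have h3 : fderiv ℝ (fun x : Fin d → ℝ => f (fun l => a l * x l + c l)) x = _ := h2.fderiv
  rw [h3]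
  have h4 : (ContinuousLinearMap.pi fun l =>
        a l • ContinuousLinearMap.proj (R := ℝ) (φ := fun _ : Fin d => ℝ) l)
      (Pi.single j (1 : ℝ)) = a j • (Pi.single j (1 : ℝ) : Fin d → ℝ) := by
    ext l
    by_cases h : l = j
    · subst h; simp
    · simp [Pi.single_eq_of_ne h]
  rw [ContinuousLinearMap.comp_apply, h4, map_smul, smul_eq_mul]

theorem contDiff_affine {n : WithTop ℕ∞} (a c : Fin d → ℝ) :
    ContDiff ℝ n (fun x : Fin d → ℝ => (fun l => a l * x l + c l)) := by
  fun_prop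

theorem contDiff_comp_affine {n : WithTop ℕ∞} {f : (Fin d → ℝ) → ℝ} (hf : ContDiff ℝ n f)
    (a c : Fin d → ℝ) : ContDiff ℝ n (fun x : Fin d → ℝ => f (fun l => a l * x l + c l)) :=
  hf.comp (contDiff_affine a c)

theorem mixedDeriv_comp_affine {n : ℕ} : ∀ (i : Fin n → Fin d) {f : (Fin d → ℝ) → ℝ}
    (_ : ContDiff ℝ (n : WithTop ℕ∞) f) (a c : Fin d → ℝ),
    mixedDeriv i (fun x => f (fun l => a l * x l + c l)) =
      fun x => (∏ j, a (i j)) * mixedDeriv i f (fun l => a l * x l + c l) := by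
  induction n with
  | zero => intro i f _ a c; simp [mixedDeriv_fin_zero]
  | succ n ih =>
    intro i f hf a c
    have h1 : (1 : WithTop ℕ∞) ≤ ((n + 1 : ℕ) : WithTop ℕ∞) := by
      exact_mod_cast Nat.succ_le_succ (Nat.zero_le n)
    rw [mixedDeriv_succ i (contDiff_comp_affine hf a c), mixedDeriv_succ i hf,
      pd_comp_affine (hf.of_le h1), mixedDeriv_const_mul _
        (contDiff_comp_affine (contDiff_pd hf _) a c), ih _ (contDiff_pd hf _)]
    ext x
    rw [Fin.prod_univ_castSucc]
    simp only [Fin.init]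
    ring

/-! ### Derivatives along a coordinate and along a line -/

theorem iteratedDeriv_update {m : ℕ} : ∀ {F : (Fin d → ℝ) → ℝ}
    (_ : ContDiff ℝ (m : WithTop ℕ∞) F) (i : Fin d) (x : Fin d → ℝ),
    iteratedDeriv m (fun t => F (Function.update x i t)) =
      fun t => mixedDeriv (fun _ : Fin m => i) F (Function.update x i t) := by
  induction m with
  | zero => intro F _ i x; simp [mixedDeriv_fin_zero]
  | succ m ih =>
    intro F hF i x
    have h1 : (1 : WithTop ℕ∞) ≤ ((m + 1 : ℕ) : WithTop ℕ∞) := by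
      exact_mod_cast Nat.succ_le_succ (Nat.zero_le m)
    have h2 : deriv (fun t => F (Function.update x i t)) =
        fun t => pd i F (Function.update x i t) := by
      ext t
      have h3 := ((hF.of_le h1).differentiable one_ne_zero
        (Function.update x i t)).hasFDerivAt.comp_hasDerivAt t (hasDerivAt_update x i t)
      exact h3.deriv
    rw [iteratedDeriv_succ', h2, ih (contDiff_pd hF i), mixedDeriv_succ _ hF]
    rfl

/-- Expanding `v` in the standard basis turns each derivative along the line into a sum over
directions. Summing over words of directions instead of multi-indices avoids multinomial
coefficients. -/
theorem iteratedDeriv_line {m : ℕ} : ∀ {F : (Fin d → ℝ) → ℝ}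
    (_ : ContDiff ℝ (m : WithTop ℕ∞) F) (c v : Fin d → ℝ),
    iteratedDeriv m (fun t : ℝ => F (fun l => c l + t * v l)) =
      fun t => ∑ i : Fin m → Fin d, (∏ j, v (i j)) * mixedDeriv i F (fun l => c l + t * v l) := by
  induction m with
  | zero => intro F _ c v; simp [mixedDeriv_fin_zero]
  | succ m ih =>
    intro F hF c v
    have h1 : (1 : WithTop ℕ∞) ≤ ((m + 1 : ℕ) : WithTop ℕ∞) := by
      exact_mod_cast Nat.succ_le_succ (Nat.zero_le m)
    have hv : v = ∑ l, v l • (Pi.single l (1 : ℝ) : Fin d → ℝ) := by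
      ext l
      simp [Finset.sum_apply, Pi.single_apply]
    have h2 : deriv (fun t : ℝ => F (fun l => c l + t * v l)) =
        fun t => (fun y => ∑ l, v l * pd l F y) (fun l => c l + t * v l) := by
      ext t
      have h4 : HasDerivAt (fun t : ℝ => (fun l => c l + t * v l)) v t := by
        rw [hasDerivAt_pi]
        intro l
        simpa using ((hasDerivAt_id t).mul_const (v l)).const_add (c l)
      have h3 := ((hF.of_le h1).differentiable one_ne_zero
        (fun l => c l + t * v l)).hasFDerivAt.comp_hasDerivAt t h4
      have h5 : deriv (fun t : ℝ => F (fun l => c l + t * v l)) t = _ := h3.deriv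
      rw [h5]
      conv_lhs => rw [hv]
      simp only [map_sum, map_smul, smul_eq_mul, pd]
      rw [← hv]
    have h6 : ∀ l, ContDiff ℝ (m : WithTop ℕ∞) (fun y => v l * pd l F y) := fun l =>
      contDiff_const.mul (contDiff_pd hF l)
    rw [iteratedDeriv_succ', h2, ih (ContDiff.sum fun l _ => h6 l)]
    ext t
    rw [← (Fin.snocEquiv (fun _ : Fin (m + 1) => Fin d)).sum_comp, Fintype.sum_prod_type,
      Finset.sum_comm]
    refine Finset.sum_congr rfl fun i _ => ?_
    rw [mixedDeriv_sum i _ fun l _ => h6 l, Finset.mul_sum]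
    refine Finset.sum_congr rfl fun l _ => ?_
    rw [mixedDeriv_const_mul i (contDiff_pd hF l), mixedDeriv_succ _ hF]
    simp only [Fin.snocEquiv, Equiv.coe_fn_mk, Fin.prod_univ_castSucc, Fin.snoc_castSucc,
      Fin.snoc_last, Fin.init_snoc]
    ring

/-! ### Sums of bounds and convergence in `C^r` -/

theorem CrBound.add {s : Fin d → ℕ} (hs : ∀ i, 0 < s i) {r : ℕ} {A B : ℝ}
    {f g : (Fin d → ℝ) → ℝ} (hf : ContDiff ℝ (r : WithTop ℕ∞) f)
    (hg : ContDiff ℝ (r : WithTop ℕ∞) g) (hA : CrBound s r A f) (hB : CrBound s r B g) :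
    CrBound s r (A + B) (fun x => f x + g x) := by
  intro n i hi x
  have hn : ((n : ℕ) : WithTop ℕ∞) ≤ (r : ℕ) := by exact_mod_cast length_le_of_sum_le hs hi
  rw [mixedDeriv_add i (hf.of_le hn) (hg.of_le hn)]
  exact (abs_add_le _ _).trans (add_le_add (hA n i hi x) (hB n i hi x))

theorem CrBound.sub {s : Fin d → ℕ} (hs : ∀ i, 0 < s i) {r : ℕ} {A B : ℝ}
    {f g : (Fin d → ℝ) → ℝ} (hf : ContDiff ℝ (r : WithTop ℕ∞) f)
    (hg : ContDiff ℝ (r : WithTop ℕ∞) g) (hA : CrBound s r A f) (hB : CrBound s r B g) :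
    CrBound s r (A + B) (fun x => f x - g x) := by
  intro n i hi x
  have hn : ((n : ℕ) : WithTop ℕ∞) ≤ (r : ℕ) := by exact_mod_cast length_le_of_sum_le hs hi
  rw [mixedDeriv_sub i (hf.of_le hn) (hg.of_le hn)]
  exact (abs_sub _ _).trans (add_le_add (hA n i hi x) (hB n i hi x))

/-- Convergence in `C^r`, uniformly with all derivatives of scaled order at most `r`. -/
def CrTendsto (s : Fin d → ℕ) (r : ℕ) (g : ℕ → (Fin d → ℝ) → ℝ) (f : (Fin d → ℝ) → ℝ) : Prop :=
  ∀ ε > 0, ∀ᶠ n in atTop, CrBound s r ε (fun x => g n x - f x)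

/-- All weights are positive, so only words of length at most `r` occur. There are finitely many of
them, and the separate uniform limits combine into one eventual bound. -/
theorem crTendsto_iff {s : Fin d → ℕ} (hs : ∀ i, 0 < s i) {r : ℕ} {g : ℕ → (Fin d → ℝ) → ℝ}
    {f : (Fin d → ℝ) → ℝ} (hg : ∀ n, ContDiff ℝ (r : WithTop ℕ∞) (g n))
    (hf : ContDiff ℝ (r : WithTop ℕ∞) f) :
    CrTendsto s r g f ↔ ∀ (m : ℕ) (i : Fin m → Fin d), ∑ j, s (i j) ≤ r →
      TendstoUniformly (fun n x => mixedDeriv i (g n) x) (mixedDeriv i f) atTop := by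
  constructor
  · intro h m i hi
    have hm : ((m : ℕ) : WithTop ℕ∞) ≤ (r : ℕ) := by exact_mod_cast length_le_of_sum_le hs hi
    rw [Metric.tendstoUniformly_iff]
    intro ε hε
    filter_upwards [h (ε / 2) (by positivity)] with n hn x
    have := hn m i hi x
    rw [mixedDeriv_sub i ((hg n).of_le hm) (hf.of_le hm)] at this
    rw [dist_comm, Real.dist_eq]
    exact this.trans_lt (by linarith)
  · intro h ε hε
    have h1 : ∀ m : Fin (r + 1), ∀ i : Fin m → Fin d, ∀ᶠ n in atTop, ∑ j, s (i j) ≤ r →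
        ∀ x, |mixedDeriv i (fun x => g n x - f x) x| ≤ ε := by
      intro m i
      by_cases hi : ∑ j, s (i j) ≤ r
      · have hm : (((m : ℕ) : ℕ) : WithTop ℕ∞) ≤ (r : ℕ) := by
          exact_mod_cast length_le_of_sum_le hs hi
        filter_upwards [Metric.tendstoUniformly_iff.mp (h m i hi) ε hε] with n hn _ x
        rw [mixedDeriv_sub i ((hg n).of_le hm) (hf.of_le hm), ← Real.dist_eq, dist_comm]
        exact (hn x).le
      · exact Eventually.of_forall fun n hi' => absurd hi' hi
    have h2 : ∀ᶠ n in atTop, ∀ m : Fin (r + 1), ∀ i : Fin m → Fin d, ∑ j, s (i j) ≤ r →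
        ∀ x, |mixedDeriv i (fun x => g n x - f x) x| ≤ ε := by
      rw [eventually_all]
      intro m
      rw [eventually_all]
      exact h1 m
    filter_upwards [h2] with n hn m i hi x
    exact hn ⟨m, Nat.lt_succ_of_le (length_le_of_sum_le hs hi)⟩ i hi x

theorem CrTendsto.add {s : Fin d → ℕ} (hs : ∀ i, 0 < s i) {r : ℕ}
    {g g' : ℕ → (Fin d → ℝ) → ℝ} {f f' : (Fin d → ℝ) → ℝ}
    (hg : ∀ n, ContDiff ℝ (r : WithTop ℕ∞) (g n)) (hf : ContDiff ℝ (r : WithTop ℕ∞) f)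
    (hg' : ∀ n, ContDiff ℝ (r : WithTop ℕ∞) (g' n)) (hf' : ContDiff ℝ (r : WithTop ℕ∞) f')
    (h : CrTendsto s r g f) (h' : CrTendsto s r g' f') :
    CrTendsto s r (fun n x => g n x + g' n x) (fun x => f x + f' x) := by
  intro ε hε
  filter_upwards [h (ε / 2) (by positivity), h' (ε / 2) (by positivity)] with n h1 h2
  have := h1.add hs ((hg n).sub hf) ((hg' n).sub hf') h2
  rw [add_halves] at this
  convert this using 2
  ring

theorem CrTendsto.sub {s : Fin d → ℕ} (hs : ∀ i, 0 < s i) {r : ℕ}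
    {g g' : ℕ → (Fin d → ℝ) → ℝ} {f f' : (Fin d → ℝ) → ℝ}
    (hg : ∀ n, ContDiff ℝ (r : WithTop ℕ∞) (g n)) (hf : ContDiff ℝ (r : WithTop ℕ∞) f)
    (hg' : ∀ n, ContDiff ℝ (r : WithTop ℕ∞) (g' n)) (hf' : ContDiff ℝ (r : WithTop ℕ∞) f')
    (h : CrTendsto s r g f) (h' : CrTendsto s r g' f') :
    CrTendsto s r (fun n x => g n x - g' n x) (fun x => f x - f' x) := by
  intro ε hε
  filter_upwards [h (ε / 2) (by positivity), h' (ε / 2) (by positivity)] with n h1 h2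
  have := h1.sub hs ((hg n).sub hf) ((hg' n).sub hf') h2
  rw [add_halves] at this
  convert this using 2
  ring

theorem CrTendsto.const_mul {s : Fin d → ℕ} (hs : ∀ i, 0 < s i) {r : ℕ}
    {g : ℕ → (Fin d → ℝ) → ℝ} {f : (Fin d → ℝ) → ℝ}
    (hg : ∀ n, ContDiff ℝ (r : WithTop ℕ∞) (g n)) (hf : ContDiff ℝ (r : WithTop ℕ∞) f)
    (h : CrTendsto s r g f) (c : ℝ) :
    CrTendsto s r (fun n x => c * g n x) (fun x => c * f x) := by
  intro ε hε
  have hc : 0 < |c| + 1 := by positivity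
  filter_upwards [h (ε / (|c| + 1)) (by positivity)] with n h1
  have h2 := h1.const_mul hs ((hg n).sub hf) c
  have h3 : |c| * (ε / (|c| + 1)) ≤ ε := by
    rw [mul_div_assoc', div_le_iff₀ hc]
    nlinarith [abs_nonneg c]
  convert h2.mono h3 using 2
  ring

/-! ### Convolution -/

/-- The convolution `ρ * f`. -/
noncomputable def smear (ρ f : (Fin d → ℝ) → ℝ) : (Fin d → ℝ) → ℝ :=
  fun x => ∫ y, ρ y * f (x - y)

theorem smear_eq_convolution (ρ f : (Fin d → ℝ) → ℝ) :
    smear ρ f = convolution ρ f (ContinuousLinearMap.mul ℝ ℝ) volume := by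
  ext x
  rw [convolution_def]
  rfl

theorem contDiff_smear_right {n : ℕ} {ρ f : (Fin d → ℝ) → ℝ} (hρ : LocallyIntegrable ρ volume)
    (hf : ContDiff ℝ (n : WithTop ℕ∞) f) (hc : HasCompactSupport f) :
    ContDiff ℝ (n : WithTop ℕ∞) (smear ρ f) := by
  rw [smear_eq_convolution]
  exact hc.contDiff_convolution_right (n := (n : ℕ∞)) _ hρ hf

theorem contDiff_smear_left {ρ f : (Fin d → ℝ) → ℝ} (hρ : ContDiff ℝ (⊤ : ℕ∞) ρ)
    (hc : HasCompactSupport ρ) (hf : LocallyIntegrable f volume) :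
    ContDiff ℝ (⊤ : ℕ∞) (smear ρ f) := by
  rw [smear_eq_convolution]
  exact hc.contDiff_convolution_left _ hρ hf

theorem pd_smear {ρ f : (Fin d → ℝ) → ℝ} (hρ : LocallyIntegrable ρ volume)
    (hf : ContDiff ℝ 1 f) (hc : HasCompactSupport f) (j : Fin d) :
    pd j (smear ρ f) = smear ρ (pd j f) := by
  ext x
  have h1 := hc.hasFDerivAt_convolution_right (ContinuousLinearMap.mul ℝ ℝ) hρ hf x
  unfold pd
  rw [smear_eq_convolution, h1.fderiv, convolution_precompR_apply _ hρ (hc.fderiv (𝕜 := ℝ))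
    (hf.continuous_fderiv one_ne_zero)]
  rfl

theorem mixedDeriv_smear {n : ℕ} {ρ : (Fin d → ℝ) → ℝ} (hρ : LocallyIntegrable ρ volume) :
    ∀ (i : Fin n → Fin d) {f : (Fin d → ℝ) → ℝ} (_ : ContDiff ℝ (n : WithTop ℕ∞) f)
      (_ : HasCompactSupport f), mixedDeriv i (smear ρ f) = smear ρ (mixedDeriv i f) := by
  induction n with
  | zero => intro i f _ _; simp [mixedDeriv_fin_zero]
  | succ n ih =>
    intro i f hf hc
    have h1 : (1 : WithTop ℕ∞) ≤ ((n + 1 : ℕ) : WithTop ℕ∞) := by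
      exact_mod_cast Nat.succ_le_succ (Nat.zero_le n)
    rw [mixedDeriv_succ i (contDiff_smear_right hρ hf hc), mixedDeriv_succ i hf,
      pd_smear hρ (hf.of_le h1) hc, ih _ (contDiff_pd hf _) (hasCompactSupport_pd hc _)]

theorem abs_smear_le {ρ f : (Fin d → ℝ) → ℝ} (hρ : Integrable ρ) {B : ℝ}
    (hB : ∀ x, |f x| ≤ B) (x : Fin d → ℝ) : |smear ρ f x| ≤ (∫ y, |ρ y|) * B := by
  unfold smear
  rw [← integral_mul_const, ← Real.norm_eq_abs]
  refine norm_integral_le_of_norm_le (hρ.abs.mul_const B) (Eventually.of_forall fun y => ?_)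
  rw [Real.norm_eq_abs, abs_mul]
  exact mul_le_mul_of_nonneg_left (hB _) (abs_nonneg _)

theorem support_smear_subset {ρ f : (Fin d → ℝ) → ℝ} {R R' : ℝ}
    (hρ : Function.support ρ ⊆ Metric.closedBall 0 R)
    (hf : Function.support f ⊆ Metric.closedBall 0 R') :
    Function.support (smear ρ f) ⊆ Metric.closedBall 0 (R' + R) := by
  intro x hx
  by_contra hlt
  apply hx
  have h0 : ∀ y, ρ y * f (x - y) = 0 := by
    intro y
    by_contra hne
    have h1 := hρ (left_ne_zero_of_mul hne)
    have h2 := hf (right_ne_zero_of_mul hne)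
    simp only [mem_closedBall_zero_iff] at h1 h2 hlt
    apply hlt
    calc ‖x‖ = ‖(x - y) + y‖ := by simp
      _ ≤ _ := (norm_add_le _ _).trans (add_le_add h2 h1)
  simp [smear, h0]

/-- A family of kernels that concentrates at the origin. -/
structure IsApproxId (ρ : ℕ → (Fin d → ℝ) → ℝ) (A : ℝ) : Prop where
  continuous : ∀ n, Continuous (ρ n)
  integral_eq : ∀ n, ∫ y, ρ n y = 1
  integral_abs_le : ∀ n, ∫ y, |ρ n y| ≤ A
  support_subset : ∃ δ : ℕ → ℝ, Tendsto δ atTop (𝓝 0) ∧ (∀ n, δ n ≤ 1) ∧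
    ∀ n, Function.support (ρ n) ⊆ Metric.closedBall 0 (δ n)

theorem hasCompactSupport_of_support_subset_closedBall {f : (Fin d → ℝ) → ℝ} {R : ℝ}
    (h : Function.support f ⊆ Metric.closedBall 0 R) : HasCompactSupport f :=
  HasCompactSupport.of_support_subset_isCompact (isCompact_closedBall 0 R) h

theorem _root_.HasCompactSupport.exists_support_subset_closedBall {f : (Fin d → ℝ) → ℝ}
    (h : HasCompactSupport f) : ∃ R : ℝ, 0 < R ∧ Function.support f ⊆ Metric.closedBall 0 R := by
  obtain ⟨R, hR, h1⟩ := h.isCompact.isBounded.subset_closedBall_lt 0 0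
  exact ⟨R, hR, (subset_tsupport f).trans h1⟩

theorem IsApproxId.hasCompactSupport {ρ : ℕ → (Fin d → ℝ) → ℝ} {A : ℝ} (h : IsApproxId ρ A)
    (n : ℕ) : HasCompactSupport (ρ n) := by
  obtain ⟨δ, -, -, h1⟩ := h.support_subset
  exact hasCompactSupport_of_support_subset_closedBall (h1 n)

theorem IsApproxId.integrable {ρ : ℕ → (Fin d → ℝ) → ℝ} {A : ℝ} (h : IsApproxId ρ A) (n : ℕ) :
    Integrable (ρ n) :=
  (h.continuous n).integrable_of_hasCompactSupport (h.hasCompactSupport n)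

/-- Since the kernels have integral one, the error is the average of `f (x - y) - f x` against them,
and `f` is uniformly continuous. The kernels may change sign, as dilates of the scaling function do,
so the bound `A` on their `L¹`-norms replaces positivity. -/
theorem IsApproxId.tendstoUniformly_smear {ρ : ℕ → (Fin d → ℝ) → ℝ} {A : ℝ} (h : IsApproxId ρ A)
    {f : (Fin d → ℝ) → ℝ} (hf : Continuous f) (hc : HasCompactSupport f) :
    TendstoUniformly (fun n x => smear (ρ n) f x) f atTop := by
  obtain ⟨δ, hδ, -, hsupp⟩ := h.support_subset
  have hA : 0 ≤ A := (integral_nonneg fun y => abs_nonneg _).trans (h.integral_abs_le 0)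
  rw [Metric.tendstoUniformly_iff]
  intro ε hε
  have huc := Metric.uniformContinuous_iff.mp (hc.uniformContinuous_of_continuous hf)
    (ε / (A + 1)) (by positivity)
  obtain ⟨η, hη, h1⟩ := huc
  filter_upwards [hδ.eventually (gt_mem_nhds hη)] with n hn x
  have h2 : Integrable (fun y => ρ n y * f (x - y)) := by
    refine Continuous.integrable_of_hasCompactSupport
      ((h.continuous n).mul (hf.comp (continuous_const.sub continuous_id))) ?_
    exact (h.hasCompactSupport n).mul_right
  have h3 : smear (ρ n) f x - f x = ∫ y, ρ n y * (f (x - y) - f x) := by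
    simp_rw [mul_sub]
    rw [integral_sub h2 ((h.integrable n).mul_const _), integral_mul_const, h.integral_eq,
      one_mul]
    rfl
  rw [dist_comm, Real.dist_eq, h3]
  calc |∫ y, ρ n y * (f (x - y) - f x)| ≤ ∫ y, |ρ n y| * (ε / (A + 1)) := by
        rw [← Real.norm_eq_abs]
        refine norm_integral_le_of_norm_le ((h.integrable n).abs.mul_const _)
          (Eventually.of_forall fun y => ?_)
        rw [Real.norm_eq_abs, abs_mul]
        by_cases hy : ρ n y = 0
        · simp [hy]
        refine mul_le_mul_of_nonneg_left ?_ (abs_nonneg _)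
        have h4 := hsupp n hy
        rw [mem_closedBall_zero_iff] at h4
        have h5 := h1 (a := x - y) (b := x) (by rw [dist_eq_norm]; simpa using h4.trans_lt hn)
        rw [Real.dist_eq] at h5
        exact h5.le
    _ ≤ A * (ε / (A + 1)) := by
        rw [integral_mul_const]
        exact mul_le_mul_of_nonneg_right (h.integral_abs_le n) (by positivity)
    _ < ε := by
        rw [mul_div_assoc', div_lt_iff₀ (by positivity)]
        nlinarith

theorem IsApproxId.crTendsto_smear {s : Fin d → ℕ} (hs : ∀ i, 0 < s i) {r : ℕ}
    {ρ : ℕ → (Fin d → ℝ) → ℝ} {A : ℝ} (h : IsApproxId ρ A)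
    {f : (Fin d → ℝ) → ℝ} (hf : ContDiff ℝ (r : WithTop ℕ∞) f) (hc : HasCompactSupport f) :
    CrTendsto s r (fun n => smear (ρ n) f) f := by
  have hl : ∀ n, LocallyIntegrable (ρ n) volume := fun n => (h.integrable n).locallyIntegrable
  rw [crTendsto_iff hs (fun n => contDiff_smear_right (hl n) hf hc) hf]
  intro m i hi
  have hm : ((m : ℕ) : WithTop ℕ∞) ≤ (r : ℕ) := by exact_mod_cast length_le_of_sum_le hs hi
  have h1 := h.tendstoUniformly_smear (continuous_mixedDeriv i (hf.of_le hm))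
    (hasCompactSupport_mixedDeriv i hc)
  convert h1 using 3 with n x
  rw [mixedDeriv_smear (hl n) i (hf.of_le hm) hc]

theorem CrBound.smear {s : Fin d → ℕ} (hs : ∀ i, 0 < s i) {r : ℕ} {B : ℝ}
    {ρ f : (Fin d → ℝ) → ℝ} (hρ : Integrable ρ) (hf : ContDiff ℝ (r : WithTop ℕ∞) f)
    (hc : HasCompactSupport f) (hB : CrBound s r B f) :
    CrBound s r ((∫ y, |ρ y|) * B) (smear ρ f) := by
  intro m i hi x
  have hm : ((m : ℕ) : WithTop ℕ∞) ≤ (r : ℕ) := by exact_mod_cast length_le_of_sum_le hs hi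
  rw [mixedDeriv_smear hρ.locallyIntegrable i (hf.of_le hm) hc]
  exact abs_smear_le hρ (hB m i hi) x

/-- There are smooth non-negative approximations of the identity. -/
theorem exists_mollifier (d : ℕ) : ∃ ρ : ℕ → (Fin d → ℝ) → ℝ, IsApproxId ρ 1 ∧
    (∀ n, ContDiff ℝ (⊤ : ℕ∞) (ρ n)) ∧ ∀ n, ∫ y, |ρ n y| = 1 := by
  let b : ∀ n : ℕ, ContDiffBump (0 : Fin d → ℝ) := fun n =>
    { rIn := 1 / ((n : ℝ) + 1) / 2, rOut := 1 / ((n : ℝ) + 1)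
      rIn_pos := by positivity, rIn_lt_rOut := half_lt_self (by positivity) }
  have hnn : ∀ n y, 0 ≤ (b n).normed volume y := fun n y => (b n).nonneg_normed y
  have habs : ∀ n, ∫ y, |(b n).normed volume y| = 1 := by
    intro n
    simp_rw [abs_of_nonneg (hnn n _)]
    exact (b n).integral_normed
  refine ⟨fun n => (b n).normed volume, ⟨fun n => (b n).continuous_normed, fun n =>
    (b n).integral_normed, fun n => (habs n).le, fun n => 1 / ((n : ℝ) + 1),
    tendsto_one_div_add_atTop_nhds_zero_nat, fun n => ?_, fun n => ?_⟩,
    fun n => (b n).contDiff_normed, habs⟩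
  · rw [div_le_one (by positivity)]
    linarith [(Nat.cast_nonneg n : (0 : ℝ) ≤ n)]
  · rw [(b n).support_normed_eq]
    exact Metric.ball_subset_closedBall

/-- Approximation of compactly supported `C^r` functions by test functions. -/
theorem exists_schwartz_approx {s : Fin d → ℕ} (hs : ∀ i, 0 < s i) {r : ℕ} {f : (Fin d → ℝ) → ℝ}
    (hf : ContDiff ℝ (r : WithTop ℕ∞) f) {R : ℝ}
    (hR : Function.support f ⊆ Metric.closedBall 0 R) :
    ∃ g : ℕ → 𝓢(Fin d → ℝ, ℝ), (∀ n, Function.support (g n) ⊆ Metric.closedBall 0 (R + 1)) ∧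
      CrTendsto s r (fun n => g n) f ∧ (∀ B, CrBound s r B f → ∀ n, CrBound s r B (g n)) ∧
      ∃ ρ : ℕ → (Fin d → ℝ) → ℝ, (∀ n, Continuous (ρ n)) ∧ (∀ n, HasCompactSupport (ρ n)) ∧
        ∀ n, ⇑(g n) = smear (ρ n) f := by
  obtain ⟨ρ, hρ, hsm, h1⟩ := exists_mollifier d
  have hc := hasCompactSupport_of_support_subset_closedBall hR
  obtain ⟨δ, -, hδ, hδs⟩ := hρ.support_subset
  have hsupp : ∀ n, Function.support (smear (ρ n) f) ⊆ Metric.closedBall 0 (R + 1) := fun n =>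
    (support_smear_subset (hδs n) hR).trans (Metric.closedBall_subset_closedBall
      (by linarith [hδ n]))
  have hcs := fun n => hasCompactSupport_of_support_subset_closedBall (hsupp n)
  have hcd := fun n => contDiff_smear_left (hsm n) (hρ.hasCompactSupport n)
    hf.continuous.locallyIntegrable
  -- The kernels are kept in the conclusion so that vanishing moments of `f` can be passed on to the
  -- approximants by `Annih.smear`.
  refine ⟨fun n => (hcs n).toSchwartzMap (hcd n), hsupp, hρ.crTendsto_smear hs hf hc, ?_,
    ρ, hρ.continuous, hρ.hasCompactSupport, fun n => rfl⟩
  intro B hB n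
  have := hB.smear hs (hρ.integrable n) hf hc
  rw [h1, one_mul] at this
  exact this

/-! ### Pairings -/

theorem contDiff_schwartz (g : 𝓢(Fin d → ℝ, ℝ)) (r : ℕ) : ContDiff ℝ (r : WithTop ℕ∞) g :=
  g.smooth r

theorem HasPairing.tendsto {s : Fin d → ℕ} (hs : ∀ i, 0 < s i) {r : ℕ}
    {ξ : 𝓢(Fin d → ℝ, ℝ) →L[ℝ] ℝ} {f : (Fin d → ℝ) → ℝ} {v : ℝ} (h : HasPairing s r ξ f v)
    (hf : ContDiff ℝ (r : WithTop ℕ∞) f) {g : ℕ → 𝓢(Fin d → ℝ, ℝ)} {R : ℝ}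
    (hR : ∀ n, Function.support (g n) ⊆ Metric.closedBall 0 R)
    (hg : CrTendsto s r (fun n => g n) f) : Tendsto (fun n => ξ (g n)) atTop (𝓝 v) :=
  h g _ (isCompact_closedBall 0 R) hR
    ((crTendsto_iff hs (fun n => contDiff_schwartz (g n) r) hf).mp hg)

theorem hasPairing_of_forall {s : Fin d → ℕ} (hs : ∀ i, 0 < s i) {r : ℕ}
    {ξ : 𝓢(Fin d → ℝ, ℝ) →L[ℝ] ℝ} {f : (Fin d → ℝ) → ℝ} {v : ℝ}
    (hf : ContDiff ℝ (r : WithTop ℕ∞) f)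
    (h : ∀ (g : ℕ → 𝓢(Fin d → ℝ, ℝ)) (R : ℝ),
      (∀ n, Function.support (g n) ⊆ Metric.closedBall 0 R) → CrTendsto s r (fun n => g n) f →
      Tendsto (fun n => ξ (g n)) atTop (𝓝 v)) : HasPairing s r ξ f v := by
  intro g K hK hgK hg
  obtain ⟨R, hR⟩ := hK.isBounded.subset_closedBall 0
  exact h g R (fun n => (hgK n).trans hR)
    ((crTendsto_iff hs (fun n => contDiff_schwartz (g n) r) hf).mpr hg)

theorem HasPairing.sub_left {s : Fin d → ℕ} {r : ℕ} {ξ ξ' : 𝓢(Fin d → ℝ, ℝ) →L[ℝ] ℝ}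
    {f : (Fin d → ℝ) → ℝ} {v v' : ℝ} (h : HasPairing s r ξ f v) (h' : HasPairing s r ξ' f v') :
    HasPairing s r (ξ - ξ') f (v - v') := by
  intro g K hK hgK hg
  simpa using (h g K hK hgK hg).sub (h' g K hK hgK hg)

theorem support_add_subset_closedBall {f g : (Fin d → ℝ) → ℝ} {R R' : ℝ}
    (hf : Function.support f ⊆ Metric.closedBall 0 R)
    (hg : Function.support g ⊆ Metric.closedBall 0 R') (c : ℝ) :
    Function.support (fun x => f x + c * g x) ⊆ Metric.closedBall 0 (max R R') := by
  intro x hx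
  by_contra hlt
  rw [mem_closedBall_zero_iff, not_le, max_lt_iff] at hlt
  apply hx
  have h1 : f x = 0 := by
    by_contra h0
    have := hf h0
    rw [mem_closedBall_zero_iff] at this
    linarith [hlt.1]
  have h2 : g x = 0 := by
    by_contra h0
    have := hg h0
    rw [mem_closedBall_zero_iff] at this
    linarith [hlt.2]
  simp [h1, h2]

/-- If `a n` approximates `f` and `g n` tends to zero, then `a n + g n` approximates `f` as well,
and subtracting the two limits gives `ξ (g n) → 0`. One existing pairing thus yields the sequential
continuity of `ξ` at zero. -/
theorem HasPairing.zero {s : Fin d → ℕ} (hs : ∀ i, 0 < s i) {r : ℕ}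
    {ξ : 𝓢(Fin d → ℝ, ℝ) →L[ℝ] ℝ} {f : (Fin d → ℝ) → ℝ} {v : ℝ} (h : HasPairing s r ξ f v)
    (hf : ContDiff ℝ (r : WithTop ℕ∞) f) (hc : HasCompactSupport f) :
    HasPairing s r ξ (fun _ => 0) 0 := by
  obtain ⟨R', -, hR'⟩ := hc.exists_support_subset_closedBall
  obtain ⟨a, ha1, ha2, -, -⟩ := exists_schwartz_approx hs hf hR'
  refine hasPairing_of_forall hs contDiff_const fun g R hR hg => ?_
  have h1 := h.tendsto hs hf ha1 ha2
  have h2 : Tendsto (fun n => ξ (a n + (1 : ℝ) • g n)) atTop (𝓝 v) := by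
    refine h.tendsto hs hf (g := fun n => a n + (1 : ℝ) • g n) (R := max (R' + 1) R) (fun n => ?_) ?_
    · exact support_add_subset_closedBall (ha1 n) (hR n) 1
    · have := ha2.add hs (fun n => contDiff_schwartz (a n) r) hf
        (fun n => contDiff_schwartz (g n) r) contDiff_const hg
      convert this using 3 with n x
      · simp
      · simp
  have h3 := h2.sub h1
  simpa using h3

/-- Two approximating sequences differ by a sequence that tends to zero in `C^r`. Continuity at zero
makes the limit independent of the sequence, so testing a single one suffices. -/
theorem hasPairing_of_approx {s : Fin d → ℕ} (hs : ∀ i, 0 < s i) {r : ℕ}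
    {ξ : 𝓢(Fin d → ℝ, ℝ) →L[ℝ] ℝ} (h0 : HasPairing s r ξ (fun _ => 0) 0)
    {f : (Fin d → ℝ) → ℝ} {v : ℝ} (hf : ContDiff ℝ (r : WithTop ℕ∞) f)
    {a : ℕ → 𝓢(Fin d → ℝ, ℝ)} {R : ℝ}
    (hR : ∀ n, Function.support (a n) ⊆ Metric.closedBall 0 R)
    (ha : CrTendsto s r (fun n => a n) f) (hv : Tendsto (fun n => ξ (a n)) atTop (𝓝 v)) :
    HasPairing s r ξ f v := by
  refine hasPairing_of_forall hs hf fun g R' hR' hg => ?_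
  have h1 : Tendsto (fun n => ξ (g n + (-1 : ℝ) • a n)) atTop (𝓝 0) := by
    refine h0.tendsto hs contDiff_const (g := fun n => g n + (-1 : ℝ) • a n) (R := max R' R)
      (fun n => ?_) ?_
    · exact support_add_subset_closedBall (hR' n) (hR n) (-1)
    · have := hg.sub hs (fun n => contDiff_schwartz (g n) r) hf
        (fun n => contDiff_schwartz (a n) r) hf ha
      convert this using 3 with n x
      · simp [sub_eq_add_neg]
      · simp
  have h2 := h1.add hv
  simpa using h2

theorem HasPairing.add_const_mul {s : Fin d → ℕ} (hs : ∀ i, 0 < s i) {r : ℕ}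
    {ξ : 𝓢(Fin d → ℝ, ℝ) →L[ℝ] ℝ} {f f' : (Fin d → ℝ) → ℝ} {v v' : ℝ}
    (h : HasPairing s r ξ f v) (h' : HasPairing s r ξ f' v')
    (hf : ContDiff ℝ (r : WithTop ℕ∞) f) (hc : HasCompactSupport f)
    (hf' : ContDiff ℝ (r : WithTop ℕ∞) f') (hc' : HasCompactSupport f') (c : ℝ) :
    HasPairing s r ξ (fun x => f x + c * f' x) (v + c * v') := by
  obtain ⟨R, -, hR⟩ := hc.exists_support_subset_closedBall
  obtain ⟨a, ha1, ha2, -, -⟩ := exists_schwartz_approx hs hf hR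
  obtain ⟨R', -, hR'⟩ := hc'.exists_support_subset_closedBall
  obtain ⟨a', ha1', ha2', -, -⟩ := exists_schwartz_approx hs hf' hR'
  refine hasPairing_of_approx hs (h.zero hs hf hc) (hf.add (contDiff_const.mul hf'))
    (a := fun n => a n + c • a' n) (R := max (R + 1) (R' + 1)) (fun n => ?_) ?_ ?_
  · exact support_add_subset_closedBall (ha1 n) (ha1' n) c
  · exact ha2.add hs (fun n => contDiff_schwartz (a n) r) hf
      (fun n => contDiff_const.mul (contDiff_schwartz (a' n) r)) (contDiff_const.mul hf')
      (ha2'.const_mul hs (fun n => contDiff_schwartz (a' n) r) hf' c)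
  · have h1 := (h.tendsto hs hf ha1 ha2).add ((h'.tendsto hs hf' ha1' ha2').const_mul c)
    simpa using h1

theorem HasPairing.sum_const_mul {s : Fin d → ℕ} (hs : ∀ i, 0 < s i) {r : ℕ}
    {ξ : 𝓢(Fin d → ℝ, ℝ) →L[ℝ] ℝ} (h0 : HasPairing s r ξ (fun _ => 0) 0) {ι : Type*}
    (S : Finset ι) {f : ι → (Fin d → ℝ) → ℝ} {v : ι → ℝ}
    (h : ∀ a ∈ S, HasPairing s r ξ (f a) (v a))
    (hf : ∀ a ∈ S, ContDiff ℝ (r : WithTop ℕ∞) (f a)) (hc : ∀ a ∈ S, HasCompactSupport (f a))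
    (c : ι → ℝ) : HasPairing s r ξ (fun x => ∑ a ∈ S, c a * f a x) (∑ a ∈ S, c a * v a) := by
  classical
  have key : ContDiff ℝ (r : WithTop ℕ∞) (fun x => ∑ a ∈ S, c a * f a x) ∧
      HasCompactSupport (fun x => ∑ a ∈ S, c a * f a x) ∧
      HasPairing s r ξ (fun x => ∑ a ∈ S, c a * f a x) (∑ a ∈ S, c a * v a) := by
    induction S using Finset.induction_on with
    | empty =>
      simp only [Finset.sum_empty]
      exact ⟨contDiff_const, HasCompactSupport.zero, h0⟩
    | insert a S ha ih =>
      obtain ⟨i1, i2, i3⟩ := ih (fun b hb => h b (by simp [hb])) (fun b hb => hf b (by simp [hb]))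
        (fun b hb => hc b (by simp [hb]))
      have ha1 := hf a (by simp)
      have ha2 := hc a (by simp)
      simp only [Finset.sum_insert ha, add_comm (c a * _)]
      exact ⟨i1.add (contDiff_const.mul ha1), i2.add (ha2.mul_left (f := fun _ => c a)),
        i3.add_const_mul hs (h a (by simp)) i1 i2 ha1 ha2 (c a)⟩
  exact key.2.2

/-- The functions with vanishing pairing are closed under limits in `C^r`. -/
theorem hasPairing_zero_of_crTendsto {s : Fin d → ℕ} (hs : ∀ i, 0 < s i) {r : ℕ}
    {ξ : 𝓢(Fin d → ℝ, ℝ) →L[ℝ] ℝ} (h0 : HasPairing s r ξ (fun _ => 0) 0)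
    {f : (Fin d → ℝ) → ℝ} (hf : ContDiff ℝ (r : WithTop ℕ∞) f)
    {h : ℕ → (Fin d → ℝ) → ℝ} {R : ℝ} (hh : ∀ n, ContDiff ℝ (r : WithTop ℕ∞) (h n))
    (hR : ∀ n, Function.support (h n) ⊆ Metric.closedBall 0 R) (hlim : CrTendsto s r h f)
    (hv : ∀ n, HasPairing s r ξ (h n) 0) : HasPairing s r ξ f 0 := by
  have h1 : ∀ n : ℕ, ∃ g : 𝓢(Fin d → ℝ, ℝ), Function.support g ⊆ Metric.closedBall 0 (R + 1) ∧
      CrBound s r (1 / ((n : ℝ) + 1)) (fun x => g x - h n x) ∧ |ξ g| ≤ 1 / ((n : ℝ) + 1) := by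
    intro n
    obtain ⟨g, hg1, hg2, -, -⟩ := exists_schwartz_approx hs (hh n) (hR n)
    have hpos : 0 < 1 / ((n : ℝ) + 1) := by positivity
    have h2 := (hv n).tendsto hs (hh n) hg1 hg2
    rw [Metric.tendsto_nhds] at h2
    obtain ⟨m, hm1, hm2⟩ := ((hg2 _ hpos).and (h2 _ hpos)).exists
    exact ⟨g m, hg1 m, hm1, by simpa using hm2.le⟩
  choose g hg1 hg2 hg3 using h1
  refine hasPairing_of_approx hs h0 hf hg1 ?_ ?_
  · intro ε hε
    have h3 := (tendsto_one_div_add_atTop_nhds_zero_nat (𝕜 := ℝ)).eventually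
      (gt_mem_nhds (half_pos hε))
    filter_upwards [h3, hlim (ε / 2) (by positivity)] with n hn1 hn2
    have h4 := ((hg2 n).mono hn1.le).add hs ((contDiff_schwartz (g n) r).sub (hh n))
      ((hh n).sub hf) hn2
    rw [add_halves] at h4
    convert h4 using 2
    ring
  · exact squeeze_zero_norm hg3 tendsto_one_div_add_atTop_nhds_zero_nat

/-- If `ξ` is of order `r` on every compact set, all pairings with `C^r` functions exist. -/
theorem exists_hasPairing {s : Fin d → ℕ} (hs : ∀ i, 0 < s i) {r : ℕ}
    {ξ : 𝓢(Fin d → ℝ, ℝ) →L[ℝ] ℝ}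
    (hξ : ∀ R : ℝ, ∃ C : ℝ, ∀ (g : 𝓢(Fin d → ℝ, ℝ)) (B : ℝ),
      Function.support g ⊆ Metric.closedBall 0 R → CrBound s r B g → |ξ g| ≤ C * B)
    {f : (Fin d → ℝ) → ℝ} (hf : ContDiff ℝ (r : WithTop ℕ∞) f) (hc : HasCompactSupport f) :
    ∃ v, HasPairing s r ξ f v := by
  have h0 : HasPairing s r ξ (fun _ => 0) 0 := by
    refine hasPairing_of_forall hs contDiff_const fun g R hR hg => ?_
    obtain ⟨C, hC⟩ := hξ R
    rw [Metric.tendsto_nhds]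
    intro ε hε
    filter_upwards [hg (ε / (|C| + 1)) (by positivity)] with n hn
    simp only [sub_zero] at hn
    rw [dist_zero_right, Real.norm_eq_abs]
    refine (hC (g n) _ (hR n) hn).trans_lt ?_
    rw [mul_div_assoc', div_lt_iff₀ (by positivity)]
    nlinarith [le_abs_self C]
  obtain ⟨R, -, hR⟩ := hc.exists_support_subset_closedBall
  obtain ⟨a, ha1, ha2, -, -⟩ := exists_schwartz_approx hs hf hR
  obtain ⟨C, hC⟩ := hξ (R + 1)
  have hcau : CauchySeq (fun n => ξ (a n)) := by
    rw [Metric.cauchySeq_iff']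
    intro ε hε
    have hev := ha2 (ε / (2 * (|C| + 1))) (by positivity)
    rw [eventually_atTop] at hev
    obtain ⟨N, hN⟩ := hev
    refine ⟨N, fun n hn => ?_⟩
    have h1 := (hN n hn).sub hs ((contDiff_schwartz (a n) r).sub hf)
      ((contDiff_schwartz (a N) r).sub hf) (hN N le_rfl)
    have h2 : (fun x => a n x - f x - (a N x - f x)) = ⇑(a n + (-1 : ℝ) • a N) := by
      ext x
      simp [sub_eq_add_neg]
    rw [h2] at h1
    have h3 := hC _ _ (by simpa using support_add_subset_closedBall (ha1 n) (ha1 N) (-1)) h1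
    rw [Real.dist_eq]
    have h4 : ξ (a n + (-1 : ℝ) • a N) = ξ (a n) - ξ (a N) := by simp [sub_eq_add_neg]
    rw [h4] at h3
    refine h3.trans_lt ?_
    have h5 : ε / (2 * (|C| + 1)) + ε / (2 * (|C| + 1)) = ε / (|C| + 1) := by
      field_simp
      ring
    rw [h5, mul_div_assoc', div_lt_iff₀ (by positivity)]
    nlinarith [le_abs_self C]
  obtain ⟨v, hv⟩ := cauchySeq_tendsto_of_complete hcau
  exact ⟨v, hasPairing_of_approx hs h0 hf ha1 ha2 hv⟩

theorem scaledNorm_le_one_iff {s : Fin d → ℕ} (hs : ∀ i, 0 < s i) {x : Fin d → ℝ} :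
    scaledNorm s x ≤ 1 ↔ ∀ i, |x i| ≤ 1 := by
  unfold scaledNorm
  constructor
  · intro h i
    have h4 : |x i| ^ (1 / (s i : ℝ)) ≤ 1 :=
      le_trans (le_ciSup (f := fun i => |x i| ^ (1 / (s i : ℝ))) (Set.finite_range _).bddAbove i) h
    have hsi : (0 : ℝ) < s i := by exact_mod_cast hs i
    by_contra hlt
    exact absurd h4 (not_le.mpr (Real.one_lt_rpow (not_le.mp hlt) (by positivity)))
  · intro h
    refine Real.iSup_le (fun i => ?_) zero_le_one
    exact Real.rpow_le_one (abs_nonneg _) (h i) (by positivity)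

/-! ### Annihilation of polynomials -/

/-- `f` annihilates all polynomials of total degree at most `m`. -/
def Annih (m : ℕ) (f : (Fin d → ℝ) → ℝ) : Prop :=
  ∀ P : MvPolynomial (Fin d) ℝ, P.totalDegree ≤ m → ∫ x, f x * MvPolynomial.eval x P = 0

/-- Every weight is at least one. Hence cancellation up to a total degree implies cancellation up to
the same scaled degree, which places wavelets in `testBallAnnihil`. -/
theorem totalDegree_le_weightedTotalDegree {s : Fin d → ℕ} (hs : ∀ i, 0 < s i)
    (P : MvPolynomial (Fin d) ℝ) : P.totalDegree ≤ P.weightedTotalDegree s := by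
  unfold MvPolynomial.totalDegree
  refine Finset.sup_le fun m hm => ?_
  refine le_trans ?_ (MvPolynomial.le_weightedTotalDegree s hm)
  rw [Finsupp.weight_apply]
  refine Finset.sum_le_sum fun i _ => ?_
  exact Nat.le_mul_of_pos_right _ (hs i)

theorem exists_polynomial_comp_affine (P : MvPolynomial (Fin d) ℝ) (a c : Fin d → ℝ) :
    ∃ Q : MvPolynomial (Fin d) ℝ, Q.totalDegree ≤ P.totalDegree ∧
      ∀ x, MvPolynomial.eval x Q = MvPolynomial.eval (fun l => a l * x l + c l) P := by
  let L : Fin d → MvPolynomial (Fin d) ℝ := fun l =>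
    MvPolynomial.C (a l) * MvPolynomial.X l + MvPolynomial.C (c l)
  have hL : ∀ l, (L l).totalDegree ≤ 1 := by
    intro l
    refine (MvPolynomial.totalDegree_add _ _).trans (max_le ?_ (by simp))
    refine (MvPolynomial.totalDegree_mul _ _).trans ?_
    simp
  refine ⟨∑ m ∈ P.support, MvPolynomial.C (P.coeff m) * ∏ l, L l ^ m l, ?_, ?_⟩
  · refine MvPolynomial.totalDegree_finsetSum_le fun m hm => ?_
    refine (MvPolynomial.totalDegree_mul _ _).trans ?_
    rw [MvPolynomial.totalDegree_C, zero_add]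
    refine (MvPolynomial.totalDegree_finsetProd _ _).trans ?_
    calc ∑ l, (L l ^ m l).totalDegree ≤ ∑ l, m l := by
          refine Finset.sum_le_sum fun l _ => ?_
          refine (MvPolynomial.totalDegree_pow _ _).trans ?_
          simpa using Nat.mul_le_mul_left (m l) (hL l)
      _ = m.sum fun _ e => e := by rw [Finsupp.sum_fintype]; simp
      _ ≤ _ := MvPolynomial.le_totalDegree hm
  · intro x
    rw [MvPolynomial.eval_eq (fun l => a l * x l + c l) P]
    simp only [map_sum, map_mul, MvPolynomial.eval_C, map_prod, map_pow]
    refine Finset.sum_congr rfl fun m _ => ?_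
    congr 1
    rw [Finset.prod_subset (Finset.subset_univ m.support)]
    · simp [L]
    · intro l _ hl
      simp [Finsupp.notMem_support_iff.mp hl]

theorem integral_comp_affine {F : (Fin d → ℝ) → ℝ} (hF : Continuous F) (a c : Fin d → ℝ)
    (ha : ∀ l, a l ≠ 0) :
    ∫ x : Fin d → ℝ, F (fun l => a l * x l + c l) = |∏ l, a l|⁻¹ * ∫ x, F x := by
  classical
  have hdet : Matrix.det (Matrix.diagonal a) ≠ 0 := by
    rw [Matrix.det_diagonal]
    exact Finset.prod_ne_zero_iff.mpr fun l _ => ha l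
  have h1 := Real.smul_map_diagonal_volume_pi hdet
  have hcont : Continuous (Matrix.toLin' (Matrix.diagonal a)) :=
    LinearMap.continuous_of_finiteDimensional _
  have h2 : ∫ x, F (x + c) = |∏ l, a l| * ∫ x : Fin d → ℝ, F (fun l => a l * x l + c l) := by
    conv_lhs => rw [← h1]
    have hFc : Continuous fun x : Fin d → ℝ => F (x + c) := by fun_prop
    rw [integral_smul_measure, integral_map hcont.aemeasurable hFc.aestronglyMeasurable,
      ENNReal.toReal_ofReal (abs_nonneg _), Matrix.det_diagonal, smul_eq_mul]
    congr 1
    refine integral_congr_ae (Eventually.of_forall fun x => ?_)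
    simp only [Matrix.toLin'_apply]
    congr 1
    ext l
    simp [Matrix.mulVec_diagonal]
  rw [integral_add_right_eq_self (fun x => F x) c] at h2
  have h3 : |∏ l, a l| ≠ 0 := by
    rw [abs_ne_zero]
    exact Finset.prod_ne_zero_iff.mpr fun l _ => ha l
  rw [h2, inv_mul_cancel_left₀ h3]

theorem continuous_eval_mvPolynomial (P : MvPolynomial (Fin d) ℝ) :
    Continuous fun x : Fin d → ℝ => MvPolynomial.eval x P :=
  MvPolynomial.continuous_eval P

/-- A change of variables moves the affine map onto the polynomial, whose total degree does not
increase. -/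
theorem Annih.comp_affine {m : ℕ} {f : (Fin d → ℝ) → ℝ} (h : Annih m f) (hf : Continuous f)
    {a : Fin d → ℝ} (ha : ∀ l, a l ≠ 0) (c : Fin d → ℝ) :
    Annih m (fun x => f (fun l => a l * x l + c l)) := by
  intro P hP
  obtain ⟨Q, hQ, hQe⟩ := exists_polynomial_comp_affine P (fun l => (a l)⁻¹)
    (fun l => -((a l)⁻¹ * c l))
  have h1 := integral_comp_affine (hf.mul (continuous_eval_mvPolynomial Q)) a c ha
  simp only [Pi.mul_apply] at h1
  rw [h Q (hQ.trans hP), mul_zero] at h1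
  rw [← h1]
  refine integral_congr_ae (Eventually.of_forall fun x => ?_)
  simp only [hQe]
  congr 3
  ext l
  field_simp [ha l]
  ring

theorem Annih.const_mul {m : ℕ} {f : (Fin d → ℝ) → ℝ} (h : Annih m f) (c : ℝ) :
    Annih m (fun x => c * f x) := by
  intro P hP
  simp_rw [mul_assoc]
  rw [integral_const_mul, h P hP, mul_zero]

/-- By Fubini, the moment of the convolution is an average over `y` of moments of translates of `f`.
Each of these is a moment of `f` against a translated polynomial of no larger degree. -/
theorem Annih.smear {m : ℕ} {f ρ : (Fin d → ℝ) → ℝ} (h : Annih m f) (hf : Continuous f)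
    (hc : HasCompactSupport f) (hρ : Continuous ρ) (hcρ : HasCompactSupport ρ) :
    Annih m (smear ρ f) := by
  intro P hP
  unfold AnisoBesov.smear
  have hP' := continuous_eval_mvPolynomial P
  have h1 : ∀ x, (∫ y, ρ y * f (x - y)) * MvPolynomial.eval x P =
      ∫ y, ρ y * f (x - y) * MvPolynomial.eval x P := fun x => (integral_mul_const _ _).symm
  simp_rw [h1]
  have hint : Integrable (Function.uncurry fun x y : Fin d → ℝ =>
      ρ y * f (x - y) * MvPolynomial.eval x P) (volume.prod volume) := by
    refine Continuous.integrable_of_hasCompactSupport ?_ ?_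
    · exact ((hρ.comp continuous_snd).mul (hf.comp (continuous_fst.sub continuous_snd))).mul
        (hP'.comp continuous_fst)
    · obtain ⟨R, -, hR⟩ := hc.exists_support_subset_closedBall
      obtain ⟨R', -, hR'⟩ := hcρ.exists_support_subset_closedBall
      refine HasCompactSupport.of_support_subset_isCompact
        (K := Metric.closedBall 0 (R + R') ×ˢ Metric.closedBall 0 R')
        ((isCompact_closedBall _ _).prod (isCompact_closedBall _ _)) ?_
      rintro ⟨x, y⟩ hxy
      have hxy' : ρ y * f (x - y) * MvPolynomial.eval x P ≠ 0 := hxy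
      have h2 := hR' (left_ne_zero_of_mul (left_ne_zero_of_mul hxy'))
      have h3 := hR (right_ne_zero_of_mul (left_ne_zero_of_mul hxy'))
      refine ⟨?_, h2⟩
      rw [mem_closedBall_zero_iff] at *
      calc ‖x‖ = ‖(x - y) + y‖ := by simp
        _ ≤ _ := (norm_add_le _ _).trans (add_le_add h3 h2)
  rw [integral_integral_swap hint]
  have h4 : ∀ y, ∫ x, ρ y * f (x - y) * MvPolynomial.eval x P = 0 := by
    intro y
    obtain ⟨Q, hQ, hQe⟩ := exists_polynomial_comp_affine P (fun _ => 1) y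
    have h5 := integral_sub_right_eq_self (μ := volume)
      (fun x : Fin d → ℝ => ρ y * (f x * MvPolynomial.eval x Q)) y
    rw [integral_const_mul (ρ y) (fun x => f x * MvPolynomial.eval x Q), h Q (hQ.trans hP),
      mul_zero] at h5
    rw [← h5]
    refine integral_congr_ae (Eventually.of_forall fun x => ?_)
    simp only [hQe, mul_assoc, Pi.sub_apply, one_mul, sub_add_cancel]
  simp [h4]

/-! ### Testing against elements of the test balls -/

theorem enorm_apply_le_supTest {s : Fin d → ℕ} (hs : ∀ i, 0 < s i) {r : ℕ}
    {F : Set ((Fin d → ℝ) → ℝ)} {η : (Fin d → ℝ) → ℝ} (hη : η ∈ F) (hη' : η ∈ testBall s r)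
    {ε : ℝ} (hε : 0 < ε) {y : Fin d → ℝ} {c : ℝ} {g : 𝓢(Fin d → ℝ, ℝ)}
    (hg : ∀ u, g u = c * rescale s ε y η u) (ξ : 𝓢(Fin d → ℝ, ℝ) →L[ℝ] ℝ) :
    ‖ξ g‖ₑ ≤ ‖c‖ₑ * supTest s F ξ ε y := by
  obtain ⟨g', hg'⟩ := exists_schwartz_rescale hs hη' hε y
  have h1 : g = c • g' := by
    ext u
    rw [hg, ← hg']
    rfl
  rw [h1, map_smul, smul_eq_mul, enorm_mul]
  gcongr
  exact le_iSup₂ (f := fun g (_ : g ∈ {g : 𝓢(Fin d → ℝ, ℝ) | ∃ η ∈ F, ⇑g = rescale s ε y η}) =>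
    ‖ξ g‖ₑ) g' ⟨η, hη, hg'⟩

/-- A test function at scale `ε` around `y` is a multiple of a rescaled element of a test ball. -/
theorem enorm_apply_le_supTest_of_bound {s : Fin d → ℕ} (hs : ∀ i, 0 < s i) {r : ℕ}
    {F : Set ((Fin d → ℝ) → ℝ)} (g : 𝓢(Fin d → ℝ, ℝ))
    (hF : F = testBall s r ∨ ∃ m, F = testBallAnnihil s r m ∧ Annih m g)
    {ε : ℝ} (hε : 0 < ε) {y : Fin d → ℝ} {B : ℝ}
    (hsupp : ∀ u, g u ≠ 0 → ∀ l, |u l - y l| ≤ ε ^ s l)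
    (hB : ∀ (n : ℕ) (i : Fin n → Fin d), ∑ j, s (i j) ≤ r →
      ∀ x, ε ^ (∑ j, s (i j)) * |mixedDeriv i g x| ≤ B) (ξ : 𝓢(Fin d → ℝ, ℝ) →L[ℝ] ℝ) :
    ‖ξ g‖ₑ ≤ ENNReal.ofReal (B * ε ^ homDim s) * supTest s F ξ ε y := by
  have hB0 : ∀ x, |g x| ≤ B := by
    intro x
    have := hB 0 Fin.elim0 (by simp) x
    simpa [mixedDeriv_fin_zero] using this
  rcases eq_or_lt_of_le ((abs_nonneg _).trans (hB0 0)) with h0 | hBpos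
  · have : g = 0 := by
      ext x
      have := hB0 x
      rw [← h0] at this
      simpa using this
    simp [this]
  have hne : ∀ l, ε ^ s l ≠ 0 := fun l => (pow_pos hε _).ne'
  set η : (Fin d → ℝ) → ℝ := fun u => B⁻¹ * g (fun l => ε ^ s l * u l + y l) with hηdef
  have hsm : ContDiff ℝ (⊤ : ℕ∞) g := g.smooth ⊤
  have hη : η ∈ testBall s r := by
    refine ⟨contDiff_const.mul (contDiff_comp_affine hsm _ _), ?_, ?_⟩
    · intro u hu
      rw [Set.mem_ofPred_eq, scaledNorm_le_one_iff hs]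
      intro l
      have h1 := hsupp _ (right_ne_zero_of_mul hu) l
      simp only [add_sub_cancel_right, abs_mul, abs_of_pos (pow_pos hε (s l))] at h1
      exact le_of_mul_le_mul_left (by simpa using h1) (pow_pos hε (s l))
    · intro n i hi x
      rw [hηdef, mixedDeriv_const_mul i (contDiff_comp_affine (g.smooth n) _ _),
        mixedDeriv_comp_affine i (g.smooth n), Finset.prod_pow_eq_pow_sum, abs_mul, abs_mul,
        abs_of_pos (pow_pos hε _), abs_of_pos (inv_pos.mpr hBpos), inv_mul_le_iff₀ hBpos, mul_one]
      exact hB n i hi _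
  have hηF : η ∈ F := by
    rcases hF with rfl | ⟨m, rfl, hm⟩
    · exact hη
    · refine ⟨hη, fun P hP => ?_⟩
      exact ((hm.comp_affine g.continuous hne y).const_mul B⁻¹) P
        ((totalDegree_le_weightedTotalDegree hs P).trans hP)
  have hεp : 0 < ε ^ homDim s := pow_pos hε _
  have hfin := enorm_apply_le_supTest hs hηF hη hε (y := y) (c := B * ε ^ homDim s) (g := g) ?_ ξ
  · have hBε : 0 ≤ B * ε ^ homDim s := by positivity
    rwa [Real.enorm_eq_ofReal hBε] at hfin
  · intro u
    simp only [rescale, dilate, hηdef]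
    have h2 : (fun l => ε ^ s l * ((ε ^ s l)⁻¹ * (u l - y l)) + y l) = u := by
      ext l
      rw [mul_inv_cancel_left₀ (hne l)]
      ring
    rw [h2]
    field_simp

/-! ### Rescaled wavelets -/

/-- The tensor product of the scaling function. -/
def tensorFun (φ : ℝ → ℝ) : (Fin d → ℝ) → ℝ := fun x => ∏ i, φ (x i)

theorem waveletFun_eq (s : Fin d → ℕ) (f : (Fin d → ℝ) → ℝ) (n : ℕ) (k : Fin d → ℤ) :
    waveletFun s f n k = fun y => (2 : ℝ) ^ ((n : ℝ) * (homDim s : ℝ) / 2) *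
      f (fun l => (2 : ℝ) ^ (n * s l) * y l + -(k l : ℝ)) := by
  ext y
  unfold waveletFun gridPoint
  congr 2
  ext l
  have : (2 : ℝ) ^ (n * s l) ≠ 0 := by positivity
  field_simp
  ring

theorem scalingFun_eq (s : Fin d → ℕ) (φ : ℝ → ℝ) (n : ℕ) (k : Fin d → ℤ) :
    scalingFun s φ n k = waveletFun s (tensorFun φ) n k := by
  ext y
  unfold scalingFun waveletFun tensorFun homDim
  rw [Finset.prod_mul_distrib]
  congr 1
  rw [← Real.rpow_sum_of_pos two_pos]
  congr 1
  push_cast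
  rw [Finset.mul_sum, Finset.sum_div]

theorem CrBound.comp_affine {s : Fin d → ℕ} (hs : ∀ i, 0 < s i) {r : ℕ} {B A : ℝ}
    {f : (Fin d → ℝ) → ℝ} (hB : CrBound s r B f) (hf : ContDiff ℝ (r : WithTop ℕ∞) f)
    {a : Fin d → ℝ} (hA : 1 ≤ A) (ha : ∀ l, |a l| ≤ A) (c : Fin d → ℝ) :
    CrBound s r (A ^ r * B) (fun x => f (fun l => a l * x l + c l)) := by
  intro n i hi x
  have hn := length_le_of_sum_le hs hi
  have hn' : ((n : ℕ) : WithTop ℕ∞) ≤ (r : ℕ) := by exact_mod_cast hn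
  rw [mixedDeriv_comp_affine i (hf.of_le hn'), abs_mul, Finset.abs_prod]
  refine mul_le_mul ?_ (hB n i hi _) (abs_nonneg _) (by positivity)
  calc ∏ j, |a (i j)| ≤ ∏ _j : Fin n, A :=
        Finset.prod_le_prod (fun _ _ => abs_nonneg _) fun j _ => ha (i j)
    _ = A ^ n := by simp
    _ ≤ A ^ r := pow_le_pow_right₀ hA hn

theorem CrTendsto.comp_affine {s : Fin d → ℕ} (hs : ∀ i, 0 < s i) {r : ℕ}
    {g : ℕ → (Fin d → ℝ) → ℝ} {f : (Fin d → ℝ) → ℝ}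
    (hg : ∀ n, ContDiff ℝ (r : WithTop ℕ∞) (g n)) (hf : ContDiff ℝ (r : WithTop ℕ∞) f)
    (h : CrTendsto s r g f) (a c : Fin d → ℝ) :
    CrTendsto s r (fun n x => g n (fun l => a l * x l + c l))
      (fun x => f (fun l => a l * x l + c l)) := by
  intro ε hε
  set A : ℝ := 1 + ∑ l, |a l| with hA
  have hA1 : 1 ≤ A := by
    rw [hA]
    linarith [Finset.sum_nonneg fun l (_ : l ∈ Finset.univ) => abs_nonneg (a l)]
  have hA2 : ∀ l, |a l| ≤ A := by
    intro l
    have := Finset.single_le_sum (f := fun l => |a l|) (fun _ _ => abs_nonneg _) (Finset.mem_univ l)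
    rw [hA]
    linarith
  have hAp : 0 < A ^ r := by positivity
  filter_upwards [h (ε / A ^ r) (by positivity)] with n hn
  have := hn.comp_affine hs ((hg n).sub hf) hA1 hA2 c
  rwa [mul_div_cancel₀ _ hAp.ne'] at this

theorem contDiff_waveletFun {m : WithTop ℕ∞} (s : Fin d → ℕ) {f : (Fin d → ℝ) → ℝ}
    (hf : ContDiff ℝ m f) (n : ℕ) (k : Fin d → ℤ) : ContDiff ℝ m (waveletFun s f n k) := by
  rw [waveletFun_eq]
  exact contDiff_const.mul (contDiff_comp_affine hf _ _)

theorem abs_sub_gridPoint_le {s : Fin d → ℕ} {f : (Fin d → ℝ) → ℝ} {R : ℝ}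
    (hR : Function.support f ⊆ Metric.closedBall 0 R) {n : ℕ} {k : Fin d → ℤ} {y : Fin d → ℝ}
    (hy : waveletFun s f n k y ≠ 0) (l : Fin d) :
    |y l - gridPoint s n k l| ≤ R * ((2 : ℝ) ^ (n * s l))⁻¹ := by
  have h1 := hR (right_ne_zero_of_mul hy)
  rw [mem_closedBall_zero_iff] at h1
  have h2 := (norm_le_pi_norm _ l).trans h1
  have hp : (0 : ℝ) < 2 ^ (n * s l) := by positivity
  rw [Real.norm_eq_abs, abs_mul, abs_of_pos hp] at h2
  rw [← div_eq_mul_inv, le_div_iff₀ hp]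
  linarith

theorem support_waveletFun_subset {s : Fin d → ℕ} {f : (Fin d → ℝ) → ℝ} {R : ℝ} (hR0 : 0 ≤ R)
    (hR : Function.support f ⊆ Metric.closedBall 0 R) (n : ℕ) (k : Fin d → ℤ) :
    Function.support (waveletFun s f n k) ⊆ Metric.closedBall 0 (‖gridPoint s n k‖ + R) := by
  intro y hy
  rw [mem_closedBall_zero_iff, pi_norm_le_iff_of_nonneg (by positivity)]
  intro l
  have h1 := abs_sub_gridPoint_le hR hy l
  have h2 : R * ((2 : ℝ) ^ (n * s l))⁻¹ ≤ R :=
    mul_le_of_le_one_right hR0 (inv_le_one_of_one_le₀ (one_le_pow₀ one_le_two))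
  have h3 := norm_le_pi_norm (gridPoint s n k) l
  rw [Real.norm_eq_abs] at h3 ⊢
  calc |y l| = |gridPoint s n k l + (y l - gridPoint s n k l)| := by simp
    _ ≤ _ := abs_add_le _ _
    _ ≤ _ := by linarith

theorem hasCompactSupport_waveletFun {s : Fin d → ℕ} {f : (Fin d → ℝ) → ℝ}
    (hf : HasCompactSupport f) (n : ℕ) (k : Fin d → ℤ) :
    HasCompactSupport (waveletFun s f n k) := by
  obtain ⟨R, hR0, hR⟩ := hf.exists_support_subset_closedBall
  exact hasCompactSupport_of_support_subset_closedBall (support_waveletFun_subset hR0.le hR n k)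

/-- A wavelet of level `n` is, up to normalisation, a limit of rescaled elements of a test ball, at
any scale comparable with `2^{-n}` around any point close to the grid point. -/
theorem enorm_pairing_waveletFun_le {s : Fin d → ℕ} (hs : ∀ i, 0 < s i) {r : ℕ}
    {F : Set ((Fin d → ℝ) → ℝ)} {f : (Fin d → ℝ) → ℝ} (hf : ContDiff ℝ (r : WithTop ℕ∞) f)
    (hF : F = testBall s r ∨ ∃ m, F = testBallAnnihil s r m ∧ Annih m f)
    {R B L : ℝ} (hR0 : 0 ≤ R) (hR : Function.support f ⊆ Metric.closedBall 0 R)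
    (hB : CrBound s r B f) (hL : 1 ≤ L)
    {n : ℕ} {k : Fin d → ℤ} {ξ : 𝓢(Fin d → ℝ, ℝ) →L[ℝ] ℝ} {v : ℝ}
    (hv : HasPairing s r ξ (waveletFun s f n k) v) {ε : ℝ} (hε1 : (R + 2) * (2 ^ n)⁻¹ ≤ ε)
    (hε2 : ε ≤ L * (2 ^ n)⁻¹) {y : Fin d → ℝ}
    (hy : ∀ l, |y l - gridPoint s n k l| ≤ ((2 : ℝ) ^ (n * s l))⁻¹) :
    ‖v‖ₑ ≤ ENNReal.ofReal (L ^ r * B * L ^ homDim s * 2 ^ (-((n : ℝ) * (homDim s : ℝ) / 2))) *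
      supTest s F ξ ε y := by
  obtain ⟨g, hg1, hg2, hg3, ρ, hρ1, hρ2, hρ3⟩ := exists_schwartz_approx hs hf hR
  have hc := hasCompactSupport_of_support_subset_closedBall hR
  have h2n : (0 : ℝ) < (2 : ℝ) ^ n := by positivity
  have hεpos : 0 < ε := lt_of_lt_of_le (by positivity) hε1
  have hcd : ∀ j, ContDiff ℝ (⊤ : ℕ∞) (waveletFun s (g j) n k) := fun j =>
    contDiff_waveletFun s ((g j).smooth ⊤) n k
  have hcs : ∀ j, HasCompactSupport (waveletFun s (g j) n k) := fun j =>
    hasCompactSupport_waveletFun (hasCompactSupport_of_support_subset_closedBall (hg1 j)) n k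
  let G : ℕ → 𝓢(Fin d → ℝ, ℝ) := fun j => (hcs j).toSchwartzMap (hcd j)
  have hG : ∀ j, ⇑(G j) = waveletFun s (g j) n k := fun j => rfl
  set K : ℝ := (2 : ℝ) ^ ((n : ℝ) * (homDim s : ℝ) / 2) with hK
  have hKpos : 0 < K := by positivity
  have hlim : Tendsto (fun j => ξ (G j)) atTop (𝓝 v) := by
    refine hv.tendsto hs (contDiff_waveletFun s hf n k) (R := ‖gridPoint s n k‖ + (R + 1))
      (fun j => ?_) ?_
    · rw [hG]
      exact support_waveletFun_subset (by positivity) (hg1 j) n k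
    · have h1 := (hg2.comp_affine hs (fun j => contDiff_schwartz (g j) r) hf
        (fun l => (2 : ℝ) ^ (n * s l)) (fun l => -(k l : ℝ))).const_mul hs
        (fun j => contDiff_comp_affine (contDiff_schwartz (g j) r) _ _)
        (contDiff_comp_affine hf _ _) K
      simp only [hG, waveletFun_eq]
      exact h1
  have hbound : ∀ j, ‖ξ (G j)‖ₑ ≤ ENNReal.ofReal (K * (L ^ r * B) * ε ^ homDim s) *
      supTest s F ξ ε y := by
    intro j
    refine enorm_apply_le_supTest_of_bound (r := r) hs (G j) ?_ hεpos (fun u hu l => ?_) ?_ ξ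
    · rcases hF with h | ⟨m, h1, h2⟩
      · exact Or.inl h
      · refine Or.inr ⟨m, h1, ?_⟩
        have h3 := h2.smear hf.continuous hc (hρ1 j) (hρ2 j)
        rw [← hρ3 j] at h3
        rw [hG, waveletFun_eq]
        exact (h3.comp_affine (g j).continuous (fun l => by positivity) _).const_mul _
    · have h1 := abs_sub_gridPoint_le (hg1 j) (s := s) (n := n) (k := k) (y := u) hu l
      have h2 := hy l
      -- The mollified wavelet has support radius `R + 1` in its own coordinates, and `y` may be
      -- displaced by one further cell.
      have h3 : |u l - y l| ≤ (R + 2) * ((2 : ℝ) ^ (n * s l))⁻¹ := by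
        calc |u l - y l| = |(u l - gridPoint s n k l) - (y l - gridPoint s n k l)| := by
              congr 1; ring
          _ ≤ _ := abs_sub _ _
          _ ≤ _ := by linarith
      refine h3.trans ?_
      calc (R + 2) * ((2 : ℝ) ^ (n * s l))⁻¹ ≤ (R + 2) ^ s l * ((2 : ℝ) ^ (n * s l))⁻¹ := by
            gcongr
            exact le_self_pow₀ (by linarith) (hs l).ne'
        _ = ((R + 2) * (2 ^ n)⁻¹) ^ s l := by rw [mul_pow, inv_pow, pow_mul]
        _ ≤ ε ^ s l := pow_le_pow_left₀ (by positivity) hε1 _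
    · intro m i hi x
      have hm := length_le_of_sum_le hs hi
      rw [hG, waveletFun_eq, mixedDeriv_const_mul i
        (contDiff_comp_affine (contDiff_schwartz (g j) m) _ _),
        mixedDeriv_comp_affine i (contDiff_schwartz (g j) m), abs_mul, abs_mul, abs_of_pos hKpos,
        Finset.abs_prod]
      have h1 : ∏ l, |(2 : ℝ) ^ (n * s (i l))| = (2 ^ n) ^ (∑ l, s (i l)) := by
        rw [← Finset.prod_pow_eq_pow_sum]
        refine Finset.prod_congr rfl fun l _ => ?_
        rw [abs_of_pos (by positivity), pow_mul]
      rw [h1]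
      have h2 : ε ^ (∑ l, s (i l)) * (2 ^ n) ^ (∑ l, s (i l)) ≤ L ^ r := by
        rw [← mul_pow]
        have h3 : ε * 2 ^ n ≤ L := by
          rwa [← div_eq_mul_inv, le_div_iff₀ h2n] at hε2
        exact (pow_le_pow_left₀ (by positivity) h3 _).trans (pow_le_pow_right₀ hL hi)
      calc ε ^ (∑ l, s (i l)) * (K * ((2 ^ n) ^ (∑ l, s (i l)) * |mixedDeriv i (g j) _|)) =
          K * ((ε ^ (∑ l, s (i l)) * (2 ^ n) ^ (∑ l, s (i l))) * |mixedDeriv i (g j) _|) := by ring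
        _ ≤ K * (L ^ r * B) := by
          gcongr
          exact hg3 B hB j m i hi _
  have hfinal : ‖v‖ₑ ≤ ENNReal.ofReal (K * (L ^ r * B) * ε ^ homDim s) * supTest s F ξ ε y :=
    le_of_tendsto ((continuous_enorm.tendsto v).comp hlim) (Eventually.of_forall hbound)
  refine hfinal.trans ?_
  refine mul_le_mul' (ENNReal.ofReal_le_ofReal ?_) le_rfl
  have hB0 := hB.nonneg
  have h4 : ε ^ homDim s ≤ L ^ homDim s * ((2 : ℝ) ^ (-((n : ℝ) * (homDim s : ℝ)))) := by
    calc ε ^ homDim s ≤ (L * (2 ^ n)⁻¹) ^ homDim s := pow_le_pow_left₀ hεpos.le hε2 _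
      _ = _ := by
        rw [mul_pow, inv_pow, ← pow_mul, Real.rpow_neg zero_le_two]
        congr 2
        rw [← Real.rpow_natCast]
        push_cast
        rfl
  calc K * (L ^ r * B) * ε ^ homDim s ≤
      K * (L ^ r * B) * (L ^ homDim s * ((2 : ℝ) ^ (-((n : ℝ) * (homDim s : ℝ))))) := by gcongr
    _ = L ^ r * B * L ^ homDim s * (K * (2 : ℝ) ^ (-((n : ℝ) * (homDim s : ℝ)))) := by ring
    _ = _ := by
      rw [hK, ← Real.rpow_add two_pos]
      congr 2
      ring

/-! ### A smooth partition of unity -/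

/-- A smooth function supported in `[0, 2]` whose integer translates sum to one. -/
noncomputable def unitBump (t : ℝ) : ℝ := Real.smoothTransition t - Real.smoothTransition (t - 1)

theorem contDiff_unitBump {n : ℕ∞} : ContDiff ℝ n unitBump :=
  Real.smoothTransition.contDiff.sub
    (Real.smoothTransition.contDiff.comp (contDiff_id.sub contDiff_const))

theorem mem_Icc_of_unitBump_ne_zero {t : ℝ} (h : unitBump t ≠ 0) : t ∈ Set.Icc (0 : ℝ) 2 := by
  by_contra hlt
  apply h
  rw [Set.mem_Icc, not_and_or, not_le, not_le] at hlt
  unfold unitBump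
  rcases hlt with h1 | h1
  · rw [Real.smoothTransition.zero_of_nonpos h1.le, Real.smoothTransition.zero_of_nonpos
      (by linarith), sub_zero]
  · rw [Real.smoothTransition.one_of_one_le (by linarith), Real.smoothTransition.one_of_one_le
      (by linarith), sub_self]

/-- The sum telescopes to the transition at `t + N ≥ 1` minus the transition at `t - N ≤ 0`. -/
theorem sum_unitBump {N : ℕ} {t : ℝ} (ht : |t| ≤ (N : ℝ) - 1) :
    ∑ j ∈ Finset.range (2 * N), unitBump (t + N - j) = 1 := by
  have h1 := Finset.sum_range_sub' (fun j : ℕ => Real.smoothTransition (t + N - j)) (2 * N)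
  have h2 : ∀ j : ℕ, unitBump (t + N - j) = Real.smoothTransition (t + N - j) -
      Real.smoothTransition (t + N - (j + 1 : ℕ)) := by
    intro j
    unfold unitBump
    congr 2
    push_cast
    ring
  simp_rw [h2]
  rw [h1]
  have h3 := abs_le.mp ht
  rw [Real.smoothTransition.one_of_one_le (by push_cast; linarith),
    Real.smoothTransition.zero_of_nonpos (by push_cast; linarith), sub_zero]

/-- A smooth partition of unity cuts `g` into boundedly many pieces, each small enough to lie in a
ball of scale `ε ≥ 1/2`. The centre of each ball may be moved by `δ`; the infimum over these
positions allows the value to be integrated over a cell later on. The pieces inherit no vanishing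
moments, so the full test ball is used. -/
theorem enorm_apply_le_sum_supTest {s : Fin d → ℕ} (hs : ∀ i, 0 < s i) (r : ℕ) (R : ℝ) :
    ∃ (Z : Finset (Fin d → ℝ)) (C δ : ℝ), 0 ≤ C ∧ 0 < δ ∧
      ∀ (ξ : 𝓢(Fin d → ℝ, ℝ) →L[ℝ] ℝ) (x : Fin d → ℝ) (g : 𝓢(Fin d → ℝ, ℝ)) (B : ℝ),
        (∀ u, g u ≠ 0 → ∀ l, |u l - x l| ≤ R) → CrBound s r B g →
        ∀ ε : ℝ, 1 / 2 ≤ ε → ε ≤ 1 →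
          ‖ξ g‖ₑ ≤ ∑ z ∈ Z, ⨅ (y : Fin d → ℝ) (_ : ∀ l, |y l - x l| ≤ δ),
            ENNReal.ofReal (C * B) * supTest s (testBall s r) ξ ε (y + z) := by
  classical
  -- Bumps have width `2 / M` and centres move by `1 / M`. The choice of `M` gives `4 / M = (1 / 2)
  -- ^ |𝔰|`, which is below `ε ^ s l` for every coordinate.
  set M : ℝ := 4 * 2 ^ homDim s with hM
  have hMpos : 0 < M := by positivity
  have hM1 : 1 ≤ M := by
    have : (1 : ℝ) ≤ 2 ^ homDim s := one_le_pow₀ one_le_two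
    linarith
  obtain ⟨N, hN⟩ := exists_nat_ge (M * R + 1)
  set χ : (Fin d → ℝ) → ℝ := tensorFun unitBump with hχ
  have hχs : ContDiff ℝ (⊤ : ℕ∞) χ := by
    refine contDiff_prod fun i _ => ?_
    exact contDiff_unitBump.comp (contDiff_apply ℝ ℝ i)
  have hχsr : ContDiff ℝ (r : WithTop ℕ∞) χ := hχs.of_le (by exact_mod_cast le_top)
  have hχc : HasCompactSupport χ := by
    refine HasCompactSupport.of_support_subset_isCompact
      (K := Set.Icc (fun _ => 0) (fun _ => 2)) isCompact_Icc ?_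
    intro u hu
    have h1 : ∀ i, unitBump (u i) ≠ 0 := fun i => Finset.prod_ne_zero_iff.mp hu i (Finset.mem_univ i)
    exact ⟨fun i => (mem_Icc_of_unitBump_ne_zero (h1 i)).1,
      fun i => (mem_Icc_of_unitBump_ne_zero (h1 i)).2⟩
  obtain ⟨A, hA⟩ := exists_crBound hs hχsr hχc
  have hA0 := hA.nonneg
  set J : Finset (Fin d → ℕ) := Fintype.piFinset fun _ => Finset.range (2 * N) with hJ
  set zf : (Fin d → ℕ) → (Fin d → ℝ) := fun j l => ((j l : ℝ) - N) / M with hzf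
  have hzinj : Function.Injective zf := by
    intro j j' h
    ext l
    have h1 := congrFun h l
    simp only [hzf] at h1
    rw [div_left_inj' hMpos.ne', sub_left_inj] at h1
    exact_mod_cast h1
  refine ⟨J.image zf, 2 ^ r * (M ^ r * A), 1 / M, by positivity, by positivity, ?_⟩
  intro ξ x g B hsupp hB ε hε1 hε2
  have hε0 : 0 < ε := by linarith
  have hB0 := hB.nonneg
  have hgc : HasCompactSupport g := by
    refine HasCompactSupport.of_support_subset_isCompact
      (K := Set.Icc (fun l => x l - R) (fun l => x l + R)) isCompact_Icc ?_
    intro u hu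
    exact ⟨fun l => by linarith [(abs_le.mp (hsupp u hu l)).1],
      fun l => by linarith [(abs_le.mp (hsupp u hu l)).2]⟩
  let θ : (Fin d → ℕ) → (Fin d → ℝ) → ℝ := fun j u =>
    χ (fun l => M * u l + (-(M * x l) + N - j l))
  have hθs : ∀ j, ContDiff ℝ (⊤ : ℕ∞) (θ j) := fun j => contDiff_comp_affine hχs (fun _ => M) _
  have hθb : ∀ j, CrBound s r (M ^ r * A) (θ j) := fun j =>
    hA.comp_affine hs hχsr (a := fun _ => M) hM1 (fun _ => (abs_of_pos hMpos).le) _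
  have hgs : ContDiff ℝ (⊤ : ℕ∞) g := g.smooth ⊤
  let G : (Fin d → ℕ) → 𝓢(Fin d → ℝ, ℝ) := fun j =>
    (hgc.mul_left (f := θ j)).toSchwartzMap ((hθs j).mul hgs)
  have hG : ∀ j, ⇑(G j) = fun u => θ j u * g u := fun j => rfl
  have hsum : g = ∑ j ∈ J, G j := by
    ext u
    rw [sum_apply]
    simp only [hG]
    rw [← Finset.sum_mul]
    by_cases hu : g u = 0
    · simp [hu]
    have h1 : ∑ j ∈ J, θ j u = 1 := by
      simp only [θ, hχ, tensorFun]
      rw [hJ, Finset.sum_prod_piFinset (Finset.range (2 * N))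
        (fun l j => unitBump (M * u l + (-(M * x l) + N - j)))]
      refine Finset.prod_eq_one fun l _ => ?_
      have h2 : |M * (u l - x l)| ≤ (N : ℝ) - 1 := by
        rw [abs_mul, abs_of_pos hMpos]
        have := mul_le_mul_of_nonneg_left (hsupp u hu l) hMpos.le
        linarith
      rw [← sum_unitBump h2]
      refine Finset.sum_congr rfl fun j _ => ?_
      congr 1
      ring
    rw [h1, one_mul]
  have hpiece : ∀ j, ‖ξ (G j)‖ₑ ≤ ⨅ (y : Fin d → ℝ) (_ : ∀ l, |y l - x l| ≤ 1 / M),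
      ENNReal.ofReal (2 ^ r * (M ^ r * A) * B) *
      supTest s (testBall s r) ξ ε (y + zf j) := by
    intro j
    refine le_iInf₂ fun y hy => ?_
    refine (enorm_apply_le_supTest_of_bound (r := r) hs (G j) (Or.inl rfl) hε0
      (B := 2 ^ r * (M ^ r * A) * B) (y := y + zf j) ?_ ?_ ξ).trans ?_
    · intro u hu l
      have h1 : θ j u ≠ 0 := left_ne_zero_of_mul hu
      have h2 := mem_Icc_of_unitBump_ne_zero (Finset.prod_ne_zero_iff.mp h1 l (Finset.mem_univ l))
      have h3 : |u l - x l - zf j l| ≤ 2 / M := by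
        have h4 : u l - x l - zf j l = (M * u l + (-(M * x l) + N - j l)) / M := by
          simp only [hzf]
          field_simp
          ring
        rw [h4, abs_div, abs_of_pos hMpos, abs_of_nonneg h2.1]
        exact div_le_div_of_nonneg_right h2.2 hMpos.le
      have h5 := hy l
      calc |u l - (y + zf j) l| = |(u l - x l - zf j l) - (y l - x l)| := by
            rw [Pi.add_apply]; congr 1; ring
        _ ≤ |u l - x l - zf j l| + |y l - x l| := abs_sub _ _
        _ ≤ 2 / M + 1 / M := add_le_add h3 h5
        _ ≤ 4 / M := by
            rw [← add_div]
            exact div_le_div_of_nonneg_right (by norm_num) hMpos.le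
        _ = (1 / 2) ^ homDim s := by
            rw [hM, one_div, inv_pow]
            field_simp
        _ ≤ (1 / 2) ^ s l := pow_le_pow_of_le_one (by norm_num) (by norm_num)
            (Finset.single_le_sum (f := s) (fun _ _ => Nat.zero_le _) (Finset.mem_univ l))
        _ ≤ ε ^ s l := pow_le_pow_left₀ (by norm_num) hε1 _
    · intro n i hi u
      have h1 := (hθb j).mul hs ((hθs j).of_le (by exact_mod_cast le_top)) (contDiff_schwartz g r) hB
        n i hi u
      calc ε ^ (∑ l, s (i l)) * |mixedDeriv i (G j) u| ≤ 1 * |mixedDeriv i (G j) u| := by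
            gcongr
            exact pow_le_one₀ hε0.le hε2
        _ ≤ _ := by
            rw [one_mul, hG]
            refine h1.trans (le_of_eq ?_)
            ring
    · refine mul_le_mul' (ENNReal.ofReal_le_ofReal ?_) le_rfl
      exact mul_le_of_le_one_right (by positivity) (pow_le_one₀ hε0.le hε2)
  calc ‖ξ g‖ₑ = ‖∑ j ∈ J, ξ (G j)‖ₑ := by rw [hsum, map_sum]
    _ ≤ ∑ j ∈ J, ‖ξ (G j)‖ₑ := enorm_sum_le _ _
    _ ≤ ∑ j ∈ J, ⨅ (y : Fin d → ℝ) (_ : ∀ l, |y l - x l| ≤ 1 / M),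
        ENNReal.ofReal (2 ^ r * (M ^ r * A) * B) *
        supTest s (testBall s r) ξ ε (y + zf j) := Finset.sum_le_sum fun j _ => hpiece j
    _ = _ := by
      rw [Finset.sum_image fun a _ b _ h => hzinj h]

/-- A coarse bound for the wavelet coefficients of a fixed level. -/
theorem enorm_pairing_le_sum_supTest {s : Fin d → ℕ} (hs : ∀ i, 0 < s i) {r : ℕ}
    {f : (Fin d → ℝ) → ℝ} (hf : ContDiff ℝ (r : WithTop ℕ∞) f) (hc : HasCompactSupport f) (n : ℕ) :
    ∃ (Z : Finset (Fin d → ℝ)) (C : ℝ≥0) (δ : ℝ), 0 < δ ∧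
      ∀ (ξ : 𝓢(Fin d → ℝ, ℝ) →L[ℝ] ℝ) (k : Fin d → ℤ) (v : ℝ),
        HasPairing s r ξ (waveletFun s f n k) v →
        ∀ ε : ℝ, 1 / 2 ≤ ε → ε ≤ 1 →
          ‖v‖ₑ ≤ ∑ z ∈ Z, ⨅ (y : Fin d → ℝ) (_ : ∀ l, |y l - gridPoint s n k l| ≤ δ),
            C * supTest s (testBall s r) ξ ε (y + z) := by
  obtain ⟨R, hR0, hR⟩ := hc.exists_support_subset_closedBall
  obtain ⟨B, hB⟩ := exists_crBound hs hf hc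
  obtain ⟨Z, C, δ, hC, hδ, hZ⟩ := enorm_apply_le_sum_supTest hs r (R + 1)
  obtain ⟨g, hg1, hg2, hg3, -⟩ := exists_schwartz_approx hs hf hR
  set K : ℝ := (2 : ℝ) ^ ((n : ℝ) * (homDim s : ℝ) / 2) with hK
  -- This crude bound on the dilation factors depends on `n`. It is harmless because the lemma is
  -- used only for finitely many levels.
  set B' : ℝ := |K| * (((2 : ℝ) ^ (n * homDim s)) ^ r * B) with hB'
  refine ⟨Z, (C * B').toNNReal, δ, hδ, ?_⟩
  intro ξ k v hv ε hε1 hε2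
  have hcd : ∀ j, ContDiff ℝ (⊤ : ℕ∞) (waveletFun s (g j) n k) := fun j =>
    contDiff_waveletFun s ((g j).smooth ⊤) n k
  have hcs : ∀ j, HasCompactSupport (waveletFun s (g j) n k) := fun j =>
    hasCompactSupport_waveletFun (hasCompactSupport_of_support_subset_closedBall (hg1 j)) n k
  let G : ℕ → 𝓢(Fin d → ℝ, ℝ) := fun j => (hcs j).toSchwartzMap (hcd j)
  have hG : ∀ j, ⇑(G j) = waveletFun s (g j) n k := fun j => rfl
  have hlim : Tendsto (fun j => ξ (G j)) atTop (𝓝 v) := by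
    refine hv.tendsto hs (contDiff_waveletFun s hf n k) (R := ‖gridPoint s n k‖ + (R + 1))
      (fun j => ?_) ?_
    · rw [hG]
      exact support_waveletFun_subset (by positivity) (hg1 j) n k
    · have h1 := (hg2.comp_affine hs (fun j => contDiff_schwartz (g j) r) hf
        (fun l => (2 : ℝ) ^ (n * s l)) (fun l => -(k l : ℝ))).const_mul hs
        (fun j => contDiff_comp_affine (contDiff_schwartz (g j) r) _ _)
        (contDiff_comp_affine hf _ _) K
      simp only [hG, waveletFun_eq]
      exact h1
  refine le_of_tendsto ((continuous_enorm.tendsto v).comp hlim) (Eventually.of_forall fun j => ?_)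
  refine hZ ξ (gridPoint s n k) (G j) B' (fun u hu l => ?_) ?_ ε hε1 hε2
  · refine (abs_sub_gridPoint_le (hg1 j) hu l).trans ?_
    exact mul_le_of_le_one_right (by positivity) (inv_le_one_of_one_le₀ (one_le_pow₀ one_le_two))
  · rw [hG, waveletFun_eq]
    refine CrBound.const_mul hs (contDiff_comp_affine (contDiff_schwartz (g j) r) _ _) ?_ K
    refine (hg3 B hB j).comp_affine hs (contDiff_schwartz (g j) r) (one_le_pow₀ one_le_two)
      (fun l => ?_) _
    rw [abs_of_pos (by positivity)]
    exact pow_le_pow_right₀ one_le_two (Nat.mul_le_mul_left n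
      (Finset.single_le_sum (f := s) (fun _ _ => Nat.zero_le _) (Finset.mem_univ l)))

/-! ### Discrete and continuous `L^p` norms -/

theorem le_essSup_smul_count {ι : Type*} [MeasurableSpace ι] {c : ℝ≥0∞} (hc : c ≠ 0) (f : ι → ℝ≥0∞) (i : ι) :
    f i ≤ essSup f (c • Measure.count) := by
  have h := ENNReal.ae_le_essSup (μ := c • (Measure.count : Measure ι)) f
  rw [ae_iff, Measure.smul_apply, smul_eq_mul, mul_eq_zero, or_iff_right hc,
    Measure.count_eq_zero_iff] at h
  by_contra hlt
  have : i ∈ {a | ¬f a ≤ essSup f (c • Measure.count)} := hlt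
  rw [h] at this
  exact this

theorem eLpNorm_enn_eq {X : Type*} [MeasurableSpace X] {μ : Measure X} {p : ℝ≥0∞} (h0 : p ≠ 0) (ht : p ≠ ∞) (f : X → ℝ≥0∞) :
    eLpNorm f p μ = (∫⁻ x, f x ^ p.toReal ∂μ) ^ (1 / p.toReal) := by
  rw [eLpNorm_eq_lintegral_rpow_enorm_toReal h0 ht]
  rfl

theorem eLpNorm_enn_top {X : Type*} [MeasurableSpace X] {μ : Measure X} (f : X → ℝ≥0∞) : eLpNorm f ∞ μ = essSup f μ := by
  rw [eLpNorm_exponent_top]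
  rfl

theorem eLpNorm_enn_mono {X : Type*} [MeasurableSpace X] {μ : Measure X} {p : ℝ≥0∞} {f g : X → ℝ≥0∞} (h : ∀ x, f x ≤ g x) :
    eLpNorm f p μ ≤ eLpNorm g p μ :=
  eLpNorm_mono_enorm h

/-- Minkowski's inequality for countable sums. -/
theorem eLpNorm_tsum_le {X : Type*} [MeasurableSpace X] {μ : Measure X}
    {F : ℕ → X → ℝ≥0∞} (hF : ∀ n, Measurable (F n)) {p : ℝ≥0∞} (hp : 1 ≤ p) :
    eLpNorm (fun x => ∑' n, F n x) p μ ≤ ∑' n, eLpNorm (F n) p μ := by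
  by_cases ht : p = ∞
  · subst ht
    simp only [eLpNorm_enn_top]
    refine essSup_le_of_ae_le _ ?_
    filter_upwards [ae_all_iff.mpr fun n => ENNReal.ae_le_essSup (μ := μ) (F n)] with x hx
    exact ENNReal.tsum_le_tsum hx
  · have hp0 : p ≠ 0 := (zero_lt_one.trans_le hp).ne'
    have hpp : 0 < p.toReal := ENNReal.toReal_pos hp0 ht
    have hmeas : ∀ N, Measurable fun x => ∑ n ∈ Finset.range N, F n x := fun N =>
      Finset.measurable_fun_sum _ fun n _ => hF n
    have h1 : ∀ x, (∑' n, F n x) ^ p.toReal =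
        ⨆ N, (∑ n ∈ Finset.range N, F n x) ^ p.toReal := by
      intro x
      rw [ENNReal.tsum_eq_iSup_nat]
      exact (ENNReal.orderIsoRpow p.toReal hpp).map_iSup _
    have hmono : Monotone fun N x => (∑ n ∈ Finset.range N, F n x) ^ p.toReal := by
      intro N M hNM x
      refine ENNReal.rpow_le_rpow ?_ hpp.le
      exact Finset.sum_le_sum_of_subset (Finset.range_mono hNM)
    -- For finite `p`, monotone convergence reduces the claim to partial sums, where the finite
    -- Minkowski inequality applies.
    rw [eLpNorm_enn_eq hp0 ht, one_div, ENNReal.rpow_inv_le_iff hpp]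
    simp only [h1]
    rw [lintegral_iSup (fun N => (hmeas N).pow_const _) hmono]
    refine iSup_le fun N => ?_
    have h2 : eLpNorm (fun x => ∑ n ∈ Finset.range N, F n x) p μ ≤
        ∑ n ∈ Finset.range N, eLpNorm (F n) p μ := by
      have := eLpNorm_sum_le (μ := μ) (s := Finset.range N) (f := F) (p := p)
        (fun n _ => (hF n).aestronglyMeasurable) hp
      rwa [show (∑ n ∈ Finset.range N, F n) = fun x => ∑ n ∈ Finset.range N, F n x by
        ext x; simp] at this
    have h3 := h2.trans (ENNReal.sum_le_tsum (Finset.range N))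
    rwa [eLpNorm_enn_eq hp0 ht, one_div, ENNReal.rpow_inv_le_iff hpp] at h3

section Measure

variable {X ι : Type*} [MeasurableSpace X] {μ : Measure X} [MeasurableSpace ι]
  [MeasurableSingletonClass ι]

/-- Discretisation: a sequence that is bounded by `G` on disjoint sets of measure at least `c` has
a smaller norm than `G`. -/
theorem eLpNorm_le_of_cells [Countable ι] {E : ι → Set X} (hE : ∀ i, MeasurableSet (E i))
    (hd : Pairwise (Function.onFun Disjoint E)) {c : ℝ≥0∞} (hc0 : c ≠ 0) (hc : ∀ i, c ≤ μ (E i))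
    {p : ℝ≥0∞} (hp : p ≠ 0) {m : ι → ℝ≥0∞} {G : X → ℝ≥0∞} (h : ∀ i, ∀ x ∈ E i, m i ≤ G x) :
    eLpNorm m p (c • Measure.count) ≤ eLpNorm G p μ := by
  by_cases ht : p = ∞
  · subst ht
    rw [eLpNorm_enn_top, eLpNorm_enn_top]
    refine essSup_le_of_ae_le _ (Eventually.of_forall fun i => ?_)
    by_contra hlt
    rw [not_le] at hlt
    have h1 : μ (E i) = 0 := by
      refine measure_mono_null (fun x hx => ?_) (ae_iff.mp (ENNReal.ae_le_essSup G))
      exact not_le.mpr (hlt.trans_le (h i x hx))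
    have h2 := hc i
    rw [h1] at h2
    exact hc0 (le_antisymm h2 bot_le)
  · have hp' : 0 < p.toReal := ENNReal.toReal_pos hp ht
    rw [eLpNorm_enn_eq hp ht, eLpNorm_enn_eq hp ht, lintegral_smul_measure, lintegral_count]
    refine ENNReal.rpow_le_rpow ?_ (by positivity)
    rw [smul_eq_mul, ← ENNReal.tsum_mul_left]
    -- `G` is not assumed measurable: monotonicity and additivity over measurable cells suffice.
    -- This matters because `G` will be a supremum over an uncountable set of test functions.
    calc ∑' i, c * m i ^ p.toReal ≤ ∑' i, ∫⁻ x in E i, G x ^ p.toReal ∂μ := by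
          refine ENNReal.tsum_le_tsum fun i => ?_
          calc c * m i ^ p.toReal ≤ m i ^ p.toReal * μ (E i) := by
                rw [mul_comm]
                exact mul_le_mul' le_rfl (hc i)
            _ = ∫⁻ x in E i, m i ^ p.toReal ∂μ := by rw [setLIntegral_const]
            _ ≤ _ := setLIntegral_mono' (hE i) fun x hx =>
                ENNReal.rpow_le_rpow (h i x hx) hp'.le
      _ = ∫⁻ x in ⋃ i, E i, G x ^ p.toReal ∂μ := (lintegral_iUnion hE hd _).symm
      _ ≤ _ := setLIntegral_le_lintegral _ _

/-- Hölder's inequality after splitting `K` as `K ^ (1 / q) * K ^ (1 / p)`, with `q` the exponent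
conjugate to `p`, so that the total mass enters with the power `p / q = p - 1`. -/
theorem rpow_tsum_mul_le [Countable ι] {K : ι → ℝ≥0∞} {A : ℝ≥0∞} (hA : ∑' i, K i ≤ A) (hAt : A ≠ ∞)
    (f : ι → ℝ≥0∞) {p : ℝ} (hp : 1 ≤ p) :
    (∑' i, K i * f i) ^ p ≤ A ^ (p - 1) * ∑' i, K i * f i ^ p := by
  rcases eq_or_lt_of_le hp with rfl | hp1
  · simp
  have hp0 : 0 < p := by linarith
  have hpq := Real.HolderConjugate.conjExponent hp1
  set q := p.conjExponent with hq
  have hq0 : 0 < q := hpq.symm.pos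
  have hKt : ∀ i, K i ≠ ∞ := fun i =>
    ne_top_of_le_ne_top hAt ((ENNReal.le_tsum i).trans hA)
  have h1 := ENNReal.lintegral_mul_le_Lp_mul_Lq (Measure.count : Measure ι) hpq.symm
    (f := fun i => K i ^ (1 / q)) (g := fun i => K i ^ (1 / p) * f i)
    (Measurable.of_discrete.aemeasurable) (Measurable.of_discrete.aemeasurable)
  simp only [Pi.mul_apply, lintegral_count] at h1
  have h2 : ∀ i, K i ^ (1 / q) * (K i ^ (1 / p) * f i) = K i * f i := by
    intro i
    rw [← mul_assoc, ← ENNReal.rpow_add_of_nonneg _ _ (by positivity) (by positivity), one_div,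
      one_div, hpq.symm.inv_add_inv_eq_one, ENNReal.rpow_one]
  have h3 : ∀ i, (K i ^ (1 / q)) ^ q = K i := fun i => by
    rw [← ENNReal.rpow_mul, one_div_mul_cancel hq0.ne', ENNReal.rpow_one]
  have h4 : ∀ i, (K i ^ (1 / p) * f i) ^ p = K i * f i ^ p := fun i => by
    rw [ENNReal.mul_rpow_of_nonneg _ _ hp0.le, ← ENNReal.rpow_mul, one_div_mul_cancel hp0.ne',
      ENNReal.rpow_one]
  simp only [h2, h3, h4] at h1
  calc (∑' i, K i * f i) ^ p ≤ ((∑' i, K i) ^ (1 / q) * (∑' i, K i * f i ^ p) ^ (1 / p)) ^ p :=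
        ENNReal.rpow_le_rpow h1 hp0.le
    _ = (∑' i, K i) ^ (p - 1) * ∑' i, K i * f i ^ p := by
        rw [ENNReal.mul_rpow_of_nonneg _ _ hp0.le, ← ENNReal.rpow_mul, ← ENNReal.rpow_mul,
          one_div_mul_cancel hp0.ne', ENNReal.rpow_one]
        congr 2
        have hp1' : p - 1 ≠ 0 := by linarith
        rw [hq, Real.conjExponent]
        field_simp
    _ ≤ _ := by
        gcongr

/-- The Schur test, from a weighted counting measure. -/
theorem eLpNorm_tsum_mul_le [Countable ι] {K : ι → X → ℝ≥0∞} (hK : ∀ i, Measurable (K i))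
    {A c : ℝ≥0∞} (hAt : A ≠ ∞) (hc : c ≠ 0) (hA : ∀ x, ∑' i, K i x ≤ A)
    (hB : ∀ i, ∫⁻ x, K i x ∂μ ≤ A * c) (f : ι → ℝ≥0∞) {p : ℝ≥0∞} (hp : 1 ≤ p) :
    eLpNorm (fun x => ∑' i, K i x * f i) p μ ≤ A * eLpNorm f p (c • Measure.count) := by
  by_cases ht : p = ∞
  · subst ht
    rw [eLpNorm_enn_top, eLpNorm_enn_top]
    refine essSup_le_of_ae_le _ (Eventually.of_forall fun x => ?_)
    calc ∑' i, K i x * f i ≤ ∑' i, K i x * essSup f (c • Measure.count) :=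
          ENNReal.tsum_le_tsum fun i => mul_le_mul' le_rfl (le_essSup_smul_count hc f i)
      _ = (∑' i, K i x) * essSup f (c • Measure.count) := ENNReal.tsum_mul_right
      _ ≤ _ := mul_le_mul' (hA x) le_rfl
  · have hp0 : p ≠ 0 := (zero_lt_one.trans_le hp).ne'
    have hp1 : 1 ≤ p.toReal := by
      rw [← ENNReal.toReal_one]
      exact ENNReal.toReal_mono ht hp
    have hpp : 0 < p.toReal := by linarith
    rw [eLpNorm_enn_eq hp0 ht, eLpNorm_enn_eq hp0 ht, lintegral_smul_measure, lintegral_count]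
    -- The bound on the sums over `i` gives the factor `A ^ (p - 1)` by Hölder, and the bound on the
    -- integrals over `x` gives the last factor `A`.
    have h1 : ∫⁻ x, (∑' i, K i x * f i) ^ p.toReal ∂μ ≤
        A ^ p.toReal * (c • ∑' i, f i ^ p.toReal) := by
      calc ∫⁻ x, (∑' i, K i x * f i) ^ p.toReal ∂μ
          ≤ ∫⁻ x, A ^ (p.toReal - 1) * ∑' i, K i x * f i ^ p.toReal ∂μ :=
            lintegral_mono fun x => rpow_tsum_mul_le (hA x) hAt f hp1
        _ = A ^ (p.toReal - 1) * ∑' i, (∫⁻ x, K i x ∂μ) * f i ^ p.toReal := by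
            rw [lintegral_const_mul _ (Measurable.tsum fun i => (hK i).mul_const _),
              lintegral_tsum fun i => ((hK i).mul_const _).aemeasurable]
            congr 2
            ext i
            rw [lintegral_mul_const _ (hK i)]
        _ ≤ A ^ (p.toReal - 1) * ∑' i, (A * c) * f i ^ p.toReal := by
            gcongr with i
            exact hB i
        _ = A ^ (p.toReal - 1) * A * (c * ∑' i, f i ^ p.toReal) := by
            rw [ENNReal.tsum_mul_left]
            ring
        _ = _ := by
            congr 1
            have h2 := ENNReal.rpow_add_of_nonneg (x := A) (p.toReal - 1) 1 (by linarith) zero_le_one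
            rw [sub_add_cancel, ENNReal.rpow_one] at h2
            exact h2.symm
    calc _ ≤ (A ^ p.toReal * (c • ∑' i, f i ^ p.toReal)) ^ (1 / p.toReal) :=
          ENNReal.rpow_le_rpow h1 (by positivity)
      _ = _ := by
          rw [ENNReal.mul_rpow_of_nonneg _ _ (by positivity), ← ENNReal.rpow_mul,
            mul_one_div_cancel hpp.ne', ENNReal.rpow_one]

/-- Hölder's inequality on a weighted counting measure, with a bounded integrable weight. -/
theorem tsum_mul_le_eLpNorm [Countable ι] {w : ι → ℝ≥0∞} {A c : ℝ≥0∞} (hAt : A ≠ ∞) (hc : c ≠ 0)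
    (hA : c * ∑' i, w i ≤ A) (hw : ∀ i, w i ≤ A) (f : ι → ℝ≥0∞) {p : ℝ≥0∞} (hp : 1 ≤ p) :
    ∑' i, c * w i * f i ≤ A * eLpNorm f p (c • Measure.count) := by
  -- On a one-point space Schur's test reads as a weighted Hölder inequality.
  have h := eLpNorm_tsum_mul_le (X := Unit) (μ := Measure.dirac ()) (K := fun i _ => c * w i)
    (fun i => measurable_const) hAt hc (fun _ => by rwa [ENNReal.tsum_mul_left])
    (fun i => by
      simp only [lintegral_const, measure_univ, mul_one]
      rw [mul_comm]
      exact mul_le_mul' (hw i) le_rfl) f hp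
  refine le_trans (le_of_eq ?_) h
  have hp0 : p ≠ 0 := (zero_lt_one.trans_le hp).ne'
  rw [eLpNorm_const _ hp0 (by simp)]
  simp

end Measure

/-! ### Comparison of norms on counting measures -/

theorem eLpNorm_enn_le_const_mul {X : Type*} [MeasurableSpace X] {μ : Measure X} {p : ℝ≥0∞}
    {f g : X → ℝ≥0∞} (c : ℝ≥0) (h : ∀ x, f x ≤ c * g x) :
    eLpNorm f p μ ≤ c * eLpNorm g p μ := by
  have := eLpNorm_le_nnreal_smul_eLpNorm_of_ae_le_mul' (μ := μ) (f := f) (g := g) (c := c)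
    (Eventually.of_forall h) p
  rwa [ENNReal.smul_def, smul_eq_mul] at this

/-- Counting measure is `c⁻¹` times the weighted one. The constant depends on `c` and `p` only, not
on the index type. -/
theorem exists_eLpNorm_count_le (p : ℝ≥0∞) {c : ℝ≥0∞} (hc : c ≠ 0) (hct : c ≠ ∞) :
    ∃ K : ℝ≥0, ∀ {ι : Type} [MeasurableSpace ι] (f : ι → ℝ≥0∞),
      eLpNorm f p Measure.count ≤ K * eLpNorm f p (c • Measure.count) := by
  have hcp : c⁻¹ ^ (1 / p).toReal ≠ ∞ :=
    ENNReal.rpow_ne_top_of_nonneg ENNReal.toReal_nonneg (ENNReal.inv_ne_top.mpr hc)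
  refine ⟨(c⁻¹ ^ (1 / p).toReal).toNNReal, fun f => ?_⟩
  rw [ENNReal.coe_toNNReal hcp]
  have h := eLpNorm_smul_measure_le c⁻¹ f p (c • Measure.count)
  rwa [smul_smul, ENNReal.inv_mul_cancel hc hct, one_smul] at h

theorem le_eLpNorm_count {ι : Type*} [Countable ι] [MeasurableSpace ι]
    [MeasurableSingletonClass ι] {p : ℝ≥0∞} (hp : p ≠ 0) (f : ι → ℝ≥0∞) (i : ι) :
    f i ≤ eLpNorm f p Measure.count := by
  by_cases ht : p = ∞
  · subst ht
    rw [eLpNorm_enn_top]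
    simpa using le_essSup_smul_count one_ne_zero f i
  · have hpp : 0 < p.toReal := ENNReal.toReal_pos hp ht
    rw [eLpNorm_enn_eq hp ht, lintegral_count, one_div, ENNReal.le_rpow_inv_iff hpp]
    exact ENNReal.le_tsum (f := fun i => f i ^ p.toReal) i

/-- For finite `q` this is the subadditivity of `t ↦ t ^ (1 / q)`. Its iteration allows finitely
many coarse levels to be treated separately. -/
theorem eLpNorm_nat_count_le_succ {q : ℝ≥0∞} (hq : 1 ≤ q) (A : ℕ → ℝ≥0∞) :
    eLpNorm A q Measure.count ≤ A 0 + eLpNorm (fun n => A (n + 1)) q Measure.count := by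
  have hq0 : q ≠ 0 := (zero_lt_one.trans_le hq).ne'
  by_cases ht : q = ∞
  · subst ht
    rw [eLpNorm_enn_top]
    refine essSup_le_of_ae_le _ (Eventually.of_forall fun n => ?_)
    cases n with
    | zero => exact le_self_add
    | succ n =>
      exact (le_eLpNorm_count ENNReal.top_ne_zero (fun n => A (n + 1)) n).trans le_add_self
  · have hq1 : 1 ≤ q.toReal := by
      rw [← ENNReal.toReal_one]
      exact ENNReal.toReal_mono ht hq
    rw [eLpNorm_enn_eq hq0 ht, eLpNorm_enn_eq hq0 ht, lintegral_count, lintegral_count,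
      tsum_eq_zero_add' ENNReal.summable]
    refine (ENNReal.rpow_add_le_add_rpow _ _ (by positivity)
      (by rw [div_le_one (by linarith)]; exact hq1)).trans (add_le_add (le_of_eq ?_) le_rfl)
    rw [← ENNReal.rpow_mul, mul_one_div_cancel (by linarith), ENNReal.rpow_one]

theorem eLpNorm_nat_count_le_add {q : ℝ≥0∞} (hq : 1 ≤ q) (A : ℕ → ℝ≥0∞) (N : ℕ) :
    eLpNorm A q Measure.count ≤
      ∑ n ∈ Finset.range N, A n + eLpNorm (fun n => A (n + N)) q Measure.count := by
  induction N with
  | zero => simp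
  | succ N ih =>
    refine ih.trans ?_
    rw [Finset.sum_range_succ, add_assoc]
    refine add_le_add le_rfl ((eLpNorm_nat_count_le_succ hq _).trans (le_of_eq ?_))
    rw [zero_add]
    congr 2
    ext n
    rw [add_assoc, add_comm 1]

/-! ### Boxes -/

/-- The half-open box with corner `x` and side lengths `w`. -/
def box (x w : Fin d → ℝ) : Set (Fin d → ℝ) := Set.pi Set.univ fun l => Set.Ico (x l) (x l + w l)

theorem measurableSet_box (x w : Fin d → ℝ) : MeasurableSet (box x w) :=
  MeasurableSet.univ_pi fun _ => measurableSet_Ico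

theorem volume_box (x w : Fin d → ℝ) : volume (box x w) = ∏ l, ENNReal.ofReal (w l) := by
  unfold box
  rw [Real.volume_pi_Ico]
  simp

theorem disjoint_box {x x' w : Fin d → ℝ} {l : Fin d} (h : w l ≤ |x l - x' l|) :
    Disjoint (box x w) (box x' w) := by
  rw [Set.disjoint_left]
  intro y hy hy'
  have h1 := hy l (Set.mem_univ l)
  have h2 := hy' l (Set.mem_univ l)
  rw [Set.mem_Ico] at h1 h2
  rcases abs_cases (x l - x' l) with h3 | h3 <;> linarith [h1.1, h1.2, h2.1, h2.2]

theorem exists_le_abs_gridPoint_sub (s : Fin d → ℕ) (n : ℕ) {k k' : Fin d → ℤ} (h : k ≠ k') :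
    ∃ l, ((2 : ℝ) ^ (n * s l))⁻¹ ≤ |gridPoint s n k l - gridPoint s n k' l| := by
  obtain ⟨l, hl⟩ := Function.ne_iff.mp h
  refine ⟨l, ?_⟩
  have hp : (0 : ℝ) < 2 ^ (n * s l) := by positivity
  unfold gridPoint
  rw [← sub_div, abs_div, abs_of_pos hp, inv_eq_one_div]
  refine div_le_div_of_nonneg_right ?_ hp.le
  exact_mod_cast Int.one_le_abs (sub_ne_zero.mpr hl)

/-! ### The scale measure -/

/-- The interval has length half its right endpoint `a`, and the density is at least `a⁻¹` there.
The exact mass `log 2` is not needed. -/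
theorem half_le_scaleMeasure (j : ℕ) :
    (2 : ℝ≥0∞)⁻¹ ≤ scaleMeasure (Set.Ico ((2 : ℝ) ^ (j + 1))⁻¹ ((2 : ℝ) ^ j)⁻¹) := by
  set a : ℝ := ((2 : ℝ) ^ j)⁻¹ with ha
  have ha' : ((2 : ℝ) ^ (j + 1))⁻¹ = a / 2 := by
    rw [ha, pow_succ, mul_inv]
    rfl
  have hapos : 0 < a := by positivity
  have ha1 : a ≤ 1 := inv_le_one_of_one_le₀ (one_le_pow₀ one_le_two)
  have hsub : Set.Ico (a / 2) a ⊆ Set.Ioo 0 1 := fun ε hε =>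
    ⟨by linarith [hε.1], by linarith [hε.2]⟩
  rw [ha', scaleMeasure, withDensity_apply _ measurableSet_Ico,
    Measure.restrict_restrict measurableSet_Ico, Set.inter_eq_left.mpr hsub]
  calc (2 : ℝ≥0∞)⁻¹ = ∫⁻ _ in Set.Ico (a / 2) a, ENNReal.ofReal a⁻¹ := by
        rw [setLIntegral_const, Real.volume_Ico, ← ENNReal.ofReal_mul (by positivity)]
        rw [show a⁻¹ * (a - a / 2) = 2⁻¹ by field_simp; ring, ENNReal.ofReal_inv_of_pos two_pos]
        simp
    _ ≤ _ := setLIntegral_mono' measurableSet_Ico fun ε hε =>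
        ENNReal.ofReal_le_ofReal (inv_anti₀ (by linarith [hε.1]) hε.2.le)

theorem disjoint_scale_intervals : Pairwise (Function.onFun Disjoint
    fun j : ℕ => Set.Ico ((2 : ℝ) ^ (j + 1))⁻¹ ((2 : ℝ) ^ j)⁻¹) := by
  have key : ∀ i j : ℕ, i < j → Disjoint (Set.Ico ((2 : ℝ) ^ (i + 1))⁻¹ ((2 : ℝ) ^ i)⁻¹)
      (Set.Ico ((2 : ℝ) ^ (j + 1))⁻¹ ((2 : ℝ) ^ j)⁻¹) := by
    intro i j hij
    rw [Set.disjoint_left]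
    intro ε h1 h2
    have : ((2 : ℝ) ^ j)⁻¹ ≤ ((2 : ℝ) ^ (i + 1))⁻¹ :=
      inv_anti₀ (by positivity) (pow_le_pow_right₀ one_le_two hij)
    linarith [h1.1, h2.2]
  intro i j hij
  rcases lt_or_gt_of_ne hij with h | h
  · exact key i j h
  · exact (key j i h).symm

/-- Discretisation in the scale variable. -/
theorem exists_eLpNorm_nat_le_scale {q : ℝ≥0∞} (hq : 1 ≤ q) : ∃ K : ℝ≥0, ∀ (G : ℝ → ℝ≥0∞)
    (m : ℕ → ℝ≥0∞), (∀ j, ∀ ε ∈ Set.Ico ((2 : ℝ) ^ (j + 1))⁻¹ ((2 : ℝ) ^ j)⁻¹, m j ≤ G ε) →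
    eLpNorm m q Measure.count ≤ K * eLpNorm G q scaleMeasure := by
  obtain ⟨K, hK⟩ := exists_eLpNorm_count_le q (c := 2⁻¹) (by simp) (by simp)
  refine ⟨K, fun G m h => (hK m).trans ?_⟩
  gcongr
  exact eLpNorm_le_of_cells (fun j => measurableSet_Ico) disjoint_scale_intervals (by simp)
    half_le_scaleMeasure (zero_lt_one.trans_le hq).ne' h

/-! ### Control of the discrete norms by the Besov norm -/

/-- The scale-one part of the Besov norm. -/
theorem exists_eLpNorm_supTest_le (s : Fin d → ℕ) (α : ℝ) (p : ℝ≥0∞) {q : ℝ≥0∞} (hq : 1 ≤ q)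
    (r : ℕ) : ∃ K : ℝ≥0, ∀ (ξ : 𝓢(Fin d → ℝ, ℝ) →L[ℝ] ℝ) (M : ℝ≥0∞),
      (∀ ε : ℝ, 1 / 2 ≤ ε → ε ≤ 1 →
        M ≤ eLpNorm (fun x => supTest s (testBall s r) ξ ε x) p volume) →
      M ≤ K * besovNorm s α p q r ξ := by
  obtain ⟨K, hK⟩ := exists_eLpNorm_nat_le_scale hq
  have hq0 : q ≠ 0 := (zero_lt_one.trans_le hq).ne'
  by_cases hα : α < 0
  · have hc0 : (0 : ℝ) < 2 ^ |α| := by positivity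
    refine ⟨K * (2 ^ |α| : ℝ).toNNReal, fun ξ M hM => ?_⟩
    simp only [besovNorm, hα, if_true, scaleNorm]
    set G : ℝ → ℝ≥0∞ := fun ε => eLpNorm (fun x : Fin d → ℝ =>
      supTest s (testBall s r) ξ ε x / ENNReal.ofReal (ε ^ α)) p volume with hG
    set D : ℝ≥0 := (2 ^ |α| : ℝ).toNNReal with hD
    have hDe : (D : ℝ≥0∞) = ENNReal.ofReal (2 ^ |α|) := rfl
    have h1 : ∀ ε ∈ Set.Ico ((2 : ℝ) ^ (0 + 1))⁻¹ ((2 : ℝ) ^ 0)⁻¹, M ≤ D * G ε := by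
      intro ε hε
      norm_num at hε
      have hε0 : 0 < ε := by linarith [hε.1]
      refine (hM ε (by linarith [hε.1]) hε.2.le).trans (eLpNorm_enn_le_const_mul D fun x => ?_)
      have h2 : 0 < ε ^ α := Real.rpow_pos_of_pos hε0 α
      have h3 : ε ^ α ≤ 2 ^ |α| := by
        rw [abs_of_neg hα, Real.rpow_neg zero_le_two, ← Real.inv_rpow zero_le_two]
        exact Real.rpow_le_rpow_of_nonpos (by norm_num) (by linarith [hε.1]) hα.le
      have h4 : ENNReal.ofReal (ε ^ α) ≠ 0 := by simpa using h2
      calc supTest s (testBall s r) ξ ε x = ENNReal.ofReal (ε ^ α) *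
            (supTest s (testBall s r) ξ ε x / ENNReal.ofReal (ε ^ α)) := by
              rw [ENNReal.mul_div_cancel h4 ENNReal.ofReal_ne_top]
        _ ≤ _ := by
            rw [hDe]
            exact mul_le_mul' (ENNReal.ofReal_le_ofReal h3) le_rfl
    -- For negative `α` the scales in `[1/2, 1)` must be averaged. A sequence living on the first
    -- dyadic interval reduces this to the discretisation already available.
    set m : ℕ → ℝ≥0∞ := fun j => if j = 0 then M else 0 with hm
    have h5 := hK (fun ε => D * G ε) m (by
      intro j ε hε
      rcases Nat.eq_zero_or_pos j with rfl | hj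
      · simpa [hm] using h1 ε (by simpa using hε)
      · simp [hm, hj.ne'])
    calc M = m 0 := by simp [hm]
      _ ≤ eLpNorm m q Measure.count := le_eLpNorm_count hq0 m 0
      _ ≤ _ := h5
      _ ≤ K * (D * eLpNorm G q scaleMeasure) := by
          gcongr
          exact eLpNorm_enn_le_const_mul D fun ε => le_rfl
      _ = _ := by push_cast; ring
  -- For `α ≥ 0` the Besov norm contains the value at scale one explicitly, tested against functions
  -- without any cancellation.
  · refine ⟨1, fun ξ M hM => ?_⟩
    simp only [besovNorm, hα, if_false]
    rw [ENNReal.coe_one, one_mul]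
    exact (hM 1 (by norm_num) le_rfl).trans le_self_add

/-- Sequences controlled by nearby values of `supTest` at scale about one are controlled by the
Besov norm. -/
theorem exists_eLpNorm_count_le_besovNorm (s : Fin d → ℕ) (α : ℝ) {p q : ℝ≥0∞} (hp : 1 ≤ p)
    (hq : 1 ≤ q) (r : ℕ) (Z : Finset (Fin d → ℝ)) {δ : ℝ} (hδ : 0 < δ) :
    ∃ K : ℝ≥0, ∀ {ι : Type} [Countable ι] [MeasurableSpace ι] [MeasurableSingletonClass ι]
      (x : ι → Fin d → ℝ), (∀ i j, i ≠ j → ∃ l, δ ≤ |x i l - x j l|) →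
      ∀ (ξ : 𝓢(Fin d → ℝ, ℝ) →L[ℝ] ℝ) (C : ℝ≥0) (v : ι → ℝ≥0∞),
      (∀ ε : ℝ, 1 / 2 ≤ ε → ε ≤ 1 → ∀ i, v i ≤ ∑ z ∈ Z,
        ⨅ (y : Fin d → ℝ) (_ : ∀ l, |y l - x i l| ≤ δ),
          C * supTest s (testBall s r) ξ ε (y + z)) →
      eLpNorm v p Measure.count ≤ K * C * besovNorm s α p q r ξ := by
  have hp0 : p ≠ 0 := (zero_lt_one.trans_le hp).ne'
  obtain ⟨K₁, hK₁⟩ := exists_eLpNorm_supTest_le s α p hq r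
  set c : ℝ≥0∞ := ∏ _l : Fin d, ENNReal.ofReal δ with hc
  have hc0 : c ≠ 0 := by
    rw [hc]
    exact Finset.prod_ne_zero_iff.mpr fun _ _ => by simpa using hδ
  have hct : c ≠ ∞ := ENNReal.prod_ne_top fun _ _ => ENNReal.ofReal_ne_top
  obtain ⟨K₂, hK₂⟩ := exists_eLpNorm_count_le p hc0 hct
  refine ⟨K₂ * Z.card * K₁, fun {ι} _ _ _ x hx ξ C v hv => ?_⟩
  have h1 : ∀ ε : ℝ, 1 / 2 ≤ ε → ε ≤ 1 → eLpNorm v p Measure.count ≤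
      ((K₂ * Z.card * C : ℝ≥0) : ℝ≥0∞) *
        eLpNorm (fun x => supTest s (testBall s r) ξ ε x) p volume := by
    intro ε hε1 hε2
    set m : (Fin d → ℝ) → ι → ℝ≥0∞ := fun z i =>
      ⨅ (y : Fin d → ℝ) (_ : ∀ l, |y l - x i l| ≤ δ),
        C * supTest s (testBall s r) ξ ε (y + z) with hm
    have h2 : ∀ z, eLpNorm (m z) p Measure.count ≤ K₂ * (C *
        eLpNorm (fun x => supTest s (testBall s r) ξ ε x) p volume) := by
      intro z
      refine (hK₂ (m z)).trans ?_
      gcongr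
      refine le_trans ?_ (eLpNorm_enn_le_const_mul C (fun y => le_rfl))
      refine eLpNorm_le_of_cells (E := fun i => box (x i + z) fun _ => δ)
        (fun i => measurableSet_box _ _) (fun i j hij => ?_) hc0 (fun i => ?_) hp0 (fun i y hy => ?_)
      · obtain ⟨l, hl⟩ := hx i j hij
        exact disjoint_box (l := l) (by simpa using hl)
      · rw [volume_box]
      · refine (iInf₂_le (y - z) fun l => ?_).trans (by rw [sub_add_cancel])
        have := hy l (Set.mem_univ l)
        rw [Set.mem_Ico, Pi.add_apply] at this
        rw [Pi.sub_apply, abs_le]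
        constructor <;> linarith [this.1, this.2]
    -- The triangle inequality is applied after discretisation, on a countable discrete index set,
    -- so that no measurability of `supTest` is needed.
    calc eLpNorm v p Measure.count ≤ eLpNorm (∑ z ∈ Z, m z) p Measure.count := by
          refine eLpNorm_enn_mono fun i => ?_
          rw [Finset.sum_apply]
          exact hv ε hε1 hε2 i
      _ ≤ ∑ z ∈ Z, eLpNorm (m z) p Measure.count :=
          eLpNorm_sum_le (fun z _ => (Measurable.of_discrete).aestronglyMeasurable) hp
      _ ≤ ∑ z ∈ Z, K₂ * (C * eLpNorm (fun x => supTest s (testBall s r) ξ ε x) p volume) :=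
          Finset.sum_le_sum fun z _ => h2 z
      _ = _ := by
          rw [Finset.sum_const, nsmul_eq_mul]
          push_cast
          ring
  rcases eq_or_ne (K₂ * Z.card * C) 0 with h0 | h0
  · have := h1 1 (by norm_num) le_rfl
    rw [h0, ENNReal.coe_zero, zero_mul] at this
    exact this.trans bot_le
  · have h3 := hK₁ ξ (eLpNorm v p Measure.count / ((K₂ * Z.card * C : ℝ≥0) : ℝ≥0∞)) ?_
    · rw [ENNReal.div_le_iff (by simpa using h0) ENNReal.coe_ne_top] at h3
      refine h3.trans (le_of_eq ?_)
      push_cast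
      ring
    · intro ε hε1 hε2
      rw [ENNReal.div_le_iff (by simpa using h0) ENNReal.coe_ne_top, mul_comm]
      exact h1 ε hε1 hε2

/-- A distribution in a Besov space is of order `r` on compact sets. -/
theorem exists_abs_apply_le_of_besovNorm_lt_top {s : Fin d → ℕ} (hs : ∀ i, 0 < s i) {α : ℝ}
    {p q : ℝ≥0∞} (hp : 1 ≤ p) (hq : 1 ≤ q) {r : ℕ} {ξ : 𝓢(Fin d → ℝ, ℝ) →L[ℝ] ℝ}
    (hξ : besovNorm s α p q r ξ < ∞) (R : ℝ) :
    ∃ C : ℝ, ∀ (g : 𝓢(Fin d → ℝ, ℝ)) (B : ℝ),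
      Function.support g ⊆ Metric.closedBall 0 R → CrBound s r B g → |ξ g| ≤ C * B := by
  obtain ⟨Z, C, δ, hC, hδ, h⟩ := enorm_apply_le_sum_supTest hs r R
  obtain ⟨K, hK⟩ := exists_eLpNorm_count_le_besovNorm s α hp hq r Z hδ
  refine ⟨K * C * (besovNorm s α p q r ξ).toReal, fun g B hg hB => ?_⟩
  have hB0 := hB.nonneg
  -- A single test function is a family indexed by one point, for which the separation condition is
  -- vacuous.
  have h1 := hK (ι := Unit) (fun _ => 0) (fun i j hij => absurd (Subsingleton.elim i j) hij) ξ
    (C * B).toNNReal (fun _ => ‖ξ g‖ₑ) (fun ε hε1 hε2 _ => by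
      refine h ξ 0 g B (fun u hu l => ?_) hB ε hε1 hε2
      have h2 := hg hu
      rw [mem_closedBall_zero_iff] at h2
      simpa using (norm_le_pi_norm u l).trans h2)
  have h2 := (le_eLpNorm_count (p := p) (zero_lt_one.trans_le hp).ne'
    (fun _ : Unit => ‖ξ g‖ₑ) ()).trans h1
  have h3 : (K : ℝ≥0∞) * ((C * B).toNNReal : ℝ≥0) * besovNorm s α p q r ξ ≠ ∞ :=
    ENNReal.mul_ne_top (ENNReal.mul_ne_top ENNReal.coe_ne_top ENNReal.coe_ne_top) hξ.ne
  have h4 := ENNReal.toReal_mono h3 h2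
  rw [toReal_enorm, Real.norm_eq_abs] at h4
  refine h4.trans (le_of_eq ?_)
  rw [ENNReal.toReal_mul, ENNReal.toReal_mul, ENNReal.coe_toReal, ENNReal.coe_toReal,
    Real.coe_toNNReal _ (by positivity)]
  ring

theorem ellNorm_le_eLpNorm_count (s : Fin d → ℕ) (p : ℝ≥0∞) (n : ℕ) (u : (Fin d → ℤ) → ℝ) :
    ellNorm s p n u ≤ eLpNorm (fun k => ‖u k‖ₑ) p Measure.count := by
  have h : ((2 : ℝ≥0∞) ^ (n * homDim s))⁻¹ ≤ 1 := ENNReal.inv_le_one.mpr (one_le_pow₀ one_le_two)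
  have h2 : ((2 : ℝ≥0∞) ^ (n * homDim s))⁻¹ • (Measure.count : Measure (Fin d → ℤ)) ≤
      Measure.count := by
    refine Measure.le_intro fun S _ _ => ?_
    rw [Measure.smul_apply, smul_eq_mul]
    exact mul_le_of_le_one_left bot_le h
  rw [eLpNorm_enorm]
  exact eLpNorm_mono_measure u h2

/-- The coefficients of a fixed level. -/
theorem exists_eLpNorm_coeff_le_besovNorm {s : Fin d → ℕ} (hs : ∀ i, 0 < s i) (α : ℝ)
    {p q : ℝ≥0∞} (hp : 1 ≤ p) (hq : 1 ≤ q) {r : ℕ} {f : (Fin d → ℝ) → ℝ}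
    (hf : ContDiff ℝ (r : WithTop ℕ∞) f) (hc : HasCompactSupport f) (n : ℕ) :
    ∃ K : ℝ≥0, ∀ (ξ : 𝓢(Fin d → ℝ, ℝ) →L[ℝ] ℝ) (v : (Fin d → ℤ) → ℝ),
      (∀ k, HasPairing s r ξ (waveletFun s f n k) (v k)) →
      eLpNorm (fun k => ‖v k‖ₑ) p Measure.count ≤ K * besovNorm s α p q r ξ := by
  obtain ⟨Z, C, δ, hδ, h⟩ := enorm_pairing_le_sum_supTest hs hf hc n
  -- Distinct grid points differ by at least one mesh width in some coordinate, and every mesh width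
  -- of level `n` is at least `2^{-n|𝔰|}`.
  set δ' : ℝ := min δ ((2 : ℝ) ^ (n * homDim s))⁻¹ with hδ'
  have hδ'pos : 0 < δ' := lt_min hδ (by positivity)
  obtain ⟨K, hK⟩ := exists_eLpNorm_count_le_besovNorm s α hp hq r Z hδ'pos
  refine ⟨K * C, fun ξ v hv => ?_⟩
  have h1 := hK (gridPoint s n) (fun k k' hkk => ?_) ξ C (fun k => ‖v k‖ₑ) ?_
  · rwa [← ENNReal.coe_mul] at h1
  · obtain ⟨l, hl⟩ := exists_le_abs_gridPoint_sub s n hkk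
    refine ⟨l, le_trans ((min_le_right _ _).trans ?_) hl⟩
    refine inv_anti₀ (by positivity) (pow_le_pow_right₀ one_le_two (Nat.mul_le_mul_left n ?_))
    exact Finset.single_le_sum (f := s) (fun _ _ => Nat.zero_le _) (Finset.mem_univ l)
  · intro ε hε1 hε2 k
    refine (h ξ k (v k) (hv k) ε hε1 hε2).trans (Finset.sum_le_sum fun z _ => ?_)
    refine le_iInf₂ fun y hy => iInf₂_le y fun l => (hy l).trans (min_le_left _ _)

/-- The coefficients of a fine level, in terms of test functions at a comparable scale. -/
theorem exists_ellNorm_le_eLpNorm_supTest {s : Fin d → ℕ} (hs : ∀ i, 0 < s i) (α : ℝ)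
    {p : ℝ≥0∞} (hp : 1 ≤ p) {r : ℕ} {F : Set ((Fin d → ℝ) → ℝ)} {f : (Fin d → ℝ) → ℝ}
    (hf : ContDiff ℝ (r : WithTop ℕ∞) f) (hc : HasCompactSupport f)
    (hF : F = testBall s r ∨ ∃ m, F = testBallAnnihil s r m ∧ Annih m f) :
    ∃ (N : ℕ) (K : ℝ≥0), ∀ (ξ : 𝓢(Fin d → ℝ, ℝ) →L[ℝ] ℝ) (j : ℕ) (v : (Fin d → ℤ) → ℝ),
      (∀ k, HasPairing s r ξ (waveletFun s f (j + N) k) (v k)) →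
      ∀ ε ∈ Set.Ico ((2 : ℝ) ^ (j + 1))⁻¹ ((2 : ℝ) ^ j)⁻¹,
        ellNorm s p (j + N) (fun k => v k /
          (2 : ℝ) ^ (-((j + N : ℕ) : ℝ) * (homDim s : ℝ) / 2 - ((j + N : ℕ) : ℝ) * α)) ≤
        K * eLpNorm (fun x => supTest s F ξ ε x / ENNReal.ofReal (ε ^ α)) p volume := by
  obtain ⟨R, hR0, hR⟩ := hc.exists_support_subset_closedBall
  obtain ⟨B, hB⟩ := exists_crBound hs hf hc
  have hB0 := hB.nonneg
  obtain ⟨N₀, hN₀⟩ := pow_unbounded_of_one_lt (R + 2) one_lt_two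
  -- With this shift `(R + 2) * 2^{-(j + N)}` is below every scale of the dyadic interval. The
  -- additional one comes from its left endpoint `2^{-(j + 1)}`.
  set N := N₀ + 1 with hN
  set L : ℝ := 2 ^ N with hL
  have hL1 : 1 ≤ L := one_le_pow₀ one_le_two
  set C₁ : ℝ := L ^ r * B * L ^ homDim s with hC₁
  have hC₁0 : 0 ≤ C₁ := by positivity
  set D : ℝ≥0 := (C₁ * L ^ |α|).toNNReal with hD
  refine ⟨N, D, fun ξ j v hv ε hε => ?_⟩
  set n := j + N with hn
  have hnj : ((2 : ℝ) ^ n)⁻¹ * L = ((2 : ℝ) ^ j)⁻¹ := by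
    rw [hn, hL, pow_add]
    field_simp
  have hε0 : 0 < ε := lt_of_lt_of_le (by positivity) hε.1
  have hε1 : (R + 2) * ((2 : ℝ) ^ n)⁻¹ ≤ ε := by
    refine le_trans ?_ hε.1
    have : ((2 : ℝ) ^ (j + 1))⁻¹ = 2 ^ N₀ * ((2 : ℝ) ^ n)⁻¹ := by
      rw [hn, hN, show j + (N₀ + 1) = N₀ + (j + 1) by ring, pow_add _ N₀]
      field_simp
    rw [this]
    gcongr
  have hε2 : ε ≤ L * ((2 : ℝ) ^ n)⁻¹ := by
    rw [mul_comm, hnj]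
    exact hε.2.le
  set e : ℝ := -(n : ℝ) * (homDim s : ℝ) / 2 - (n : ℝ) * α with he
  have hpt : ∀ k, ∀ y ∈ box (gridPoint s n k) (fun l => ((2 : ℝ) ^ (n * s l))⁻¹),
      ‖v k / (2 : ℝ) ^ e‖ₑ ≤ D * (supTest s F ξ ε y / ENNReal.ofReal (ε ^ α)) := by
    intro k y hy
    have h1 := enorm_pairing_waveletFun_le hs hf hF hR0.le hR hB hL1 (hv k) hε1 hε2 (y := y)
      (fun l => by
        have := hy l (Set.mem_univ l)
        rw [Set.mem_Ico] at this
        rw [abs_le]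
        have h2 : (0 : ℝ) ≤ ((2 : ℝ) ^ (n * s l))⁻¹ := by positivity
        constructor <;> linarith [this.1, this.2])
    have hεα : 0 < ε ^ α := Real.rpow_pos_of_pos hε0 α
    have h2 : ‖v k / (2 : ℝ) ^ e‖ₑ = ENNReal.ofReal ((2 : ℝ) ^ (-e)) * ‖v k‖ₑ := by
      rw [div_eq_inv_mul, enorm_mul, Real.rpow_neg zero_le_two,
        Real.enorm_eq_ofReal (by positivity)]
    rw [h2]
    calc ENNReal.ofReal ((2 : ℝ) ^ (-e)) * ‖v k‖ₑ
        ≤ ENNReal.ofReal ((2 : ℝ) ^ (-e)) * (ENNReal.ofReal (C₁ *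
          2 ^ (-((n : ℝ) * (homDim s : ℝ) / 2))) * supTest s F ξ ε y) := by gcongr
      _ = ENNReal.ofReal (C₁ * (2 : ℝ) ^ ((n : ℝ) * α)) * supTest s F ξ ε y := by
          rw [← mul_assoc, ← ENNReal.ofReal_mul (by positivity)]
          congr 2
          rw [mul_left_comm, ← Real.rpow_add two_pos]
          congr 2
          rw [he]
          ring
      _ ≤ ENNReal.ofReal (C₁ * L ^ |α| * (ε ^ α)⁻¹) * supTest s F ξ ε y := by
          refine mul_le_mul' (ENNReal.ofReal_le_ofReal ?_) le_rfl
          rw [mul_assoc C₁]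
          refine mul_le_mul_of_nonneg_left ?_ hC₁0
          rw [← div_eq_mul_inv, le_div_iff₀ hεα, Real.rpow_mul zero_le_two, Real.rpow_natCast,
            ← Real.mul_rpow (by positivity) hε0.le]
          -- The product `2 ^ n * ε` lies between `1` and `L`, so its power `α` is at most `L ^ |α|`
          -- for either sign of `α`.
          have ht1 : 1 ≤ (2 : ℝ) ^ n * ε := by
            have h3 : 1 * ((2 : ℝ) ^ n)⁻¹ ≤ ε := le_trans (by gcongr; linarith) hε1
            rw [one_mul] at h3
            calc (1 : ℝ) = 2 ^ n * (2 ^ n)⁻¹ := by field_simp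
              _ ≤ _ := by gcongr
          have ht2 : (2 : ℝ) ^ n * ε ≤ L := by
            calc (2 : ℝ) ^ n * ε ≤ 2 ^ n * (L * (2 ^ n)⁻¹) := by gcongr
              _ = L := by field_simp
          calc ((2 : ℝ) ^ n * ε) ^ α ≤ ((2 : ℝ) ^ n * ε) ^ |α| :=
                Real.rpow_le_rpow_of_exponent_le ht1 (le_abs_self α)
            _ ≤ L ^ |α| := Real.rpow_le_rpow (by positivity) ht2 (abs_nonneg α)
      _ = _ := by
          rw [ENNReal.ofReal_mul (by positivity), ENNReal.ofReal_inv_of_pos hεα,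
            show (D : ℝ≥0∞) = ENNReal.ofReal (C₁ * L ^ |α|) from rfl, ENNReal.div_eq_inv_mul,
            mul_assoc]
  refine le_trans ?_ (eLpNorm_enn_le_const_mul D fun y => le_rfl)
  unfold ellNorm
  rw [← eLpNorm_enorm]
  refine eLpNorm_le_of_cells
    (E := fun k => box (gridPoint s n k) fun l => ((2 : ℝ) ^ (n * s l))⁻¹)
    (fun k => measurableSet_box _ _) (fun k k' hkk => ?_) ?_ (fun k => ?_)
    (zero_lt_one.trans_le hp).ne' hpt
  · obtain ⟨l, hl⟩ := exists_le_abs_gridPoint_sub s n hkk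
    exact disjoint_box hl
  · exact ENNReal.inv_ne_zero.mpr (ENNReal.pow_ne_top ENNReal.ofNat_ne_top)
  · rw [volume_box, homDim, Finset.mul_sum, ← Finset.prod_pow_eq_pow_sum,
      ENNReal.prod_inv_distrib]
    · refine le_of_eq (Finset.prod_congr rfl fun l _ => ?_)
      rw [ENNReal.ofReal_inv_of_pos (by positivity), ENNReal.ofReal_pow zero_le_two]
      simp
    · intro a _ b _ _
      exact Or.inr (ENNReal.pow_ne_top ENNReal.ofNat_ne_top)

/-- The wavelet coefficients are controlled by the Besov norm. -/
theorem exists_coeffNorm_le_besovNorm {s : Fin d → ℕ} (hs : ∀ i, 0 < s i) (α : ℝ)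
    {p q : ℝ≥0∞} (hp : 1 ≤ p) (hq : 1 ≤ q) {r : ℕ} (hr : |α| < (r : ℝ))
    {φ : ℝ → ℝ} {Ψ : Finset ((Fin d → ℝ) → ℝ)} (hφ : ContDiff ℝ (r : WithTop ℕ∞) φ)
    (hφc : HasCompactSupport φ) (hΨ : ∀ ψ ∈ Ψ, ContDiff ℝ (r : WithTop ℕ∞) ψ)
    (hΨc : ∀ ψ ∈ Ψ, HasCompactSupport ψ) (hΨa : ∀ ψ ∈ Ψ, Annih r ψ) :
    ∃ K : ℝ≥0, ∀ (ξ : 𝓢(Fin d → ℝ, ℝ) →L[ℝ] ℝ) (a : ℕ → Ψ → (Fin d → ℤ) → ℝ)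
      (b : (Fin d → ℤ) → ℝ), IsWaveletCoeffs s r φ Ψ ξ a b →
      detailNorm s α p q Ψ a + ellNorm s p 0 b ≤ K * besovNorm s α p q r ξ := by
  have hΦ : ContDiff ℝ (r : WithTop ℕ∞) (tensorFun φ : (Fin d → ℝ) → ℝ) :=
    contDiff_prod fun i _ => hφ.comp (contDiff_apply ℝ ℝ i)
  have hΦc : HasCompactSupport (tensorFun φ : (Fin d → ℝ) → ℝ) := by
    refine HasCompactSupport.of_support_subset_isCompact
      (K := Set.pi Set.univ fun _ : Fin d => tsupport φ) (isCompact_univ_pi fun _ => hφc) ?_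
    intro u hu i _
    exact subset_tsupport _ (Finset.prod_ne_zero_iff.mp hu i (Finset.mem_univ i))
  obtain ⟨K₀, hK₀⟩ := exists_eLpNorm_coeff_le_besovNorm hs α hp hq hΦ hΦc 0
  obtain ⟨Ks, hKs⟩ := exists_eLpNorm_nat_le_scale hq
  have hψ : ∀ ψ : Ψ, ∃ K : ℝ≥0, ∀ (ξ : 𝓢(Fin d → ℝ, ℝ) →L[ℝ] ℝ) (a : ℕ → (Fin d → ℤ) → ℝ),
      (∀ n k, HasPairing s r ξ (waveletFun s ψ.1 n k) (a n k)) →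
      eLpNorm (fun n : ℕ => ellNorm s p n (fun k => a n k /
        (2 : ℝ) ^ (-(n : ℝ) * (homDim s : ℝ) / 2 - (n : ℝ) * α))) q Measure.count ≤
        K * besovNorm s α p q r ξ := by
    rintro ⟨ψ, hψΨ⟩
    -- `F` is the set of test functions in the multi-scale part of the norm. For `α ≥ 0` these have
    -- vanishing moments, which the wavelets share because `⌊α⌋ ≤ r`.
    obtain ⟨F, hF1, hF2⟩ : ∃ F : Set ((Fin d → ℝ) → ℝ),
        (F = testBall s r ∨ ∃ m, F = testBallAnnihil s r m ∧ Annih m ψ) ∧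
        ∀ ξ, scaleNorm s F α p q ξ ≤ besovNorm s α p q r ξ := by
      by_cases hα : α < 0
      · exact ⟨testBall s r, Or.inl rfl, fun ξ => by simp [besovNorm, hα]⟩
      · refine ⟨testBallAnnihil s r ⌊α⌋₊, Or.inr ⟨⌊α⌋₊, rfl, fun P hP => ?_⟩, fun ξ => ?_⟩
        · refine hΨa ψ hψΨ P (hP.trans ?_)
          rw [not_lt] at hα
          rw [abs_of_nonneg hα] at hr
          exact_mod_cast (Nat.floor_le hα).trans hr.le
        · simp only [besovNorm, hα, if_false]
          exact le_add_self
    obtain ⟨N, K, hK⟩ := exists_ellNorm_le_eLpNorm_supTest hs α hp (hΨ ψ hψΨ) (hΨc ψ hψΨ) hF1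
    -- The levels below `N` have no matching scale in `(0, 1)`; each is bounded on its own through
    -- the scales near one.
    have hcoarse : ∀ n, ∃ Kn : ℝ≥0, ∀ (ξ : 𝓢(Fin d → ℝ, ℝ) →L[ℝ] ℝ) (v : (Fin d → ℤ) → ℝ),
        (∀ k, HasPairing s r ξ (waveletFun s ψ n k) (v k)) →
        ellNorm s p n (fun k => v k /
          (2 : ℝ) ^ (-(n : ℝ) * (homDim s : ℝ) / 2 - (n : ℝ) * α)) ≤
          Kn * besovNorm s α p q r ξ := by
      intro n
      obtain ⟨K₁, hK₁⟩ := exists_eLpNorm_coeff_le_besovNorm hs α hp hq (hΨ ψ hψΨ) (hΨc ψ hψΨ) n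
      set w : ℝ := (2 : ℝ) ^ (-(n : ℝ) * (homDim s : ℝ) / 2 - (n : ℝ) * α) with hw
      refine ⟨‖w⁻¹‖₊ * K₁, fun ξ v hv => (ellNorm_le_eLpNorm_count s p n _).trans ?_⟩
      refine (eLpNorm_enn_le_const_mul (g := fun k => ‖v k‖ₑ) ‖w⁻¹‖₊ fun k => ?_).trans ?_
      · rw [div_eq_inv_mul, enorm_mul]
        rfl
      · rw [ENNReal.coe_mul, mul_assoc]
        gcongr
        exact hK₁ ξ v hv
    choose Kn hKn using hcoarse
    refine ⟨∑ n ∈ Finset.range N, Kn n + Ks * K, fun ξ a ha => ?_⟩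
    refine (eLpNorm_nat_count_le_add hq _ N).trans ?_
    rw [ENNReal.coe_add, add_mul, ENNReal.ofNNReal_finsetSum, Finset.sum_mul]
    refine add_le_add (Finset.sum_le_sum fun n _ => hKn n ξ (a n) (ha n)) ?_
    refine (hKs _ _ fun j ε hε => hK ξ j (a (j + N)) (ha (j + N)) ε hε).trans ?_
    rw [ENNReal.coe_mul, mul_assoc]
    gcongr
    refine (eLpNorm_enn_le_const_mul K fun ε => le_rfl).trans ?_
    gcongr
    exact hF2 ξ
  choose Kψ hKψ using hψ
  refine ⟨∑ ψ, Kψ ψ + K₀, fun ξ a b hab => ?_⟩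
  rw [ENNReal.coe_add, add_mul]
  refine add_le_add (iSup_le fun ψ => ?_) ?_
  · refine (hKψ ψ ξ (fun n => a n ψ) fun n k => hab.1 n ψ k).trans ?_
    gcongr
    exact Finset.single_le_sum (f := Kψ) (fun _ _ => zero_le) (Finset.mem_univ ψ)
  · refine (ellNorm_le_eLpNorm_count s p 0 b).trans (hK₀ ξ b fun k => ?_)
    rw [← scalingFun_eq]
    exact hab.2 k

/-! ### Taylor expansion and interpolation -/

theorem abs_sub_taylor_le {g : ℝ → ℝ} {m : ℕ} (hg : ContDiff ℝ (m : WithTop ℕ∞) g) {a b B : ℝ}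
    (hab : a < b) (hB : ∀ t ∈ Set.Icc a b, |iteratedDeriv m g t| ≤ B) {t : ℝ}
    (ht : t ∈ Set.Icc a b) :
    |g t - ∑ k ∈ Finset.range m, iteratedDeriv k g a * (((k.factorial : ℝ))⁻¹ * (t - a) ^ k)| ≤
      B * (b - a) ^ m := by
  cases m with
  | zero => simpa using hB t ht
  | succ m =>
    have hu := uniqueDiffOn_Icc hab
    have hB0 : 0 ≤ B := (abs_nonneg _).trans (hB t ht)
    have h1 : ∀ k ≤ m + 1, ∀ y ∈ Set.Icc a b,
        iteratedDerivWithin k g (Set.Icc a b) y = iteratedDeriv k g y := fun k hk y hy =>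
      iteratedDerivWithin_eq_iteratedDeriv hu
        ((hg.of_le (by exact_mod_cast hk)).contDiffAt) hy
    have h2 := taylor_mean_remainder_bound hab.le (f := g) (n := m) (C := B)
      (by exact_mod_cast hg.contDiffOn) ht
      (fun y hy => by rw [h1 _ le_rfl y hy]; exact hB y hy)
    rw [taylor_within_apply, Real.norm_eq_abs] at h2
    have h3 : ∑ k ∈ Finset.range (m + 1),
        iteratedDeriv k g a * (((k.factorial : ℝ))⁻¹ * (t - a) ^ k) =
        ∑ k ∈ Finset.range (m + 1), (((k.factorial : ℝ))⁻¹ * (t - a) ^ k) •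
          iteratedDerivWithin k g (Set.Icc a b) a := by
      refine Finset.sum_congr rfl fun k hk => ?_
      rw [h1 k (Finset.mem_range.mp hk).le a (Set.left_mem_Icc.mpr hab.le), smul_eq_mul, mul_comm]
    rw [h3]
    refine h2.trans ?_
    have h4 : (t - a) ^ (m + 1) ≤ (b - a) ^ (m + 1) :=
      pow_le_pow_left₀ (by linarith [ht.1]) (by linarith [ht.2]) _
    have h5 : (1 : ℝ) ≤ m.factorial := by exact_mod_cast m.factorial_pos
    calc B * (t - a) ^ (m + 1) / m.factorial ≤ B * (t - a) ^ (m + 1) := by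
          refine div_le_self (mul_nonneg hB0 (pow_nonneg (by linarith [ht.1]) _)) h5
      _ ≤ _ := by gcongr

/-- Polynomial interpolation of order `m` at the nodes `0, …, m - 1`. -/
theorem exists_interpolation (m : ℕ) {R : ℝ} (hR0 : 0 < R) (hR : (m : ℝ) ≤ R) :
    ∃ (L : Fin m → Polynomial ℝ) (C : ℝ), 1 ≤ C ∧ (∀ j, (L j).natDegree ≤ m) ∧
      (∀ t ∈ Set.Icc (-R) R, ∑ j, |(L j).eval t| ≤ C) ∧
      ∀ (g : ℝ → ℝ), ContDiff ℝ (m : WithTop ℕ∞) g → ∀ B : ℝ,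
        (∀ t ∈ Set.Icc (-R) R, |iteratedDeriv m g t| ≤ B) → ∀ t ∈ Set.Icc (-R) R,
          |g t - ∑ j : Fin m, g (j : ℕ) * (L j).eval t| ≤ C * B := by
  set v : Fin m → ℝ := fun j => ((j : ℕ) : ℝ) with hv
  have hvs : Set.InjOn v (Finset.univ : Finset (Fin m)) := by
    intro i _ j _ hij
    simp only [hv] at hij
    exact Fin.ext (by exact_mod_cast hij)
  set L : Fin m → Polynomial ℝ := fun j => Lagrange.basis Finset.univ v j with hL
  have hcont : Continuous fun t => ∑ j, |(L j).eval t| :=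
    continuous_finsetSum _ fun j _ => (L j).continuous.abs
  obtain ⟨A, hA⟩ := isCompact_Icc.exists_bound_of_continuousOn
    (hcont.continuousOn (s := Set.Icc (-R) R))
  have hA' : ∀ t ∈ Set.Icc (-R) R, ∑ j, |(L j).eval t| ≤ |A| := fun t ht =>
    (le_abs_self _).trans ((hA t ht).trans (le_abs_self A))
  refine ⟨L, (1 + |A|) * (1 + (R + R) ^ m), ?_, fun j => ?_, fun t ht => ?_, ?_⟩
  · nlinarith [abs_nonneg A, pow_nonneg (by linarith : 0 ≤ R + R) m]
  · rw [hL]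
    simp only
    rw [Lagrange.natDegree_basis hvs (Finset.mem_univ j)]
    simp
  · refine (hA' t ht).trans ?_
    nlinarith [abs_nonneg A, pow_nonneg (by linarith : 0 ≤ R + R) m]
  · intro g hg B hB t ht
    have hB0 : 0 ≤ B := (abs_nonneg _).trans (hB t ht)
    -- The Taylor polynomial at `-R` has degree below `m`, so interpolation reproduces it and only
    -- the interpolation error of `g - P` remains. That is bounded by Taylor's remainder and the sum
    -- of the Lagrange polynomials, the nodes lying in the interval since `m ≤ R`.
    set P : Polynomial ℝ := ∑ k ∈ Finset.range m,
      Polynomial.C (iteratedDeriv k g (-R) * ((k.factorial : ℝ))⁻¹) *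
        (Polynomial.X - Polynomial.C (-R)) ^ k with hP
    have hPe : ∀ u, P.eval u = ∑ k ∈ Finset.range m,
        iteratedDeriv k g (-R) * (((k.factorial : ℝ))⁻¹ * (u - -R) ^ k) := by
      intro u
      rw [hP, Polynomial.eval_finsetSum]
      refine Finset.sum_congr rfl fun k _ => ?_
      simp
      ring
    have hPd : P.degree < (Finset.univ : Finset (Fin m)).card := by
      rw [Finset.card_fin, hP]
      rw [← Polynomial.mem_degreeLT]
      refine Submodule.sum_mem _ fun k hk => Polynomial.mem_degreeLT.mpr ?_
      refine lt_of_le_of_lt ((Polynomial.degree_mul_le _ _).trans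
        (add_le_add_left Polynomial.degree_C_le _)) ?_
      rw [Polynomial.degree_pow, Polynomial.degree_X_sub_C]
      simpa using Finset.mem_range.mp hk
    have hPi := Lagrange.eq_interpolate hvs hPd
    have hPi' : ∀ u, P.eval u = ∑ j : Fin m, P.eval ((j : ℕ) : ℝ) * (L j).eval u := by
      intro u
      conv_lhs => rw [hPi, Lagrange.interpolate_apply, Polynomial.eval_finsetSum]
      simp [hL, hv]
    have hd : ∀ u ∈ Set.Icc (-R) R, |g u - P.eval u| ≤ B * (R + R) ^ m := by
      intro u hu
      have := abs_sub_taylor_le hg (by linarith : -R < R) hB hu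
      rw [hPe]
      simpa using this
    have hnode : ∀ j : Fin m, ((j : ℕ) : ℝ) ∈ Set.Icc (-R) R := by
      intro j
      have h1 : ((j : ℕ) : ℝ) ≤ m := by exact_mod_cast j.2.le
      exact ⟨by linarith [Nat.cast_nonneg (α := ℝ) (j : ℕ)], h1.trans hR⟩
    have h1 : g t - ∑ j : Fin m, g (j : ℕ) * (L j).eval t =
        (g t - P.eval t) - ∑ j : Fin m, (g (j : ℕ) - P.eval ((j : ℕ) : ℝ)) * (L j).eval t := by
      simp only [sub_mul, Finset.sum_sub_distrib]
      rw [← hPi' t]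
      ring
    rw [h1]
    calc _ ≤ |g t - P.eval t| +
          |∑ j : Fin m, (g (j : ℕ) - P.eval ((j : ℕ) : ℝ)) * (L j).eval t| := abs_sub _ _
      _ ≤ B * (R + R) ^ m + ∑ j : Fin m, B * (R + R) ^ m * |(L j).eval t| := by
          refine add_le_add (hd t ht) ((Finset.abs_sum_le_sum_abs _ _).trans ?_)
          refine Finset.sum_le_sum fun j _ => ?_
          rw [abs_mul]
          gcongr
          exact hd _ (hnode j)
      _ ≤ B * (R + R) ^ m + B * (R + R) ^ m * |A| := by
          rw [← Finset.mul_sum]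
          gcongr
          exact hA' t ht
      _ = (1 + |A|) * (R + R) ^ m * B := by ring
      _ ≤ _ := by
          gcongr
          linarith

/-- Interpolation in the coordinate `i`. -/
noncomputable def interpCoord {m : ℕ} (L : Fin m → Polynomial ℝ) (i : Fin d)
    (F : (Fin d → ℝ) → ℝ) : (Fin d → ℝ) → ℝ :=
  fun x => ∑ j : Fin m, F (Function.update x i ((j : ℕ) : ℝ)) * (L j).eval (x i)

/-- Interpolation in all the coordinates in a list. -/
noncomputable def interpList {m : Fin d → ℕ} (L : ∀ i, Fin (m i) → Polynomial ℝ)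
    (F : (Fin d → ℝ) → ℝ) : List (Fin d) → (Fin d → ℝ) → ℝ
  | [] => F
  | i :: l => interpCoord (L i) i (interpList L F l)

/-- Finite sums of products of functions that do not depend on the coordinates in `l` and of
polynomials of degree at most `r` in each of the coordinates in `l`. -/
noncomputable def polyInCoords (r : ℕ) (l : List (Fin d)) : Submodule ℝ ((Fin d → ℝ) → ℝ) :=
  Submodule.span ℝ {G | ∃ (h : (Fin d → ℝ) → ℝ) (P : Fin d → Polynomial ℝ),
    (∀ x y, (∀ i, i ∉ l → x i = y i) → h x = h y) ∧ (∀ i, (P i).natDegree ≤ r) ∧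
    G = fun x => h x * (l.map fun i => (P i).eval (x i)).prod}

/-- On a generator, interpolation in coordinate `i` freezes `x i` at a node inside `h` and supplies
a polynomial factor in `x i` instead. Because the list has no repetitions, the earlier factors do
not involve `x i` and are left untouched. -/
theorem interpList_mem_polyInCoords {r : ℕ} {m : Fin d → ℕ} {L : ∀ i, Fin (m i) → Polynomial ℝ}
    (hL : ∀ i j, (L i j).natDegree ≤ r) (F : (Fin d → ℝ) → ℝ) {l : List (Fin d)}
    (hl : l.Nodup) : interpList L F l ∈ polyInCoords r l := by
  induction l with
  | nil =>
    refine Submodule.subset_span ⟨F, 0, fun x y h => ?_, fun i => by simp, ?_⟩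
    · rw [funext fun i => h i List.not_mem_nil]
    · ext x
      simp [interpList]
  | cons i l ih =>
    rw [List.nodup_cons] at hl
    have key : ∀ G ∈ polyInCoords r l, interpCoord (L i) i G ∈ polyInCoords r (i :: l) := by
      intro G hG
      unfold polyInCoords at hG
      induction hG using Submodule.span_induction with
      | mem G hG =>
        obtain ⟨h, P, hh, hP, rfl⟩ := hG
        have h1 : interpCoord (L i) i (fun x => h x * (l.map fun i => (P i).eval (x i)).prod) =
            ∑ j : Fin (m i), fun x => h (Function.update x i ((j : ℕ) : ℝ)) *
              ((i :: l).map fun i' => (Function.update P i (L i j) i').eval (x i')).prod := by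
          ext x
          rw [Finset.sum_apply]
          refine Finset.sum_congr rfl fun j _ => ?_
          rw [List.map_cons, List.prod_cons, Function.update_self]
          have h2 : (l.map fun i' => (P i').eval (Function.update x i ((j : ℕ) : ℝ) i')) =
              l.map fun i' => (Function.update P i (L i j) i').eval (x i') := by
            refine List.map_congr_left fun i' hi' => ?_
            have hne : i' ≠ i := fun he => hl.1 (he ▸ hi')
            rw [Function.update_of_ne hne, Function.update_of_ne hne]
          simp only
          rw [h2]
          ring
        rw [h1]
        refine Submodule.sum_mem _ fun j _ => Submodule.subset_span ⟨_, _, ?_, ?_, rfl⟩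
        · intro x y hxy
          refine hh _ _ fun i' hi' => ?_
          by_cases he : i' = i
          · subst he; simp
          · rw [Function.update_of_ne he, Function.update_of_ne he]
            exact hxy i' (by simp [he, hi'])
        · intro i'
          by_cases he : i' = i
          · subst he; simpa using hL i' j
          · rw [Function.update_of_ne he]; exact hP i'
      | zero =>
        have : interpCoord (L i) i (0 : (Fin d → ℝ) → ℝ) = 0 := by
          ext x; simp [interpCoord]
        rw [this]
        exact Submodule.zero_mem _
      | add G G' _ _ h1 h2 =>
        have : interpCoord (L i) i (G + G') = interpCoord (L i) i G + interpCoord (L i) i G' := by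
          ext x
          simp [interpCoord, add_mul, Finset.sum_add_distrib]
        rw [this]
        exact Submodule.add_mem _ h1 h2
      | smul c G _ h1 =>
        have : interpCoord (L i) i (c • G) = c • interpCoord (L i) i G := by
          ext x
          simp [interpCoord, Finset.mul_sum, mul_assoc]
        rw [this]
        exact Submodule.smul_mem _ _ h1
    exact key _ (ih hl.2)

/-- Write the error as `(F - I_i F) + I_i (F - I_l F)`. The first term is a one-dimensional
interpolation error, and `I_i` is bounded in the supremum norm. Thus only pure derivatives of `F`
itself occur, and no regularity of the intermediate interpolants is used. -/
theorem exists_abs_sub_interpList_le (m : Fin d → ℕ) {R : ℝ} (hR0 : 0 < R)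
    (hR : ∀ i, (m i : ℝ) ≤ R) :
    ∃ L : ∀ i, Fin (m i) → Polynomial ℝ, (∀ i j, (L i j).natDegree ≤ m i) ∧
      ∀ l : List (Fin d), ∃ C : ℝ, 0 ≤ C ∧ ∀ F : (Fin d → ℝ) → ℝ,
        (∀ i, ContDiff ℝ (m i : WithTop ℕ∞) F) → ∀ B : Fin d → ℝ,
        (∀ i x, (∀ j, |x j| ≤ R) → |mixedDeriv (fun _ : Fin (m i) => i) F x| ≤ B i) →
        ∀ x : Fin d → ℝ, (∀ j, |x j| ≤ R) → |F x - interpList L F l x| ≤ C * ∑ i, B i := by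
  choose L C hC1 hLd hLC hLi using fun i => exists_interpolation (m i) hR0 (hR i)
  refine ⟨L, hLd, fun l => ?_⟩
  induction l with
  | nil =>
    refine ⟨0, le_rfl, fun F _ B _ x _ => ?_⟩
    simp [interpList]
  | cons i l ih =>
    obtain ⟨C', hC'0, hC'⟩ := ih
    have hCi : 0 ≤ C i := zero_le_one.trans (hC1 i)
    refine ⟨C i + C' * C i, by positivity, fun F hF B hB x hx => ?_⟩
    have hB0 : ∀ i, 0 ≤ B i := fun i =>
      (abs_nonneg _).trans (hB i 0 (by simp [hR0.le]))
    have hxi : x i ∈ Set.Icc (-R) R := abs_le.mp (hx i)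
    have hupd : ∀ t ∈ Set.Icc (-R) R, ∀ j, |Function.update x i t j| ≤ R := by
      intro t ht j
      by_cases he : j = i
      · subst he; simpa using abs_le.mpr ht
      · rw [Function.update_of_ne he]; exact hx j
    have h1 : |F x - interpCoord (L i) i F x| ≤ C i * B i := by
      have h2 := hLi i (fun t => F (Function.update x i t)) (by
        refine (hF i).comp ?_
        rw [contDiff_pi]
        intro j
        by_cases he : j = i
        · subst he; simpa using contDiff_fun_id
        · simp only [Function.update_of_ne he]; exact contDiff_const) (B i)
        (fun t ht => by
          rw [iteratedDeriv_update (hF i) i x]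
          exact hB i _ (hupd t ht)) (x i) hxi
      simpa [interpCoord] using h2
    have h3 : |interpCoord (L i) i F x - interpCoord (L i) i (interpList L F l) x| ≤
        (C' * ∑ i, B i) * C i := by
      unfold interpCoord
      rw [← Finset.sum_sub_distrib]
      refine (Finset.abs_sum_le_sum_abs _ _).trans ?_
      calc _ ≤ ∑ j : Fin (m i), (C' * ∑ i, B i) * |(L i j).eval (x i)| := by
            refine Finset.sum_le_sum fun j _ => ?_
            rw [← sub_mul, abs_mul]
            gcongr
            refine hC' F hF B hB _ (hupd _ ⟨?_, ?_⟩)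
            · linarith [Nat.cast_nonneg (α := ℝ) (j : ℕ)]
            · exact le_trans (by exact_mod_cast j.2.le) (hR i)
        _ ≤ _ := by
            rw [← Finset.mul_sum]
            have := Finset.sum_nonneg fun i (_ : i ∈ Finset.univ) => hB0 i
            gcongr
            exact hLC i _ hxi
    have h4 : B i ≤ ∑ i, B i :=
      Finset.single_le_sum (fun i _ => hB0 i) (Finset.mem_univ i)
    calc |F x - interpList L F (i :: l) x|
        = |(F x - interpCoord (L i) i F x) +
          (interpCoord (L i) i F x - interpCoord (L i) i (interpList L F l) x)| := by
          rw [interpList]; congr 1; ring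
      _ ≤ C i * B i + (C' * ∑ i, B i) * C i := (abs_add_le _ _).trans (add_le_add h1 h3)
      _ ≤ C i * ∑ i, B i + (C' * ∑ i, B i) * C i := by gcongr
      _ = _ := by ring

/-! ### Orthogonality and cancellation of the wavelets -/

theorem integral_waveletFamily_mul {s : Fin d → ℕ} {r : ℕ} {φ : ℝ → ℝ}
    {Ψ : Finset ((Fin d → ℝ) → ℝ)} (hW : IsWaveletSystem s r φ Ψ) (n : ℕ)
    [DecidableEq ((Fin d → ℤ) ⊕ ({m : ℕ // n ≤ m} × Ψ × (Fin d → ℤ)))]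
    (i j : (Fin d → ℤ) ⊕ ({m : ℕ // n ≤ m} × Ψ × (Fin d → ℤ))) :
    ∫ x, waveletFamily s φ Ψ n i x * waveletFamily s φ Ψ n j x = if i = j then 1 else 0 := by
  obtain ⟨b, hb⟩ := hW.basis n
  have h1 := (orthonormal_iff_ite.mp b.orthonormal) i j
  rw [MeasureTheory.L2.inner_def] at h1
  rw [← h1]
  refine integral_congr_ae ?_
  filter_upwards [hb i, hb j] with x hi hj
  rw [hi, hj]
  simp [mul_comm]

theorem continuous_tensorFun {φ : ℝ → ℝ} (hφ : Continuous φ) :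
    Continuous (tensorFun φ : (Fin d → ℝ) → ℝ) := by
  unfold tensorFun
  fun_prop

theorem contDiff_tensorFun {n : WithTop ℕ∞} {φ : ℝ → ℝ} (hφ : ContDiff ℝ n φ) :
    ContDiff ℝ n (tensorFun φ : (Fin d → ℝ) → ℝ) := by
  unfold tensorFun
  exact contDiff_prod fun i _ => hφ.comp (contDiff_apply ℝ ℝ i)

theorem exists_forall_abs_le {φ : ℝ → ℝ} (hφ : HasCompactSupport φ) :
    ∃ R : ℝ, 0 < R ∧ ∀ t, φ t ≠ 0 → |t| ≤ R := by
  obtain ⟨R, hR⟩ := hφ.isCompact.isBounded.subset_closedBall 0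
  refine ⟨max R 1, lt_max_of_lt_right one_pos, fun t ht => ?_⟩
  have := hR (subset_tsupport φ ht)
  rw [mem_closedBall_zero_iff, Real.norm_eq_abs] at this
  exact this.trans (le_max_left _ _)

theorem hasCompactSupport_tensorFun {φ : ℝ → ℝ} (hφ : HasCompactSupport φ) :
    HasCompactSupport (tensorFun φ : (Fin d → ℝ) → ℝ) := by
  obtain ⟨R, hR0, hR⟩ := exists_forall_abs_le hφ
  refine hasCompactSupport_of_support_subset_closedBall (R := R) fun x hx => ?_
  rw [mem_closedBall_zero_iff, pi_norm_le_iff_of_nonneg hR0.le]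
  intro i
  exact hR _ (Finset.prod_ne_zero_iff.mp hx i (Finset.mem_univ i))

theorem waveletFun_zero_zero (s : Fin d → ℕ) (f : (Fin d → ℝ) → ℝ) : waveletFun s f 0 0 = f := by
  ext y
  simp [waveletFun_eq]

theorem waveletFun_zero (s : Fin d → ℕ) (f : (Fin d → ℝ) → ℝ) (k : Fin d → ℤ) :
    waveletFun s f 0 k = fun y => f (fun l => y l - k l) := by
  ext y
  simp [waveletFun_eq, sub_eq_add_neg]

/-- On a bounded interval, polynomials of degree at most `r` are finite linear combinations of the
translates of the scaling function. -/
theorem exists_eq_sum_translates {s : Fin d → ℕ} {r : ℕ} {φ : ℝ → ℝ}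
    {Ψ : Finset ((Fin d → ℝ) → ℝ)} (hW : IsWaveletSystem s r φ Ψ) (R : ℝ) :
    ∃ Z : Finset ℤ, ∀ P : Polynomial ℝ, P.natDegree ≤ r → ∃ c : ℤ → ℝ, ∀ t : ℝ, |t| ≤ R →
      P.eval t = ∑ k ∈ Z, c k * φ (t - k) := by
  obtain ⟨R', hR'0, hR'⟩ := exists_forall_abs_le hW.compact_scaling
  obtain ⟨N, hN⟩ := exists_nat_ge (R + R')
  refine ⟨Finset.Icc (-N) N, fun P hP => ⟨fun k => ∫ y : ℝ, P.eval y * φ (y - k),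
    fun t ht => ?_⟩⟩
  refine (hW.reproduce P hP t).unique (hasSum_sum_of_ne_finset_zero fun k hk => ?_)
  by_contra hne
  have h1 := hR' _ (right_ne_zero_of_mul hne)
  apply hk
  rw [Finset.mem_Icc]
  have h2 : |(k : ℝ)| ≤ N := by
    calc |(k : ℝ)| = |t - (t - k)| := by congr 1; ring
      _ ≤ |t| + |t - k| := abs_sub _ _
      _ ≤ R + R' := add_le_add ht h1
      _ ≤ N := hN
  rw [abs_le] at h2
  constructor
  · exact_mod_cast h2.1
  · exact_mod_cast h2.2

/-- The product may have total degree well above `r`, so the moment condition on the wavelets does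
not cover it. On the support of the wavelet each factor is a finite combination of translates of the
scaling function. The product is then a finite combination of scaling functions of level zero, to
which the wavelet is orthogonal. -/
theorem integral_mul_prod_polynomial {s : Fin d → ℕ} {r : ℕ} {φ : ℝ → ℝ}
    {Ψ : Finset ((Fin d → ℝ) → ℝ)} (hW : IsWaveletSystem s r φ Ψ) (ψ : Ψ)
    (P : Fin d → Polynomial ℝ) (hP : ∀ i, (P i).natDegree ≤ r) :
    ∫ x, ψ.1 x * ∏ i, (P i).eval (x i) = 0 := by
  classical
  have hψ := hW.contDiff_wavelet ψ.1 ψ.2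
  have hψc := hW.compact_wavelet ψ.1 ψ.2
  obtain ⟨R, hR0, hR⟩ := hψc.exists_support_subset_closedBall
  obtain ⟨Z, hZ⟩ := exists_eq_sum_translates hW R
  choose c hc using fun i => hZ (P i) (hP i)
  have h1 : ∀ x, ψ.1 x * ∏ i, (P i).eval (x i) =
      ∑ z ∈ Fintype.piFinset (fun _ : Fin d => Z),
        (∏ i, c i (z i)) * (ψ.1 x * scalingFun s φ 0 z x) := by
    intro x
    by_cases hx : ψ.1 x = 0
    · simp [hx]
    have hx' : ∀ i, |x i| ≤ R := fun i => by
      have := hR hx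
      rw [mem_closedBall_zero_iff] at this
      exact (norm_le_pi_norm x i).trans this
    have h2 : ∏ i, (P i).eval (x i) = ∏ i, ∑ k ∈ Z, c i k * φ (x i - k) :=
      Finset.prod_congr rfl fun i _ => hc i _ (hx' i)
    rw [h2, Finset.prod_univ_sum, Finset.mul_sum]
    refine Finset.sum_congr rfl fun z _ => ?_
    rw [scalingFun_eq, waveletFun_zero, Finset.prod_mul_distrib]
    unfold tensorFun
    ring
  simp_rw [h1]
  rw [integral_finsetSum]
  · refine Finset.sum_eq_zero fun z _ => ?_
    rw [integral_const_mul]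
    have h3 := integral_waveletFamily_mul hW 0 (Sum.inr (⟨0, le_rfl⟩, ψ, 0)) (Sum.inl z)
    simp only [waveletFamily, waveletFun_zero_zero] at h3
    rw [h3]
    simp
  · intro z _
    refine Integrable.const_mul ?_ _
    refine (hψ.continuous.mul ?_).integrable_of_hasCompactSupport hψc.mul_right
    rw [scalingFun_eq]
    exact (contDiff_waveletFun s (contDiff_tensorFun hW.contDiff_scaling) 0 z).continuous

/-- Once the list contains all coordinates, the coefficient `h` is constant and only products of
one-variable polynomials remain. Continuity is carried along for integrability in the additive step.
-/
theorem integral_mul_of_mem_polyInCoords {s : Fin d → ℕ} {r : ℕ} {φ : ℝ → ℝ}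
    {Ψ : Finset ((Fin d → ℝ) → ℝ)} (hW : IsWaveletSystem s r φ Ψ) (ψ : Ψ)
    {G : (Fin d → ℝ) → ℝ} (hG : G ∈ polyInCoords r (Finset.univ : Finset (Fin d)).toList) :
    Continuous G ∧ ∫ x, ψ.1 x * G x = 0 := by
  have hψ := (hW.contDiff_wavelet ψ.1 ψ.2).continuous
  have hψc := hW.compact_wavelet ψ.1 ψ.2
  unfold polyInCoords at hG
  induction hG using Submodule.span_induction with
  | mem G hG =>
    obtain ⟨h, P, hh, hP, rfl⟩ := hG
    have h1 : (fun x => h x *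
        ((Finset.univ : Finset (Fin d)).toList.map fun i => (P i).eval (x i)).prod) =
        fun x => h 0 * ∏ i, (P i).eval (x i) := by
      ext x
      rw [Finset.prod_map_toList, hh x 0]
      simp
    rw [h1]
    constructor
    · exact continuous_const.mul (continuous_finsetProd _ fun i _ =>
        (P i).continuous.comp (continuous_apply i))
    · simp_rw [mul_left_comm _ (h 0)]
      rw [integral_const_mul, integral_mul_prod_polynomial hW ψ P hP, mul_zero]
  | zero => exact ⟨continuous_const, by simp⟩
  | add G G' _ _ h1 h2 =>
    refine ⟨h1.1.add h2.1, ?_⟩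
    simp only [Pi.add_apply, mul_add]
    rw [integral_add, h1.2, h2.2, add_zero]
    · exact (hψ.mul h1.1).integrable_of_hasCompactSupport hψc.mul_right
    · exact (hψ.mul h2.1).integrable_of_hasCompactSupport hψc.mul_right
  | smul c G _ h1 =>
    refine ⟨h1.1.const_smul c, ?_⟩
    simp only [Pi.smul_apply, smul_eq_mul, mul_left_comm _ c]
    rw [integral_const_mul, h1.2, mul_zero]

/-- A wavelet only sees the pure derivatives of order `m i ≤ r` in the coordinate directions. -/
theorem exists_abs_integral_wavelet_mul_le {s : Fin d → ℕ} {r : ℕ} {φ : ℝ → ℝ}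
    {Ψ : Finset ((Fin d → ℝ) → ℝ)} (hW : IsWaveletSystem s r φ Ψ) (ψ : Ψ) {m : Fin d → ℕ}
    (hm : ∀ i, m i ≤ r) :
    ∃ R C : ℝ, 0 < R ∧ 0 ≤ C ∧ Function.support ψ.1 ⊆ Metric.closedBall 0 R ∧
      ∀ F : (Fin d → ℝ) → ℝ, (∀ i, ContDiff ℝ (m i : WithTop ℕ∞) F) →
      Continuous F → ∀ B : Fin d → ℝ,
        (∀ i x, (∀ j, |x j| ≤ R) → |mixedDeriv (fun _ : Fin (m i) => i) F x| ≤ B i) →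
        |∫ x, ψ.1 x * F x| ≤ C * ∑ i, B i := by
  have hψ := (hW.contDiff_wavelet ψ.1 ψ.2).continuous
  have hψc := hW.compact_wavelet ψ.1 ψ.2
  obtain ⟨R₀, hR₀0, hR₀⟩ := hψc.exists_support_subset_closedBall
  -- The cube has to contain both the support of the wavelet and the interpolation nodes.
  set R : ℝ := R₀ + r with hRdef
  have hR0 : 0 < R := by positivity
  have hR : ∀ i, (m i : ℝ) ≤ R := fun i => by
    have : (m i : ℝ) ≤ r := by exact_mod_cast hm i
    linarith
  have hsub : Function.support ψ.1 ⊆ Metric.closedBall 0 R :=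
    hR₀.trans (Metric.closedBall_subset_closedBall (by
      rw [hRdef]; linarith [Nat.cast_nonneg (α := ℝ) r]))
  obtain ⟨L, hLd, hL⟩ := exists_abs_sub_interpList_le m hR0 hR
  obtain ⟨C, hC0, hC⟩ := hL (Finset.univ : Finset (Fin d)).toList
  refine ⟨R, (∫ x, |ψ.1 x|) * C, hR0,
    mul_nonneg (integral_nonneg fun _ => abs_nonneg _) hC0, hsub, fun F hF hFc B hB => ?_⟩
  obtain ⟨hGc, hG⟩ := integral_mul_of_mem_polyInCoords hW ψ
    (interpList_mem_polyInCoords (fun i j => (hLd i j).trans (hm i)) F (Finset.nodup_toList _))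
  set G := interpList L F (Finset.univ : Finset (Fin d)).toList
  have hint : Integrable fun x => |ψ.1 x| :=
    hψ.abs.integrable_of_hasCompactSupport hψc.abs
  -- The wavelet does not see the interpolant, so `F` may be replaced by the interpolation error.
  have h1 : ∫ x, ψ.1 x * F x = ∫ x, ψ.1 x * (F x - G x) := by
    simp only [mul_sub]
    rw [integral_sub, hG, sub_zero]
    · exact (hψ.mul hFc).integrable_of_hasCompactSupport hψc.mul_right
    · exact (hψ.mul hGc).integrable_of_hasCompactSupport hψc.mul_right
  rw [h1]
  calc |∫ x, ψ.1 x * (F x - G x)| ≤ ∫ x, |ψ.1 x * (F x - G x)| := abs_integral_le_integral_abs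
    _ ≤ ∫ x, |ψ.1 x| * (C * ∑ i, B i) := by
        refine integral_mono ?_ (hint.mul_const _) fun x => ?_
        · exact ((hψ.mul (hFc.sub hGc)).integrable_of_hasCompactSupport hψc.mul_right).abs
        · simp only
          by_cases hx : ψ.1 x = 0
          · simp [hx]
          rw [abs_mul]
          gcongr
          refine hC F hF B hB x fun j => ?_
          have := hsub hx
          rw [mem_closedBall_zero_iff] at this
          exact (norm_le_pi_norm x j).trans this
    _ = _ := by rw [integral_mul_const]; ring

/-! ### Wavelets of level `n` paired with functions -/

theorem gridPoint_eq (s : Fin d → ℕ) (n : ℕ) (k : Fin d → ℤ) (l : Fin d) :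
    gridPoint s n k l = ((2 : ℝ) ^ (n * s l))⁻¹ * k l := by
  rw [gridPoint, div_eq_inv_mul]

theorem prod_two_pow (s : Fin d → ℕ) (n : ℕ) : ∏ l, (2 : ℝ) ^ (n * s l) = 2 ^ (n * homDim s) := by
  rw [Finset.prod_pow_eq_pow_sum, homDim, Finset.mul_sum]

/-- Change of variables in a pairing with a wavelet of level `n`. -/
theorem integral_waveletFun_mul {s : Fin d → ℕ} {f G : (Fin d → ℝ) → ℝ} (hf : Continuous f)
    (hG : Continuous G) (n : ℕ) (k : Fin d → ℤ) :
    ∫ y, waveletFun s f n k y * G y = 2 ^ (-((n : ℝ) * (homDim s : ℝ) / 2)) *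
      ∫ u, f u * G (fun l => ((2 : ℝ) ^ (n * s l))⁻¹ * u l + gridPoint s n k l) := by
  have hc : Continuous fun u : Fin d → ℝ =>
      f u * G (fun l => ((2 : ℝ) ^ (n * s l))⁻¹ * u l + gridPoint s n k l) := by fun_prop
  have h1 := integral_comp_affine hc (fun l => (2 : ℝ) ^ (n * s l)) (fun l => -(k l : ℝ))
    (fun l => by positivity)
  have h2 : ∀ y : Fin d → ℝ, waveletFun s f n k y * G y =
      (2 : ℝ) ^ ((n : ℝ) * (homDim s : ℝ) / 2) *
      (f (fun l => (2 : ℝ) ^ (n * s l) * y l + -(k l : ℝ)) *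
      G (fun l => ((2 : ℝ) ^ (n * s l))⁻¹ * ((2 : ℝ) ^ (n * s l) * y l + -(k l : ℝ)) +
        gridPoint s n k l)) := by
    intro y
    rw [waveletFun_eq, mul_assoc]
    congr 3
    ext l
    rw [gridPoint_eq]
    have : (2 : ℝ) ^ (n * s l) ≠ 0 := by positivity
    field_simp
    ring
  simp_rw [h2]
  rw [integral_const_mul, h1, prod_two_pow, abs_of_pos (by positivity), ← mul_assoc]
  congr 1
  rw [← Real.rpow_natCast, ← Real.rpow_neg zero_le_two, ← Real.rpow_add two_pos]
  congr 1
  push_cast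
  ring

/-- Pairings of wavelets with functions, in terms of local bounds for pure derivatives. -/
theorem exists_abs_integral_waveletFun_mul_le {s : Fin d → ℕ} {r : ℕ} {φ : ℝ → ℝ}
    {Ψ : Finset ((Fin d → ℝ) → ℝ)} (hW : IsWaveletSystem s r φ Ψ) (ψ : Ψ) {m : Fin d → ℕ}
    (hm : ∀ i, m i ≤ r) :
    ∃ R C : ℝ, 0 < R ∧ 0 ≤ C ∧ Function.support ψ.1 ⊆ Metric.closedBall 0 R ∧
      ∀ G : (Fin d → ℝ) → ℝ, (∀ i, ContDiff ℝ (m i : WithTop ℕ∞) G) → Continuous G →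
      ∀ (n : ℕ) (k : Fin d → ℤ) (B : Fin d → ℝ),
        (∀ i y, (∀ j, |y j - gridPoint s n k j| ≤ R * ((2 : ℝ) ^ (n * s j))⁻¹) →
          |mixedDeriv (fun _ : Fin (m i) => i) G y| ≤ B i) →
        |∫ y, waveletFun s ψ.1 n k y * G y| ≤ C * 2 ^ (-((n : ℝ) * (homDim s : ℝ) / 2)) *
          ∑ i, ((2 : ℝ) ^ (n * (s i * m i)))⁻¹ * B i := by
  obtain ⟨R, C, hR0, hC0, hR, h⟩ := exists_abs_integral_wavelet_mul_le hW ψ hm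
  refine ⟨R, C, hR0, hC0, hR, fun G hG hGc n k B hB => ?_⟩
  rw [integral_waveletFun_mul (hW.contDiff_wavelet ψ.1 ψ.2).continuous hGc, abs_mul,
    abs_of_pos (by positivity), mul_comm C, mul_assoc]
  refine mul_le_mul_of_nonneg_left ?_ (by positivity)
  refine h _ (fun i => contDiff_comp_affine (hG i) _ _) (by fun_prop) _ fun i x hx => ?_
  rw [mixedDeriv_comp_affine _ (hG i)]
  simp only [Finset.prod_const, Finset.card_fin]
  rw [abs_mul, inv_pow, ← pow_mul, mul_assoc, abs_of_pos (by positivity)]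
  gcongr
  refine hB i _ fun j => ?_
  rw [add_sub_cancel_right, abs_mul, abs_of_pos (by positivity), mul_comm]
  gcongr
  exact hx j

/-! ### Pairings of wavelets with rescaled test functions -/

theorem rescale_eq (s : Fin d → ℕ) (ε : ℝ) (x : Fin d → ℝ) (η : (Fin d → ℝ) → ℝ) :
    rescale s ε x η = fun y => (ε ^ homDim s)⁻¹ *
      η (fun l => (ε ^ s l)⁻¹ * y l + -((ε ^ s l)⁻¹ * x l)) := by
  ext y
  unfold rescale dilate
  congr 2
  ext l
  ring

theorem contDiff_rescale {n : WithTop ℕ∞} (s : Fin d → ℕ) (ε : ℝ) (x : Fin d → ℝ)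
    {η : (Fin d → ℝ) → ℝ} (hη : ContDiff ℝ n η) : ContDiff ℝ n (rescale s ε x η) := by
  rw [rescale_eq]
  exact contDiff_const.mul (contDiff_comp_affine hη _ _)

theorem mixedDeriv_rescale {s : Fin d → ℕ} {ε : ℝ} (x : Fin d → ℝ) {η : (Fin d → ℝ) → ℝ}
    {n : ℕ} (hη : ContDiff ℝ (n : WithTop ℕ∞) η) (i : Fin n → Fin d) (y : Fin d → ℝ) :
    mixedDeriv i (rescale s ε x η) y = (ε ^ homDim s)⁻¹ * ((ε ^ ∑ j, s (i j))⁻¹ *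
      mixedDeriv i η (fun l => (ε ^ s l)⁻¹ * y l + -((ε ^ s l)⁻¹ * x l))) := by
  rw [rescale_eq, mixedDeriv_const_mul _ (contDiff_comp_affine hη _ _),
    mixedDeriv_comp_affine _ hη]
  simp only [Finset.prod_inv_distrib, Finset.prod_pow_eq_pow_sum]

theorem abs_sub_le_of_rescale_ne_zero {s : Fin d → ℕ} (hs : ∀ i, 0 < s i) {r : ℕ} {ε : ℝ}
    (hε : 0 < ε) {x y : Fin d → ℝ} {η : (Fin d → ℝ) → ℝ} (hη : η ∈ testBall s r)
    (hy : rescale s ε x η y ≠ 0) (l : Fin d) : |y l - x l| ≤ ε ^ s l := by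
  have h1 := (scaledNorm_le_one_iff hs).mp (hη.2.1 (right_ne_zero_of_mul hy)) l
  have hp : 0 < ε ^ s l := pow_pos hε _
  rwa [abs_mul, abs_inv, abs_of_pos hp, inv_mul_le_iff₀ hp, mul_one] at h1

theorem testBall.contDiff {s : Fin d → ℕ} {r : ℕ} {η : (Fin d → ℝ) → ℝ} (hη : η ∈ testBall s r)
    (n : ℕ) : ContDiff ℝ (n : WithTop ℕ∞) η :=
  hη.1.of_le (by exact_mod_cast le_top)

/-- If the scale of the test function is larger than that of the wavelet, the cancellations of
the wavelet make their pairing small. -/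
theorem exists_abs_integral_waveletFun_rescale_le {s : Fin d → ℕ} {r : ℕ} (hs : ∀ i, 0 < s i)
    {φ : ℝ → ℝ} {Ψ : Finset ((Fin d → ℝ) → ℝ)} (hW : IsWaveletSystem s r φ Ψ) (ψ : Ψ)
    {m : Fin d → ℕ} (hm : ∀ i, s i * m i ≤ r) {β : ℝ} (hβ : ∀ i, -((s i * m i : ℕ) : ℝ) ≤ β) :
    ∃ C : ℝ, 0 ≤ C ∧ ∀ (n : ℕ) (k : Fin d → ℤ) (ε : ℝ), 0 < ε → 1 ≤ 2 ^ n * ε →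
      ∀ (x : Fin d → ℝ), ∀ η ∈ testBall s r, |∫ y, waveletFun s ψ.1 n k y * rescale s ε x η y| ≤
        C * 2 ^ (-((n : ℝ) * (homDim s : ℝ) / 2)) * (ε ^ homDim s)⁻¹ * (2 ^ n * ε) ^ β := by
  have hm' : ∀ i, m i ≤ r := fun i => (Nat.le_mul_of_pos_left _ (hs i)).trans (hm i)
  obtain ⟨R, C, hR0, hC0, hR, h⟩ := exists_abs_integral_waveletFun_mul_le hW ψ hm'
  refine ⟨C * d, by positivity, fun n k ε hε hε1 x η hη => ?_⟩
  have h1 := h (rescale s ε x η) (fun i => contDiff_rescale s ε x (testBall.contDiff hη (m i)))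
    (contDiff_rescale s ε x (testBall.contDiff hη 0)).continuous n k
    (fun i => (ε ^ homDim s)⁻¹ * (ε ^ (s i * m i))⁻¹) (fun i y _ => by
      rw [mixedDeriv_rescale x (testBall.contDiff hη (m i)), abs_mul, abs_mul,
        abs_of_pos (by positivity), abs_of_pos (by positivity)]
      have h2 := hη.2.2 (m i) (fun _ => i) (by simpa [mul_comm] using hm i)
        (fun l => (ε ^ s l)⁻¹ * y l + -((ε ^ s l)⁻¹ * x l))
      have h3 : ∑ _j : Fin (m i), s i = s i * m i := by simp [mul_comm]
      rw [h3]
      gcongr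
      exact mul_le_of_le_one_right (by positivity) h2)
  refine h1.trans ?_
  have h2 : ∀ i, ((2 : ℝ) ^ (n * (s i * m i)))⁻¹ * ((ε ^ homDim s)⁻¹ * (ε ^ (s i * m i))⁻¹) ≤
      (ε ^ homDim s)⁻¹ * (2 ^ n * ε) ^ β := by
    intro i
    have h3 : ((2 : ℝ) ^ (n * (s i * m i)))⁻¹ * (ε ^ (s i * m i))⁻¹ =
        (2 ^ n * ε) ^ (-((s i * m i : ℕ) : ℝ)) := by
      rw [Real.rpow_neg (by positivity), Real.rpow_natCast, mul_pow, ← pow_mul, mul_inv]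
    rw [mul_left_comm, h3]
    exact mul_le_mul_of_nonneg_left (Real.rpow_le_rpow_of_exponent_le hε1 (hβ i)) (by positivity)
  calc _ ≤ C * 2 ^ (-((n : ℝ) * (homDim s : ℝ) / 2)) *
        ∑ _i : Fin d, (ε ^ homDim s)⁻¹ * (2 ^ n * ε) ^ β :=
        mul_le_mul_of_nonneg_left (Finset.sum_le_sum fun i _ => h2 i) (by positivity)
    _ = _ := by
        rw [Finset.sum_const, Finset.card_univ, Fintype.card_fin, nsmul_eq_mul]
        ring

/-! ### Taylor expansion of a wavelet on the support of a test function of smaller scale -/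

theorem abs_prod_apply_le_one {x : Fin d → ℝ} (hx : ∀ l, |x l| ≤ 1) {n : ℕ}
    (i : Fin n → Fin d) : |∏ j, x (i j)| ≤ 1 := by
  rw [Finset.abs_prod]
  exact Finset.prod_le_one (fun _ _ => abs_nonneg _) fun j _ => hx _

theorem hasCompactSupport_of_mem_testBall {s : Fin d → ℕ} (hs : ∀ i, 0 < s i) {r : ℕ} {η : (Fin d → ℝ) → ℝ}
    (hη : η ∈ testBall s r) : HasCompactSupport η := by
  refine hasCompactSupport_of_support_subset_closedBall (R := 1) fun x hx => ?_
  rw [mem_closedBall_zero_iff, pi_norm_le_iff_of_nonneg zero_le_one]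
  exact (scaledNorm_le_one_iff hs).mp (hη.2.1 hx)

theorem abs_integral_testBall_mul_le {s : Fin d → ℕ} (hs : ∀ i, 0 < s i) {r : ℕ}
    {η F : (Fin d → ℝ) → ℝ} (hη : η ∈ testBall s r) {B : ℝ}
    (hB : ∀ x, (∀ l, |x l| ≤ 1) → |F x| ≤ B) : |∫ x, η x * F x| ≤ 2 ^ d * B := by
  set S : Set (Fin d → ℝ) := Set.Icc (fun _ => -1) (fun _ => 1) with hS
  have hS' : ∀ x, x ∈ S ↔ ∀ l, |x l| ≤ 1 := fun x => by
    simp only [hS, Set.mem_Icc, Pi.le_def, abs_le]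
    exact forall_and.symm
  have hB0 : 0 ≤ B := (abs_nonneg _).trans (hB 0 (by simp))
  have h1 : ∀ x ∉ S, η x * F x = 0 := by
    intro x hx
    by_contra hne
    exact hx ((hS' x).mpr ((scaledNorm_le_one_iff hs).mp (hη.2.1 (left_ne_zero_of_mul hne))))
  rw [← setIntegral_eq_integral_of_forall_compl_eq_zero h1]
  have hvol : volume S = ENNReal.ofReal (2 ^ d) := by
    rw [hS, Real.volume_Icc_pi]
    norm_num
  have h2 := norm_setIntegral_le_of_norm_le_const (μ := volume) (s := S)
    (f := fun x => η x * F x) (C := B) (by rw [hvol]; exact ENNReal.ofReal_lt_top)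
    (fun x hx => by
      rw [Real.norm_eq_abs, abs_mul]
      have h3 : |η x| ≤ 1 := by simpa [mixedDeriv_fin_zero] using hη.2.2 0 Fin.elim0 (by simp) x
      calc |η x| * |F x| ≤ 1 * B := by
            gcongr
            exact hB x ((hS' x).mp hx)
        _ = B := one_mul B)
  rw [Real.norm_eq_abs, Measure.real, hvol, ENNReal.toReal_ofReal (by positivity)] at h2
  rwa [mul_comm]

/-- Taylor's formula in several variables, with a bound adapted to a scaling by `t ≤ 1`. -/
theorem abs_sub_taylor_scaled_le {s : Fin d → ℕ} {f : (Fin d → ℝ) → ℝ} {m : ℕ} {B : ℝ}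
    (hs : ∀ i, 0 < s i)
    (hf : ContDiff ℝ (m : WithTop ℕ∞) f)
    (hB : ∀ n ≤ m, ∀ i : Fin n → Fin d, ∀ x, |mixedDeriv i f x| ≤ B) (c : Fin d → ℝ) {t : ℝ}
    (ht : 0 ≤ t) (ht1 : t ≤ 1) {v : Fin d → ℝ} (hv : ∀ l, |v l| ≤ 1) :
    |f (fun l => c l + t ^ s l * v l) - ∑ n ∈ Finset.range m, ∑ i : Fin n → Fin d,
      if ∑ j, s (i j) < m then
        ((n.factorial : ℝ))⁻¹ * t ^ (∑ j, s (i j)) * mixedDeriv i f c * ∏ j, v (i j) else 0| ≤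
      (∑ n ∈ Finset.range (m + 1), (d : ℝ) ^ n) * (B * t ^ m) := by
  have hB0 : 0 ≤ B := (abs_nonneg _).trans (hB 0 m.zero_le Fin.elim0 c)
  set w : Fin d → ℝ := fun l => t ^ s l * v l with hw
  have hprod : ∀ {n : ℕ} (i : Fin n → Fin d), ∏ j, w (i j) =
      t ^ (∑ j, s (i j)) * ∏ j, v (i j) := fun i => by
    simp only [hw, Finset.prod_mul_distrib, Finset.prod_pow_eq_pow_sum]
  have hprod' : ∀ {n : ℕ} (i : Fin n → Fin d), m ≤ ∑ j, s (i j) → |∏ j, w (i j)| ≤ t ^ m := by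
    intro n i hi
    rw [hprod, abs_mul, abs_of_nonneg (by positivity)]
    calc t ^ (∑ j, s (i j)) * |∏ j, v (i j)| ≤ t ^ m * 1 := by
          gcongr ?_ * ?_
          · exact pow_le_pow_of_le_one ht ht1 hi
          · exact abs_prod_apply_le_one hv i
      _ = t ^ m := mul_one _
  set g : ℝ → ℝ := fun u => f (fun l => c l + u * w l) with hg
  have hgd : ContDiff ℝ (m : WithTop ℕ∞) g := by
    refine hf.comp ?_
    rw [contDiff_pi]
    intro l
    fun_prop
  have hder : ∀ n ≤ m, ∀ u, iteratedDeriv n g u =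
      ∑ i : Fin n → Fin d, (∏ j, w (i j)) * mixedDeriv i f (fun l => c l + u * w l) := by
    intro n hn u
    rw [hg, iteratedDeriv_line (hf.of_le (by exact_mod_cast hn))]
  -- The one-variable formula is applied on the segment from `c` in the direction `w`. A word of
  -- length `m` has scaled degree at least `m`, so the remainder is of order `t ^ m`.
  have h1 := abs_sub_taylor_le hgd zero_lt_one (B := (d : ℝ) ^ m * (B * t ^ m))
    (fun u _ => by
      rw [hder m le_rfl]
      refine (Finset.abs_sum_le_sum_abs _ _).trans ?_
      calc _ ≤ ∑ _i : Fin m → Fin d, B * t ^ m := by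
            refine Finset.sum_le_sum fun i _ => ?_
            rw [abs_mul, mul_comm]
            gcongr
            · exact hB m le_rfl i _
            · refine hprod' i ?_
              calc m = ∑ _j : Fin m, 1 := by simp
                _ ≤ _ := Finset.sum_le_sum fun j _ => hs (i j)
        _ = _ := by simp) (Set.right_mem_Icc.mpr zero_le_one)
  simp only [sub_zero, one_pow, mul_one] at h1
  have h2 : g 1 = f (fun l => c l + t ^ s l * v l) := by simp [hg, hw]
  -- Terms of ordinary order below `m` but scaled degree at least `m` are moved to the error, since
  -- the test function need not annihilate them. Each is of order `t ^ m`.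
  have h3 : |∑ n ∈ Finset.range m, iteratedDeriv n g 0 * ((n.factorial : ℝ))⁻¹ -
      ∑ n ∈ Finset.range m, ∑ i : Fin n → Fin d, (if ∑ j, s (i j) < m then
        ((n.factorial : ℝ))⁻¹ * t ^ (∑ j, s (i j)) * mixedDeriv i f c * ∏ j, v (i j) else 0)| ≤
      ∑ n ∈ Finset.range m, (d : ℝ) ^ n * (B * t ^ m) := by
    rw [← Finset.sum_sub_distrib]
    refine (Finset.abs_sum_le_sum_abs _ _).trans (Finset.sum_le_sum fun n hn => ?_)
    have hn' := (Finset.mem_range.mp hn).le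
    rw [hder n hn', Finset.sum_mul, ← Finset.sum_sub_distrib]
    refine (Finset.abs_sum_le_sum_abs _ _).trans ?_
    calc _ ≤ ∑ _i : Fin n → Fin d, B * t ^ m := by
          refine Finset.sum_le_sum fun i _ => ?_
          simp only [zero_mul, add_zero]
          split_ifs with hi
          · rw [hprod]
            have : t ^ (∑ j, s (i j)) * (∏ j, v (i j)) * mixedDeriv i f c *
                ((n.factorial : ℝ))⁻¹ - ((n.factorial : ℝ))⁻¹ * t ^ (∑ j, s (i j)) *
                mixedDeriv i f c * ∏ j, v (i j) = 0 := by ring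
            rw [this, abs_zero]
            positivity
          · rw [sub_zero, abs_mul, abs_mul, mul_comm B]
            have h4 : |((n.factorial : ℝ))⁻¹| ≤ 1 := by
              rw [abs_inv, Nat.abs_cast]
              exact inv_le_one_of_one_le₀ (by exact_mod_cast n.factorial_pos)
            calc _ ≤ |∏ j, w (i j)| * |mixedDeriv i f c| * 1 := by gcongr
              _ ≤ t ^ m * B := by
                  rw [mul_one]
                  gcongr
                  · exact hprod' i (not_lt.mp hi)
                  · exact hB n hn' i c
      _ = _ := by simp
  rw [← h2, Finset.sum_range_succ, add_mul, Finset.sum_mul, add_comm]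
  refine (abs_sub_le _ _ _).trans (add_le_add h1 h3)

theorem integral_testBallAnnihil_mul_prod {s : Fin d → ℕ} {r m : ℕ}
    {η : (Fin d → ℝ) → ℝ} (hη : η ∈ testBallAnnihil s r m) {n : ℕ} (i : Fin n → Fin d)
    (hi : ∑ j, s (i j) ≤ m) : ∫ v, η v * ∏ j, v (i j) = 0 := by
  have h := hη.2 (∏ j, MvPolynomial.X (i j)) (by
    unfold MvPolynomial.weightedTotalDegree
    refine Finset.sup_le fun e he => ?_
    have h1 : (MvPolynomial.coeff e (∏ j, (MvPolynomial.X (i j) : MvPolynomial (Fin d) ℝ))) ≠ 0 :=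
      MvPolynomial.mem_support_iff.mp he
    have h2 : MvPolynomial.IsWeightedHomogeneous s
        (∏ j, (MvPolynomial.X (i j) : MvPolynomial (Fin d) ℝ)) (∑ j, s (i j)) :=
      MvPolynomial.IsWeightedHomogeneous.prod _ _ _ fun j _ =>
        MvPolynomial.isWeightedHomogeneous_X ℝ s (i j)
    rw [h2 h1]
    exact hi)
  simpa [map_prod] using h

/-- If the scale of the test function is smaller than that of the wavelet, the cancellations of
the test function make their pairing small. -/
theorem exists_abs_integral_waveletFun_rescale_le_of_annihil {s : Fin d → ℕ} {r : ℕ}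
    (hs : ∀ i, 0 < s i)
    {f : (Fin d → ℝ) → ℝ} (hf : ContDiff ℝ (r : WithTop ℕ∞) f) (hfc : HasCompactSupport f)
    {m : ℕ} (hm : m ≤ r) :
    ∃ C : ℝ, 0 ≤ C ∧ ∀ (n : ℕ) (k : Fin d → ℤ) (ε : ℝ), 0 < ε → 2 ^ n * ε ≤ 1 →
      ∀ (x : Fin d → ℝ), ∀ η ∈ testBall s r, (m = 0 ∨ η ∈ testBallAnnihil s r (m - 1)) →
        |∫ y, waveletFun s f n k y * rescale s ε x η y| ≤
        C * 2 ^ ((n : ℝ) * (homDim s : ℝ) / 2) * (2 ^ n * ε) ^ m := by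
  -- All words of length at most `m` are needed here, including those of scaled degree beyond `r`.
  -- Taking all weights equal to one gives bounds by ordinary order.
  obtain ⟨B, hB⟩ := exists_crBound (s := fun _ : Fin d => 1) (fun _ => one_pos) hf hfc
  have hB' : ∀ n ≤ m, ∀ i : Fin n → Fin d, ∀ x, |mixedDeriv i f x| ≤ B := fun n hn i x =>
    hB n i (by simpa using hn.trans hm) x
  have hB0 : 0 ≤ B := hB.nonneg
  refine ⟨2 ^ d * ((∑ n ∈ Finset.range (m + 1), (d : ℝ) ^ n) * B), by positivity,
    fun n k ε hε hε1 x η hη hηm => ?_⟩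
  have hfm : ContDiff ℝ (m : WithTop ℕ∞) f := hf.of_le (by exact_mod_cast hm)
  set t : ℝ := 2 ^ n * ε with ht
  have ht0 : 0 < t := by positivity
  set c : Fin d → ℝ := fun l => 2 ^ (n * s l) * x l + -(k l : ℝ) with hc
  have hηc : Continuous η := (testBall.contDiff hη 0).continuous
  have hηs := hasCompactSupport_of_mem_testBall hs hη
  have hfcont := hf.continuous
  set F : (Fin d → ℝ) → ℝ := fun v => f (fun l => c l + t ^ s l * v l) with hF
  have hFc : Continuous F := by fun_prop
  set T : (Fin d → ℝ) → ℝ := fun v => ∑ n ∈ Finset.range m, ∑ i : Fin n → Fin d,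
      if ∑ j, s (i j) < m then
        ((n.factorial : ℝ))⁻¹ * t ^ (∑ j, s (i j)) * mixedDeriv i f c * ∏ j, v (i j) else 0 with hT
  have hTc : Continuous T := by
    refine continuous_finsetSum _ fun n _ => continuous_finsetSum _ fun i _ => ?_
    split_ifs <;> fun_prop
  have hint : ∀ {G : (Fin d → ℝ) → ℝ}, Continuous G → Integrable fun v => η v * G v :=
    fun hG => (hηc.mul hG).integrable_of_hasCompactSupport hηs.mul_right
  -- The monomials in `T` have scaled degree at most `m - 1`, which the test function annihilates.
  -- For `m = 0` the sum is empty and no cancellation is required.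
  have hT0 : ∫ v, η v * T v = 0 := by
    simp only [hT, Finset.mul_sum]
    rw [integral_finsetSum _ fun n _ => integrable_finsetSum _ fun i _ => hint (by
      split_ifs <;> fun_prop)]
    refine Finset.sum_eq_zero fun n hn => ?_
    rw [integral_finsetSum _ fun i _ => hint (by split_ifs <;> fun_prop)]
    refine Finset.sum_eq_zero fun i _ => ?_
    split_ifs with hi
    · simp_rw [mul_left_comm (η _)]
      rw [integral_const_mul, integral_testBallAnnihil_mul_prod (hηm.resolve_left (by omega)) i
        (by omega), mul_zero]
    · simp
  have h1 : ∫ y, waveletFun s f n k y * rescale s ε x η y =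
      2 ^ ((n : ℝ) * (homDim s : ℝ) / 2) * ∫ v, η v * F v := by
    have h2 := integral_comp_affine (hηc.mul hFc) (fun l => (ε ^ s l)⁻¹)
      (fun l => -((ε ^ s l)⁻¹ * x l)) (fun l => by positivity)
    simp only [Pi.mul_apply] at h2
    have h3 : ∀ y, waveletFun s f n k y * rescale s ε x η y =
        (2 : ℝ) ^ ((n : ℝ) * (homDim s : ℝ) / 2) * ((ε ^ homDim s)⁻¹ *
        (η (fun l => (ε ^ s l)⁻¹ * y l + -((ε ^ s l)⁻¹ * x l)) *
        F (fun l => (ε ^ s l)⁻¹ * y l + -((ε ^ s l)⁻¹ * x l)))) := by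
      intro y
      have h4 : F (fun l => (ε ^ s l)⁻¹ * y l + -((ε ^ s l)⁻¹ * x l)) =
          f (fun l => (2 : ℝ) ^ (n * s l) * y l + -(k l : ℝ)) := by
        simp only [hF, hc]
        congr 1
        ext l
        rw [ht, mul_pow, ← pow_mul]
        have : ε ^ s l ≠ 0 := by positivity
        field_simp
        ring
      rw [h4, waveletFun_eq, rescale_eq]
      ring
    simp_rw [h3]
    rw [integral_const_mul, integral_const_mul, h2, ← mul_assoc (ε ^ homDim s)⁻¹]
    congr 1
    have h5 : |∏ l, (ε ^ s l)⁻¹| = (ε ^ homDim s)⁻¹ := by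
      rw [Finset.prod_inv_distrib, Finset.prod_pow_eq_pow_sum, abs_of_pos (by positivity), homDim]
    rw [h5, inv_inv, inv_mul_cancel₀ (by positivity), one_mul]
  have h6 : ∫ v, η v * F v = ∫ v, η v * (F v - T v) := by
    simp only [mul_sub]
    rw [integral_sub (hint hFc) (hint hTc), hT0, sub_zero]
  rw [h1, h6, abs_mul, abs_of_pos (by positivity)]
  have h7 := abs_integral_testBall_mul_le hs hη (F := fun v => F v - T v)
    (B := (∑ n ∈ Finset.range (m + 1), (d : ℝ) ^ n) * (B * t ^ m))
    fun v hv => abs_sub_taylor_scaled_le hs hfm hB' c ht0.le hε1 hv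
  calc _ ≤ (2 : ℝ) ^ ((n : ℝ) * (homDim s : ℝ) / 2) *
        (2 ^ d * ((∑ n ∈ Finset.range (m + 1), (d : ℝ) ^ n) * (B * t ^ m))) := by gcongr
    _ = _ := by ring

/-! ### Summation over scales -/

/-- The decay of the interaction between the level `n` and the scale `ε`. -/
noncomputable def scaleDecay (δ : ℝ) (n : ℕ) (ε : ℝ) : ℝ :=
  (min (2 ^ n * ε) (2 ^ n * ε)⁻¹) ^ δ

theorem measurable_scaleDecay (δ : ℝ) (n : ℕ) : Measurable (scaleDecay δ n) := by
  unfold scaleDecay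
  fun_prop

/-- If `2 ^ N ≤ ε⁻¹ < 2 ^ (N + 1)`, the term of index `n` is at most a constant times `2^{-δ|N -
n|}`. The sum is dominated by a two-sided geometric series independent of `ε`. -/
theorem tsum_scaleDecay_le {δ : ℝ} (hδ : 0 < δ) :
    ∃ A : ℝ≥0∞, A ≠ ∞ ∧ ∀ ε : ℝ, 0 < ε → ε ≤ 1 →
      ∑' n, ENNReal.ofReal (scaleDecay δ n ε) ≤ A := by
  set θ : ℝ := (2⁻¹ : ℝ) ^ δ with hθ
  have hθ0 : 0 ≤ θ := by positivity
  have hθ1 : θ < 1 := Real.rpow_lt_one (by norm_num) (by norm_num) hδ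
  have hsum : Summable fun z : ℤ => 2 ^ δ * θ ^ z.natAbs := by
    refine Summable.mul_left _ ?_
    rw [summable_int_iff_summable_nat_and_neg]
    simp only [Int.natAbs_natCast, Int.natAbs_neg]
    exact ⟨summable_geometric_of_lt_one hθ0 hθ1, summable_geometric_of_lt_one hθ0 hθ1⟩
  refine ⟨_, hsum.tsum_ofReal_ne_top, fun ε hε hε1 => ?_⟩
  obtain ⟨N, hN1, hN2⟩ := exists_nat_pow_near (one_le_inv_iff₀.mpr ⟨hε, hε1⟩)
    (one_lt_two : (1 : ℝ) < 2)
  have hu1 : 2 ^ N * ε ≤ 1 := by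
    calc (2 : ℝ) ^ N * ε ≤ ε⁻¹ * ε := by gcongr
      _ = 1 := inv_mul_cancel₀ hε.ne'
  have hu2 : 1 ≤ 2 ^ (N + 1) * ε := by
    calc (1 : ℝ) = ε⁻¹ * ε := (inv_mul_cancel₀ hε.ne').symm
      _ ≤ _ := by gcongr
  have hinj : Function.Injective fun n : ℕ => (N : ℤ) - n := fun a b h => by
    simp only at h; omega
  refine le_trans (ENNReal.tsum_le_tsum fun n => ?_)
    (ENNReal.tsum_comp_le_tsum_of_injective hinj _)
  refine ENNReal.ofReal_le_ofReal ?_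
  have hpos : 0 < min (2 ^ n * ε) (2 ^ n * ε)⁻¹ := lt_min (by positivity) (by positivity)
  have key : min (2 ^ n * ε) (2 ^ n * ε)⁻¹ ≤ 2 * 2⁻¹ ^ ((N : ℤ) - n).natAbs := by
    rcases le_or_gt n N with h | h
    · obtain ⟨j, rfl⟩ := Nat.exists_eq_add_of_le h
      have h1 : (((n + j : ℕ) : ℤ) - n).natAbs = j := by omega
      rw [h1]
      refine (min_le_left _ _).trans ?_
      have h2 : (2 : ℝ) ^ n * ε = 2⁻¹ ^ j * (2 ^ (n + j) * ε) := by
        rw [pow_add, inv_pow]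
        field_simp
      rw [h2]
      have h3 : (0 : ℝ) < 2⁻¹ ^ j := by positivity
      nlinarith
    · obtain ⟨j, rfl⟩ := Nat.exists_eq_add_of_lt h
      have h1 : ((N : ℤ) - (N + j + 1 : ℕ)).natAbs = j + 1 := by omega
      rw [h1]
      refine (min_le_right _ _).trans ?_
      have h2 : (2 : ℝ) ^ (N + j + 1) * ε = 2 ^ j * (2 ^ (N + 1) * ε) := by ring
      have h5 : (2 : ℝ) * 2⁻¹ ^ (j + 1) = (2 ^ j)⁻¹ := by
        rw [pow_succ, inv_pow]
        field_simp
      rw [h2, mul_inv, h5]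
      have h3 : (2 ^ (N + 1) * ε)⁻¹ ≤ 1 := inv_le_one_of_one_le₀ hu2
      have h4 : (0 : ℝ) < (2 ^ j)⁻¹ := by positivity
      nlinarith
  unfold scaleDecay
  calc _ ≤ (2 * 2⁻¹ ^ ((N : ℤ) - n).natAbs) ^ δ := Real.rpow_le_rpow hpos.le key hδ.le
    _ = _ := by
        rw [Real.mul_rpow zero_le_two (by positivity), hθ, ← Real.rpow_natCast,
          ← Real.rpow_natCast, ← Real.rpow_mul (by norm_num), ← Real.rpow_mul (by norm_num),
          mul_comm δ]

/-- Split at `c = 2^{-n}` and extend both pieces: the integrals of `(t / c)^δ dt / t` below `c` and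
of `(c / t)^δ dt / t` above `c` are each `1 / δ`, whatever `n` is. -/
theorem lintegral_scaleDecay_le {δ : ℝ} (hδ : 0 < δ) (n : ℕ) :
    ∫⁻ ε, ENNReal.ofReal (scaleDecay δ n ε) ∂scaleMeasure ≤ ENNReal.ofReal (2 / δ) := by
  set c : ℝ := (2 ^ n)⁻¹ with hc
  have hc0 : 0 < c := by positivity
  have hcn : 2 ^ n = c⁻¹ := by rw [hc, inv_inv]
  have hint1 : IntegrableOn (fun t : ℝ => t ^ (δ - 1)) (Set.Ioc 0 c) := by
    rw [← intervalIntegrable_iff_integrableOn_Ioc_of_le hc0.le]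
    exact intervalIntegral.intervalIntegrable_rpow' (by linarith)
  have hint2 : IntegrableOn (fun t : ℝ => t ^ (-δ - 1)) (Set.Ioi c) :=
    integrableOn_Ioi_rpow_of_lt (by linarith) hc0
  have h1 : ∫⁻ t in Set.Ioc 0 c, ENNReal.ofReal (c ^ (-δ) * t ^ (δ - 1)) =
      ENNReal.ofReal (1 / δ) := by
    rw [← ofReal_integral_eq_lintegral_ofReal (hint1.const_mul _)]
    · rw [integral_const_mul, ← intervalIntegral.integral_of_le hc0.le,
        integral_rpow (Or.inl (by linarith)), sub_add_cancel, Real.zero_rpow hδ.ne', sub_zero,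
        ← mul_div_assoc, ← Real.rpow_add hc0]
      simp
    · filter_upwards [ae_restrict_mem measurableSet_Ioc] with t ht
      have := ht.1
      positivity
  have h2 : ∫⁻ t in Set.Ioi c, ENNReal.ofReal (c ^ δ * t ^ (-δ - 1)) =
      ENNReal.ofReal (1 / δ) := by
    rw [← ofReal_integral_eq_lintegral_ofReal (hint2.const_mul _)]
    · rw [integral_const_mul, integral_Ioi_rpow_of_lt (by linarith) hc0, sub_add_cancel,
        neg_div_neg_eq, ← mul_div_assoc, ← Real.rpow_add hc0]
      simp
    · filter_upwards [ae_restrict_mem measurableSet_Ioi] with t ht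
      have : 0 < t := hc0.trans ht
      positivity
  have hm : Measurable fun ε : ℝ => ENNReal.ofReal (scaleDecay δ n ε) :=
    (measurable_scaleDecay δ n).ennreal_ofReal
  unfold scaleMeasure
  rw [lintegral_withDensity_eq_lintegral_mul _ (by fun_prop) hm]
  calc _ ≤ ∫⁻ t in Set.Ioc 0 c ∪ Set.Ioi c, ((fun ε => ENNReal.ofReal ε⁻¹) * fun ε =>
        ENNReal.ofReal (scaleDecay δ n ε)) t := by
        refine lintegral_mono_set fun t ht => ?_
        rcases le_or_gt t c with h | h
        · exact Or.inl ⟨ht.1, h⟩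
        · exact Or.inr h
    _ ≤ _ + _ := lintegral_union_le _ _ _
    _ ≤ ENNReal.ofReal (1 / δ) + ENNReal.ofReal (1 / δ) := by
        refine add_le_add (le_trans ?_ h1.le) (le_trans ?_ h2.le)
        · refine setLIntegral_mono' measurableSet_Ioc fun t ht => ?_
          have ht0 := ht.1
          rw [Pi.mul_apply, ← ENNReal.ofReal_mul (by positivity)]
          refine ENNReal.ofReal_le_ofReal ?_
          unfold scaleDecay
          have h3 : (min (2 ^ n * t) (2 ^ n * t)⁻¹) ^ δ ≤ (2 ^ n * t) ^ δ :=
            Real.rpow_le_rpow (le_min (by positivity) (by positivity)) (min_le_left _ _) hδ.le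
          calc t⁻¹ * (min (2 ^ n * t) (2 ^ n * t)⁻¹) ^ δ ≤ t⁻¹ * (2 ^ n * t) ^ δ := by gcongr
            _ = _ := by
              rw [hcn, Real.mul_rpow (by positivity) ht0.le, Real.inv_rpow hc0.le,
                ← Real.rpow_neg hc0.le, Real.rpow_sub_one ht0.ne']
              field_simp
        · refine setLIntegral_mono' measurableSet_Ioi fun t ht => ?_
          have ht0 : 0 < t := hc0.trans ht
          rw [Pi.mul_apply, ← ENNReal.ofReal_mul (by positivity)]
          refine ENNReal.ofReal_le_ofReal ?_
          unfold scaleDecay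
          have h3 : (min (2 ^ n * t) (2 ^ n * t)⁻¹) ^ δ ≤ ((2 ^ n * t)⁻¹) ^ δ :=
            Real.rpow_le_rpow (le_min (by positivity) (by positivity)) (min_le_right _ _) hδ.le
          calc t⁻¹ * (min (2 ^ n * t) (2 ^ n * t)⁻¹) ^ δ ≤ t⁻¹ * ((2 ^ n * t)⁻¹) ^ δ := by gcongr
            _ = _ := by
              rw [hcn, mul_inv, inv_inv, Real.mul_rpow (by positivity) (by positivity),
                Real.inv_rpow ht0.le, ← Real.rpow_neg ht0.le, Real.rpow_sub_one ht0.ne']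
              field_simp
    _ = _ := by
        rw [← ENNReal.ofReal_add (by positivity) (by positivity)]
        congr 1
        ring

theorem ae_scaleMeasure : ∀ᵐ ε ∂scaleMeasure, ε ∈ Set.Ioo (0 : ℝ) 1 := by
  unfold scaleMeasure
  exact (withDensity_absolutelyContinuous _ _).ae_le (ae_restrict_mem measurableSet_Ioo)

/-- Schur's test for the sum over levels. -/
theorem exists_eLpNorm_tsum_scaleDecay_le {δ : ℝ} (hδ : 0 < δ) {q : ℝ≥0∞} (hq : 1 ≤ q) :
    ∃ A : ℝ≥0, ∀ e : ℕ → ℝ≥0∞,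
      eLpNorm (fun ε => ∑' n, ENNReal.ofReal (scaleDecay δ n ε) * e n) q scaleMeasure ≤
        A * eLpNorm e q Measure.count ∧
      ∑' n, ENNReal.ofReal (scaleDecay δ n 1) * e n ≤ A * eLpNorm e q Measure.count := by
  obtain ⟨A₁, hA₁, h₁⟩ := tsum_scaleDecay_le hδ
  set A := A₁ + ENNReal.ofReal (2 / δ) with hA
  have hAt : A ≠ ∞ := ENNReal.add_ne_top.mpr ⟨hA₁, ENNReal.ofReal_ne_top⟩
  refine ⟨A.toNNReal, fun e => ?_⟩
  rw [ENNReal.coe_toNNReal hAt]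
  constructor
  -- Schur's test asks for the bound on the sums at every point of the line, but it is available
  -- only for positive `ε ≤ 1`. The kernel is cut off outside `(0, 1)`, a null set of the scale
  -- measure.
  · have h2 := eLpNorm_tsum_mul_le (μ := scaleMeasure)
      (K := fun n ε => (Set.Ioo (0 : ℝ) 1).indicator
        (fun ε => ENNReal.ofReal (scaleDecay δ n ε)) ε)
      (fun n => (measurable_scaleDecay δ n).ennreal_ofReal.indicator measurableSet_Ioo)
      hAt one_ne_zero (fun ε => ?_) (fun n => ?_) e hq
    · rw [one_smul] at h2
      refine le_trans (eLpNorm_mono_enorm_ae ?_) h2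
      filter_upwards [ae_scaleMeasure] with ε hε
      simp only [Set.indicator_of_mem hε]
      exact le_rfl
    · by_cases hε : ε ∈ Set.Ioo (0 : ℝ) 1
      · simp only [Set.indicator_of_mem hε]
        exact (h₁ ε hε.1 hε.2.le).trans le_self_add
      · simp [Set.indicator_of_notMem hε]
    · rw [mul_one]
      refine le_trans (lintegral_mono fun ε => ?_)
        ((lintegral_scaleDecay_le hδ n).trans le_add_self)
      exact Set.indicator_le_self _ _ _
  · calc _ ≤ ∑' n, ENNReal.ofReal (scaleDecay δ n 1) * eLpNorm e q Measure.count :=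
          ENNReal.tsum_le_tsum fun n => mul_le_mul' le_rfl
            (le_eLpNorm_count (zero_lt_one.trans_le hq).ne' e n)
      _ = (∑' n, ENNReal.ofReal (scaleDecay δ n 1)) * eLpNorm e q Measure.count :=
          ENNReal.tsum_mul_right
      _ ≤ _ := mul_le_mul' ((h₁ 1 one_pos le_rfl).trans le_self_add) le_rfl

/-! ### Summation over the grid points of a level -/

/-- The points whose distance to `x_k` is at most of the order of the larger one of the scales `ε`
and `2^{-n}`. -/
def interactionSet (s : Fin d → ℕ) (R : ℝ) (n : ℕ) (k : Fin d → ℤ) (ε : ℝ) :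
    Set (Fin d → ℝ) :=
  Set.Icc (fun l => gridPoint s n k l - R * max ε (2 ^ n)⁻¹ ^ s l)
    (fun l => gridPoint s n k l + R * max ε (2 ^ n)⁻¹ ^ s l)

theorem mem_interactionSet {s : Fin d → ℕ} {R : ℝ} {n : ℕ} {k : Fin d → ℤ} {ε : ℝ}
    {x : Fin d → ℝ} : x ∈ interactionSet s R n k ε ↔
      ∀ l, |x l - gridPoint s n k l| ≤ R * max ε (2 ^ n)⁻¹ ^ s l := by
  simp only [interactionSet, Set.mem_Icc, Pi.le_def, abs_le]
  rw [← forall_and]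
  refine forall_congr' fun l => ?_
  constructor <;> rintro ⟨h1, h2⟩ <;> constructor <;> linarith

theorem volume_interactionSet (s : Fin d → ℕ) {R : ℝ} (hR : 0 ≤ R) (n : ℕ) (k : Fin d → ℤ)
    (ε : ℝ) : volume (interactionSet s R n k ε) =
      ENNReal.ofReal ((2 * R) ^ d * max ε (2 ^ n)⁻¹ ^ homDim s) := by
  have hM : 0 < max ε ((2 : ℝ) ^ n)⁻¹ := lt_max_of_lt_right (by positivity)
  rw [interactionSet, Real.volume_Icc_pi, ← ENNReal.ofReal_prod_of_nonneg]
  · congr 1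
    have : ∀ l, gridPoint s n k l + R * max ε (2 ^ n)⁻¹ ^ s l -
        (gridPoint s n k l - R * max ε (2 ^ n)⁻¹ ^ s l) =
        (2 * R) * max ε (2 ^ n)⁻¹ ^ s l := fun l => by ring
    simp only [this]
    rw [Finset.prod_mul_distrib, Finset.prod_const, Finset.card_univ, Fintype.card_fin,
      Finset.prod_pow_eq_pow_sum, homDim]
  · intro l _
    have : 0 ≤ R * max ε ((2 : ℝ) ^ n)⁻¹ ^ s l := by positivity
    linarith

/-- In coordinate `l` the admissible integers lie in an interval of length `2 * ρ l`, which contains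
at most `2 * ρ l + 1` of them. The additional one is absorbed into the factor because `2 ^ n * M ≥
1`. -/
theorem tsum_indicator_interactionSet_le (s : Fin d → ℕ) {R : ℝ} (hR : 0 ≤ R) (n : ℕ)
    (ε : ℝ) (x : Fin d → ℝ) :
    ∑' k, (interactionSet s R n k ε).indicator (fun _ => (1 : ℝ≥0∞)) x ≤
      ENNReal.ofReal ((2 * R + 1) ^ d * (2 ^ n * max ε (2 ^ n)⁻¹) ^ homDim s) := by
  set M := max ε ((2 : ℝ) ^ n)⁻¹ with hM
  have hM0 : 0 < M := lt_max_of_lt_right (by positivity)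
  have hM1 : 1 ≤ 2 ^ n * M := by
    calc (1 : ℝ) = 2 ^ n * (2 ^ n)⁻¹ := by field_simp
      _ ≤ _ := by gcongr; exact le_max_right _ _
  set ρ : Fin d → ℝ := fun l => R * (2 ^ n * M) ^ s l with hρ
  set T : Finset (Fin d → ℤ) := Fintype.piFinset fun l =>
    Finset.Icc ⌈2 ^ (n * s l) * x l - ρ l⌉ ⌊2 ^ (n * s l) * x l + ρ l⌋ with hT
  have hmem : ∀ k, x ∈ interactionSet s R n k ε → k ∈ T := by
    intro k hk
    rw [mem_interactionSet] at hk
    rw [hT, Fintype.mem_piFinset]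
    intro l
    have h1 := hk l
    have hp : (0 : ℝ) < 2 ^ (n * s l) := by positivity
    have h2 : |2 ^ (n * s l) * x l - k l| ≤ ρ l := by
      have h3 : 2 ^ (n * s l) * x l - k l = 2 ^ (n * s l) * (x l - gridPoint s n k l) := by
        rw [gridPoint]
        field_simp
      rw [h3, abs_mul, abs_of_pos hp, hρ]
      calc _ ≤ 2 ^ (n * s l) * (R * M ^ s l) := by gcongr
        _ = _ := by simp only [mul_pow, ← pow_mul]; ring
    rw [abs_le] at h2
    rw [Finset.mem_Icc, Int.ceil_le, Int.le_floor]
    constructor <;> linarith [h2.1, h2.2]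
  have h1 : ∀ k ∉ T, (interactionSet s R n k ε).indicator (fun _ => (1 : ℝ≥0∞)) x = 0 :=
    fun k hk => Set.indicator_of_notMem (fun h => hk (hmem k h)) _
  rw [tsum_eq_sum h1]
  calc _ ≤ ∑ _k ∈ T, (1 : ℝ≥0∞) :=
        Finset.sum_le_sum fun k _ => Set.indicator_le_self' (fun _ _ => zero_le_one) _
    _ = ENNReal.ofReal (T.card : ℝ) := by simp
    _ ≤ _ := by
        refine ENNReal.ofReal_le_ofReal ?_
        rw [hT, Fintype.card_piFinset]
        push_cast
        calc _ ≤ ∏ l, (2 * R + 1) * (2 ^ n * M) ^ s l := by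
              refine Finset.prod_le_prod (fun _ _ => Nat.cast_nonneg _) fun l _ => ?_
              rw [Int.card_Icc]
              have h2 : (1 : ℝ) ≤ (2 ^ n * M) ^ s l := one_le_pow₀ hM1
              have h3 : 0 ≤ ρ l := by positivity
              have h4 : ((⌊2 ^ (n * s l) * x l + ρ l⌋ + 1 - ⌈2 ^ (n * s l) * x l - ρ l⌉ : ℤ) : ℝ) ≤
                  2 * ρ l + 1 := by
                push_cast
                linarith [Int.floor_le (2 ^ (n * s l) * x l + ρ l),
                  Int.le_ceil (2 ^ (n * s l) * x l - ρ l)]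
              have h5 : ∀ z : ℤ, (z : ℝ) ≤ 2 * ρ l + 1 → ((z.toNat : ℕ) : ℝ) ≤ 2 * ρ l + 1 := by
                intro z hz
                rcases le_total 0 z with h | h
                · have : ((z.toNat : ℕ) : ℤ) = z := Int.toNat_of_nonneg h
                  have h6 : ((z.toNat : ℕ) : ℝ) = (z : ℝ) := by exact_mod_cast this
                  rwa [h6]
                · rw [Int.toNat_of_nonpos h, Nat.cast_zero]
                  linarith
              refine (h5 _ h4).trans ?_
              rw [hρ]
              simp only
              linarith
          _ = _ := by
              rw [Finset.prod_mul_distrib, Finset.prod_const, Finset.card_univ, Fintype.card_fin,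
                Finset.prod_pow_eq_pow_sum, homDim]

/-- Schur's test for the sum over the grid points of a level. -/
theorem eLpNorm_tsum_indicator_interactionSet_le (s : Fin d → ℕ) {R : ℝ} (hR : 0 ≤ R)
    {p : ℝ≥0∞} (hp : 1 ≤ p) (n : ℕ) (ε : ℝ) (f : (Fin d → ℤ) → ℝ≥0∞) :
    eLpNorm (fun x => ∑' k, (interactionSet s R n k ε).indicator
      (fun _ => ENNReal.ofReal ((2 ^ n * max ε (2 ^ n)⁻¹) ^ homDim s)⁻¹) x * f k) p volume ≤
      ENNReal.ofReal ((2 * R + 1) ^ d) *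
        eLpNorm f p (((2 : ℝ≥0∞) ^ (n * homDim s))⁻¹ • Measure.count) := by
  set M := max ε ((2 : ℝ) ^ n)⁻¹ with hM
  have hM0 : 0 < M := lt_max_of_lt_right (by positivity)
  refine eLpNorm_tsum_mul_le (fun k => measurable_const.indicator measurableSet_Icc)
    ENNReal.ofReal_ne_top (ENNReal.inv_ne_zero.mpr (ENNReal.pow_ne_top ENNReal.ofNat_ne_top))
    (fun x => ?_) (fun k => ?_) f hp
  · have h1 : ∀ k, (interactionSet s R n k ε).indicator
        (fun _ => ENNReal.ofReal ((2 ^ n * M) ^ homDim s)⁻¹) x =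
        ENNReal.ofReal ((2 ^ n * M) ^ homDim s)⁻¹ *
        (interactionSet s R n k ε).indicator (fun _ => (1 : ℝ≥0∞)) x := fun k => by
      by_cases h : x ∈ interactionSet s R n k ε <;> simp [h]
    refine (tsum_congr h1).trans_le ?_
    rw [ENNReal.tsum_mul_left]
    refine (mul_le_mul' le_rfl (tsum_indicator_interactionSet_le s hR n ε x)).trans ?_
    rw [← ENNReal.ofReal_mul (by positivity)]
    refine ENNReal.ofReal_le_ofReal (le_of_eq ?_)
    rw [← hM]
    field_simp
  · rw [lintegral_indicator measurableSet_Icc, setLIntegral_const]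
    have h2 : ((2 : ℝ≥0∞) ^ (n * homDim s))⁻¹ = ENNReal.ofReal ((2 ^ (n * homDim s))⁻¹) := by
      rw [ENNReal.ofReal_inv_of_pos (by positivity), ENNReal.ofReal_pow zero_le_two]
      simp
    have h3 := volume_interactionSet s hR n k ε
    rw [interactionSet] at h3
    rw [h3, h2, ← ENNReal.ofReal_mul (by positivity), ← ENNReal.ofReal_mul (by positivity)]
    refine ENNReal.ofReal_le_ofReal ?_
    rw [← hM, mul_pow (2 ^ n) M, ← pow_mul]
    calc _ = (2 * R) ^ d * (2 ^ (n * homDim s))⁻¹ := by field_simp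
      _ ≤ _ := by
        gcongr
        linarith

/-! ### Control of the Besov norm by the discrete norms -/

/-- The orders of cancellation used for large and for small scales, and the resulting decay. -/
theorem exists_cancellation_orders {s : Fin d → ℕ} {α : ℝ} {r : ℕ} (hr : |α| < (r : ℝ))
    (hrs : α ≤ 0 → ∀ i, |α| < ((s i * (r / s i) : ℕ) : ℝ)) :
    ∃ (m : Fin d → ℕ) (m' : ℕ) (δ : ℝ), 0 < δ ∧ (∀ i, s i * m i ≤ r) ∧
      (∀ i, δ ≤ α + ((s i * m i : ℕ) : ℝ)) ∧ m' ≤ r ∧ δ ≤ m' - α ∧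
      (α < 0 → m' = 0) ∧ (0 ≤ α → m' - 1 = ⌊α⌋₊) := by
  obtain ⟨m, hm, hmα⟩ : ∃ m : Fin d → ℕ, (∀ i, s i * m i ≤ r) ∧
      ∀ i, 0 < α + ((s i * m i : ℕ) : ℝ) := by
    rcases le_or_gt α 0 with h | h
    -- For `α ≤ 0` every pure derivative of scaled order at most `r` is used.
    · refine ⟨fun i => r / s i, fun i => Nat.mul_div_le r (s i), fun i => ?_⟩
      have := hrs h i
      rw [abs_of_nonpos h] at this
      linarith
    -- For `α > 0` the decay of the coefficients already suffices at fine levels, and no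
    -- cancellation of the wavelet is used.
    · exact ⟨0, fun i => by simp, fun i => by simpa using h⟩
  obtain ⟨m', hm', hm'α, h1, h2⟩ : ∃ m' : ℕ, m' ≤ r ∧ 0 < m' - α ∧ (α < 0 → m' = 0) ∧
      (0 ≤ α → m' - 1 = ⌊α⌋₊) := by
    rcases lt_or_ge α 0 with h | h
    · exact ⟨0, r.zero_le, by simpa using h, fun _ => rfl, fun h' => absurd h (not_lt.mpr h')⟩
    · rw [abs_of_nonneg h] at hr
      refine ⟨⌊α⌋₊ + 1, (Nat.floor_lt h).mpr hr, ?_, fun h' => absurd h' (not_lt.mpr h),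
        fun _ => rfl⟩
      push_cast
      linarith [Nat.lt_floor_add_one α]
  obtain ⟨ε, hε, hε'⟩ : ∃ ε : ℝ, 0 < ε ∧ ∀ i, ε < α + ((s i * m i : ℕ) : ℝ) := by
    have hS : 0 ≤ ∑ i, (α + ((s i * m i : ℕ) : ℝ))⁻¹ :=
      Finset.sum_nonneg fun i _ => (inv_pos.mpr (hmα i)).le
    -- An explicit positive number below finitely many positive numbers, which also avoids a minimum
    -- over a possibly empty index set.
    refine ⟨(1 + ∑ i, (α + ((s i * m i : ℕ) : ℝ))⁻¹)⁻¹, by positivity, fun i => ?_⟩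
    rw [inv_lt_comm₀ (by positivity) (hmα i)]
    have := Finset.single_le_sum (f := fun i => (α + ((s i * m i : ℕ) : ℝ))⁻¹)
      (fun i _ => (inv_pos.mpr (hmα i)).le) (Finset.mem_univ i)
    linarith
  exact ⟨m, m', min ε (m' - α), lt_min hε hm'α, hm,
    fun i => (min_le_left _ _).trans (hε' i).le, hm', min_le_right _ _, h1, h2⟩

/-! ### The interaction kernel between levels and scales -/

/-- The bound on the pairing of wavelets of level `n` with test functions of scale `ε`. -/
noncomputable def kerBound (s : Fin d → ℕ) (α δ R C : ℝ) (n : ℕ) (k : Fin d → ℤ) (ε : ℝ)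
    (x : Fin d → ℝ) : ℝ≥0∞ :=
  (interactionSet s R n k ε).indicator (fun _ => ENNReal.ofReal
    (C * 2 ^ (-((n : ℝ) * (homDim s : ℝ) / 2)) * (max ε (2 ^ n)⁻¹ ^ homDim s)⁻¹ *
      (scaleDecay δ n ε * (2 ^ n * ε) ^ α))) x

theorem scaleDecay_nonneg (δ : ℝ) (n : ℕ) {ε : ℝ} (hε : 0 < ε) : 0 ≤ scaleDecay δ n ε :=
  Real.rpow_nonneg (le_min (by positivity) (by positivity)) _

theorem kerBound_mono {s : Fin d → ℕ} {α δ R R' C C' : ℝ} (hR : R ≤ R') (hC : C ≤ C') (n : ℕ)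
    (k : Fin d → ℤ) {ε : ℝ} (hε : 0 < ε) (x : Fin d → ℝ) :
    kerBound s α δ R C n k ε x ≤ kerBound s α δ R' C' n k ε x := by
  have hM : 0 < max ε ((2 : ℝ) ^ n)⁻¹ := lt_max_of_lt_left hε
  have hD := scaleDecay_nonneg δ n hε
  unfold kerBound
  refine le_trans (Set.indicator_le_indicator_of_subset (fun y hy => ?_) (fun _ => zero_le) x)
    (Set.indicator_le_indicator (ENNReal.ofReal_le_ofReal ?_))
  · rw [mem_interactionSet] at hy ⊢
    exact fun l => (hy l).trans (by gcongr)
  · gcongr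

/-- It remains to see the vanishing outside the interaction set, which is disjointness of supports:
`R` comes from the wavelet, the additional one from the test function, and both scales are at most
their maximum. -/
theorem enorm_integral_waveletFun_rescale_le {s : Fin d → ℕ} (hs : ∀ i, 0 < s i) {r : ℕ}
    {f : (Fin d → ℝ) → ℝ} {R : ℝ} (hR0 : 0 ≤ R) (hR : Function.support f ⊆ Metric.closedBall 0 R)
    {α δ C : ℝ} {n : ℕ} {k : Fin d → ℤ} {ε : ℝ} (hε : 0 < ε) {x : Fin d → ℝ}
    {η : (Fin d → ℝ) → ℝ} (hη : η ∈ testBall s r)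
    (h : |∫ y, waveletFun s f n k y * rescale s ε x η y| ≤
      C * 2 ^ (-((n : ℝ) * (homDim s : ℝ) / 2)) * (max ε (2 ^ n)⁻¹ ^ homDim s)⁻¹ *
      (scaleDecay δ n ε * (2 ^ n * ε) ^ α)) :
    ‖∫ y, waveletFun s f n k y * rescale s ε x η y‖ₑ ≤ kerBound s α δ (R + 1) C n k ε x := by
  unfold kerBound
  by_cases hx : x ∈ interactionSet s (R + 1) n k ε
  · rw [Set.indicator_of_mem hx, Real.enorm_eq_ofReal_abs]
    exact ENNReal.ofReal_le_ofReal h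
  · have h0 : ∀ y, waveletFun s f n k y * rescale s ε x η y = 0 := by
      intro y
      by_contra hne
      refine hx (mem_interactionSet.mpr fun l => ?_)
      have h1 := abs_sub_gridPoint_le hR (left_ne_zero_of_mul hne) l
      have h2 := abs_sub_le_of_rescale_ne_zero hs hε hη (right_ne_zero_of_mul hne) l
      have h3 : ((2 : ℝ) ^ (n * s l))⁻¹ ≤ max ε (2 ^ n)⁻¹ ^ s l := by
        rw [pow_mul, ← inv_pow]
        exact pow_le_pow_left₀ (by positivity) (le_max_right _ _) _
      have h4 : ε ^ s l ≤ max ε (2 ^ n)⁻¹ ^ s l := pow_le_pow_left₀ hε.le (le_max_left _ _) _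
      calc |x l - gridPoint s n k l| = |(y l - gridPoint s n k l) - (y l - x l)| := by
            congr 1; ring
        _ ≤ |y l - gridPoint s n k l| + |y l - x l| := abs_sub _ _
        _ ≤ R * max ε (2 ^ n)⁻¹ ^ s l + max ε (2 ^ n)⁻¹ ^ s l :=
            add_le_add (h1.trans (by gcongr)) (h2.trans h4)
        _ = _ := by ring
    simp [h0]

/-- Only regularity and support of `f` are used, so the scaling function is covered as well. At `2 ^
n * ε = 1` the bound of order zero is enough and the test function needs no moments; this serves the
scale-one part of the norm. Below that value the expansion of order `m` is used. -/
theorem exists_enorm_integral_le_kerBound_of_small {s : Fin d → ℕ} (hs : ∀ i, 0 < s i) {r : ℕ}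
    {f : (Fin d → ℝ) → ℝ} (hf : ContDiff ℝ (r : WithTop ℕ∞) f) (hfc : HasCompactSupport f)
    {α δ : ℝ} {m : ℕ} (hm : m ≤ r) (hδ : δ ≤ m - α) :
    ∃ R C : ℝ, 0 ≤ R ∧ 0 ≤ C ∧ ∀ (n : ℕ) (k : Fin d → ℤ) (ε : ℝ), 0 < ε → 2 ^ n * ε ≤ 1 →
      ∀ (x : Fin d → ℝ), ∀ η ∈ testBall s r,
        (2 ^ n * ε = 1 ∨ m = 0 ∨ η ∈ testBallAnnihil s r (m - 1)) →
        ‖∫ y, waveletFun s f n k y * rescale s ε x η y‖ₑ ≤ kerBound s α δ R C n k ε x := by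
  obtain ⟨R, hR0, hR⟩ := hfc.exists_support_subset_closedBall
  obtain ⟨C₁, hC₁0, hC₁⟩ :=
    exists_abs_integral_waveletFun_rescale_le_of_annihil hs hf hfc (Nat.zero_le r)
  obtain ⟨C₂, hC₂0, hC₂⟩ := exists_abs_integral_waveletFun_rescale_le_of_annihil hs hf hfc hm
  refine ⟨R + 1, C₁ + C₂, by positivity, by positivity, fun n k ε hε hε1 x η hη h => ?_⟩
  refine enorm_integral_waveletFun_rescale_le hs hR0.le hR hε hη ?_
  set t : ℝ := 2 ^ n * ε with ht
  have ht0 : 0 < t := by positivity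
  have hmax : max ε ((2 : ℝ) ^ n)⁻¹ = (2 ^ n)⁻¹ := by
    refine max_eq_right ?_
    rw [le_inv_comm₀ hε (by positivity), le_inv_comm₀ (by positivity) hε,
      ← one_div, le_div_iff₀ (by positivity), mul_comm]
    exact hε1
  have hpow : (2 : ℝ) ^ ((n : ℝ) * (homDim s : ℝ) / 2) =
      2 ^ (-((n : ℝ) * (homDim s : ℝ) / 2)) * (max ε (2 ^ n)⁻¹ ^ homDim s)⁻¹ := by
    rw [hmax, inv_pow, inv_inv, ← pow_mul, ← Real.rpow_natCast, ← Real.rpow_add two_pos]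
    congr 1
    push_cast
    ring
  set E : ℝ := 2 ^ (-((n : ℝ) * (homDim s : ℝ) / 2)) * (max ε (2 ^ n)⁻¹ ^ homDim s)⁻¹ with hE
  have hE0 : 0 ≤ E := by rw [← hpow]; positivity
  have hdecay : scaleDecay δ n ε * t ^ α = t ^ (δ + α) := by
    unfold scaleDecay
    rw [← ht, min_eq_left (hε1.trans (one_le_inv_iff₀.mpr ⟨ht0, hε1⟩)), ← Real.rpow_add ht0]
  rw [hdecay, mul_assoc (C₁ + C₂), ← hE]
  have hD0 : 0 ≤ t ^ (δ + α) := by positivity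
  rcases h with h | h
  · have h1 := hC₁ n k ε hε hε1 x η hη (Or.inl rfl)
    rw [hpow, mul_assoc] at h1
    rw [h, Real.one_rpow]
    refine h1.trans ?_
    rw [pow_zero]
    nlinarith
  · have h1 := hC₂ n k ε hε hε1 x η hη h
    rw [hpow] at h1
    have h2 : t ^ m ≤ t ^ (δ + α) := by
      rw [← Real.rpow_natCast]
      exact Real.rpow_le_rpow_of_exponent_ge ht0 hε1 (by linarith)
    refine h1.trans ?_
    calc C₂ * E * t ^ m ≤ C₂ * E * t ^ (δ + α) := by gcongr
      _ ≤ _ := by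
        gcongr
        linarith

/-- For `2 ^ n * ε ≥ 1` the cancellations of the wavelet give the power `α - δ`; below, those of the
test function give `α + δ`. Both are the same expression in terms of `scaleDecay`. -/
theorem exists_enorm_integral_le_kerBound {s : Fin d → ℕ} (hs : ∀ i, 0 < s i) {r : ℕ} {φ : ℝ → ℝ}
    {Ψ : Finset ((Fin d → ℝ) → ℝ)} (hW : IsWaveletSystem s r φ Ψ) (ψ : Ψ)
    {α δ : ℝ} {m : Fin d → ℕ} (hm : ∀ i, s i * m i ≤ r)
    (hδm : ∀ i, δ ≤ α + ((s i * m i : ℕ) : ℝ)) {m' : ℕ} (hm' : m' ≤ r) (hδ : δ ≤ m' - α) :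
    ∃ R C : ℝ, 0 ≤ R ∧ 0 ≤ C ∧ ∀ (n : ℕ) (k : Fin d → ℤ) (ε : ℝ), 0 < ε →
      ∀ (x : Fin d → ℝ), ∀ η ∈ testBall s r,
        (1 ≤ 2 ^ n * ε ∨ m' = 0 ∨ η ∈ testBallAnnihil s r (m' - 1)) →
        ‖∫ y, waveletFun s ψ.1 n k y * rescale s ε x η y‖ₑ ≤ kerBound s α δ R C n k ε x := by
  have hf := hW.contDiff_wavelet ψ.1 ψ.2
  have hfc := hW.compact_wavelet ψ.1 ψ.2
  obtain ⟨R, hR0, hR⟩ := hfc.exists_support_subset_closedBall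
  obtain ⟨R₁, C₁, hR₁, hC₁, h₁⟩ := exists_enorm_integral_le_kerBound_of_small hs hf hfc hm' hδ
  obtain ⟨C₂, hC₂, h₂⟩ := exists_abs_integral_waveletFun_rescale_le hs hW ψ hm
    (β := α - δ) (fun i => by linarith [hδm i])
  refine ⟨R₁ + (R + 1), C₁ + C₂, by positivity, by positivity, fun n k ε hε x η hη h => ?_⟩
  rcases le_or_gt 1 ((2 : ℝ) ^ n * ε) with ht1 | ht1
  · refine (enorm_integral_waveletFun_rescale_le (C := C₂) (α := α) (δ := δ) hs hR0.le hR hε hη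
      ?_).trans (kerBound_mono (by linarith) (by linarith) n k hε x)
    have h3 := h₂ n k ε hε ht1 x η hη
    have ht0 : (0 : ℝ) < 2 ^ n * ε := by positivity
    have hmax : max ε ((2 : ℝ) ^ n)⁻¹ = ε := by
      refine max_eq_left ?_
      rw [inv_le_iff_one_le_mul₀ (by positivity), mul_comm]
      exact ht1
    have hdecay : scaleDecay δ n ε * (2 ^ n * ε) ^ α = (2 ^ n * ε) ^ (α - δ) := by
      unfold scaleDecay
      rw [min_eq_right ((inv_le_one_of_one_le₀ ht1).trans ht1), Real.inv_rpow ht0.le,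
        ← Real.rpow_neg ht0.le, ← Real.rpow_add ht0]
      congr 1
      ring
    rw [hmax, hdecay]
    exact h3
  · exact (h₁ n k ε hε ht1.le x η hη (Or.inr (h.resolve_left (not_le.mpr ht1)))).trans
      (kerBound_mono (by linarith) (by linarith) n k hε x)

/-- The `L^p`-norm of the contribution of a level. -/
theorem eLpNorm_tsum_kerBound_le (s : Fin d → ℕ) (α δ : ℝ) {R C : ℝ} (hR : 0 ≤ R) (hC : 0 ≤ C)
    {p : ℝ≥0∞} (hp : 1 ≤ p) (n : ℕ) {ε : ℝ} (hε : 0 < ε) (A : (Fin d → ℤ) → ℝ) :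
    eLpNorm (fun x => ∑' k, ‖A k‖ₑ * kerBound s α δ R C n k ε x) p volume ≤
      ENNReal.ofReal (C * (2 * R + 1) ^ d) * ENNReal.ofReal (ε ^ α) *
        (ENNReal.ofReal (scaleDecay δ n ε) * ellNorm s p n (fun k => A k /
          (2 : ℝ) ^ (-(n : ℝ) * (homDim s : ℝ) / 2 - (n : ℝ) * α))) := by
  set e : ℝ := -(n : ℝ) * (homDim s : ℝ) / 2 - (n : ℝ) * α with he
  have hD := scaleDecay_nonneg δ n hε
  have hM : 0 < max ε ((2 : ℝ) ^ n)⁻¹ := lt_max_of_lt_left hε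
  set M := max ε ((2 : ℝ) ^ n)⁻¹ with hMdef
  -- After factoring out `c` and normalising the coefficients, what remains is a normalised
  -- indicator kernel, whose Schur bound does not depend on `n` or `ε`.
  set c : ℝ≥0 := (C * ε ^ α * scaleDecay δ n ε).toNNReal with hc
  have hpt : ∀ x, ∑' k, ‖A k‖ₑ * kerBound s α δ R C n k ε x ≤
      c * ∑' k, (interactionSet s R n k ε).indicator
        (fun _ => ENNReal.ofReal ((2 ^ n * M) ^ homDim s)⁻¹) x * ‖A k / (2 : ℝ) ^ e‖ₑ := by
    intro x
    rw [← ENNReal.tsum_mul_left]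
    refine ENNReal.tsum_le_tsum fun k => ?_
    unfold kerBound
    by_cases hx : x ∈ interactionSet s R n k ε
    · rw [Set.indicator_of_mem hx, Set.indicator_of_mem hx, Real.enorm_eq_ofReal_abs,
        Real.enorm_eq_ofReal_abs, ← ENNReal.ofReal_mul (abs_nonneg _), hc,
        ← ENNReal.ofReal_mul (by positivity), ← ENNReal.ofReal.eq_1,
        ← ENNReal.ofReal_mul (by positivity)]
      refine ENNReal.ofReal_le_ofReal (le_of_eq ?_)
      rw [abs_div, abs_of_pos (Real.rpow_pos_of_pos two_pos e), ← hMdef,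
        Real.mul_rpow (by positivity) hε.le, mul_pow, div_eq_mul_inv |A k|]
      have h1 : (2 : ℝ) ^ (-((n : ℝ) * (homDim s : ℝ) / 2)) * ((2 : ℝ) ^ n) ^ α =
          ((2 ^ n) ^ homDim s)⁻¹ * (2 : ℝ) ^ (-e) := by
        rw [← pow_mul, ← Real.rpow_natCast 2 n, ← Real.rpow_mul zero_le_two,
          ← Real.rpow_natCast 2 (n * homDim s), ← Real.rpow_neg zero_le_two, ← Real.rpow_add two_pos, ← Real.rpow_add two_pos]
        congr 1
        rw [he]
        push_cast
        ring
      rw [Real.rpow_neg zero_le_two e] at h1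
      rw [mul_inv]
      linear_combination |A k| * C * (M ^ homDim s)⁻¹ * scaleDecay δ n ε * ε ^ α * h1
    · rw [Set.indicator_of_notMem hx, Set.indicator_of_notMem hx]
      simp
  refine (eLpNorm_enn_le_const_mul c hpt).trans ?_
  refine (mul_le_mul' le_rfl (eLpNorm_tsum_indicator_interactionSet_le s hR hp n ε _)).trans ?_
  unfold ellNorm
  rw [eLpNorm_enorm, hc, ← ENNReal.ofReal.eq_1, ENNReal.ofReal_mul (by positivity),
    ENNReal.ofReal_mul hC, ENNReal.ofReal_mul hC]
  exact le_of_eq (by ring)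

theorem measurable_tsum_kerBound (s : Fin d → ℕ) (α δ R C : ℝ) (n : ℕ) (ε : ℝ)
    (A : (Fin d → ℤ) → ℝ) :
    Measurable fun x => ∑' k, ‖A k‖ₑ * kerBound s α δ R C n k ε x :=
  Measurable.tsum fun _ => (measurable_const.indicator measurableSet_Icc).const_mul _

/-! ### Assembling all levels -/

/-- The coefficients in the level `n` of the expansion, one family for the scaling function and one
for each wavelet. -/
def channelCoeff {Ψ : Finset ((Fin d → ℝ) → ℝ)} (a : ℕ → Ψ → (Fin d → ℤ) → ℝ)
    (b : (Fin d → ℤ) → ℝ) : Option Ψ → ℕ → (Fin d → ℤ) → ℝ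
  | none, 0 => b
  | none, _ + 1 => 0
  | some ψ, n => a n ψ

/-- The `ℓ^p`-norms of the coefficients of the levels. -/
noncomputable def levelNorm (s : Fin d → ℕ) (α : ℝ) (p : ℝ≥0∞) {Ψ : Finset ((Fin d → ℝ) → ℝ)}
    (a : ℕ → Ψ → (Fin d → ℤ) → ℝ) (b : (Fin d → ℤ) → ℝ) (o : Option Ψ) (n : ℕ) : ℝ≥0∞ :=
  ellNorm s p n fun k => channelCoeff a b o n k /
    (2 : ℝ) ^ (-(n : ℝ) * (homDim s : ℝ) / 2 - (n : ℝ) * α)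

theorem eLpNorm_sum_levelNorm_le (s : Fin d → ℕ) (α : ℝ) (p : ℝ≥0∞) {q : ℝ≥0∞} (hq : 1 ≤ q)
    {Ψ : Finset ((Fin d → ℝ) → ℝ)} (a : ℕ → Ψ → (Fin d → ℤ) → ℝ) (b : (Fin d → ℤ) → ℝ) :
    eLpNorm (fun n => ∑ o, levelNorm s α p a b o n) q Measure.count ≤
      (Ψ.card + 1 : ℕ) * (detailNorm s α p q Ψ a + ellNorm s p 0 b) := by
  have h1 : (fun n => ∑ o, levelNorm s α p a b o n) = ∑ o, levelNorm s α p a b o := by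
    ext n; simp
  rw [h1]
  refine (eLpNorm_sum_le (fun o _ => (Measurable.of_discrete).aestronglyMeasurable) hq).trans ?_
  have h2 : ∀ o, eLpNorm (levelNorm s α p a b o) q Measure.count ≤
      detailNorm s α p q Ψ a + ellNorm s p 0 b := by
    intro o
    cases o with
    | none =>
      refine le_trans ?_ le_add_self
      -- The scaling channel lives on level zero only, where the normalising power of two equals
      -- one.
      refine (eLpNorm_nat_count_le_add hq _ 1).trans (le_of_eq ?_)
      have h3 : (fun n => levelNorm s α p a b none (n + 1)) = 0 := by
        ext n
        simp [levelNorm, channelCoeff, ellNorm]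
      rw [h3, eLpNorm_zero, Finset.sum_range_one, add_zero]
      simp [levelNorm, channelCoeff]
    | some ψ =>
      refine le_trans ?_ le_self_add
      exact le_iSup (fun ψ : Ψ => eLpNorm (fun n : ℕ => ellNorm s p n fun k => a n ψ k /
        (2 : ℝ) ^ (-(n : ℝ) * (homDim s : ℝ) / 2 - (n : ℝ) * α)) q Measure.count) ψ
  refine (Finset.sum_le_sum fun o _ => h2 o).trans (le_of_eq ?_)
  rw [Finset.sum_const, nsmul_eq_mul, Finset.card_univ, Fintype.card_option, Fintype.card_coe]

/-- The bound on all pairings with test functions of scale `ε` around `x`. -/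
noncomputable def totalBound (s : Fin d → ℕ) (α δ R C : ℝ) {Ψ : Finset ((Fin d → ℝ) → ℝ)}
    (a : ℕ → Ψ → (Fin d → ℤ) → ℝ) (b : (Fin d → ℤ) → ℝ) (ε : ℝ) (x : Fin d → ℝ) : ℝ≥0∞ :=
  ∑' n, ∑ o, ∑' k, ‖channelCoeff a b o n k‖ₑ * kerBound s α δ R C n k ε x

theorem eLpNorm_totalBound_le (s : Fin d → ℕ) (α δ : ℝ) {R C : ℝ} (hR : 0 ≤ R) (hC : 0 ≤ C)
    {p : ℝ≥0∞} (hp : 1 ≤ p) {Ψ : Finset ((Fin d → ℝ) → ℝ)} (a : ℕ → Ψ → (Fin d → ℤ) → ℝ)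
    (b : (Fin d → ℤ) → ℝ) {ε : ℝ} (hε : 0 < ε) :
    eLpNorm (totalBound s α δ R C a b ε) p volume ≤
      ENNReal.ofReal (C * (2 * R + 1) ^ d) * ENNReal.ofReal (ε ^ α) *
        ∑' n, ENNReal.ofReal (scaleDecay δ n ε) * ∑ o, levelNorm s α p a b o n := by
  have hm : ∀ n o, Measurable fun x => ∑' k, ‖channelCoeff a b o n k‖ₑ *
      kerBound s α δ R C n k ε x := fun n o => measurable_tsum_kerBound s α δ R C n ε _
  refine (eLpNorm_tsum_le (fun n => Finset.measurable_fun_sum _ fun o _ => hm n o) hp).trans ?_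
  rw [← ENNReal.tsum_mul_left]
  refine ENNReal.tsum_le_tsum fun n => ?_
  have h1 : (fun x => ∑ o, ∑' k, ‖channelCoeff a b o n k‖ₑ * kerBound s α δ R C n k ε x) =
      ∑ o, fun x => ∑' k, ‖channelCoeff a b o n k‖ₑ * kerBound s α δ R C n k ε x := by
    ext x; simp
  rw [h1, Finset.mul_sum, Finset.mul_sum]
  refine (eLpNorm_sum_le (fun o _ => (hm n o).aestronglyMeasurable) hp).trans ?_
  exact Finset.sum_le_sum fun o _ =>
    eLpNorm_tsum_kerBound_le s α δ hR hC hp n hε (channelCoeff a b o n)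

theorem hasCompactSupport_rescale {s : Fin d → ℕ} (hs : ∀ i, 0 < s i) {r : ℕ}
    {η : (Fin d → ℝ) → ℝ} (hη : η ∈ testBall s r) {ε : ℝ} (hε : 0 < ε) (x : Fin d → ℝ) :
    HasCompactSupport (rescale s ε x η) := by
  refine HasCompactSupport.of_support_subset_isCompact
    (K := Set.Icc (fun i => x i - ε ^ s i) (fun i => x i + ε ^ s i)) isCompact_Icc fun y hy => ?_
  have h := fun l => abs_le.mp (abs_sub_le_of_rescale_ne_zero hs hε hη hy l)
  exact ⟨fun l => by linarith [(h l).1], fun l => by linarith [(h l).2]⟩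

/-- The Besov norm is controlled by the wavelet coefficients. -/
theorem exists_besovNorm_le {s : Fin d → ℕ} (hs : ∀ i, 0 < s i) {α : ℝ}
    {p q : ℝ≥0∞} (hp : 1 ≤ p) (hq : 1 ≤ q) {r : ℕ} (hr : |α| < (r : ℝ))
    (hrs : α ≤ 0 → ∀ i, |α| < ((s i * (r / s i) : ℕ) : ℝ))
    {φ : ℝ → ℝ} {Ψ : Finset ((Fin d → ℝ) → ℝ)} (hW : IsWaveletSystem s r φ Ψ) :
    ∃ K : ℝ≥0, ∀ (ξ : 𝓢(Fin d → ℝ, ℝ) →L[ℝ] ℝ) (a : ℕ → Ψ → (Fin d → ℤ) → ℝ)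
      (b : (Fin d → ℤ) → ℝ),
      (∀ g : 𝓢(Fin d → ℝ, ℝ), HasCompactSupport g → ‖ξ g‖ₑ ≤
        (∑' k, ‖b k‖ₑ * ‖∫ y, scalingFun s φ 0 k y * g y‖ₑ) +
        ∑ ψ : Ψ, ∑' n, ∑' k, ‖a n ψ k‖ₑ * ‖∫ y, waveletFun s ψ.1 n k y * g y‖ₑ) →
      besovNorm s α p q r ξ ≤ K * (detailNorm s α p q Ψ a + ellNorm s p 0 b) := by
  obtain ⟨m, m', δ, hδ, hm, hδm, hm', hδm', hneg, hpos⟩ := exists_cancellation_orders hr hrs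
  obtain ⟨R₀, C₀, hR₀, hC₀, hK₀⟩ := exists_enorm_integral_le_kerBound_of_small hs
    (contDiff_tensorFun hW.contDiff_scaling) (hasCompactSupport_tensorFun hW.compact_scaling)
    hm' hδm'
  choose R C hR hC hK using fun ψ : Ψ => exists_enorm_integral_le_kerBound hs hW ψ hm hδm hm' hδm'
  obtain ⟨A, hA⟩ := exists_eLpNorm_tsum_scaleDecay_le hδ hq
  set R' : ℝ := R₀ + ∑ ψ, R ψ with hR'
  set C' : ℝ := C₀ + ∑ ψ, C ψ with hC'
  have hRs : 0 ≤ ∑ ψ, R ψ := Finset.sum_nonneg fun ψ _ => hR ψ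
  have hCs : 0 ≤ ∑ ψ, C ψ := Finset.sum_nonneg fun ψ _ => hC ψ
  have hR'0 : 0 ≤ R' := by positivity
  have hC'0 : 0 ≤ C' := by positivity
  have hRψ : ∀ ψ, R ψ ≤ R' := fun ψ => by
    linarith [Finset.single_le_sum (fun ψ _ => hR ψ) (Finset.mem_univ ψ)]
  have hCψ : ∀ ψ, C ψ ≤ C' := fun ψ => by
    linarith [Finset.single_le_sum (fun ψ _ => hC ψ) (Finset.mem_univ ψ)]
  set D : ℝ≥0 := (C' * (2 * R' + 1) ^ d).toNNReal with hD
  refine ⟨2 * (D * (A * (Ψ.card + 1 : ℕ))), fun ξ a b hξ => ?_⟩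
  set N := detailNorm s α p q Ψ a + ellNorm s p 0 b with hN
  set e : ℕ → ℝ≥0∞ := fun n => ∑ o, levelNorm s α p a b o n with he
  have heN : eLpNorm e q Measure.count ≤ (Ψ.card + 1 : ℕ) * N :=
    eLpNorm_sum_levelNorm_le s α p hq a b
  -- The alternatives are the scale-one term, negative `α`, and nonnegative `α` with test functions
  -- having vanishing moments. In each of them the kernel bound is available at all levels.
  have key : ∀ ε : ℝ, 0 < ε → ε ≤ 1 → ∀ x : Fin d → ℝ, ∀ F ⊆ testBall s r,
      (ε = 1 ∨ m' = 0 ∨ F ⊆ testBallAnnihil s r (m' - 1)) →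
      supTest s F ξ ε x ≤ totalBound s α δ R' C' a b ε x := by
    intro ε hε hε1 x F hF h
    unfold supTest
    refine iSup₂_le fun g hg => ?_
    obtain ⟨η, hηF, hgη⟩ := hg
    have hη := hF hηF
    have hgc : HasCompactSupport g := hgη ▸ hasCompactSupport_rescale hs hη hε x
    refine (hξ g hgc).trans ?_
    rw [hgη]
    have hb : ∑' k, ‖b k‖ₑ * ‖∫ y, scalingFun s φ 0 k y * rescale s ε x η y‖ₑ ≤
        ∑' n, ∑' k, ‖channelCoeff a b none n k‖ₑ * kerBound s α δ R' C' n k ε x := by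
      refine le_trans ?_ (ENNReal.le_tsum 0)
      refine ENNReal.tsum_le_tsum fun k => mul_le_mul' le_rfl ?_
      rw [scalingFun_eq]
      refine (hK₀ 0 k ε hε (by simpa using hε1) x η hη ?_).trans
        (kerBound_mono (by linarith) (by linarith) 0 k hε x)
      rcases h with h | h | h
      · exact Or.inl (by simpa using h)
      · exact Or.inr (Or.inl h)
      · exact Or.inr (Or.inr (h hηF))
    have ha : ∀ ψ : Ψ, ∑' n, ∑' k, ‖a n ψ k‖ₑ *
        ‖∫ y, waveletFun s ψ.1 n k y * rescale s ε x η y‖ₑ ≤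
        ∑' n, ∑' k, ‖channelCoeff a b (some ψ) n k‖ₑ * kerBound s α δ R' C' n k ε x := by
      intro ψ
      refine ENNReal.tsum_le_tsum fun n => ENNReal.tsum_le_tsum fun k => mul_le_mul' le_rfl ?_
      refine (hK ψ n k ε hε x η hη ?_).trans (kerBound_mono (hRψ ψ) (hCψ ψ) n k hε x)
      rcases h with h | h | h
      -- At scale one every level `n ≥ 0` is at least as fine as the test function.
      · refine Or.inl ?_
        rw [h, mul_one]
        exact one_le_pow₀ one_le_two
      · exact Or.inr (Or.inl h)
      · exact Or.inr (Or.inr (h hηF))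
    refine (add_le_add hb (Finset.sum_le_sum fun ψ _ => ha ψ)).trans (le_of_eq ?_)
    unfold totalBound
    rw [← Fintype.sum_option (fun o => ∑' n, ∑' k, ‖channelCoeff a b o n k‖ₑ *
      kerBound s α δ R' C' n k ε x)]
    exact (Summable.tsum_finsetSum fun _ _ => ENNReal.summable).symm
  have hscale : ∀ F ⊆ testBall s r, (m' = 0 ∨ F ⊆ testBallAnnihil s r (m' - 1)) →
      scaleNorm s F α p q ξ ≤ D * (A * (Ψ.card + 1 : ℕ)) * N := by
    intro F hF h
    unfold scaleNorm
    calc _ ≤ eLpNorm (fun ε => D * ∑' n, ENNReal.ofReal (scaleDecay δ n ε) * e n) q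
          scaleMeasure := by
          refine eLpNorm_mono_enorm_ae ?_
          filter_upwards [ae_scaleMeasure] with ε hε
          have hεα : 0 < ε ^ α := Real.rpow_pos_of_pos hε.1 α
          have hc : (ENNReal.ofReal (ε ^ α))⁻¹ ≠ ∞ := by
            simpa using hεα
          rw [enorm_eq_self, enorm_eq_self]
          have h1 := eLpNorm_enn_le_const_mul (μ := (volume : Measure (Fin d → ℝ))) (p := p)
            (f := fun x => supTest s F ξ ε x / ENNReal.ofReal (ε ^ α))
            (g := totalBound s α δ R' C' a b ε) (ENNReal.ofReal (ε ^ α))⁻¹.toNNReal (fun x => by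
              rw [ENNReal.coe_toNNReal hc, ENNReal.div_eq_inv_mul]
              exact mul_le_mul' le_rfl (key ε hε.1 hε.2.le x F hF (Or.inr h)))
          refine h1.trans ?_
          rw [ENNReal.coe_toNNReal hc]
          refine (mul_le_mul' le_rfl (eLpNorm_totalBound_le s α δ hR'0 hC'0 hp a b hε.1)).trans
            (le_of_eq ?_)
          rw [mul_comm (ENNReal.ofReal (C' * _)), mul_assoc, ← mul_assoc _ (ENNReal.ofReal (ε ^ α)),
            ENNReal.inv_mul_cancel (by simpa using hεα) ENNReal.ofReal_ne_top, one_mul]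
          rfl
      _ ≤ D * eLpNorm (fun ε => ∑' n, ENNReal.ofReal (scaleDecay δ n ε) * e n) q
          scaleMeasure := eLpNorm_enn_le_const_mul D fun _ => le_rfl
      _ ≤ D * (A * ((Ψ.card + 1 : ℕ) * N)) :=
          mul_le_mul' le_rfl ((hA e).1.trans (mul_le_mul' le_rfl heN))
      _ = _ := by ring
  have hone : eLpNorm (fun x => supTest s (testBall s r) ξ 1 x) p volume ≤
      D * (A * (Ψ.card + 1 : ℕ)) * N := by
    calc _ ≤ eLpNorm (totalBound s α δ R' C' a b 1) p volume :=
          eLpNorm_enn_mono fun x => key 1 one_pos le_rfl x _ subset_rfl (Or.inl rfl)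
      _ ≤ _ := eLpNorm_totalBound_le s α δ hR'0 hC'0 hp a b one_pos
      _ = D * ∑' n, ENNReal.ofReal (scaleDecay δ n 1) * e n := by
          rw [Real.one_rpow, ENNReal.ofReal_one, mul_one]
          rfl
      _ ≤ D * (A * ((Ψ.card + 1 : ℕ) * N)) :=
          mul_le_mul' le_rfl ((hA e).2.trans (mul_le_mul' le_rfl heN))
      _ = _ := by ring
  have htwo : ((2 * (D * (A * (Ψ.card + 1 : ℕ))) : ℝ≥0) : ℝ≥0∞) * N =
      D * (A * (Ψ.card + 1 : ℕ)) * N + D * (A * (Ψ.card + 1 : ℕ)) * N := by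
    push_cast
    ring
  rw [htwo]
  unfold besovNorm
  split_ifs with hα
  · exact (hscale _ subset_rfl (Or.inl (hneg hα))).trans le_self_add
  · refine add_le_add hone (hscale _ (fun η hη => hη.1) (Or.inr ?_))
    rw [hpos (not_lt.mp hα)]

/-! ### Decay of the pairings at infinity -/

/-- An integrable weight. -/
noncomputable def decayWeight (x : Fin d → ℝ) : ℝ := ((1 + ‖x‖) ^ (d + 1))⁻¹

theorem decayWeight_pos (x : Fin d → ℝ) : 0 < decayWeight x := by
  unfold decayWeight; positivity

theorem decayWeight_le_one (x : Fin d → ℝ) : decayWeight x ≤ 1 :=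
  inv_le_one_of_one_le₀ (one_le_pow₀ (by linarith [norm_nonneg x]))

/-- A Peetre-type inequality: `1 + ‖x‖ ≤ (1 + R) * (1 + ‖y‖)` whenever `x` and `y` are within
distance `R`. -/
theorem decayWeight_le {x y : Fin d → ℝ} {R : ℝ} (hR : 0 ≤ R) (h : ‖y - x‖ ≤ R) :
    decayWeight y ≤ (1 + R) ^ (d + 1) * decayWeight x := by
  unfold decayWeight
  have h1 : 1 + ‖x‖ ≤ (1 + R) * (1 + ‖y‖) := by
    have h2 : ‖x‖ ≤ ‖y‖ + ‖y - x‖ := by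
      calc ‖x‖ = ‖y - (y - x)‖ := by congr 1; abel
        _ ≤ _ := norm_sub_le _ _
    nlinarith [norm_nonneg y]
  rw [← div_eq_mul_inv, le_div_iff₀ (by positivity), inv_mul_le_iff₀ (by positivity), mul_comm,
    ← mul_pow]
  exact pow_le_pow_left₀ (by positivity) h1 _

theorem integrable_decayWeight : Integrable (decayWeight : (Fin d → ℝ) → ℝ) := by
  have h := integrable_one_add_norm (E := Fin d → ℝ) (μ := volume) (r := ((d + 1 : ℕ) : ℝ))
    (by simp)
  refine h.congr (Eventually.of_forall fun x => ?_)
  simp only [decayWeight]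
  rw [Real.rpow_neg (by positivity), Real.rpow_natCast]

theorem norm_sub_le_of_mem_box {s : Fin d → ℕ} {n : ℕ} {k : Fin d → ℤ} {y : Fin d → ℝ}
    (hy : y ∈ box (gridPoint s n k) (fun l => ((2 : ℝ) ^ (n * s l))⁻¹)) :
    ‖y - gridPoint s n k‖ ≤ 1 := by
  rw [pi_norm_le_iff_of_nonneg zero_le_one]
  intro l
  have h1 := hy l (Set.mem_univ l)
  rw [Set.mem_Ico] at h1
  have h2 : ((2 : ℝ) ^ (n * s l))⁻¹ ≤ 1 := inv_le_one_of_one_le₀ (one_le_pow₀ one_le_two)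
  rw [Pi.sub_apply, Real.norm_eq_abs, abs_le]
  constructor <;> linarith [h1.1, h1.2]

theorem volume_gridCell (s : Fin d → ℕ) (n : ℕ) (k : Fin d → ℤ) :
    volume (box (gridPoint s n k) (fun l => ((2 : ℝ) ^ (n * s l))⁻¹)) =
      ((2 : ℝ≥0∞) ^ (n * homDim s))⁻¹ := by
  rw [volume_box, homDim, Finset.mul_sum, ← Finset.prod_pow_eq_pow_sum,
    ENNReal.prod_inv_distrib]
  · refine Finset.prod_congr rfl fun l _ => ?_
    rw [ENNReal.ofReal_inv_of_pos (by positivity), ENNReal.ofReal_pow zero_le_two]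
    simp
  · intro a _ b _ _
    exact Or.inr (ENNReal.pow_ne_top ENNReal.ofNat_ne_top)

/-- The weights sum to a Riemann sum of an integrable function. Cells have sup-norm diameter at most
one, so this sum is bounded by an integral uniformly in `n`. Together with boundedness of the
weight, Hölder's inequality follows with a constant independent of `n` and `p`. -/
theorem exists_tsum_decayWeight_mul_le (s : Fin d → ℕ) : ∃ A : ℝ≥0, ∀ (n : ℕ)
    (f : (Fin d → ℤ) → ℝ≥0∞) {p : ℝ≥0∞}, 1 ≤ p →
    ∑' k, ((2 : ℝ≥0∞) ^ (n * homDim s))⁻¹ * ENNReal.ofReal (decayWeight (gridPoint s n k)) * f k ≤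
      A * eLpNorm f p (((2 : ℝ≥0∞) ^ (n * homDim s))⁻¹ • Measure.count) := by
  set I : ℝ≥0∞ := ∫⁻ x : Fin d → ℝ, ENNReal.ofReal (2 ^ (d + 1) * decayWeight x) with hI
  have hIt : I ≠ ∞ := by
    rw [hI, ← ofReal_integral_eq_lintegral_ofReal (integrable_decayWeight.const_mul _)]
    · exact ENNReal.ofReal_ne_top
    · exact Eventually.of_forall fun x => by
        have := decayWeight_pos x
        simp only [Pi.zero_apply]
        positivity
  refine ⟨1 + I.toNNReal, fun n f p hp => ?_⟩
  have hc : ((2 : ℝ≥0∞) ^ (n * homDim s))⁻¹ ≠ 0 :=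
    ENNReal.inv_ne_zero.mpr (ENNReal.pow_ne_top ENNReal.ofNat_ne_top)
  have hA : ((1 + I.toNNReal : ℝ≥0) : ℝ≥0∞) = 1 + I := by
    push_cast
    rw [ENNReal.coe_toNNReal hIt]
  rw [hA]
  refine tsum_mul_le_eLpNorm (ENNReal.add_ne_top.mpr ⟨ENNReal.one_ne_top, hIt⟩) hc ?_ ?_ f hp
  · refine le_trans ?_ le_add_self
    have h := eLpNorm_le_of_cells (μ := (volume : Measure (Fin d → ℝ))) (p := 1)
      (E := fun k => box (gridPoint s n k) fun l => ((2 : ℝ) ^ (n * s l))⁻¹)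
      (fun k => measurableSet_box _ _) (fun k k' hkk => by
        obtain ⟨l, hl⟩ := exists_le_abs_gridPoint_sub s n hkk
        exact disjoint_box hl) hc (fun k => (volume_gridCell s n k).ge) one_ne_zero
      (m := fun k => ENNReal.ofReal (decayWeight (gridPoint s n k)))
      (G := fun x => ENNReal.ofReal (2 ^ (d + 1) * decayWeight x)) (fun k y hy => by
        refine ENNReal.ofReal_le_ofReal ?_
        have := decayWeight_le (x := y) (y := gridPoint s n k) zero_le_one
          (by rw [norm_sub_rev]; exact norm_sub_le_of_mem_box hy)
        rwa [one_add_one_eq_two] at this)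
    rw [eLpNorm_one_eq_lintegral_enorm, eLpNorm_one_eq_lintegral_enorm, lintegral_smul_measure,
      lintegral_count] at h
    simpa only [smul_eq_mul, enorm_eq_self] using h
  · intro k
    refine le_trans ?_ le_self_add
    rw [← ENNReal.ofReal_one]
    exact ENNReal.ofReal_le_ofReal (decayWeight_le_one _)

/-- All derivatives of scaled order at most `r` decay like `P` times the weight. -/
def DecayBound (s : Fin d → ℕ) (r : ℕ) (P : ℝ) (G : (Fin d → ℝ) → ℝ) : Prop :=
  ∀ (n : ℕ) (i : Fin n → Fin d), ∑ j, s (i j) ≤ r → ∀ y, |mixedDeriv i G y| ≤ P * decayWeight y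

theorem abs_mixedDeriv_le_norm {n : ℕ} (i : Fin n → Fin d) (f : (Fin d → ℝ) → ℝ)
    (x : Fin d → ℝ) : |mixedDeriv i f x| ≤ ‖iteratedFDeriv ℝ n f x‖ := by
  have h1 : ∀ j, ‖(Pi.single (i j) (1 : ℝ) : Fin d → ℝ)‖ = 1 := fun j => by
    rw [Pi.norm_single, norm_one]
  have h2 := (iteratedFDeriv ℝ n f x).le_opNorm fun j => (Pi.single (i j) (1 : ℝ) : Fin d → ℝ)
  rwa [Finset.prod_eq_one fun j _ => h1 j, mul_one] at h2

theorem decayBound_schwartz {s : Fin d → ℕ} (hs : ∀ i, 0 < s i) (r : ℕ) (g : 𝓢(Fin d → ℝ, ℝ)) :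
    DecayBound s r (2 ^ (d + 1) *
      (Finset.Iic (d + 1, r)).sup (schwartzSeminormFamily ℝ (Fin d → ℝ) ℝ) g) g := by
  intro n i hi y
  have h := SchwartzMap.one_add_le_sup_seminorm_apply (𝕜 := ℝ) (m := (d + 1, r)) (k := d + 1)
    (n := n) le_rfl (length_le_of_sum_le hs hi) g y
  unfold decayWeight
  rw [← div_eq_mul_inv, le_div_iff₀ (by positivity), mul_comm]
  refine le_trans ?_ h
  gcongr
  exact abs_mixedDeriv_le_norm i g y

theorem CrBound.decayBound {s : Fin d → ℕ} {r : ℕ} {B R : ℝ} {G : (Fin d → ℝ) → ℝ}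
    (h : CrBound s r B G) (hR0 : 0 ≤ R) (hR : Function.support G ⊆ Metric.closedBall 0 R) :
    DecayBound s r ((1 + R) ^ (d + 1) * B) G := by
  intro n i hi y
  have hB := h.nonneg
  have hw := decayWeight_pos y
  by_cases hy : y ∈ Metric.closedBall (0 : Fin d → ℝ) R
  · rw [mem_closedBall_zero_iff] at hy
    have h1 : 1 ≤ (1 + R) ^ (d + 1) * decayWeight y := by
      unfold decayWeight
      rw [← div_eq_mul_inv, one_le_div (by positivity)]
      exact pow_le_pow_left₀ (by positivity) (by linarith) _
    calc |mixedDeriv i G y| ≤ 1 * B := by rw [one_mul]; exact h n i hi y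
      _ ≤ ((1 + R) ^ (d + 1) * decayWeight y) * B := by gcongr
      _ = _ := by ring
  · have h1 : iteratedFDeriv ℝ n G y = 0 := by
      by_contra hne
      refine hy (closure_minimal hR Metric.isClosed_closedBall ?_)
      exact support_iteratedFDeriv_subset n hne
    unfold mixedDeriv
    rw [h1]
    simp only [zero_apply, abs_zero]
    positivity

/-- At level zero no cancellation is needed; decay in the position of the grid point comes from the
decay of `G`. -/
theorem exists_abs_integral_waveletFun_zero_le (s : Fin d → ℕ) {f : (Fin d → ℝ) → ℝ}
    (hf : Continuous f) (hfc : HasCompactSupport f) : ∃ C : ℝ, 0 ≤ C ∧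
      ∀ (k : Fin d → ℤ) (G : (Fin d → ℝ) → ℝ) (P : ℝ), Continuous G →
        (∀ y, |G y| ≤ P * decayWeight y) →
        |∫ y, waveletFun s f 0 k y * G y| ≤ C * decayWeight (gridPoint s 0 k) * P := by
  obtain ⟨R, hR0, hR⟩ := hfc.exists_support_subset_closedBall
  have hint : Integrable fun x => |f x| := (hf.integrable_of_hasCompactSupport hfc).abs
  refine ⟨(∫ x, |f x|) * (1 + R) ^ (d + 1), mul_nonneg (integral_nonneg fun _ => abs_nonneg _)
    (by positivity), fun k G P hG hP => ?_⟩
  have hP0 : 0 ≤ P := by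
    have := (abs_nonneg _).trans (hP 0)
    exact nonneg_of_mul_nonneg_left this (decayWeight_pos 0)
  rw [integral_waveletFun_mul hf hG]
  simp only [Nat.cast_zero, zero_mul, zero_div, neg_zero, Real.rpow_zero, one_mul, pow_zero,
    inv_one]
  refine abs_integral_le_integral_abs.trans ?_
  have h1 : ∀ u, |f u * G (fun l => u l + gridPoint s 0 k l)| ≤
      |f u| * ((1 + R) ^ (d + 1) * decayWeight (gridPoint s 0 k) * P) := by
    intro u
    by_cases hu : f u = 0
    · simp [hu]
    rw [abs_mul]
    gcongr
    refine (hP _).trans ?_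
    rw [mul_comm]
    gcongr
    refine decayWeight_le hR0.le ?_
    have h2 : (fun l => u l + gridPoint s 0 k l) - gridPoint s 0 k = u := by
      ext l; simp
    rw [h2]
    simpa using hR hu
  calc _ ≤ ∫ u, |f u| * ((1 + R) ^ (d + 1) * decayWeight (gridPoint s 0 k) * P) := by
        refine integral_mono ?_ (hint.mul_const _) h1
        refine ((hf.mul ?_).integrable_of_hasCompactSupport hfc.mul_right).abs
        exact hG.comp (by fun_prop)
    _ = _ := by
        rw [integral_mul_const]
        ring

/-- The pure derivatives of `G` near the grid point are bounded by the weight there, and the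
cancellations give the power `2 ^ (n * β)`. Taken with `β = α - δ`, this beats the size of the
coefficients of level `n`. -/
theorem exists_abs_integral_waveletFun_le_decayWeight {s : Fin d → ℕ} (hs : ∀ i, 0 < s i) {r : ℕ}
    {φ : ℝ → ℝ} {Ψ : Finset ((Fin d → ℝ) → ℝ)} (hW : IsWaveletSystem s r φ Ψ) (ψ : Ψ)
    {m : Fin d → ℕ} (hm : ∀ i, s i * m i ≤ r) {β : ℝ} (hβ : ∀ i, -((s i * m i : ℕ) : ℝ) ≤ β) :
    ∃ C : ℝ, 0 ≤ C ∧ ∀ (n : ℕ) (k : Fin d → ℤ) (G : (Fin d → ℝ) → ℝ) (P : ℝ),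
      ContDiff ℝ (r : WithTop ℕ∞) G → DecayBound s r P G →
      |∫ y, waveletFun s ψ.1 n k y * G y| ≤ C * (2 ^ (-((n : ℝ) * (homDim s : ℝ) / 2)) *
        2 ^ ((n : ℝ) * β) * decayWeight (gridPoint s n k)) * P := by
  have hm' : ∀ i, m i ≤ r := fun i => (Nat.le_mul_of_pos_left _ (hs i)).trans (hm i)
  obtain ⟨R, C, hR0, hC0, -, h⟩ := exists_abs_integral_waveletFun_mul_le hW ψ hm'
  refine ⟨C * d * (1 + R) ^ (d + 1), by positivity, fun n k G P hG hP => ?_⟩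
  have hP0 : 0 ≤ P := by
    have := (abs_nonneg _).trans (hP 0 Fin.elim0 (by simp) 0)
    exact nonneg_of_mul_nonneg_left this (decayWeight_pos 0)
  have hw := decayWeight_pos (gridPoint s n k)
  have h1 := h G (fun i => hG.of_le (by exact_mod_cast hm' i)) hG.continuous n k
    (fun _ => P * ((1 + R) ^ (d + 1) * decayWeight (gridPoint s n k))) (fun i y hy => by
      refine (hP (m i) (fun _ => i) (by simpa [mul_comm] using hm i) y).trans ?_
      gcongr
      refine decayWeight_le hR0.le ?_
      rw [pi_norm_le_iff_of_nonneg hR0.le]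
      intro j
      refine (hy j).trans (mul_le_of_le_one_right hR0.le ?_)
      exact inv_le_one_of_one_le₀ (one_le_pow₀ one_le_two))
  refine h1.trans ?_
  have h2 : ∀ i, ((2 : ℝ) ^ (n * (s i * m i)))⁻¹ ≤ 2 ^ ((n : ℝ) * β) := by
    intro i
    rw [← Real.rpow_natCast, ← Real.rpow_neg zero_le_two]
    refine Real.rpow_le_rpow_of_exponent_le one_le_two ?_
    push_cast
    have := hβ i
    push_cast at this
    nlinarith [Nat.cast_nonneg (α := ℝ) n]
  calc _ ≤ C * 2 ^ (-((n : ℝ) * (homDim s : ℝ) / 2)) * ∑ _i : Fin d, 2 ^ ((n : ℝ) * β) *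
        (P * ((1 + R) ^ (d + 1) * decayWeight (gridPoint s n k))) :=
        mul_le_mul_of_nonneg_left (Finset.sum_le_sum fun i _ =>
          mul_le_mul_of_nonneg_right (h2 i) (by positivity)) (by positivity)
    _ = _ := by
        rw [Finset.sum_const, Finset.card_univ, Fintype.card_fin, nsmul_eq_mul]
        ring

/-! ### Distributions with prescribed wavelet coefficients -/

/-- The index set of the wavelet basis of level zero. -/
abbrev WaveletIndex (d : ℕ) (Ψ : Finset ((Fin d → ℝ) → ℝ)) : Type :=
  (Fin d → ℤ) ⊕ ({m : ℕ // 0 ≤ m} × Ψ × (Fin d → ℤ))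

/-- The coefficients with respect to the wavelet basis of level zero. -/
def familyCoeff {Ψ : Finset ((Fin d → ℝ) → ℝ)} (a : ℕ → Ψ → (Fin d → ℤ) → ℝ)
    (b : (Fin d → ℤ) → ℝ) : WaveletIndex d Ψ → ℝ
  | Sum.inl k => b k
  | Sum.inr (m, ψ, k) => a m.1 ψ k

theorem tsum_waveletIndex {Ψ : Finset ((Fin d → ℝ) → ℝ)} (F : WaveletIndex d Ψ → ℝ≥0∞) :
    ∑' i, F i = ∑' k, F (Sum.inl k) +
      ∑ ψ : Ψ, ∑' n : ℕ, ∑' k, F (Sum.inr (⟨n, n.zero_le⟩, ψ, k)) := by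
  rw [Summable.tsum_sum ENNReal.summable ENNReal.summable]
  congr 1
  rw [ENNReal.tsum_prod']
  simp_rw [ENNReal.tsum_prod' (α := Ψ), tsum_fintype]
  rw [Summable.tsum_finsetSum fun _ _ => ENNReal.summable]
  refine Finset.sum_congr rfl fun ψ _ => ?_
  let e : ℕ ≃ {m : ℕ // 0 ≤ m} := ⟨fun n => ⟨n, n.zero_le⟩, fun m => m.1, fun _ => rfl, fun _ => rfl⟩
  exact (e.tsum_eq fun m => ∑' k, F (Sum.inr (m, ψ, k))).symm

theorem contDiff_waveletFamily {s : Fin d → ℕ} {r : ℕ} {φ : ℝ → ℝ}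
    {Ψ : Finset ((Fin d → ℝ) → ℝ)} (hW : IsWaveletSystem s r φ Ψ) (n : ℕ)
    (i : (Fin d → ℤ) ⊕ ({m : ℕ // n ≤ m} × Ψ × (Fin d → ℤ))) :
    ContDiff ℝ (r : WithTop ℕ∞) (waveletFamily s φ Ψ n i) := by
  rcases i with k | ⟨m, ψ, k⟩
  · simp only [waveletFamily]
    rw [scalingFun_eq]
    exact contDiff_waveletFun s (contDiff_tensorFun hW.contDiff_scaling) _ _
  · exact contDiff_waveletFun s (hW.contDiff_wavelet ψ.1 ψ.2) _ _

theorem hasCompactSupport_waveletFamily {s : Fin d → ℕ} {r : ℕ} {φ : ℝ → ℝ}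
    {Ψ : Finset ((Fin d → ℝ) → ℝ)} (hW : IsWaveletSystem s r φ Ψ) (n : ℕ)
    (i : (Fin d → ℤ) ⊕ ({m : ℕ // n ≤ m} × Ψ × (Fin d → ℤ))) :
    HasCompactSupport (waveletFamily s φ Ψ n i) := by
  rcases i with k | ⟨m, ψ, k⟩
  · simp only [waveletFamily]
    rw [scalingFun_eq]
    exact hasCompactSupport_waveletFun (hasCompactSupport_tensorFun hW.compact_scaling) _ _
  · exact hasCompactSupport_waveletFun (hW.compact_wavelet ψ.1 ψ.2) _ _

theorem ellNorm_level_le_detailNorm (s : Fin d → ℕ) (α : ℝ) (p : ℝ≥0∞) {q : ℝ≥0∞} (hq : 1 ≤ q)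
    {Ψ : Finset ((Fin d → ℝ) → ℝ)} (a : ℕ → Ψ → (Fin d → ℤ) → ℝ) (ψ : Ψ) (n : ℕ) :
    ellNorm s p n (fun k => a n ψ k /
      (2 : ℝ) ^ (-(n : ℝ) * (homDim s : ℝ) / 2 - (n : ℝ) * α)) ≤ detailNorm s α p q Ψ a :=
  (le_eLpNorm_count (zero_lt_one.trans_le hq).ne' (fun n : ℕ => ellNorm s p n (fun k => a n ψ k /
      (2 : ℝ) ^ (-(n : ℝ) * (homDim s : ℝ) / 2 - (n : ℝ) * α))) n).trans
    (le_iSup (fun ψ : Ψ => eLpNorm (fun n : ℕ => ellNorm s p n fun k => a n ψ k /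
        (2 : ℝ) ^ (-(n : ℝ) * (homDim s : ℝ) / 2 - (n : ℝ) * α)) q Measure.count) ψ)

/-- After normalising the coefficients, the powers of two combine to the mass `2^{-n|𝔰|}` of a grid
point times `2^{-nδ}`. Each level is bounded by the detail norm, uniformly in `n`, and the geometric
factor sums over the levels for every `q`. -/
theorem tsum_coeff_mul_decayWeight_ne_top {s : Fin d → ℕ} {α δ : ℝ} (hδ : 0 < δ) {p q : ℝ≥0∞}
    (hp : 1 ≤ p) (hq : 1 ≤ q) {Ψ : Finset ((Fin d → ℝ) → ℝ)} {a : ℕ → Ψ → (Fin d → ℤ) → ℝ}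
    (ha : detailNorm s α p q Ψ a < ∞) {C : ℝ} (hC : 0 ≤ C) (ψ : Ψ) :
    ∑' (n : ℕ) (k : Fin d → ℤ), ‖a n ψ k‖ₑ * ENNReal.ofReal (C *
      (2 ^ (-((n : ℝ) * (homDim s : ℝ) / 2)) * 2 ^ ((n : ℝ) * (α - δ)) *
        decayWeight (gridPoint s n k))) ≠ ∞ := by
  obtain ⟨A, hA⟩ := exists_tsum_decayWeight_mul_le s
  have hθ1 : (2 : ℝ) ^ (-δ) < 1 := Real.rpow_lt_one_of_one_lt_of_neg one_lt_two (by linarith)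
  have hgeo : Summable fun n : ℕ => C * ((2 : ℝ) ^ (-δ)) ^ n :=
    (summable_geometric_of_lt_one (by positivity) hθ1).mul_left C
  have hlev : ∀ n : ℕ, ∑' k : Fin d → ℤ, ‖a n ψ k‖ₑ * ENNReal.ofReal (C *
      (2 ^ (-((n : ℝ) * (homDim s : ℝ) / 2)) * 2 ^ ((n : ℝ) * (α - δ)) *
        decayWeight (gridPoint s n k))) ≤
      ENNReal.ofReal (C * ((2 : ℝ) ^ (-δ)) ^ n) * (A * detailNorm s α p q Ψ a) := by
    intro n
    set e : ℝ := -(n : ℝ) * (homDim s : ℝ) / 2 - (n : ℝ) * α with he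
    have h1 := hA n (fun k => ‖a n ψ k / (2 : ℝ) ^ e‖ₑ) hp
    have h2 : eLpNorm (fun k => ‖a n ψ k / (2 : ℝ) ^ e‖ₑ) p
        (((2 : ℝ≥0∞) ^ (n * homDim s))⁻¹ • Measure.count) ≤ detailNorm s α p q Ψ a := by
      rw [eLpNorm_enorm]
      exact ellNorm_level_le_detailNorm s α p hq a ψ n
    refine le_trans (le_of_eq ?_) (mul_le_mul' le_rfl (h1.trans (mul_le_mul' le_rfl h2)))
    rw [← ENNReal.tsum_mul_left]
    refine tsum_congr fun k => ?_
    have hw := (decayWeight_pos (gridPoint s n k)).le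
    have h3 : ((2 : ℝ≥0∞) ^ (n * homDim s))⁻¹ = ENNReal.ofReal ((2 ^ (n * homDim s))⁻¹) := by
      rw [ENNReal.ofReal_inv_of_pos (by positivity), ENNReal.ofReal_pow zero_le_two]
      simp
    rw [h3, Real.enorm_eq_ofReal_abs, Real.enorm_eq_ofReal_abs,
      ← ENNReal.ofReal_mul (abs_nonneg _), ← ENNReal.ofReal_mul (by positivity),
      ← ENNReal.ofReal_mul (by positivity), ← ENNReal.ofReal_mul (by positivity)]
    congr 1
    rw [abs_div, abs_of_pos (Real.rpow_pos_of_pos two_pos e), div_eq_mul_inv |a n ψ k|,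
      ← Real.rpow_neg zero_le_two e]
    have h4 : (2 : ℝ) ^ (-((n : ℝ) * (homDim s : ℝ) / 2)) * 2 ^ ((n : ℝ) * (α - δ)) =
        (2 ^ (-δ)) ^ n * ((2 ^ (n * homDim s))⁻¹ * 2 ^ (-e)) := by
      rw [← Real.rpow_natCast (2 ^ (-δ)) n, ← Real.rpow_mul zero_le_two,
        ← Real.rpow_natCast 2 (n * homDim s), ← Real.rpow_neg zero_le_two,
        ← Real.rpow_add two_pos, ← Real.rpow_add two_pos, ← Real.rpow_add two_pos]
      congr 1
      rw [he]
      push_cast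
      ring
    linear_combination |a n ψ k| * C * decayWeight (gridPoint s n k) * h4
  refine ne_top_of_le_ne_top ?_ (ENNReal.tsum_le_tsum hlev)
  rw [ENNReal.tsum_mul_right]
  exact ENNReal.mul_ne_top hgeo.tsum_ofReal_ne_top
    (ENNReal.mul_ne_top ENNReal.coe_ne_top ha.ne)

theorem tsum_coeff_zero_mul_decayWeight_ne_top {s : Fin d → ℕ} {p : ℝ≥0∞} (hp : 1 ≤ p)
    {b : (Fin d → ℤ) → ℝ} (hb : ellNorm s p 0 b < ∞) {C : ℝ} (hC : 0 ≤ C) :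
    ∑' k : Fin d → ℤ, ‖b k‖ₑ * ENNReal.ofReal (C * decayWeight (gridPoint s 0 k)) ≠ ∞ := by
  obtain ⟨A, hA⟩ := exists_tsum_decayWeight_mul_le s
  have h1 := hA 0 (fun k => ‖b k‖ₑ) hp
  rw [eLpNorm_enorm] at h1
  simp only [zero_mul, pow_zero, inv_one, one_mul] at h1
  have h2 : eLpNorm b p ((1 : ℝ≥0∞) • Measure.count) < ∞ := by
    simpa [ellNorm] using hb
  have h3 : ∀ k, ‖b k‖ₑ * ENNReal.ofReal (C * decayWeight (gridPoint s 0 k)) =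
      ENNReal.ofReal C * (ENNReal.ofReal (decayWeight (gridPoint s 0 k)) * ‖b k‖ₑ) := fun k => by
    rw [ENNReal.ofReal_mul hC]; ring
  rw [tsum_congr h3, ENNReal.tsum_mul_left]
  exact ENNReal.mul_ne_top ENNReal.ofReal_ne_top
    (ne_top_of_le_ne_top (ENNReal.mul_ne_top ENNReal.coe_ne_top h2.ne) h1)

/-- The pairings of the wavelet basis with rapidly decaying functions are summable against
coefficients of finite norm. -/
theorem exists_pairing_bound {s : Fin d → ℕ} (hs : ∀ i, 0 < s i) {α : ℝ}
    {p q : ℝ≥0∞} (hp : 1 ≤ p) (hq : 1 ≤ q) {r : ℕ} (hr : |α| < (r : ℝ))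
    (hrs : α ≤ 0 → ∀ i, |α| < ((s i * (r / s i) : ℕ) : ℝ))
    {φ : ℝ → ℝ} {Ψ : Finset ((Fin d → ℝ) → ℝ)} (hW : IsWaveletSystem s r φ Ψ) :
    ∃ D : WaveletIndex d Ψ → ℝ,
      (∀ (i : WaveletIndex d Ψ) (G : (Fin d → ℝ) → ℝ) (P : ℝ), ContDiff ℝ (r : WithTop ℕ∞) G →
        DecayBound s r P G → |∫ y, waveletFamily s φ Ψ 0 i y * G y| ≤ D i * P) ∧
      ∀ (a : ℕ → Ψ → (Fin d → ℤ) → ℝ) (b : (Fin d → ℤ) → ℝ), detailNorm s α p q Ψ a < ∞ →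
        ellNorm s p 0 b < ∞ → Summable fun i => |familyCoeff a b i| * D i := by
  obtain ⟨m, m', δ, hδ, hm, hδm, -, -, -, -⟩ := exists_cancellation_orders hr hrs
  obtain ⟨C₀, hC₀, h₀⟩ := exists_abs_integral_waveletFun_zero_le s
    (continuous_tensorFun (d := d) hW.contDiff_scaling.continuous)
    (hasCompactSupport_tensorFun hW.compact_scaling)
  choose C hC h using fun ψ : Ψ => exists_abs_integral_waveletFun_le_decayWeight hs hW ψ hm
    (β := α - δ) (fun i => by linarith [hδm i])
  let D : WaveletIndex d Ψ → ℝ := fun i => match i with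
    | Sum.inl k => C₀ * decayWeight (gridPoint s 0 k)
    | Sum.inr (n, ψ, k) => C ψ * (2 ^ (-((n.1 : ℝ) * (homDim s : ℝ) / 2)) *
        2 ^ ((n.1 : ℝ) * (α - δ)) * decayWeight (gridPoint s n.1 k))
  have hD0 : ∀ i, 0 ≤ D i := by
    rintro (k | ⟨n, ψ, k⟩)
    · exact mul_nonneg hC₀ (decayWeight_pos _).le
    · have := (decayWeight_pos (gridPoint s n.1 k)).le
      have := hC ψ
      simp only [D]
      positivity
  refine ⟨D, ?_, fun a b ha hb => ?_⟩
  · rintro (k | ⟨n, ψ, k⟩) G P hG hP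
    · simp only [waveletFamily, scalingFun_eq]
      exact h₀ k G P hG.continuous fun y => by
        simpa [mixedDeriv_fin_zero] using hP 0 Fin.elim0 (by simp) y
    · exact h ψ n.1 k G P hG hP
  · have h1 : ∑' i, ‖|familyCoeff a b i| * D i‖ₑ ≠ ∞ := by
      have h2 : ∀ i, ‖|familyCoeff a b i| * D i‖ₑ = ‖familyCoeff a b i‖ₑ * ENNReal.ofReal (D i) := by
        intro i
        rw [enorm_mul, Real.enorm_eq_ofReal (hD0 i), Real.enorm_abs]
      rw [tsum_congr h2, tsum_waveletIndex]
      refine ENNReal.add_ne_top.mpr ⟨tsum_coeff_zero_mul_decayWeight_ne_top hp hb hC₀,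
        ENNReal.sum_ne_top.mpr fun ψ _ => tsum_coeff_mul_decayWeight_ne_top hδ hp hq ha (hC ψ) ψ⟩
    rw [tsum_enorm_ne_top_iff_summable_norm] at h1
    exact h1.congr fun i => by
      rw [Real.norm_of_nonneg (mul_nonneg (abs_nonneg _) (hD0 i))]

theorem CrTendsto.tendsto_integral_mul {s : Fin d → ℕ} {r : ℕ} {g : ℕ → (Fin d → ℝ) → ℝ}
    {f w : (Fin d → ℝ) → ℝ} (hg : ∀ n, Continuous (g n)) (hf : Continuous f)
    (h : CrTendsto s r g f) (hw : Continuous w) (hc : HasCompactSupport w) :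
    Tendsto (fun n => ∫ y, w y * g n y) atTop (𝓝 (∫ y, w y * f y)) := by
  have hint : ∀ {u : (Fin d → ℝ) → ℝ}, Continuous u → Integrable fun y => w y * u y :=
    fun hu => (hw.mul hu).integrable_of_hasCompactSupport hc.mul_right
  have hint' : Integrable fun y => |w y| := (hw.integrable_of_hasCompactSupport hc).abs
  set I := ∫ y, |w y| with hI
  have hI0 : 0 ≤ I := integral_nonneg fun _ => abs_nonneg _
  rw [Metric.tendsto_nhds]
  intro ε hε
  filter_upwards [h (ε / (I + 1)) (by positivity)] with n hn
  rw [Real.dist_eq, ← integral_sub (hint (hg n)) (hint hf)]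
  calc _ ≤ ∫ y, |w y * g n y - w y * f y| := abs_integral_le_integral_abs
    _ ≤ ∫ y, |w y| * (ε / (I + 1)) := by
        refine integral_mono ((hint (hg n)).sub (hint hf)).abs (hint'.mul_const _) fun y => ?_
        simp only
        rw [← mul_sub, abs_mul]
        gcongr
        simpa [mixedDeriv_fin_zero] using hn 0 Fin.elim0 (by simp) y
    _ = I * (ε / (I + 1)) := integral_mul_const _ _
    _ < ε := by
        rw [← mul_div_assoc, div_lt_iff₀ (by positivity)]
        nlinarith

/-- Coefficients of finite norm are those of a tempered distribution. -/
theorem exists_distribution {s : Fin d → ℕ} (hs : ∀ i, 0 < s i) {α : ℝ}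
    {p q : ℝ≥0∞} (hp : 1 ≤ p) (hq : 1 ≤ q) {r : ℕ} (hr : |α| < (r : ℝ))
    (hrs : α ≤ 0 → ∀ i, |α| < ((s i * (r / s i) : ℕ) : ℝ))
    {φ : ℝ → ℝ} {Ψ : Finset ((Fin d → ℝ) → ℝ)} (hW : IsWaveletSystem s r φ Ψ)
    {a : ℕ → Ψ → (Fin d → ℤ) → ℝ} {b : (Fin d → ℤ) → ℝ} (ha : detailNorm s α p q Ψ a < ∞)
    (hb : ellNorm s p 0 b < ∞) :
    ∃ ξ : 𝓢(Fin d → ℝ, ℝ) →L[ℝ] ℝ, IsWaveletCoeffs s r φ Ψ ξ a b ∧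
      ∀ g : 𝓢(Fin d → ℝ, ℝ), ‖ξ g‖ₑ ≤
        (∑' k, ‖b k‖ₑ * ‖∫ y, scalingFun s φ 0 k y * g y‖ₑ) +
        ∑ ψ : Ψ, ∑' n, ∑' k, ‖a n ψ k‖ₑ * ‖∫ y, waveletFun s ψ.1 n k y * g y‖ₑ := by
  classical
  obtain ⟨D, hD, hsum⟩ := exists_pairing_bound hs hp hq hr hrs hW
  replace hsum := hsum a b ha hb
  set c := familyCoeff a b with hc
  set I : WaveletIndex d Ψ → ((Fin d → ℝ) → ℝ) → ℝ := fun i G =>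
    ∫ y, waveletFamily s φ Ψ 0 i y * G y with hI
  have hbound : ∀ (i : WaveletIndex d Ψ) (G : (Fin d → ℝ) → ℝ) (P : ℝ),
      ContDiff ℝ (r : WithTop ℕ∞) G → DecayBound s r P G → ‖c i * I i G‖ ≤ |c i| * D i * P := by
    intro i G P hG hP
    rw [Real.norm_eq_abs, abs_mul, mul_assoc]
    exact mul_le_mul_of_nonneg_left (hD i G P hG hP) (abs_nonneg _)
  have hsummable : ∀ (G : (Fin d → ℝ) → ℝ) (P : ℝ), ContDiff ℝ (r : WithTop ℕ∞) G →
      DecayBound s r P G → Summable fun i => c i * I i G := fun G P hG hP =>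
    Summable.of_norm_bounded (hsum.mul_right P) fun i => hbound i G P hG hP
  have hint : ∀ (i : WaveletIndex d Ψ) (G : (Fin d → ℝ) → ℝ), Continuous G →
      Integrable fun y => waveletFamily s φ Ψ 0 i y * G y := fun i G hG =>
    ((contDiff_waveletFamily hW 0 i).continuous.mul hG).integrable_of_hasCompactSupport
      (hasCompactSupport_waveletFamily hW 0 i).mul_right
  let ξ : 𝓢(Fin d → ℝ, ℝ) →L[ℝ] ℝ := SchwartzMap.mkCLMtoNormedSpace (𝕜 := ℝ) (σ := RingHom.id ℝ)
    (fun g => ∑' i, c i * I i g)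
    (fun f g => by
      have hf := hsummable f _ (contDiff_schwartz f r) (decayBound_schwartz hs r f)
      have hg := hsummable g _ (contDiff_schwartz g r) (decayBound_schwartz hs r g)
      rw [← hf.tsum_add hg]
      refine tsum_congr fun i => ?_
      simp only [hI, add_apply, mul_add]
      rw [integral_add (hint i f f.continuous) (hint i g g.continuous), mul_add])
    (fun t f => by
      simp only [RingHom.id_apply, smul_eq_mul]
      rw [← tsum_mul_left]
      refine tsum_congr fun i => ?_
      simp only [hI, smul_apply, smul_eq_mul, mul_left_comm _ t]
      rw [integral_const_mul, mul_left_comm])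
    ⟨Finset.Iic (d + 1, r), |∑' i, |c i| * D i| * 2 ^ (d + 1), by positivity, fun g => by
      have h1 : ∀ i, ‖c i * I i g‖ ≤ _ :=
        fun i => hbound i g _ (contDiff_schwartz g r) (decayBound_schwartz hs r g)
      refine (tsum_of_norm_bounded (hsum.mul_right _).hasSum h1).trans ?_
      rw [tsum_mul_right, mul_assoc]
      gcongr
      exact le_abs_self _⟩
  have hξ : ∀ g, ξ g = ∑' i, c i * I i g := fun g => rfl
  have hpair : ∀ j, HasPairing s r ξ (waveletFamily s φ Ψ 0 j) (c j) := by
    intro j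
    have hfj := contDiff_waveletFamily hW 0 j
    refine hasPairing_of_forall hs hfj fun g R hR hg => ?_
    obtain ⟨B, hB⟩ := exists_crBound hs hfj (hasCompactSupport_waveletFamily hW 0 j)
    -- By orthonormality the series collapses to its term of index `j` at a basis function.
    have h1 : c j = ∑' i, c i * I i (waveletFamily s φ Ψ 0 j) := by
      rw [tsum_eq_single j]
      · simp only [hI]
        rw [integral_waveletFamily_mul hW, if_pos rfl, mul_one]
      · intro i hij
        simp only [hI]
        rw [integral_waveletFamily_mul hW, if_neg hij, mul_zero]
    rw [h1]
    simp only [hξ]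
    set R' := max R 0 with hR'
    -- Eventually `g n` is within one of the basis function in `C^r`, and its support stays in a
    -- fixed ball. It therefore satisfies a decay bound independent of `n`, which gives a summable
    -- majorant.
    refine tendsto_tsum_of_dominated_convergence
      (bound := fun i => |c i| * D i * ((1 + R') ^ (d + 1) * (B + 1))) (hsum.mul_right _)
      (fun i => ?_) ?_
    · exact (hg.tendsto_integral_mul (fun n => (g n).continuous) hfj.continuous
        (contDiff_waveletFamily hW 0 i).continuous
        (hasCompactSupport_waveletFamily hW 0 i)).const_mul _
    · filter_upwards [hg 1 one_pos] with n hn i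
      refine hbound i (g n) _ (contDiff_schwartz _ r) (CrBound.decayBound ?_ (le_max_right _ _)
        ((hR n).trans (Metric.closedBall_subset_closedBall (le_max_left _ _))))
      have h2 := CrBound.add hs hfj ((contDiff_schwartz (g n) r).sub hfj) hB hn
      simpa using h2
  refine ⟨ξ, ⟨fun n ψ k => hpair (Sum.inr (⟨n, n.zero_le⟩, ψ, k)), fun k => hpair (Sum.inl k)⟩,
    fun g => ?_⟩
  rw [hξ]
  refine enorm_tsum_le_tsum_enorm.trans (le_of_eq ?_)
  rw [tsum_waveletIndex]
  simp only [enorm_mul, hI, hc, familyCoeff, waveletFamily]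

/-! ### Completeness of the wavelets -/

/-- Vanishing coefficients give zero in `L²`, and continuity upgrades this to every point. -/
theorem eq_zero_of_forall_integral_waveletFamily_eq_zero {s : Fin d → ℕ} {r : ℕ} {φ : ℝ → ℝ}
    {Ψ : Finset ((Fin d → ℝ) → ℝ)} (hW : IsWaveletSystem s r φ Ψ) (n : ℕ)
    {f : (Fin d → ℝ) → ℝ} (hf : Continuous f) (hc : HasCompactSupport f)
    (h : ∀ i, ∫ x, waveletFamily s φ Ψ n i x * f x = 0) : f = 0 := by
  obtain ⟨b, hb⟩ := hW.basis n
  have hfL : MemLp f 2 volume := hf.memLp_of_hasCompactSupport hc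
  have h1 : b.repr (hfL.toLp f) = 0 := by
    ext i
    rw [b.repr_apply_apply, MeasureTheory.L2.inner_def]
    rw [lp.coeFn_zero, Pi.zero_apply, ← h i]
    refine integral_congr_ae ?_
    filter_upwards [hb i, hfL.coeFn_toLp] with x hx hx'
    rw [hx, hx']
    simp [mul_comm]
  have h2 : hfL.toLp f = 0 := by
    rwa [map_eq_zero_iff _ b.repr.injective] at h1
  have h3 : f =ᵐ[volume] (0 : (Fin d → ℝ) → ℝ) := by
    have := hfL.coeFn_toLp
    rw [h2] at this
    exact this.symm.trans (Lp.coeFn_zero ℝ 2 volume)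
  exact (hf.ae_eq_iff_eq volume continuous_const).mp h3

theorem finite_gridPoint_norm_le (s : Fin d → ℕ) (n : ℕ) (R : ℝ) :
    {k : Fin d → ℤ | ‖gridPoint s n k‖ ≤ R}.Finite := by
  obtain ⟨N, hN⟩ : ∃ N : ℕ, ∀ l, 2 ^ (n * s l) * R ≤ N := by
    choose N hN using fun l => exists_nat_ge (2 ^ (n * s l) * R)
    refine ⟨∑ l, N l, fun l => (hN l).trans ?_⟩
    exact_mod_cast Finset.single_le_sum (fun l _ => (N l).zero_le) (Finset.mem_univ l)
  refine (Fintype.piFinset fun _ : Fin d => Finset.Icc (-(N : ℤ)) N).finite_toSet.subset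
    fun k hk => ?_
  rw [Finset.mem_coe, Fintype.mem_piFinset]
  intro l
  have h1 := (norm_le_pi_norm (gridPoint s n k) l).trans hk
  rw [gridPoint, Real.norm_eq_abs, abs_div, abs_of_pos (by positivity : (0 : ℝ) < 2 ^ (n * s l)),
    div_le_iff₀ (by positivity), mul_comm] at h1
  have h2 := abs_le.mp (h1.trans (hN l))
  rw [Finset.mem_Icc]
  exact ⟨by exact_mod_cast h2.1, by exact_mod_cast h2.2⟩

theorem finite_integral_waveletFun_mul_ne_zero (s : Fin d → ℕ) {f g : (Fin d → ℝ) → ℝ}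
    (hf : HasCompactSupport f) (hg : HasCompactSupport g) (n : ℕ) :
    {k : Fin d → ℤ | ∫ x, waveletFun s f n k x * g x ≠ 0}.Finite := by
  obtain ⟨R, hR0, hR⟩ := hf.exists_support_subset_closedBall
  obtain ⟨R', hR'0, hR'⟩ := hg.exists_support_subset_closedBall
  refine (finite_gridPoint_norm_le s n (R' + R)).subset fun k hk => ?_
  obtain ⟨x, hx⟩ : ∃ x, waveletFun s f n k x * g x ≠ 0 := by
    by_contra! hall
    exact hk (by simp [hall])
  rw [Set.mem_ofPred_eq, pi_norm_le_iff_of_nonneg (by positivity)]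
  intro l
  have h1 := abs_sub_gridPoint_le hR (left_ne_zero_of_mul hx) l
  have h2 : R * ((2 : ℝ) ^ (n * s l))⁻¹ ≤ R :=
    mul_le_of_le_one_right hR0.le (inv_le_one_of_one_le₀ (one_le_pow₀ one_le_two))
  have h3 := hR' (right_ne_zero_of_mul hx)
  rw [mem_closedBall_zero_iff] at h3
  have h4 := (norm_le_pi_norm x l).trans h3
  rw [Real.norm_eq_abs] at h4 ⊢
  calc |gridPoint s n k l| = |x l - (x l - gridPoint s n k l)| := by congr 1; ring
    _ ≤ |x l| + |x l - gridPoint s n k l| := abs_sub _ _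
    _ ≤ R' + R := add_le_add h4 (h1.trans h2)

/-- A distribution with vanishing wavelet coefficients vanishes on all functions that are orthogonal
to the wavelets of all large levels. -/
theorem hasPairing_zero_of_orthogonal {s : Fin d → ℕ} (hs : ∀ i, 0 < s i) {r : ℕ} {φ : ℝ → ℝ}
    {Ψ : Finset ((Fin d → ℝ) → ℝ)} (hW : IsWaveletSystem s r φ Ψ)
    {ξ : 𝓢(Fin d → ℝ, ℝ) →L[ℝ] ℝ}
    (hξ : ∀ i, HasPairing s r ξ (waveletFamily s φ Ψ 0 i) 0)
    {f : (Fin d → ℝ) → ℝ} (hf : ContDiff ℝ (r : WithTop ℕ∞) f) (hc : HasCompactSupport f) (M : ℕ)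
    (h : ∀ (ψ : Ψ) (m : ℕ), M ≤ m → ∀ k, ∫ x, waveletFun s ψ.1 m k x * f x = 0) :
    HasPairing s r ξ f 0 := by
  classical
  have h0 : HasPairing s r ξ (fun _ => 0) 0 :=
    (hξ (Sum.inl 0)).zero hs (contDiff_waveletFamily hW 0 _) (hasCompactSupport_waveletFamily hW 0 _)
  set c : WaveletIndex d Ψ → ℝ := fun i => ∫ x, waveletFamily s φ Ψ 0 i x * f x with hcdef
  -- Levels from `M` on do not contribute by orthogonality, and on each remaining level only
  -- finitely many basis functions meet the support of `f`.
  have hfin : {i | c i ≠ 0}.Finite := by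
    have h1 : (Sum.inl '' {k | ∫ x, waveletFun s (tensorFun φ) 0 k x * f x ≠ 0} ∪
        ⋃ m : Fin M, ⋃ ψ : Ψ, (fun k => (Sum.inr (⟨m.1, m.1.zero_le⟩, ψ, k) : WaveletIndex d Ψ)) ''
          {k | ∫ x, waveletFun s ψ.1 m.1 k x * f x ≠ 0}).Finite := by
      refine Set.Finite.union (Set.Finite.image _ ?_) (Set.finite_iUnion fun m =>
        Set.finite_iUnion fun ψ => Set.Finite.image _ ?_)
      · exact finite_integral_waveletFun_mul_ne_zero s
          (hasCompactSupport_tensorFun hW.compact_scaling) hc 0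
      · exact finite_integral_waveletFun_mul_ne_zero s (hW.compact_wavelet ψ.1 ψ.2) hc m.1
    refine h1.subset ?_
    rintro (k | ⟨⟨m, hm⟩, ψ, k⟩) hi
    · left
      refine ⟨k, ?_, rfl⟩
      simpa [hcdef, waveletFamily, scalingFun_eq] using hi
    · right
      have hmM : m < M := by
        by_contra hlt
        exact hi (h ψ m (not_lt.mp hlt) k)
      simp only [Set.mem_iUnion]
      exact ⟨⟨m, hmM⟩, ψ, k, hi, rfl⟩
  set S := hfin.toFinset with hS
  have hfam : ∀ i, Continuous (waveletFamily s φ Ψ 0 i) := fun i =>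
    (contDiff_waveletFamily hW 0 i).continuous
  have hfamc : ∀ i, HasCompactSupport (waveletFamily s φ Ψ 0 i) := fun i =>
    hasCompactSupport_waveletFamily hW 0 i
  -- The difference of both sides is continuous with compact support and has no coefficients, so the
  -- finite expansion holds pointwise, not only in `L²`.
  have hexp : f = fun x => ∑ i ∈ S, c i * waveletFamily s φ Ψ 0 i x := by
    have hDc : Continuous fun x => f x - ∑ i ∈ S, c i * waveletFamily s φ Ψ 0 i x :=
      hf.continuous.sub (continuous_finsetSum _ fun i _ => continuous_const.mul (hfam i))
    have hsumc : HasCompactSupport fun x => ∑ i ∈ S, c i * waveletFamily s φ Ψ 0 i x := by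
      have h2 : ∀ T : Finset (WaveletIndex d Ψ),
          HasCompactSupport fun x => ∑ i ∈ T, c i * waveletFamily s φ Ψ 0 i x := by
        intro T
        induction T using Finset.induction_on with
        | empty =>
          simp only [Finset.sum_empty]
          exact HasCompactSupport.zero
        | insert i T hi ih =>
          simp only [Finset.sum_insert hi]
          exact ((hfamc i).mul_left (f := fun _ => c i)).add ih
      exact h2 S
    have h3 := eq_zero_of_forall_integral_waveletFamily_eq_zero hW 0 hDc (hc.sub hsumc) (fun j => by
      simp only [mul_sub, Finset.mul_sum]
      have hi1 : ∀ {u : (Fin d → ℝ) → ℝ}, Continuous u →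
          Integrable fun x => waveletFamily s φ Ψ 0 j x * u x := fun hu =>
        ((hfam j).mul hu).integrable_of_hasCompactSupport (hfamc j).mul_right
      rw [integral_sub (hi1 hf.continuous) (integrable_finsetSum _ fun i _ =>
        hi1 (u := fun x => c i * waveletFamily s φ Ψ 0 i x) (continuous_const.mul (hfam i))),
        integral_finsetSum _ fun i _ =>
        hi1 (u := fun x => c i * waveletFamily s φ Ψ 0 i x) (continuous_const.mul (hfam i))]
      simp_rw [mul_left_comm _ (c _)]
      simp_rw [integral_const_mul, integral_waveletFamily_mul hW]
      simp only [mul_ite, mul_one, mul_zero]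
      rw [Finset.sum_ite_eq]
      split_ifs with hj
      · simp [hcdef]
      · have hj' : c j = 0 := by
          by_contra hne
          exact hj (hfin.mem_toFinset.mpr hne)
        simpa [hcdef] using hj')
    ext x
    have := congrFun h3 x
    simp only [Pi.zero_apply] at this
    linarith
  rw [hexp]
  have h4 := HasPairing.sum_const_mul hs h0 S (v := fun _ => 0) (fun i _ => hξ i)
    (fun i _ => contDiff_waveletFamily hW 0 i) (fun i _ => hfamc i) c
  simpa using h4

/-- For `m ≥ M` the grid of level `M` is contained in that of level `m`, so translating by one of
its points maps wavelets of level `m` to wavelets of level `m`. What is left is the orthogonality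
between scaling functions of level `n` and wavelets of level `m ≥ n`. -/
theorem integral_waveletFun_mul_translate_eq_zero {s : Fin d → ℕ} {r : ℕ} {φ : ℝ → ℝ}
    {Ψ : Finset ((Fin d → ℝ) → ℝ)} (hW : IsWaveletSystem s r φ Ψ) {n M : ℕ} (hnM : n ≤ M)
    (z : Fin d → ℤ) (ψ : Ψ) {m : ℕ} (hm : M ≤ m) (k : Fin d → ℤ) :
    ∫ x, waveletFun s ψ.1 m k x *
      waveletFun s (tensorFun φ) n 0 (x - gridPoint s M z) = 0 := by
  classical
  rw [← integral_add_right_eq_self _ (gridPoint s M z)]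
  simp only [add_sub_cancel_right]
  have h1 : ∀ x, waveletFun s ψ.1 m k (x + gridPoint s M z) =
      waveletFun s ψ.1 m (fun l => k l - 2 ^ ((m - M) * s l) * z l) x := by
    intro x
    rw [waveletFun_eq, waveletFun_eq]
    refine congrArg (fun z => _ * ψ.1 z) (funext fun l => ?_)
    have h2 : (2 : ℝ) ^ (m * s l) = 2 ^ ((m - M) * s l) * 2 ^ (M * s l) := by
      rw [← pow_add, ← add_mul, Nat.sub_add_cancel hm]
    rw [Pi.add_apply, gridPoint, h2]
    push_cast
    field_simp
    ring
  simp_rw [h1]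
  have h3 := integral_waveletFamily_mul hW n (Sum.inr (⟨m, hnM.trans hm⟩, ψ,
    fun l => k l - 2 ^ ((m - M) * s l) * z l)) (Sum.inl 0)
  simpa [waveletFamily, scalingFun_eq] using h3

/-! ### Riemann sums -/

theorem mem_gridCell_floor (s : Fin d → ℕ) (n : ℕ) (y : Fin d → ℝ) :
    y ∈ box (gridPoint s n fun l => ⌊2 ^ (n * s l) * y l⌋)
      (fun l => ((2 : ℝ) ^ (n * s l))⁻¹) := by
  intro l _
  have hp : (0 : ℝ) < 2 ^ (n * s l) := by positivity
  rw [Set.mem_Ico, gridPoint_eq]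
  have h1 := Int.floor_le (2 ^ (n * s l) * y l)
  have h2 := Int.lt_floor_add_one (2 ^ (n * s l) * y l)
  constructor
  · rw [inv_mul_le_iff₀ hp]
    exact h1
  · rw [← mul_add_one, lt_inv_mul_iff₀ hp]
    exact h2

theorem norm_sub_le_of_mem_gridCell {s : Fin d → ℕ} (hs : ∀ i, 0 < s i) {n : ℕ} {k : Fin d → ℤ}
    {y : Fin d → ℝ} (hy : y ∈ box (gridPoint s n k) (fun l => ((2 : ℝ) ^ (n * s l))⁻¹)) :
    ‖y - gridPoint s n k‖ ≤ (2⁻¹ : ℝ) ^ n := by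
  rw [pi_norm_le_iff_of_nonneg (by positivity)]
  intro l
  have h1 := hy l (Set.mem_univ l)
  rw [Set.mem_Ico] at h1
  have h2 : ((2 : ℝ) ^ (n * s l))⁻¹ ≤ 2⁻¹ ^ n := by
    rw [inv_pow]
    gcongr
    · exact one_le_two
    · exact Nat.le_mul_of_pos_right n (hs l)
  have h3 : (0 : ℝ) < ((2 : ℝ) ^ (n * s l))⁻¹ := by positivity
  rw [Pi.sub_apply, Real.norm_eq_abs, abs_le]
  constructor <;> linarith [h1.1, h1.2]

/-- The Riemann sum of level `n` of the convolution of `g` and `f`. -/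
noncomputable def riemannSum (s : Fin d → ℕ) (R : ℝ) (g f : (Fin d → ℝ) → ℝ) (n : ℕ)
    (x : Fin d → ℝ) : ℝ :=
  ∑ k ∈ (finite_gridPoint_norm_le s n R).toFinset,
    (2 ^ (n * homDim s))⁻¹ * g (gridPoint s n k) * f (x - gridPoint s n k)

/-- On each cell the integrand is replaced by its value at the corner, with an error controlled by
the moduli of continuity of `g` and `f`, uniformly in `x`. Corners of norm at most `R + 1` cover the
support of `g` by cells, and all these cells lie in the ball of radius `R + 2`, so the errors add up
to a multiple of its volume. -/
theorem tendstoUniformly_riemannSum {s : Fin d → ℕ} (hs : ∀ i, 0 < s i) {g f : (Fin d → ℝ) → ℝ}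
    (hg : Continuous g) {R : ℝ} (hR : Function.support g ⊆ Metric.closedBall 0 R)
    (hf : Continuous f) (hfc : HasCompactSupport f) :
    TendstoUniformly (riemannSum s (R + 1) g f) (smear g f) atTop := by
  classical
  have hgc := hasCompactSupport_of_support_subset_closedBall hR
  obtain ⟨A, hA⟩ := hgc.exists_bound_of_continuous hg
  obtain ⟨B, hB⟩ := hfc.exists_bound_of_continuous hf
  have hA0 : 0 ≤ A := (norm_nonneg _).trans (hA 0)
  have hB0 : 0 ≤ B := (norm_nonneg _).trans (hB 0)
  set V : ℝ := (volume : Measure (Fin d → ℝ)).real (Metric.closedBall 0 (R + 2)) with hV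
  have hV0 : 0 ≤ V := measureReal_nonneg
  rw [Metric.tendstoUniformly_iff]
  intro ε hε
  set ε' : ℝ := ε / ((A + B) * V + 1) with hε'
  have hε'0 : 0 < ε' := by positivity
  obtain ⟨η₁, hη₁, h₁⟩ := Metric.uniformContinuous_iff.mp
    (hgc.uniformContinuous_of_continuous hg) ε' hε'0
  obtain ⟨η₂, hη₂, h₂⟩ := Metric.uniformContinuous_iff.mp
    (hfc.uniformContinuous_of_continuous hf) ε' hε'0
  have htend : Tendsto (fun n : ℕ => (2⁻¹ : ℝ) ^ n) atTop (𝓝 0) :=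
    tendsto_pow_atTop_nhds_zero_of_lt_one (by norm_num) (by norm_num)
  filter_upwards [htend.eventually (gt_mem_nhds (lt_min hη₁ hη₂))] with n hn x
  set Z := (finite_gridPoint_norm_le s n (R + 1)).toFinset with hZ
  have hZmem : ∀ k, k ∈ Z ↔ ‖gridPoint s n k‖ ≤ R + 1 := fun k => by simp [hZ]
  set E : (Fin d → ℤ) → Set (Fin d → ℝ) := fun k =>
    box (gridPoint s n k) (fun l => ((2 : ℝ) ^ (n * s l))⁻¹) with hE
  have hEm : ∀ k, MeasurableSet (E k) := fun k => measurableSet_box _ _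
  have hEd : Pairwise (Function.onFun Disjoint E) := fun k k' hkk => by
    obtain ⟨l, hl⟩ := exists_le_abs_gridPoint_sub s n hkk
    exact disjoint_box hl
  have hEv : ∀ k, volume (E k) = ((2 : ℝ≥0∞) ^ (n * homDim s))⁻¹ := volume_gridCell s n
  have hEv' : ∀ k, (volume : Measure (Fin d → ℝ)).real (E k) = (2 ^ (n * homDim s))⁻¹ := fun k => by
    rw [Measure.real, hEv]
    simp
  have hint : Integrable fun y => g y * f (x - y) := by
    refine Continuous.integrable_of_hasCompactSupport ?_ hgc.mul_right
    exact hg.mul (hf.comp (continuous_const.sub continuous_id))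
  have hone : (2⁻¹ : ℝ) ^ n ≤ 1 := pow_le_one₀ (by norm_num) (by norm_num)
  have h3 : smear g f x = ∑ k ∈ Z, ∫ y in E k, g y * f (x - y) := by
    rw [← integral_biUnion_finset Z (fun k _ => hEm k) (fun k _ k' _ hkk => hEd hkk)
      (fun k _ => hint.integrableOn)]
    refine (setIntegral_eq_integral_of_forall_compl_eq_zero fun y hy => ?_).symm
    by_contra hne
    apply hy
    have hyR := hR (left_ne_zero_of_mul hne)
    rw [mem_closedBall_zero_iff] at hyR
    have hcell := mem_gridCell_floor s n y
    refine Set.mem_iUnion₂.mpr ⟨_, (hZmem _).mpr ?_, hcell⟩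
    have h4 := norm_sub_le_of_mem_gridCell hs hcell
    set p := gridPoint s n fun l => ⌊2 ^ (n * s l) * y l⌋
    calc ‖p‖ = ‖y - (y - p)‖ := by congr 1; abel
      _ ≤ ‖y‖ + ‖y - p‖ := norm_sub_le _ _
      _ ≤ R + 1 := add_le_add hyR (h4.trans hone)
  have h5 : riemannSum s (R + 1) g f n x =
      ∑ k ∈ Z, ∫ _y in E k, g (gridPoint s n k) * f (x - gridPoint s n k) := by
    unfold riemannSum
    refine Finset.sum_congr rfl fun k _ => ?_
    rw [setIntegral_const, hEv', smul_eq_mul, mul_assoc]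
  have h6 : ∀ k, |(∫ y in E k, g y * f (x - y)) -
      ∫ _y in E k, g (gridPoint s n k) * f (x - gridPoint s n k)| ≤
      ε' * (A + B) * (volume : Measure (Fin d → ℝ)).real (E k) := by
    intro k
    have hvol : volume (E k) < ∞ := by
      rw [hEv]
      exact ENNReal.inv_lt_top.mpr (by positivity)
    have hcon : IntegrableOn (fun _ => g (gridPoint s n k) * f (x - gridPoint s n k)) (E k) :=
      integrableOn_const hvol.ne
    rw [← integral_sub hint.integrableOn hcon, ← Real.norm_eq_abs]
    refine norm_setIntegral_le_of_norm_le_const hvol fun y hy => ?_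
    have h7 := (norm_sub_le_of_mem_gridCell hs hy).trans_lt hn
    have h8 := h₁ (a := y) (b := gridPoint s n k)
      (by rw [dist_eq_norm]; exact h7.trans_le (min_le_left _ _))
    have h9 := h₂ (a := x - y) (b := x - gridPoint s n k) (by
      rw [dist_eq_norm, sub_sub_sub_cancel_left, norm_sub_rev]
      exact h7.trans_le (min_le_right _ _))
    rw [dist_eq_norm] at h8 h9
    calc ‖g y * f (x - y) - g (gridPoint s n k) * f (x - gridPoint s n k)‖
        = ‖(g y - g (gridPoint s n k)) * f (x - y) + g (gridPoint s n k) *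
          (f (x - y) - f (x - gridPoint s n k))‖ := by congr 1; ring
      _ ≤ ε' * B + A * ε' := by
          refine (norm_add_le _ _).trans ?_
          rw [norm_mul, norm_mul]
          gcongr
          · exact hB _
          · exact hA _
      _ = ε' * (A + B) := by ring
  have h10 : ∑ k ∈ Z, (volume : Measure (Fin d → ℝ)).real (E k) ≤ V := by
    rw [← measureReal_biUnion_finset (fun k _ k' _ hkk => hEd hkk) (fun k _ => hEm k)
      (fun k _ => by rw [hEv]; exact ENNReal.inv_ne_top.mpr (by positivity))]
    refine measureReal_mono (Set.iUnion₂_subset fun k hk y hy => ?_) measure_closedBall_lt_top.ne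
    rw [mem_closedBall_zero_iff]
    have h11 := (norm_sub_le_of_mem_gridCell hs hy).trans hone
    have h12 := (hZmem k).mp hk
    calc ‖y‖ = ‖gridPoint s n k + (y - gridPoint s n k)‖ := by congr 1; abel
      _ ≤ _ := norm_add_le _ _
      _ ≤ R + 2 := by linarith
  rw [Real.dist_eq, h3, h5, ← Finset.sum_sub_distrib]
  calc _ ≤ ∑ k ∈ Z, ε' * (A + B) * (volume : Measure (Fin d → ℝ)).real (E k) :=
        (Finset.abs_sum_le_sum_abs _ _).trans (Finset.sum_le_sum fun k _ => h6 k)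
    _ ≤ ε' * (A + B) * V := by
        rw [← Finset.mul_sum]
        gcongr
    _ < ε := by
        rw [hε', div_mul_eq_mul_div, div_mul_eq_mul_div, div_lt_iff₀ (by positivity)]
        nlinarith

theorem contDiff_translate {n : WithTop ℕ∞} {f : (Fin d → ℝ) → ℝ} (hf : ContDiff ℝ n f)
    (c : Fin d → ℝ) : ContDiff ℝ n fun x => f (x - c) :=
  hf.comp (contDiff_id.sub contDiff_const)

theorem mixedDeriv_translate {n : ℕ} (i : Fin n → Fin d) {f : (Fin d → ℝ) → ℝ}
    (hf : ContDiff ℝ (n : WithTop ℕ∞) f) (c : Fin d → ℝ) :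
    mixedDeriv i (fun x => f (x - c)) = fun x => mixedDeriv i f (x - c) := by
  have h1 := mixedDeriv_comp_affine i hf (fun _ => 1) (fun l => -c l)
  simp only [one_mul, Finset.prod_const_one] at h1
  exact h1

theorem contDiff_riemannSum (s : Fin d → ℕ) (R : ℝ) (g : (Fin d → ℝ) → ℝ) {m : WithTop ℕ∞}
    {f : (Fin d → ℝ) → ℝ} (hf : ContDiff ℝ m f) (n : ℕ) :
    ContDiff ℝ m (riemannSum s R g f n) := by
  unfold riemannSum
  exact ContDiff.sum fun k _ => contDiff_const.mul (contDiff_translate hf _)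

theorem mixedDeriv_riemannSum (s : Fin d → ℕ) (R : ℝ) (g : (Fin d → ℝ) → ℝ) {m : ℕ}
    (i : Fin m → Fin d) {f : (Fin d → ℝ) → ℝ} (hf : ContDiff ℝ (m : WithTop ℕ∞) f) (n : ℕ) :
    mixedDeriv i (riemannSum s R g f n) = riemannSum s R g (mixedDeriv i f) n := by
  have h1 := mixedDeriv_sum i (finite_gridPoint_norm_le s n R).toFinset
    (f := fun k x => (2 ^ (n * homDim s))⁻¹ * g (gridPoint s n k) * f (x - gridPoint s n k))
    (fun k _ => contDiff_const.mul (contDiff_translate hf _))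
  ext x
  refine (congrFun h1 x).trans (Finset.sum_congr rfl fun k _ => ?_)
  rw [mixedDeriv_const_mul i (contDiff_translate hf _), mixedDeriv_translate i hf]

theorem support_riemannSum_subset (s : Fin d → ℕ) (R : ℝ) (g : (Fin d → ℝ) → ℝ)
    {f : (Fin d → ℝ) → ℝ} {R' : ℝ} (hf : Function.support f ⊆ Metric.closedBall 0 R') (n : ℕ) :
    Function.support (riemannSum s R g f n) ⊆ Metric.closedBall 0 (R' + R) := by
  intro x hx
  obtain ⟨k, hk, hne⟩ := Finset.exists_ne_zero_of_sum_ne_zero hx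
  rw [Set.Finite.mem_toFinset, Set.mem_ofPred_eq] at hk
  have h1 := hf (right_ne_zero_of_mul hne)
  rw [mem_closedBall_zero_iff] at h1 ⊢
  calc ‖x‖ = ‖x - gridPoint s n k + gridPoint s n k‖ := by rw [sub_add_cancel]
    _ ≤ R' + R := (norm_add_le _ _).trans (add_le_add h1 hk)

theorem crTendsto_riemannSum {s : Fin d → ℕ} (hs : ∀ i, 0 < s i) {r : ℕ}
    {g f : (Fin d → ℝ) → ℝ} (hg : Continuous g) {R : ℝ}
    (hR : Function.support g ⊆ Metric.closedBall 0 R)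
    (hf : ContDiff ℝ (r : WithTop ℕ∞) f) (hfc : HasCompactSupport f) :
    CrTendsto s r (riemannSum s (R + 1) g f) (smear g f) := by
  have hl : LocallyIntegrable g volume := hg.locallyIntegrable
  rw [crTendsto_iff hs (contDiff_riemannSum s _ g hf) (contDiff_smear_right hl hf hfc)]
  intro m i hi
  have hm : ((m : ℕ) : WithTop ℕ∞) ≤ (r : ℕ) := by exact_mod_cast length_le_of_sum_le hs hi
  rw [mixedDeriv_smear hl i (hf.of_le hm) hfc]
  simp_rw [mixedDeriv_riemannSum s _ g i (hf.of_le hm)]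
  exact tendstoUniformly_riemannSum hs hg hR (continuous_mixedDeriv i (hf.of_le hm))
    (hasCompactSupport_mixedDeriv i hfc)

theorem CrTendsto.comp_tendsto {s : Fin d → ℕ} {r : ℕ} {g : ℕ → (Fin d → ℝ) → ℝ}
    {f : (Fin d → ℝ) → ℝ} (h : CrTendsto s r g f) {u : ℕ → ℕ} (hu : Tendsto u atTop atTop) :
    CrTendsto s r (fun n => g (u n)) f :=
  fun ε hε => hu.eventually (h ε hε)

theorem smear_comm (f g : (Fin d → ℝ) → ℝ) : smear f g = smear g f := by
  ext x
  unfold smear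
  rw [← integral_sub_left_eq_self _ _ x]
  simp only [sub_sub_cancel]
  exact integral_congr_ae (Eventually.of_forall fun y => mul_comm _ _)

/-! ### Dilates of the scaling function as an approximate identity -/

/-- Otherwise the reproduction of the constant polynomial one would yield zero. -/
theorem integral_scaling_ne_zero {s : Fin d → ℕ} {r : ℕ} {φ : ℝ → ℝ}
    {Ψ : Finset ((Fin d → ℝ) → ℝ)} (hW : IsWaveletSystem s r φ Ψ) : ∫ x, φ x ≠ 0 := by
  intro h0
  have h1 := hW.reproduce 1 (by simp) 0
  simp only [Polynomial.eval_one, one_mul] at h1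
  have h2 : ∀ k : ℤ, ∫ y : ℝ, φ (y - k) = 0 := fun k => by
    rw [integral_sub_right_eq_self φ (k : ℝ), h0]
  simp only [h2, zero_mul] at h1
  exact zero_ne_one (hasSum_zero.unique h1)

theorem integral_tensorFun (φ : ℝ → ℝ) :
    ∫ x : Fin d → ℝ, tensorFun φ x = (∫ t, φ t) ^ d := by
  unfold tensorFun
  rw [integral_fintype_prod_volume_eq_prod (fun _ : Fin d => φ)]
  simp

/-- The dilates of an integrable function, normalised in `L¹`. -/
theorem isApproxId_waveletFun {s : Fin d → ℕ} (hs : ∀ i, 0 < s i) {f : (Fin d → ℝ) → ℝ}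
    (hf : Continuous f) {R : ℝ} (hR0 : 0 < R) (hR : Function.support f ⊆ Metric.closedBall 0 R)
    (h1 : ∫ x, f x = 1) {m : ℕ} (hm : R * 2⁻¹ ^ m ≤ 1) :
    IsApproxId (fun j x => (2 : ℝ) ^ (((j + m : ℕ) : ℝ) * (homDim s : ℝ) / 2) *
      waveletFun s f (j + m) 0 x) (∫ x, |f x|) := by
  have hscale : ∀ {u : (Fin d → ℝ) → ℝ}, Continuous u → ∀ n : ℕ,
      ∫ x, (2 : ℝ) ^ ((n : ℝ) * (homDim s : ℝ) / 2) * waveletFun s u n 0 x = ∫ x, u x := by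
    intro u hu n
    have h2 := integral_waveletFun_mul (s := s) hu (G := fun _ => 1) continuous_const n 0
    simp only [mul_one] at h2
    rw [integral_const_mul, h2, ← mul_assoc, ← Real.rpow_add two_pos, add_neg_cancel,
      Real.rpow_zero, one_mul]
  refine ⟨fun j => ?_, fun j => ?_, fun j => ?_, fun j => R * 2⁻¹ ^ (j + m), ?_, fun j => ?_,
    fun j x hx => ?_⟩
  · have := contDiff_waveletFun (m := 0) s (contDiff_zero.mpr hf) (j + m) 0
    exact continuous_const.mul this.continuous
  · rw [hscale hf, h1]
  · have h2 : ∀ x, |(2 : ℝ) ^ (((j + m : ℕ) : ℝ) * (homDim s : ℝ) / 2) *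
        waveletFun s f (j + m) 0 x| = (2 : ℝ) ^ (((j + m : ℕ) : ℝ) * (homDim s : ℝ) / 2) *
        waveletFun s (fun y => |f y|) (j + m) 0 x := by
      intro x
      unfold waveletFun
      rw [abs_mul, abs_mul, abs_of_pos (by positivity)]
    simp_rw [h2]
    rw [hscale hf.abs]
  · have h2 : Tendsto (fun j : ℕ => (2⁻¹ : ℝ) ^ (j + m)) atTop (𝓝 0) :=
      (tendsto_pow_atTop_nhds_zero_of_lt_one (by norm_num) (by norm_num)).comp
        (tendsto_add_atTop_nat m)
    simpa using h2.const_mul R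
  · refine le_trans ?_ hm
    gcongr ?_ * ?_
    exact pow_le_pow_of_le_one (by norm_num) (by norm_num) (Nat.le_add_left m j)
  · rw [mem_closedBall_zero_iff, pi_norm_le_iff_of_nonneg (by positivity)]
    intro l
    have h2 := abs_sub_gridPoint_le hR (right_ne_zero_of_mul hx) l
    have h3 : gridPoint s (j + m) 0 l = 0 := by simp [gridPoint]
    rw [h3, sub_zero] at h2
    refine h2.trans ?_
    simp only [inv_pow]
    gcongr
    · exact one_le_two
    · exact Nat.le_mul_of_pos_right _ (hs l)

/-- A distribution with vanishing wavelet coefficients vanishes. -/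
theorem apply_eq_zero_of_hasPairing_waveletFamily {s : Fin d → ℕ} (hs : ∀ i, 0 < s i) {r : ℕ}
    {φ : ℝ → ℝ} {Ψ : Finset ((Fin d → ℝ) → ℝ)} (hW : IsWaveletSystem s r φ Ψ)
    {ξ : 𝓢(Fin d → ℝ, ℝ) →L[ℝ] ℝ}
    (hξ : ∀ i, HasPairing s r ξ (waveletFamily s φ Ψ 0 i) 0)
    (g : 𝓢(Fin d → ℝ, ℝ)) (hg : HasCompactSupport g) : ξ g = 0 := by
  have h0 : HasPairing s r ξ (fun _ => 0) 0 :=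
    (hξ (Sum.inl 0)).zero hs (contDiff_waveletFamily hW 0 _) (hasCompactSupport_waveletFamily hW 0 _)
  obtain ⟨R, hR0, hR⟩ := hg.exists_support_subset_closedBall
  have hgl : LocallyIntegrable g volume := g.continuous.locallyIntegrable
  set Φ : (Fin d → ℝ) → ℝ := tensorFun φ with hΦ
  have hΦr : ContDiff ℝ (r : WithTop ℕ∞) Φ := contDiff_tensorFun hW.contDiff_scaling
  have hΦc : HasCompactSupport Φ := hasCompactSupport_tensorFun hW.compact_scaling
  -- The convolution is a `C^r`-limit of Riemann sums on the grids of level `M + n`. Each sum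
  -- combines translates of a scaling function of level `n` by points of that grid, hence is
  -- orthogonal to all wavelets of level at least `M + n` and is killed by `ξ`.
  have hsm : ∀ n : ℕ, HasPairing s r ξ (smear g (waveletFun s Φ n 0)) 0 := by
    intro n
    have hr' := contDiff_waveletFun s hΦr n 0
    have hc' := hasCompactSupport_waveletFun (s := s) hΦc n 0
    obtain ⟨R', -, hR'⟩ := hc'.exists_support_subset_closedBall
    refine hasPairing_zero_of_crTendsto hs h0 (contDiff_smear_right hgl hr' hc')
      (fun M => contDiff_riemannSum s _ g hr' (M + n))
      (fun M => support_riemannSum_subset s _ g hR' (M + n))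
      ((crTendsto_riemannSum hs g.continuous hR hr' hc').comp_tendsto (tendsto_add_atTop_nat n))
      fun M => ?_
    refine hasPairing_zero_of_orthogonal hs hW hξ (contDiff_riemannSum s _ g hr' (M + n))
      (hasCompactSupport_of_support_subset_closedBall
        (support_riemannSum_subset s (R + 1) g hR' (M + n))) (M + n) fun ψ m hm k => ?_
    have hψ := (contDiff_waveletFun s (hW.contDiff_wavelet ψ.1 ψ.2) m k).continuous
    have hψc := hasCompactSupport_waveletFun (s := s) (hW.compact_wavelet ψ.1 ψ.2) m k
    simp only [riemannSum, Finset.mul_sum]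
    rw [integral_finsetSum _ fun z _ => ?_]
    · refine Finset.sum_eq_zero fun z _ => ?_
      simp_rw [mul_left_comm (waveletFun s ψ.1 m k _)]
      rw [integral_const_mul,
        integral_waveletFun_mul_translate_eq_zero hW (Nat.le_add_left n M) z ψ hm k, mul_zero]
    · exact (hψ.mul (continuous_const.mul
        (contDiff_translate hr' _).continuous)).integrable_of_hasCompactSupport hψc.mul_right
  -- Dividing by this nonzero integral makes the dilates approximate identities.
  set κ : ℝ := ∫ x, Φ x with hκ
  have hκ0 : κ ≠ 0 := by
    rw [hκ, hΦ, integral_tensorFun]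
    exact pow_ne_zero _ (integral_scaling_ne_zero hW)
  set f : (Fin d → ℝ) → ℝ := fun x => κ⁻¹ * Φ x with hf
  have hfr : ContDiff ℝ (r : WithTop ℕ∞) f := contDiff_const.mul hΦr
  have hfc : HasCompactSupport f := hΦc.mul_left
  have hf1 : ∫ x, f x = 1 := by
    rw [hf, integral_const_mul, ← hκ, inv_mul_cancel₀ hκ0]
  obtain ⟨R', hR'0, hR'⟩ := hfc.exists_support_subset_closedBall
  -- The first `m` dilates are skipped, so that all kernels are supported in the unit ball.
  obtain ⟨m, hm⟩ : ∃ m : ℕ, R' * 2⁻¹ ^ m ≤ 1 := by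
    obtain ⟨m, hm⟩ := exists_pow_lt_of_lt_one (inv_pos.mpr hR'0) (by norm_num : (2⁻¹ : ℝ) < 1)
    refine ⟨m, ?_⟩
    rw [← le_inv_mul_iff₀ hR'0, mul_one]
    exact hm.le
  have hid := isApproxId_waveletFun hs hfr.continuous hR'0 hR' hf1 hm
  set ρ : ℕ → (Fin d → ℝ) → ℝ := fun j x => (2 : ℝ) ^ (((j + m : ℕ) : ℝ) * (homDim s : ℝ) / 2) *
    waveletFun s f (j + m) 0 x with hρ
  -- The scalar multiple is written as a sum with one term, in the form required by
  -- `HasPairing.sum_const_mul`.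
  have hρeq : ∀ j, smear (ρ j) g = fun x =>
      ∑ _u ∈ ({()} : Finset Unit), ((2 : ℝ) ^ (((j + m : ℕ) : ℝ) * (homDim s : ℝ) / 2) * κ⁻¹) *
        smear g (waveletFun s Φ (j + m) 0) x := by
    intro j
    rw [smear_comm]
    ext x
    rw [Finset.sum_singleton]
    unfold smear
    rw [← integral_const_mul]
    refine integral_congr_ae (Eventually.of_forall fun y => ?_)
    simp only [hρ, hf, waveletFun]
    ring
  obtain ⟨δ, -, hδ1, hδ⟩ := hid.support_subset
  have hpair : HasPairing s r ξ g 0 := by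
    refine hasPairing_zero_of_crTendsto hs h0 (contDiff_schwartz g r)
      (h := fun j => smear (ρ j) g) (R := R + 1)
      (fun j => contDiff_smear_right (hid.continuous j).locallyIntegrable (contDiff_schwartz g r) hg)
      (fun j => (support_smear_subset (hδ j) hR).trans
        (Metric.closedBall_subset_closedBall (by linarith [hδ1 j])))
      (hid.crTendsto_smear hs (contDiff_schwartz g r) hg) fun j => ?_
    have hr' := contDiff_waveletFun s hΦr (j + m) 0
    have hc' := hasCompactSupport_waveletFun (s := s) hΦc (j + m) 0
    obtain ⟨R₁, -, hR₁⟩ := hc'.exists_support_subset_closedBall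
    have h2 := HasPairing.sum_const_mul hs h0 ({()} : Finset Unit) (v := fun _ => 0)
      (f := fun _ => smear g (waveletFun s Φ (j + m) 0)) (fun _ _ => hsm (j + m))
      (fun _ _ => contDiff_smear_right hgl hr' hc')
      (fun _ _ => hasCompactSupport_of_support_subset_closedBall (support_smear_subset hR hR₁))
      (fun _ => (2 : ℝ) ^ (((j + m : ℕ) : ℝ) * (homDim s : ℝ) / 2) * κ⁻¹)
    rw [hρeq j]
    simpa using h2
  -- The constant sequence `g` is admissible, so its limit `ξ g` equals the pairing zero.
  have h3 := hpair.tendsto hs (contDiff_schwartz g r) (g := fun _ => g) (R := R) (fun _ => hR)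
    (fun ε hε => Eventually.of_forall fun _ => by
      intro k i hi x
      simp only [sub_self]
      rw [mixedDeriv_zero]
      simpa using hε.le)
  exact tendsto_nhds_unique tendsto_const_nhds h3

/-! ### Existence of the coefficients, and their injectivity on compactly supported test functions
-/

/-- A finite Besov norm makes the distribution of order `r` on compact sets, so all its pairings
with compactly supported `C^r` functions exist. -/
theorem exists_isWaveletCoeffs {s : Fin d → ℕ} (hs : ∀ i, 0 < s i) {α : ℝ}
    {p q : ℝ≥0∞} (hp : 1 ≤ p) (hq : 1 ≤ q) {r : ℕ}
    {φ : ℝ → ℝ} {Ψ : Finset ((Fin d → ℝ) → ℝ)} (hW : IsWaveletSystem s r φ Ψ)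
    {ξ : 𝓢(Fin d → ℝ, ℝ) →L[ℝ] ℝ} (hξ : besovNorm s α p q r ξ < ∞) :
    ∃ (a : ℕ → Ψ → (Fin d → ℤ) → ℝ) (b : (Fin d → ℤ) → ℝ), IsWaveletCoeffs s r φ Ψ ξ a b := by
  have h1 := exists_abs_apply_le_of_besovNorm_lt_top hs hp hq hξ
  have h2 : ∀ i, ∃ v, HasPairing s r ξ (waveletFamily s φ Ψ 0 i) v := fun i =>
    exists_hasPairing hs h1 (contDiff_waveletFamily hW 0 i) (hasCompactSupport_waveletFamily hW 0 i)
  choose v hv using h2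
  exact ⟨fun n ψ k => v (Sum.inr (⟨n, Nat.zero_le n⟩, ψ, k)), fun k => v (Sum.inl k),
    fun n ψ k => hv (Sum.inr (⟨n, Nat.zero_le n⟩, ψ, k)), fun k => hv (Sum.inl k)⟩

theorem IsWaveletCoeffs.apply_eq {s : Fin d → ℕ} (hs : ∀ i, 0 < s i) {r : ℕ} {φ : ℝ → ℝ}
    {Ψ : Finset ((Fin d → ℝ) → ℝ)} (hW : IsWaveletSystem s r φ Ψ)
    {ξ ξ' : 𝓢(Fin d → ℝ, ℝ) →L[ℝ] ℝ} {a : ℕ → Ψ → (Fin d → ℤ) → ℝ} {b : (Fin d → ℤ) → ℝ}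
    (h : IsWaveletCoeffs s r φ Ψ ξ a b) (h' : IsWaveletCoeffs s r φ Ψ ξ' a b)
    (g : 𝓢(Fin d → ℝ, ℝ)) (hg : HasCompactSupport g) : ξ g = ξ' g := by
  refine sub_eq_zero.mp (apply_eq_zero_of_hasPairing_waveletFamily hs hW (ξ := ξ - ξ') ?_ g hg)
  rintro (k | ⟨m, ψ, k⟩)
  · simpa [waveletFamily] using (h.2 k).sub_left (h'.2 k)
  · simpa [waveletFamily] using (h.1 m.1 ψ k).sub_left (h'.1 m.1 ψ k)

end AnisoBesov

/-! ### The characterisation by wavelet coefficients -/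

theorem proposition2p2 (d : ℕ) (hd : 0 < d) (s : Fin d → ℕ) (hs : ∀ i, 0 < s i)
    (α : ℝ) (p q : ℝ≥0∞) (hp : 1 ≤ p) (hq : 1 ≤ q) (r : ℕ) (hr : |α| < (r : ℝ))
    (hrs : α ≤ 0 → ∀ i, |α| < ((s i * (r / s i) : ℕ) : ℝ))
    (φ : ℝ → ℝ) (Ψ : Finset ((Fin d → ℝ) → ℝ))
    (hW : AnisoBesov.IsWaveletSystem s r φ Ψ) :
    (∀ ξ ∈ AnisoBesov.besovSpace s α p q r,
      ∃ (a : ℕ → Ψ → (Fin d → ℤ) → ℝ) (b : (Fin d → ℤ) → ℝ),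
        AnisoBesov.IsWaveletCoeffs s r φ Ψ ξ a b ∧
        AnisoBesov.detailNorm s α p q Ψ a < ∞ ∧ AnisoBesov.ellNorm s p 0 b < ∞) ∧
    (∀ (a : ℕ → Ψ → (Fin d → ℤ) → ℝ) (b : (Fin d → ℤ) → ℝ),
      AnisoBesov.detailNorm s α p q Ψ a < ∞ → AnisoBesov.ellNorm s p 0 b < ∞ →
      ∃ ξ ∈ AnisoBesov.besovSpace s α p q r,
        AnisoBesov.IsWaveletCoeffs s r φ Ψ ξ a b) ∧
    (∃ C : ℝ≥0, 0 < C ∧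
      ∀ (ξ : 𝓢(Fin d → ℝ, ℝ) →L[ℝ] ℝ) (a : ℕ → Ψ → (Fin d → ℤ) → ℝ) (b : (Fin d → ℤ) → ℝ),
        AnisoBesov.IsWaveletCoeffs s r φ Ψ ξ a b →
        AnisoBesov.detailNorm s α p q Ψ a + AnisoBesov.ellNorm s p 0 b
            ≤ C * AnisoBesov.besovNorm s α p q r ξ ∧
        AnisoBesov.besovNorm s α p q r ξ
            ≤ C * (AnisoBesov.detailNorm s α p q Ψ a + AnisoBesov.ellNorm s p 0 b)) := by
  obtain ⟨K₁, hK₁⟩ := AnisoBesov.exists_coeffNorm_le_besovNorm hs α hp hq hr hW.contDiff_scaling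
    hW.compact_scaling hW.contDiff_wavelet hW.compact_wavelet hW.annihilate
  obtain ⟨K₂, hK₂⟩ := AnisoBesov.exists_besovNorm_le hs hp hq hr hrs hW
  -- Adding one makes the constant positive, which also turns the upper bound into `∞` when the
  -- coefficients have infinite norm.
  refine ⟨fun ξ hξ => ?_, fun a b ha hb => ?_, K₁ + K₂ + 1, by positivity, fun ξ a b h => ?_⟩
  · obtain ⟨a, b, h⟩ := AnisoBesov.exists_isWaveletCoeffs hs hp hq hW hξ
    have hlt := (hK₁ ξ a b h).trans_lt (ENNReal.mul_lt_top ENNReal.coe_lt_top hξ)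
    exact ⟨a, b, h, le_self_add.trans_lt hlt, le_add_self.trans_lt hlt⟩
  · obtain ⟨ξ, h, hξ⟩ := AnisoBesov.exists_distribution hs hp hq hr hrs hW ha hb
    exact ⟨ξ, (hK₂ ξ a b fun g _ => hξ g).trans_lt
      (ENNReal.mul_lt_top ENNReal.coe_lt_top (ENNReal.add_lt_top.mpr ⟨ha, hb⟩)), h⟩
  · have hle₁ : (K₁ : ℝ≥0∞) ≤ (K₁ + K₂ + 1 : ℝ≥0) :=
      ENNReal.coe_le_coe.mpr (by rw [add_assoc]; exact le_self_add)
    have hle₂ : (K₂ : ℝ≥0∞) ≤ (K₁ + K₂ + 1 : ℝ≥0) :=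
      ENNReal.coe_le_coe.mpr (le_add_self.trans le_self_add)
    refine ⟨(hK₁ ξ a b h).trans (by gcongr), ?_⟩
    by_cases hN : AnisoBesov.detailNorm s α p q Ψ a + AnisoBesov.ellNorm s p 0 b = ∞
    · rw [hN, ENNReal.mul_top (by simp)]
      exact le_top
    obtain ⟨ha, hb⟩ := ENNReal.add_lt_top.mp (lt_top_iff_ne_top.mpr hN)
    -- The series bound required by `hK₂` is known only for the synthesised distribution. It
    -- transfers to `ξ` because both have the same coefficients and hence agree on compactly
    -- supported test functions, the only ones that enter the Besov norm.
    obtain ⟨ξ', h', hξ'⟩ := AnisoBesov.exists_distribution hs hp hq hr hrs hW ha hb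
    refine (hK₂ ξ a b fun g hg => ?_).trans (by gcongr)
    rw [h.apply_eq hs hW h' g hg]
    exact hξ' g
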